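/- **Conventions.** Let $u=u(x,y,z,t)$ with $(x,y,z,t)=(x^1,x^2,x^3,x^4)$, write $u_i,u_{ij}$ for its partial derivatives and $D_i$ for the total derivatives; all functions are real and smooth. A second order equation $E=0$ for $u$ is called *integrable* if near every jet of $E=0$ (and of its differential consequences) at which the symbol $\sum_{i\le j}E_{u_{ij}}\xi_i\xi_j$ is nondegenerate it has a dispersionless Lax pair: vector fields $V,W$ in $\partial_x,\partial_y,\partial_z,\partial_t,\partial_\lambda$, with coefficients smooth in finitely many derivatives of $u$ and in the spectral parameter $\lambda$ (ranging over a nonempty open set), such that on solutions $\langle V,W\rangle$ is Frobenius-integrable by virtue of the equation and projects to 2-planes in $\mathbb R^4$ which are totally null for the conformal metric inverse to the symbol, distinct values of $\lambda$ giving distinct planes. For a set $\mathfrak a$ of generating functions on the space $J^1$ of 1-jets, an equation is *$\mathfrak a$-symmetric* if all contact vector fields with generating function in $\mathfrak a$ are infinitesimal symmetries of it. Below, $\Omega\subset J^1$ is open and $Q:\Omega\to\mathbb R$ is smooth, and equations are considered over $\Omega$. **(III)** Let $\mathfrak a_0''=\{A(t,u_4)\}$. The equation $$u_{24}-u_{14}u_{33}+u_{13}u_{34}=Q\,u_{34}$$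 is both $\mathfrak a_0''$-symmetric and integrable if and only if every point $q\in\Omega$ satisfies (a)–(d): (a) *General branch.* If $Q_{u_1}(q)\ne0$, then near $q$ $$Q=\frac{Fu_2+u_1}{\Delta}-\Delta L-\frac{1}{2\Delta}\Bigl((F_x-FF_y)u_3^2+2(G_x-GF_y-zF_y)u_3-2zG_y+H\Bigr),\qquad \Delta=Fu_3+G+z\neq0,$$ for some functions $F,G,H,L$ of $(x,y)$ with $L_x+(FL)_y=\tfrac12F_{yy}$. (b) If $Q_{u_1}=0$ near $q$ and $Q_{u_2}(q)\ne0$, then near $q$ $$Q=\frac{u_2+zf_y+h}{u_3+f}-f_x-k(x)(u_3+f)$$ for some $f(x,y),h(x,y),k(x)$, and a point transformation $u\mapsto u+\psi(x,y,z,t)$ brings the equation to the form with $Q=\dfrac{u_2}{u_3}-k(x)u_3$. (c) If $Q_{u_1}=Q_{u_2}=0$ near $q$, then near $q$ $$Q=zf_y-(f_x+k(x))u_3+h$$ for some $f(x,y),h(x,y),k(x)$, and a point transformation $u\mapsto u+\psi$ brings the equation to the form with $Q=z\tilde f_y-\tilde f_x\,u_3$ for some $\tilde f(x,y)$. (d)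 If $Q_{u_1}=Q_{u_2}=Q_{u_3}=0$ near $q$, then near $q$ $Q=zf(y)+h(x,y)$ for some $f(y),h(x,y)$, and a point transformation $u\mapsto u+\psi$ brings the equation to the form with $Q=zf(y)$. (The points to which one of (a)–(c) applies are dense in $\Omega$.) In all these cases a Lax pair over the whole of $\Omega$, with $\lambda\in\mathbb R$, is $$V=-u_{34}\partial_x+u_{14}\partial_z+\lambda\partial_t+(u_{14}Q_{u_1}+u_{24}Q_{u_2}+u_{34}Q_{u_3})\lambda\partial_\lambda,$$ $$W=-u_{33}\partial_x+\partial_y+(\lambda+u_{13}-Q)\partial_z+(Q_z+u_{13}Q_{u_1}+u_{23}Q_{u_2}+u_{33}Q_{u_3})\lambda\partial_\lambda.$$ **(II)** Let $\mathfrak a_0''\oplus\mathfrak a_0'''=\{A(x,u_1)+B(t,u_4)\}$. The equation $$u_{12}u_{34}-u_{13}u_{24}=Q\,u_{14}$$ is both $\mathfrak a_0''\oplus\mathfrak a_0'''$-symmetric and integrable if and only if near every point of $\Omega$ $$Q=f_y(y,z)\,u_3-f_z(y,z)\,u_2+h(y,z)$$ for some functions $f,h$ of $(y,z)$. For $Q$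 of this form on $\Omega$, a Lax pair, with $\lambda\in\mathbb R\setminus\{1\}$, is $$V=\tfrac{\lambda}{\lambda-1}u_{34}\partial_x-\tfrac{u_{14}}{\lambda-1}\partial_z-u_{13}\partial_t+f_z\,u_{14}\,\lambda\,\partial_\lambda,\qquad W=\tfrac{\lambda}{\lambda-1}u_{24}\partial_x-\tfrac{u_{14}}{\lambda-1}\partial_y-u_{12}\partial_t+f_y\,u_{14}\,\lambda\,\partial_\lambda.$$ -/

import Mathlib

open scoped ContDiff Topology Pointwise

namespace DispersionlessLax

noncomputable section

/-! ### Jets of functions `u(x, y, z, t)`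

The independent variables `(x, y, z, t) = (x¹, x², x³, x⁴)` carry the indices `0, 1, 2, 3 : Fin 4`. -/

/-- Infinite jets of functions `u` on `ℝ⁴`: the base point `j.1` and the values `j.2 I` of all partial
derivatives `u_I`, where `I` is a multiset of indices (`j.2 0 = u`, `j.2 {i} = u_i`, `j.2 {i, k} = u_ik`). -/
abbrev Jet : Type := (Fin 4 → ℝ) × (Multiset (Fin 4) → ℝ)

/-- First jets `(x, u, p)` with `p i = u_i`. -/
abbrev J1 : Type := (Fin 4 → ℝ) × ℝ × (Fin 4 → ℝ)

/-- The projection of an infinite jet to its first jet. -/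
def toJ1 (j : Jet) : J1 := (j.1, j.2 0, fun i => j.2 {i})

/-- The total derivative `D_i = ∂_{x^i} + ∑_I u_{I+i} ∂_{u_I}` as a tangent vector at the jet `j`. -/
def totalVec (i : Fin 4) (j : Jet) : Jet := (Pi.single i 1, fun I => j.2 (i ::ₘ I))

/-- The total derivative `D_i f` of a function on jets. -/
def totalDeriv (i : Fin 4) (f : Jet → ℝ) (j : Jet) : ℝ := lineDeriv ℝ f j (totalVec i j)

/-- Iterated total derivatives. -/
def totalDerivs (l : List (Fin 4)) (f : Jet → ℝ) : Jet → ℝ := l.foldr totalDeriv f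

/-- The infinite prolongation of the equation `F = 0`: jets annihilated by `F` and all its total
derivatives. -/
def prolongation (F : Jet → ℝ) : Set Jet := {j | ∀ l : List (Fin 4), totalDerivs l F j = 0}

/-- The symbol `∑_{i ≤ k} (∂F/∂u_ik) ξ_i ξ_k` of the second order equation `F = 0` at the jet `j`. -/
def symbol (F : Jet → ℝ) (j : Jet) (ξ : Fin 4 → ℝ) : ℝ :=
  lineDeriv ℝ F j (0, fun I => if I.card = 2 then (I.map ξ).prod else 0)

/-- The symbol is a nondegenerate quadratic form at `j`. -/
def SymbolNondegenerate (F : Jet → ℝ) (j : Jet) : Prop :=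
  ∀ ξ, (∀ η, symbol F j (ξ + η) - symbol F j ξ - symbol F j η = 0) → ξ = 0

/-- The jets of the (prolonged) equation `F = 0` at which its symbol is nondegenerate. -/
def regularJets (F : Jet → ℝ) : Set Jet := {j | j ∈ prolongation F ∧ SymbolNondegenerate F j}

/-! ### Dispersionless Lax pairs -/

/-- A vector field `∑ X^i D_i + X^λ ∂_λ` whose coefficients `((X^i)_i, X^λ)` depend on the jets of `u` and
on the spectral parameter `λ`; on the graph of a function `u`, `D_i` is `∂_{x^i}`. -/
abbrev SpectralField : Type := Jet × ℝ → (Fin 4 → ℝ) × ℝ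

/-- A function of jets and `λ` that, near `w`, is a smooth function of finitely many coordinates. -/
def SmoothAt (f : Jet × ℝ → ℝ) (w : Jet × ℝ) : Prop :=
  ∃ (s : Finset (Multiset (Fin 4))) (g : ((Fin 4 → ℝ) × (s → ℝ)) × ℝ → ℝ),
    ContDiffAt ℝ ∞ g ((w.1.1, fun I => w.1.2 I), w.2) ∧
      ∀ᶠ v in 𝓝 w, f v = g ((v.1.1, fun I => v.1.2 I), v.2)

/-- The derivative `X(g)`. -/
def SpectralField.act (X : SpectralField) (g : Jet × ℝ → ℝ) (w : Jet × ℝ) : ℝ :=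
  lineDeriv ℝ g w (∑ i, (X w).1 i • totalVec i w.1, (X w).2)

/-- The commutator `[X, Y]`. -/
def SpectralField.bracket (X Y : SpectralField) : SpectralField := fun w =>
  (fun i => X.act (fun v => (Y v).1 i) w - Y.act (fun v => (X v).1 i) w,
    X.act (fun v => (Y v).2) w - Y.act (fun v => (X v).2) w)

/-- The 2-plane in `ℝ⁴` onto which `⟨V, W⟩` projects. -/
def projectedPlane (V W : SpectralField) (w : Jet × ℝ) : Submodule ℝ (Fin 4 → ℝ) :=
  Submodule.span ℝ {(V w).1, (W w).1}

/-- `V, W` is a dispersionless Lax pair of the equation `F = 0` over the open set `U` of jets, with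
spectral parameter in the open set `Λ`: `⟨V, W⟩` projects to 2-planes in `ℝ⁴` which are characteristic
(all covectors annihilating the plane are null for the symbol, i.e. the plane is totally null for
the conformal metric inverse to the symbol) and are parametrized by `λ`, and the distribution
`⟨V, W⟩` is Frobenius-integrable by virtue of the equation. -/
structure IsLaxPair (F : Jet → ℝ) (U : Set Jet) (Λ : Set ℝ) (V W : SpectralField) : Prop where
  isOpen_jets : IsOpen U
  isOpen_param : IsOpen Λ
  nonempty_param : Λ.Nonempty
  smooth_base : ∀ w ∈ U ×ˢ Λ, ∀ i, SmoothAt (fun v => (V v).1 i) w ∧ SmoothAt (fun v => (W v).1 i) w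
  smooth_spectral : ∀ w ∈ U ×ˢ Λ, SmoothAt (fun v => (V v).2) w ∧ SmoothAt (fun v => (W v).2) w
  rank_two : ∀ j ∈ U ∩ regularJets F, ∀ l ∈ Λ, LinearIndependent ℝ ![(V (j, l)).1, (W (j, l)).1]
  characteristic : ∀ j ∈ U ∩ regularJets F, ∀ l ∈ Λ, ∀ ξ : Fin 4 → ℝ,
    (∀ v ∈ projectedPlane V W (j, l), ∑ i, ξ i * v i = 0) → symbol F j ξ = 0
  parametrized : ∀ j ∈ U ∩ regularJets F, Set.InjOn (fun l => projectedPlane V W (j, l)) Λ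
  frobenius : ∀ j ∈ U ∩ regularJets F, ∀ l ∈ Λ,
    V.bracket W (j, l) ∈ Submodule.span ℝ {V (j, l), W (j, l)}

/-- Integrability over the set `U` of jets: near every jet of `U` that is regular for the equation
`F = 0` the equation possesses a dispersionless Lax pair. -/
def LaxIntegrable (F : Jet → ℝ) (U : Set Jet) : Prop :=
  ∀ j ∈ U ∩ regularJets F, ∃ (U' : Set Jet) (Λ : Set ℝ) (V W : SpectralField),
    j ∈ U' ∧ IsLaxPair F U' Λ V W

/-! ### Contact symmetries -/

/-- The partial derivative of a function on 1-jets by `u_i`. -/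
def dp (i : Fin 4) (f : J1 → ℝ) (q : J1) : ℝ := fderiv ℝ f q (0, 0, Pi.single i 1)

/-- The prolongation to jets of the contact vector field with generating function `f`:
`∑_I (D_I f) ∂_{u_I} - ∑_k f_{u_k} D_k`. -/
def contactVec (f : J1 → ℝ) (j : Jet) : Jet :=
  (fun k => -dp k f (toJ1 j),
    fun I => totalDerivs I.toList (f ∘ toJ1) j - ∑ k, dp k f (toJ1 j) * j.2 (k ::ₘ I))

/-- All contact fields with generating function in `S` are (infinitesimal) symmetries of the
equation `F = 0` over `U`. -/
def IsSymmetric (S : Set (J1 → ℝ)) (F : Jet → ℝ) (U : Set Jet) : Prop :=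
  ∀ f ∈ S, ∀ j ∈ U, F j = 0 → lineDeriv ℝ F j (contactVec f j) = 0

/-- The copy of the Poisson algebra of the plane `(x^i, u_i)`: generating functions `A(x^i, u_i)`. -/
def poissonIdeal (i : Fin 4) : Set (J1 → ℝ) :=
  {f | ∃ A : ℝ × ℝ → ℝ, ContDiff ℝ ∞ A ∧ f = fun q => A (q.1 i, q.2.2 i)}

/-! ### The two families of equations -/

/-- Type III: `u₂₄ - u₁₄ u₃₃ + u₁₃ u₃₄ = Q u₃₄`. -/
def eqIII (Q : J1 → ℝ) (j : Jet) : ℝ :=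
  j.2 {1, 3} - j.2 {0, 3} * j.2 {2, 2} + j.2 {0, 2} * j.2 {2, 3} - Q (toJ1 j) * j.2 {2, 3}

/-- Type II: `u₁₂ u₃₄ - u₁₃ u₂₄ = Q u₁₄`. -/
def eqII (Q : J1 → ℝ) (j : Jet) : ℝ :=
  j.2 {0, 1} * j.2 {2, 3} - j.2 {0, 2} * j.2 {1, 3} - Q (toJ1 j) * j.2 {0, 3}

/-- Partial derivative by the first of two variables. -/
def pd1 (f : ℝ × ℝ → ℝ) (a : ℝ × ℝ) : ℝ := fderiv ℝ f a (1, 0)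

/-- Partial derivative by the second of two variables. -/
def pd2 (f : ℝ × ℝ → ℝ) (a : ℝ × ℝ) : ℝ := fderiv ℝ f a (0, 1)

/-- The point `(x, y)` under a 1-jet. -/
def xy (q : J1) : ℝ × ℝ := (q.1 0, q.1 1)

/-- The point `(y, z)` under a 1-jet. -/
def yz (q : J1) : ℝ × ℝ := (q.1 1, q.1 2)

/-- `Δ = F u₃ + G + z`. -/
def deltaIII (F G : ℝ × ℝ → ℝ) (q : J1) : ℝ := F (xy q) * q.2.2 2 + G (xy q) + q.1 2

/-- The general branch of type III:
`Q = (F u₂ + u₁)/Δ - Δ L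
  - ((F_x - F F_y) u₃² + 2 (G_x - G F_y - z F_y) u₃ - 2 z G_y + H)/(2Δ)`. -/
def generalIII (F G H L : ℝ × ℝ → ℝ) (q : J1) : ℝ :=
  (F (xy q) * q.2.2 1 + q.2.2 0) / deltaIII F G q - deltaIII F G q * L (xy q)
    - ((pd1 F (xy q) - F (xy q) * pd2 F (xy q)) * q.2.2 2 ^ 2
        + 2 * (pd1 G (xy q) - G (xy q) * pd2 F (xy q) - q.1 2 * pd2 F (xy q)) * q.2.2 2
        - 2 * q.1 2 * pd2 G (xy q) + H (xy q)) / (2 * deltaIII F G q)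

/-- The first singular branch of type III before normalization:
`Q = (u₂ + z f_y + h)/(u₃ + f) - f_x - k(x) (u₃ + f)`. -/
def singularIII₁ (f h : ℝ × ℝ → ℝ) (k : ℝ → ℝ) (q : J1) : ℝ :=
  (q.2.2 1 + q.1 2 * pd2 f (xy q) + h (xy q)) / (q.2.2 2 + f (xy q)) - pd1 f (xy q)
    - k (q.1 0) * (q.2.2 2 + f (xy q))

/-- The second singular branch of type III before normalization:
`Q = z f_y - (f_x + k(x)) u₃ + h`. -/
def singularIII₂ (f h : ℝ × ℝ → ℝ) (k : ℝ → ℝ) (q : J1) : ℝ :=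
  q.1 2 * pd2 f (xy q) - (pd1 f (xy q) + k (q.1 0)) * q.2.2 2 + h (xy q)

/-- The third singular branch of type III before normalization: `Q = z f(y) + h(x, y)`. -/
def singularIII₃ (f : ℝ → ℝ) (h : ℝ × ℝ → ℝ) (q : J1) : ℝ := q.1 2 * f (q.1 1) + h (xy q)

/-- The branch of type II: `Q = f_y u₃ - f_z u₂ + h`, with `f, h` functions of `(y, z)`. -/
def branchII (f h : ℝ × ℝ → ℝ) (q : J1) : ℝ :=
  pd1 f (yz q) * q.2.2 2 - pd2 f (yz q) * q.2.2 1 + h (yz q)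

/-- Iterated partial derivatives of a function on `ℝ⁴`. -/
def partialDerivs (l : List (Fin 4)) (ψ : (Fin 4 → ℝ) → ℝ) : (Fin 4 → ℝ) → ℝ :=
  l.foldr (fun i g x => fderiv ℝ g x (Pi.single i 1)) ψ

/-- The prolongation to jets of the point transformation `(x, u) ↦ (x, u + ψ(x))`. -/
def translateJet (ψ : (Fin 4 → ℝ) → ℝ) (j : Jet) : Jet :=
  (j.1, fun I => j.2 I + partialDerivs I.toList ψ j.1)

/-- Over the set `N` of 1-jets, a point transformation `(x, u) ↦ (x, u + ψ(x))` takes the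
equation of type III with right hand side `Q` to that with right hand side `Q'`. -/
def PointReducesIII (Q Q' : J1 → ℝ) (N : Set J1) : Prop :=
  ∃ ψ : (Fin 4 → ℝ) → ℝ, (∀ q ∈ N, ContDiffAt ℝ ∞ ψ q.1) ∧
    ∀ j : Jet, toJ1 j ∈ N → (eqIII Q j = 0 ↔ eqIII Q' (translateJet ψ j) = 0)

/-! ### The Lax pairs -/

/-- Type III:
`V = -u₃₄ ∂_x + u₁₄ ∂_z + λ ∂_t + (u₁₄ Q_{u₁} + u₂₄ Q_{u₂} + u₃₄ Q_{u₃}) λ ∂_λ`. -/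
def laxVIII (Q : J1 → ℝ) : SpectralField := fun w =>
  (![-w.1.2 {2, 3}, 0, w.1.2 {0, 3}, w.2],
    (w.1.2 {0, 3} * dp 0 Q (toJ1 w.1) + w.1.2 {1, 3} * dp 1 Q (toJ1 w.1)
      + w.1.2 {2, 3} * dp 2 Q (toJ1 w.1)) * w.2)

/-- Type III: `W = -u₃₃ ∂_x + ∂_y + (λ + u₁₃ - Q) ∂_z
  + (Q_z + u₁₃ Q_{u₁} + u₂₃ Q_{u₂} + u₃₃ Q_{u₃}) λ ∂_λ`. -/
def laxWIII (Q : J1 → ℝ) : SpectralField := fun w =>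
  (![-w.1.2 {2, 2}, 1, w.2 + w.1.2 {0, 2} - Q (toJ1 w.1), 0],
    (fderiv ℝ Q (toJ1 w.1) (Pi.single 2 1, 0, 0) + w.1.2 {0, 2} * dp 0 Q (toJ1 w.1)
      + w.1.2 {1, 2} * dp 1 Q (toJ1 w.1) + w.1.2 {2, 2} * dp 2 Q (toJ1 w.1)) * w.2)

/-- Type II:
`V = λ/(λ-1) u₃₄ ∂_x - u₁₄/(λ-1) ∂_z - u₁₃ ∂_t + f_z u₁₄ λ ∂_λ`. -/
def laxVII (f : ℝ × ℝ → ℝ) : SpectralField := fun w =>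
  (![w.2 / (w.2 - 1) * w.1.2 {2, 3}, 0, -(w.1.2 {0, 3} / (w.2 - 1)), -w.1.2 {0, 2}],
    pd2 f (yz (toJ1 w.1)) * w.1.2 {0, 3} * w.2)

/-- Type II:
`W = λ/(λ-1) u₂₄ ∂_x - u₁₄/(λ-1) ∂_y - u₁₂ ∂_t + f_y u₁₄ λ ∂_λ`. -/
def laxWII (f : ℝ × ℝ → ℝ) : SpectralField := fun w =>
  (![w.2 / (w.2 - 1) * w.1.2 {1, 3}, -(w.1.2 {0, 3} / (w.2 - 1)), 0, -w.1.2 {0, 1}],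
    pd1 f (yz (toJ1 w.1)) * w.1.2 {0, 3} * w.2)

/-! ### Local forms of `Q` near a 1-jet -/

/-- Near `q`, `Q` belongs to the general branch of type III. -/
def IsGeneralNear (Q : J1 → ℝ) (q : J1) : Prop :=
  ∃ (O : Set (ℝ × ℝ)) (F G H L : ℝ × ℝ → ℝ) (N : Set J1), IsOpen O ∧ N ∈ 𝓝 q ∧
    ContDiffOn ℝ ∞ F O ∧ ContDiffOn ℝ ∞ G O ∧ ContDiffOn ℝ ∞ H O ∧ ContDiffOn ℝ ∞ L O ∧
    (∀ a ∈ O, pd1 L a + pd2 (F * L) a = 1 / 2 * pd2 (pd2 F) a) ∧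
    ∀ r ∈ N, xy r ∈ O ∧ deltaIII F G r ≠ 0 ∧ Q r = generalIII F G H L r

/-- Near `q`, `Q` belongs to the first singular branch of type III, and a point transformation
brings the equation to the form with `Q = u₂/u₃ - k(x) u₃`. -/
def IsSingular₁Near (Q : J1 → ℝ) (q : J1) : Prop :=
  ∃ (O : Set (ℝ × ℝ)) (f h : ℝ × ℝ → ℝ) (k : ℝ → ℝ) (N : Set J1), IsOpen O ∧ N ∈ 𝓝 q ∧
    ContDiffOn ℝ ∞ f O ∧ ContDiffOn ℝ ∞ h O ∧ (∀ a ∈ O, ContDiffAt ℝ ∞ k a.1) ∧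
    (∀ r ∈ N, xy r ∈ O ∧ r.2.2 2 + f (xy r) ≠ 0 ∧ Q r = singularIII₁ f h k r) ∧
    PointReducesIII Q (fun r => r.2.2 1 / r.2.2 2 - k (r.1 0) * r.2.2 2) N

/-- Near `q`, `Q` belongs to the second singular branch of type III, and a point transformation
brings the equation to the form with `Q = z f_y - f_x u₃`. -/
def IsSingular₂Near (Q : J1 → ℝ) (q : J1) : Prop :=
  ∃ (O : Set (ℝ × ℝ)) (f h f' : ℝ × ℝ → ℝ) (k : ℝ → ℝ) (N : Set J1), IsOpen O ∧ N ∈ 𝓝 q ∧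
    ContDiffOn ℝ ∞ f O ∧ ContDiffOn ℝ ∞ h O ∧ ContDiffOn ℝ ∞ f' O ∧
    (∀ a ∈ O, ContDiffAt ℝ ∞ k a.1) ∧
    (∀ r ∈ N, xy r ∈ O ∧ Q r = singularIII₂ f h k r) ∧
    PointReducesIII Q (fun r => r.1 2 * pd2 f' (xy r) - pd1 f' (xy r) * r.2.2 2) N

/-- Near `q`, `Q` belongs to the third singular branch of type III, and a point transformation
brings the equation to the form with `Q = z f(y)`. -/
def IsSingular₃Near (Q : J1 → ℝ) (q : J1) : Prop :=
  ∃ (O : Set (ℝ × ℝ)) (f : ℝ → ℝ) (h : ℝ × ℝ → ℝ) (N : Set J1), IsOpen O ∧ N ∈ 𝓝 q ∧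
    (∀ a ∈ O, ContDiffAt ℝ ∞ f a.2) ∧ ContDiffOn ℝ ∞ h O ∧
    (∀ r ∈ N, xy r ∈ O ∧ Q r = singularIII₃ f h r) ∧
    PointReducesIII Q (fun r => r.1 2 * f (r.1 1)) N

/-- Near `q`, `Q = f_y u₃ - f_z u₂ + h` with functions `f, h` of `(y, z)`. -/
def IsBranchIINear (Q : J1 → ℝ) (q : J1) : Prop :=
  ∃ (O : Set (ℝ × ℝ)) (f h : ℝ × ℝ → ℝ) (N : Set J1), IsOpen O ∧ N ∈ 𝓝 q ∧
    ContDiffOn ℝ ∞ f O ∧ ContDiffOn ℝ ∞ h O ∧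
    ∀ r ∈ N, yz r ∈ O ∧ Q r = branchII f h r

end

end DispersionlessLax

open DispersionlessLax

namespace DispersionlessLax

noncomputable section

/-! ### Smooth functions of finitely many jet coordinates -/

/-! The symmetry condition is elementary. The second order part of the prolonged contact field
multiplies the left hand side of the equation by a factor, so what remains is the derivative of `Q`
along the field on `J¹`. Testing with the generating functions `1`, `t`, `u₄` (and `x`, `u₁` for
type II) shows that symmetry means independence of `Q` of `t, u, u₄` (and of `x, u₁`):
`isSymmetric_eqIII_iff`, `isSymmetric_eqII_iff`.

Integrability is analysed through the null planes of the symbol, which form two families. Where a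
2×2 minor of the base components of a Lax pair does not vanish, the pair can be replaced by a frame
`X, Y` with two constant components, and this frame commutes on solutions
(`IsLaxPair.exists_normalPair`). A plane of a given family is fixed by one function. The base
components of `[X, Y] = 0` give its derivatives along `X` and `Y`, and one compatibility condition
remains. For the self-dual family this is `v * condIII = 0`, respectively `m (1 - m) * condII = 0`;
since different `λ` give different planes, the exceptional values of `v` and `m` can be avoided. For
the anti-self-dual family the condition involves fourth derivatives of `u`. If `ξ` is a null
covector, adding a multiple of `ξ⁴` to the fourth derivatives of a solution jet violates no equation
up to that order, and comparing the condition before and after gives an identity in `ξ`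
(`NormalPair.compat`) which a suitable `ξ` contradicts. Hence `condIII` and `condII` vanish at all
regular jets. The second derivatives of `u` not fixed by the equation being arbitrary, this amounts
to a system of differential equations for `Q` on `J¹`: `CondIII`, `CondII`.

These systems are then solved. In type II `Q` is affine in `u₂, u₃` and the divergence condition
gives the potential `f`. In type III with `Q_{u₁} ≠ 0`, the function `1 / Q_{u₁}` is `Δ`, the
combination `rhoIII` turns out to depend on `x, y` only and is `-2 L`, and `H` is what is left over;
with `Q_{u₁} = 0` the cases are simpler and a shift `u ↦ u + z a(x, y) + g(x, y)` normalizes `Q`.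
Conversely the local forms satisfy the systems, first on a dense set and then everywhere by
continuity, and the systems are what makes the explicit fields an integrable distribution
(`isLaxPair_eqIII`, `isLaxPair_eqII`).

The phrase "by virtue of the equation" is made precise by solving the equation for one leading
derivative: `LeadingForm.solve` completes free data to a formal solution, which shows that total
derivatives are tangent to the prolonged equation. Identities valid only on solutions may therefore
be differentiated (`LeadingForm.act_congr`). -/

/-- The base point, the jet coordinates with multi-indices in `s`, and the parameter. -/
def coords (s : Finset (Multiset (Fin 4))) (w : Jet × ℝ) : ((Fin 4 → ℝ) × (s → ℝ)) × ℝ :=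
  ((w.1.1, fun I => w.1.2 I), w.2)

lemma continuous_coords (s : Finset (Multiset (Fin 4))) : Continuous (coords s) := by
  unfold coords; fun_prop

lemma coords_add_smul (s : Finset (Multiset (Fin 4))) (w d : Jet × ℝ) (t : ℝ) :
    coords s (w + t • d) = coords s w + t • coords s d := rfl

/-- Forgetting some of the jet coordinates. -/
def restrictCoords {s s' : Finset (Multiset (Fin 4))} (h : s ⊆ s')
    (y : ((Fin 4 → ℝ) × (s' → ℝ)) × ℝ) : ((Fin 4 → ℝ) × (s → ℝ)) × ℝ :=
  ((y.1.1, fun I => y.1.2 ⟨I, h I.2⟩), y.2)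

lemma contDiff_restrictCoords {s s' : Finset (Multiset (Fin 4))} (h : s ⊆ s') :
    ContDiff ℝ ∞ (restrictCoords h) := by
  unfold restrictCoords; fun_prop

lemma smoothAt_iff {f : Jet × ℝ → ℝ} {w : Jet × ℝ} :
    SmoothAt f w ↔ ∃ (s : Finset (Multiset (Fin 4))) (g : ((Fin 4 → ℝ) × (s → ℝ)) × ℝ → ℝ),
      ContDiffAt ℝ ∞ g (coords s w) ∧ f =ᶠ[𝓝 w] g ∘ coords s := Iff.rfl

/-- Used to write several smooth functions over one common finite set of jet coordinates. -/
lemma SmoothAt.exists_of_superset {f : Jet × ℝ → ℝ} {w : Jet × ℝ} (h : SmoothAt f w) :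
    ∃ s : Finset (Multiset (Fin 4)), ∀ s' : Finset (Multiset (Fin 4)), s ⊆ s' →
      ∃ g : ((Fin 4 → ℝ) × (s' → ℝ)) × ℝ → ℝ,
        ContDiffAt ℝ ∞ g (coords s' w) ∧ f =ᶠ[𝓝 w] g ∘ coords s' := by
  obtain ⟨s, g, hg, hf⟩ := smoothAt_iff.1 h
  refine ⟨s, fun s' hs => ⟨g ∘ restrictCoords hs, ?_, hf⟩⟩
  exact ContDiffAt.comp _ hg (contDiff_restrictCoords hs).contDiffAt

lemma SmoothAt.congr {f g : Jet × ℝ → ℝ} {w : Jet × ℝ} (h : SmoothAt f w) (e : g =ᶠ[𝓝 w] f) :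
    SmoothAt g w := by
  obtain ⟨s, k, hk, hf⟩ := h
  exact ⟨s, k, hk, e.trans hf⟩

lemma SmoothAt.continuousAt {f : Jet × ℝ → ℝ} {w : Jet × ℝ} (h : SmoothAt f w) :
    ContinuousAt f w := by
  obtain ⟨s, g, hg, hf⟩ := smoothAt_iff.1 h
  exact (ContinuousAt.comp (f := coords s) hg.continuousAt
    (continuous_coords s).continuousAt).congr hf.symm

/-- A smooth function of finitely many smooth functions is smooth. -/
lemma SmoothAt.comp_family {ι : Type} [Fintype ι] {f : ι → Jet × ℝ → ℝ} {w : Jet × ℝ}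
    (hf : ∀ i, SmoothAt (f i) w) {φ : (ι → ℝ) → ℝ} (hφ : ContDiffAt ℝ ∞ φ (fun i => f i w)) :
    SmoothAt (fun v => φ (fun i => f i v)) w := by
  classical
  choose s hs using fun i => (hf i).exists_of_superset
  choose g hg hfg using fun i => hs i (Finset.univ.biUnion s)
    (Finset.subset_biUnion_of_mem s (Finset.mem_univ i))
  refine smoothAt_iff.2 ⟨Finset.univ.biUnion s, fun y => φ (fun i => g i y), ?_, ?_⟩
  · have e : (fun i => f i w) = fun i => g i (coords (Finset.univ.biUnion s) w) :=
      funext fun i => (hfg i).self_of_nhds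
    rw [e] at hφ
    exact ContDiffAt.comp (f := fun y => fun i => g i y) _ hφ (contDiffAt_pi.2 hg)
  · filter_upwards [Filter.eventually_all.2 hfg] with v hv
    simp only [Function.comp_apply] at hv ⊢
    congr 1
    exact funext hv

lemma SmoothAt.comp₂ {f g : Jet × ℝ → ℝ} {w : Jet × ℝ} (hf : SmoothAt f w) (hg : SmoothAt g w)
    {φ : ℝ → ℝ → ℝ} (hφ : ContDiffAt ℝ ∞ (fun p : ℝ × ℝ => φ p.1 p.2) (f w, g w)) :
    SmoothAt (fun v => φ (f v) (g v)) w := by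
  have := SmoothAt.comp_family (ι := Fin 2) (f := ![f, g]) (w := w)
    (φ := fun p => φ (p 0) (p 1)) (by intro i; fin_cases i <;> simpa)
    (ContDiffAt.comp (g := fun p : ℝ × ℝ => φ p.1 p.2) (f := fun p : Fin 2 → ℝ => (p 0, p 1)) _
      (by simpa using hφ) (by fun_prop))
  simpa using this

lemma smoothAt_const (a : ℝ) (w : Jet × ℝ) : SmoothAt (fun _ => a) w :=
  ⟨∅, fun _ => a, contDiffAt_const, .of_forall fun _ => rfl⟩

lemma smoothAt_base (i : Fin 4) (w : Jet × ℝ) : SmoothAt (fun v => v.1.1 i) w :=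
  ⟨∅, fun y => y.1.1 i, by fun_prop, .of_forall fun _ => rfl⟩

lemma smoothAt_coord (I : Multiset (Fin 4)) (w : Jet × ℝ) : SmoothAt (fun v => v.1.2 I) w :=
  ⟨{I}, fun y => y.1.2 ⟨I, by simp⟩, by fun_prop, .of_forall fun _ => rfl⟩

lemma smoothAt_param (w : Jet × ℝ) : SmoothAt (fun v => v.2) w :=
  ⟨∅, fun y => y.2, by fun_prop, .of_forall fun _ => rfl⟩

section Algebra

variable {f g : Jet × ℝ → ℝ} {w : Jet × ℝ}

lemma SmoothAt.add (hf : SmoothAt f w) (hg : SmoothAt g w) : SmoothAt (fun v => f v + g v) w :=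
  hf.comp₂ (φ := fun a b => a + b) hg (by fun_prop)

lemma SmoothAt.sub (hf : SmoothAt f w) (hg : SmoothAt g w) : SmoothAt (fun v => f v - g v) w :=
  hf.comp₂ (φ := fun a b => a - b) hg (by fun_prop)

lemma SmoothAt.mul (hf : SmoothAt f w) (hg : SmoothAt g w) : SmoothAt (fun v => f v * g v) w :=
  hf.comp₂ (φ := fun a b => a * b) hg (by fun_prop)

lemma SmoothAt.neg (hf : SmoothAt f w) : SmoothAt (fun v => -f v) w :=
  hf.comp₂ (φ := fun a _ => -a) hf (by fun_prop)

lemma SmoothAt.pow (hf : SmoothAt f w) (n : ℕ) : SmoothAt (fun v => f v ^ n) w :=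
  hf.comp₂ (φ := fun a _ => a ^ n) hf (by fun_prop)

lemma SmoothAt.div (hf : SmoothAt f w) (hg : SmoothAt g w) (h : g w ≠ 0) :
    SmoothAt (fun v => f v / g v) w :=
  hf.comp₂ (φ := fun a b => a / b) hg (by
    exact ContDiffAt.div contDiffAt_fst contDiffAt_snd h)

lemma SmoothAt.sum {ι : Type} [Fintype ι] {F : ι → Jet × ℝ → ℝ} (h : ∀ i, SmoothAt (F i) w) :
    SmoothAt (fun v => ∑ i, F i v) w :=
  SmoothAt.comp_family (φ := fun y => ∑ i, y i) h (by fun_prop)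

end Algebra

lemma SmoothAt.comp_toJ1 {h : J1 → ℝ} {w : Jet × ℝ} (hh : ContDiffAt ℝ ∞ h (toJ1 w.1)) :
    SmoothAt (fun v => h (toJ1 v.1)) w := by
  have := SmoothAt.comp_family (ι := Fin 4 ⊕ Unit ⊕ Fin 4) (w := w)
    (f := Sum.elim (fun i v => v.1.1 i) (Sum.elim (fun _ v => v.1.2 0) (fun i v => v.1.2 {i})))
    (φ := fun y => h (fun i => y (.inl i), y (.inr (.inl ())), fun i => y (.inr (.inr i))))
    (by
      rintro (i | i | i)
      · exact smoothAt_base i w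
      · exact smoothAt_coord 0 w
      · exact smoothAt_coord {i} w)
    (ContDiffAt.comp (g := h) (f := fun y : Fin 4 ⊕ Unit ⊕ Fin 4 → ℝ =>
      ((fun i => y (.inl i), y (.inr (.inl ())), fun i => y (.inr (.inr i))) : J1)) _
      (by simpa [toJ1] using hh) (by fun_prop))
  simpa [toJ1] using this

/-! ### Derivatives along curves -/

/-- Stated for topological vector spaces because jet space is an infinite product, not a normed
space; continuity of the line `t ↦ x + t v` is all that is needed. -/
lemma hasLineDerivAt_congr {E : Type*} [TopologicalSpace E] [AddCommGroup E] [Module ℝ E]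
    [ContinuousAdd E] [ContinuousSMul ℝ E] {f g : E → ℝ} {a : ℝ} {x v : E}
    (h : HasLineDerivAt ℝ g a x v) (e : f =ᶠ[𝓝 x] g) : HasLineDerivAt ℝ f a x v := by
  have hc : ContinuousAt (fun t : ℝ => x + t • v) 0 := by fun_prop
  refine HasDerivAt.congr_of_eventuallyEq h ?_
  have e' : ∀ᶠ y in 𝓝 (x + (0 : ℝ) • v), f y = g y := by rw [zero_smul, add_zero]; exact e
  exact hc.eventually e'

lemma lineDeriv_congr {E : Type*} [TopologicalSpace E] [AddCommGroup E] [Module ℝ E]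
    [ContinuousAdd E] [ContinuousSMul ℝ E] {f g : E → ℝ} {x : E}
    (e : f =ᶠ[𝓝 x] g) (v : E) : lineDeriv ℝ f x v = lineDeriv ℝ g x v := by
  have hc : ContinuousAt (fun t : ℝ => x + t • v) 0 := by fun_prop
  refine Filter.EventuallyEq.deriv_eq ?_
  have e' : ∀ᶠ y in 𝓝 (x + (0 : ℝ) • v), f y = g y := by rw [zero_smul, add_zero]; exact e
  exact hc.eventually e'

lemma lineDeriv_eq_fderiv_coords {f : Jet × ℝ → ℝ} {w : Jet × ℝ}
    {s : Finset (Multiset (Fin 4))} {g : ((Fin 4 → ℝ) × (s → ℝ)) × ℝ → ℝ}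
    (hg : DifferentiableAt ℝ g (coords s w)) (hf : f =ᶠ[𝓝 w] g ∘ coords s) (d : Jet × ℝ) :
    HasLineDerivAt ℝ f (fderiv ℝ g (coords s w) (coords s d)) w d := by
  refine hasLineDerivAt_congr ?_ hf
  exact hg.hasFDerivAt.hasLineDerivAt (coords s d)

lemma SmoothAt.hasLineDerivAt {f : Jet × ℝ → ℝ} {w : Jet × ℝ} (h : SmoothAt f w) (d : Jet × ℝ) :
    HasLineDerivAt ℝ f (lineDeriv ℝ f w d) w d := by
  obtain ⟨s, g, hg, hf⟩ := smoothAt_iff.1 h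
  have := lineDeriv_eq_fderiv_coords (hg.differentiableAt (by simp)) hf d
  rwa [this.lineDeriv]

/-- Line derivatives need not be additive in the direction. Here additivity is inherited from the
Fréchet derivative in finitely many coordinates. -/
lemma SmoothAt.lineDeriv_add {f : Jet × ℝ → ℝ} {w : Jet × ℝ} (h : SmoothAt f w) (d d' : Jet × ℝ) :
    lineDeriv ℝ f w (d + d') = lineDeriv ℝ f w d + lineDeriv ℝ f w d' := by
  obtain ⟨s, g, hg, hf⟩ := smoothAt_iff.1 h
  have := fun d => (lineDeriv_eq_fderiv_coords (hg.differentiableAt (by simp)) hf d).lineDeriv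
  simp only [this]
  exact map_add _ (coords s d) (coords s d')

lemma SmoothAt.lineDeriv_smul {f : Jet × ℝ → ℝ} {w : Jet × ℝ} (h : SmoothAt f w) (a : ℝ)
    (d : Jet × ℝ) : lineDeriv ℝ f w (a • d) = a * lineDeriv ℝ f w d := by
  obtain ⟨s, g, hg, hf⟩ := smoothAt_iff.1 h
  have := fun d => (lineDeriv_eq_fderiv_coords (hg.differentiableAt (by simp)) hf d).lineDeriv
  simp only [this]
  exact map_smul _ a (coords s d)

/-- A curve with differentiable coordinates. -/
structure HasCoordDerivAt (c : ℝ → Jet) (d : Jet) : Prop where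
  base : ∀ i, HasDerivAt (fun t => (c t).1 i) (d.1 i) 0
  coord : ∀ I, HasDerivAt (fun t => (c t).2 I) (d.2 I) 0

lemma HasCoordDerivAt.continuousAt {c : ℝ → Jet} {d : Jet} (h : HasCoordDerivAt c d) :
    ContinuousAt c 0 := by
  refine ContinuousAt.prodMk (f := fun t => (c t).1) (g := fun t => (c t).2) ?_ ?_
  · exact continuousAt_pi.2 fun i => (h.base i).continuousAt
  · exact continuousAt_pi.2 fun i => (h.coord i).continuousAt

lemma hasCoordDerivAt_line (j d : Jet) : HasCoordDerivAt (fun t => j + t • d) d where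
  base i := by
    have := ((hasDerivAt_id (0 : ℝ)).mul_const (d.1 i)).const_add (j.1 i)
    simpa using this
  coord I := by
    have := ((hasDerivAt_id (0 : ℝ)).mul_const (d.2 I)).const_add (j.2 I)
    simpa using this

/-- The chain rule is needed along curves and not only along lines: the prolonged equation is not a
linear subspace, and its tangent vectors are realized by curves of formal solutions. -/
lemma SmoothAt.hasDerivAt_comp {f : Jet × ℝ → ℝ} {c : ℝ → Jet} {d : Jet} {l : ℝ → ℝ} {l' : ℝ}
    (h : SmoothAt f (c 0, l 0)) (hc : HasCoordDerivAt c d) (hl : HasDerivAt l l' 0) :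
    HasDerivAt (fun t => f (c t, l t)) (lineDeriv ℝ f (c 0, l 0) (d, l')) 0 := by
  obtain ⟨s, g, hg, hf⟩ := smoothAt_iff.1 h
  rw [(lineDeriv_eq_fderiv_coords (hg.differentiableAt (by simp)) hf (d, l')).lineDeriv]
  have h1 : HasDerivAt (fun t => coords s (c t, l t)) (coords s (d, l')) 0 :=
    ((hasDerivAt_pi.2 hc.base).prodMk
      (hasDerivAt_pi.2 fun I : s => hc.coord I)).prodMk hl
  have h2 : ContinuousAt (fun t => (c t, l t)) 0 := hc.continuousAt.prodMk hl.continuousAt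
  have h3 := HasFDerivAt.comp_hasDerivAt (0 : ℝ) (hg.differentiableAt (by simp)).hasFDerivAt h1
  exact h3.congr_of_eventuallyEq (h2.eventually hf)

/-! ### The coordinate derivations -/

/-- The vector fields `D_i` and `∂_λ`. -/
def basisVec : Option (Fin 4) → Jet × ℝ → Jet × ℝ
  | none, _ => (0, 1)
  | some i, w => (totalVec i w.1, 0)

/-- The linear parts of the vector fields `D_i` and `∂_λ`. -/
def basisLin : Option (Fin 4) → Jet × ℝ → Jet × ℝ
  | none, _ => 0
  | some i, d => ((0, fun I => d.1.2 (i ::ₘ I)), 0)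

/-- The derivations `D_i` and `∂_λ`. -/
def basisDeriv (o : Option (Fin 4)) (f : Jet × ℝ → ℝ) (w : Jet × ℝ) : ℝ :=
  lineDeriv ℝ f w (basisVec o w)

/-- The coefficients of `D_i` are affine in the jet coordinates, with constant part `∂_{x^i}` and
linear part `basisLin`; their derivative along a direction is thus exact. -/
lemma basisVec_add_smul (o : Option (Fin 4)) (w d : Jet × ℝ) (t : ℝ) :
    basisVec o (w + t • d) = basisVec o w + t • basisLin o d := by
  cases o with
  | none => simp [basisVec, basisLin]
  | some i => ext <;> simp [basisVec, basisLin, totalVec]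

/-- The two sides are the derivatives of the coefficients of one field along the other, so equality
says that `D_i`, `D_k` and `∂_λ` commute. It holds because `u_{I+i+k}` is symmetric in `i, k`. -/
lemma basisLin_comm (o o' : Option (Fin 4)) (w : Jet × ℝ) :
    basisLin o (basisVec o' w) = basisLin o' (basisVec o w) := by
  cases o <;> cases o' <;> simp [basisVec, basisLin, totalVec, Multiset.cons_swap]
  all_goals rfl

/-- `basisVec` in coordinates. -/
lemma basisVec_coords (o : Option (Fin 4)) (s : Finset (Multiset (Fin 4))) :
    ∃ s', s ⊆ s' ∧ ∃ A : ((Fin 4 → ℝ) × (s' → ℝ)) × ℝ → ((Fin 4 → ℝ) × (s → ℝ)) × ℝ,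
      ContDiff ℝ ∞ A ∧ ∀ w, coords s (basisVec o w) = A (coords s' w) := by
  classical
  cases o with
  | none => exact ⟨s, subset_rfl, fun _ => ((0, 0), 1), contDiff_const, fun w => rfl⟩
  | some i =>
    refine ⟨s ∪ s.image (i ::ₘ ·), Finset.subset_union_left,
      fun y => ((Pi.single i 1, fun I => y.1.2 ⟨i ::ₘ I.1,
        Finset.mem_union_right _ (Finset.mem_image_of_mem _ I.2)⟩), 0), ?_, fun w => rfl⟩
    refine ((contDiff_const (c := (Pi.single i 1 : Fin 4 → ℝ))).prodMk
      (contDiff_pi.2 fun I => ?_)).prodMk contDiff_const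
    exact (contDiff_pi.1 (contDiff_snd.comp contDiff_fst) _)

lemma SmoothAt.smoothAt_basisDeriv {f : Jet × ℝ → ℝ} {w : Jet × ℝ} (h : SmoothAt f w)
    (o : Option (Fin 4)) : SmoothAt (basisDeriv o f) w := by
  obtain ⟨s, g, hg, hf⟩ := smoothAt_iff.1 h
  obtain ⟨s', hs, A, hA, hAw⟩ := basisVec_coords o s
  have hr : ContDiff ℝ ∞ (restrictCoords hs) := contDiff_restrictCoords hs
  refine smoothAt_iff.2 ⟨s', fun y => fderiv ℝ g (restrictCoords hs y) (A y), ?_, ?_⟩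
  · have h1 : ContDiffAt ℝ ∞ (fderiv ℝ g) (restrictCoords hs (coords s' w)) :=
      ContDiffAt.fderiv_right (m := ∞) hg (by simp)
    exact (ContDiffAt.comp _ h1 hr.contDiffAt).clm_apply hA.contDiffAt
  · have hd : ∀ᶠ v in 𝓝 w, DifferentiableAt ℝ g (coords s v) := by
      have h1 : ContDiffAt ℝ 1 g (coords s w) := hg.of_le (by simp)
      exact (continuous_coords s).continuousAt.eventually
        ((h1.eventually (by decide)).mono fun y hy => hy.differentiableAt (by simp))
    filter_upwards [hd, hf.eventually_nhds] with v hv hfv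
    rw [Function.comp_apply, ← hAw]
    exact (lineDeriv_eq_fderiv_coords hv hfv _).lineDeriv

/-- An iterated derivative is a second derivative of the coordinate expression plus a first
derivative along `basisLin`; both parts are symmetric. -/
lemma SmoothAt.basisDeriv_comm {f : Jet × ℝ → ℝ} {w : Jet × ℝ} (h : SmoothAt f w)
    (o o' : Option (Fin 4)) :
    basisDeriv o (basisDeriv o' f) w =
      basisDeriv o' (basisDeriv o f) w := by
  obtain ⟨s, g, hg, hf⟩ := smoothAt_iff.1 h
  have hd : ∀ᶠ v in 𝓝 w, DifferentiableAt ℝ g (coords s v) := by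
    have h1 : ContDiffAt ℝ 1 g (coords s w) := hg.of_le (by simp)
    exact (continuous_coords s).continuousAt.eventually
      ((h1.eventually (by decide)).mono fun y hy => hy.differentiableAt (by simp))
  have hD : DifferentiableAt ℝ (fderiv ℝ g) (coords s w) :=
    (ContDiffAt.fderiv_right (m := 1) hg (WithTop.coe_le_coe.2 le_top)).differentiableAt (by simp)
  have key : ∀ o o' : Option (Fin 4), basisDeriv o (basisDeriv o' f) w =
      fderiv ℝ (fderiv ℝ g) (coords s w) (coords s (basisVec o w)) (coords s (basisVec o' w)) +
        fderiv ℝ g (coords s w) (coords s (basisLin o' (basisVec o w))) := by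
    intro o o'
    have e : basisDeriv o' f =ᶠ[𝓝 w]
        fun v => fderiv ℝ g (coords s v) (coords s (basisVec o' v)) := by
      filter_upwards [hd, hf.eventually_nhds] with v hv hfv
      exact (lineDeriv_eq_fderiv_coords hv hfv _).lineDeriv
    rw [basisDeriv, lineDeriv_congr e]
    refine HasLineDerivAt.lineDeriv ?_
    unfold HasLineDerivAt
    beta_reduce
    simp only [basisVec_add_smul, coords_add_smul]
    have hline : ∀ a b : ((Fin 4 → ℝ) × (s → ℝ)) × ℝ,
        HasDerivAt (fun t : ℝ => a + t • b) b 0 := fun a b => by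
      simpa using ((hasDerivAt_id (0 : ℝ)).smul_const b).const_add a
    have h1 : HasDerivAt (fun t : ℝ => fderiv ℝ g (coords s w + t • coords s (basisVec o w)))
        (fderiv ℝ (fderiv ℝ g) (coords s w) (coords s (basisVec o w))) 0 := by
      have h2 : HasFDerivAt (fderiv ℝ g) (fderiv ℝ (fderiv ℝ g) (coords s w))
          (coords s w + (0 : ℝ) • coords s (basisVec o w)) := by simpa using hD.hasFDerivAt
      exact h2.comp_hasDerivAt (0 : ℝ) (hline _ _)
    simpa using h1.clm_apply (hline (coords s (basisVec o' w)) _)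
  rw [key, key, basisLin_comm o' o]
  congr 1
  exact (hg.isSymmSndFDerivAt (by simp only [minSmoothness_of_isRCLikeNormedField]; exact WithTop.coe_le_coe.2 le_top)) _ _

/-! ### Calculus of spectral fields -/

section Rules

variable {f g : Jet × ℝ → ℝ} {w : Jet × ℝ}

lemma SmoothAt.lineDeriv_fun_add (hf : SmoothAt f w) (hg : SmoothAt g w) (d : Jet × ℝ) :
    lineDeriv ℝ (fun v => f v + g v) w d = lineDeriv ℝ f w d + lineDeriv ℝ g w d := by
  have h := HasDerivAt.add (hf.hasLineDerivAt d) (hg.hasLineDerivAt d)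
  exact HasLineDerivAt.lineDeriv h

lemma SmoothAt.lineDeriv_fun_sub (hf : SmoothAt f w) (hg : SmoothAt g w) (d : Jet × ℝ) :
    lineDeriv ℝ (fun v => f v - g v) w d = lineDeriv ℝ f w d - lineDeriv ℝ g w d := by
  have h := HasDerivAt.sub (hf.hasLineDerivAt d) (hg.hasLineDerivAt d)
  exact HasLineDerivAt.lineDeriv h

lemma SmoothAt.lineDeriv_fun_neg (hf : SmoothAt f w) (d : Jet × ℝ) :
    lineDeriv ℝ (fun v => -f v) w d = -lineDeriv ℝ f w d := by
  have h := HasDerivAt.neg (hf.hasLineDerivAt d)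
  exact HasLineDerivAt.lineDeriv h

lemma SmoothAt.lineDeriv_fun_mul (hf : SmoothAt f w) (hg : SmoothAt g w) (d : Jet × ℝ) :
    lineDeriv ℝ (fun v => f v * g v) w d =
      lineDeriv ℝ f w d * g w + f w * lineDeriv ℝ g w d := by
  have h := HasDerivAt.mul (hf.hasLineDerivAt d) (hg.hasLineDerivAt d)
  have := HasLineDerivAt.lineDeriv (f := fun v => f v * g v) (x := w) (v := d) h
  simpa using this

lemma SmoothAt.lineDeriv_fun_div (hf : SmoothAt f w) (hg : SmoothAt g w) (h0 : g w ≠ 0)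
    (d : Jet × ℝ) :
    lineDeriv ℝ (fun v => f v / g v) w d =
      (lineDeriv ℝ f w d * g w - f w * lineDeriv ℝ g w d) / g w ^ 2 := by
  have h := HasDerivAt.div (hf.hasLineDerivAt d) (hg.hasLineDerivAt d) (by simpa using h0)
  have := HasLineDerivAt.lineDeriv (f := fun v => f v / g v) (x := w) (v := d) h
  simpa using this

lemma lineDeriv_fun_const (a : ℝ) (w d : Jet × ℝ) : lineDeriv ℝ (fun _ => a) w d = 0 := by
  simp [lineDeriv]

lemma lineDeriv_coord (I : Multiset (Fin 4)) (w d : Jet × ℝ) :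
    lineDeriv ℝ (fun v : Jet × ℝ => v.1.2 I) w d = d.1.2 I :=
  HasLineDerivAt.lineDeriv
    (by simpa [HasLineDerivAt] using (hasCoordDerivAt_line w.1 d.1).coord I)

lemma lineDeriv_param (w d : Jet × ℝ) :
    lineDeriv ℝ (fun v : Jet × ℝ => v.2) w d = d.2 := by
  refine HasLineDerivAt.lineDeriv ?_
  have := ((hasDerivAt_id (0 : ℝ)).mul_const d.2).const_add w.2
  simpa [HasLineDerivAt] using this

/-- The projection of tangent vectors of the jet space to tangent vectors of `J¹`. -/
def toJ1Vec (d : Jet) : J1 := (d.1, d.2 0, fun i => d.2 {i})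

lemma toJ1_add_smul (j d : Jet) (t : ℝ) : toJ1 (j + t • d) = toJ1 j + t • toJ1Vec d := rfl

lemma lineDeriv_comp_toJ1 {h : J1 → ℝ} {w : Jet × ℝ} (hh : DifferentiableAt ℝ h (toJ1 w.1))
    (d : Jet × ℝ) :
    lineDeriv ℝ (fun v : Jet × ℝ => h (toJ1 v.1)) w d = fderiv ℝ h (toJ1 w.1) (toJ1Vec d.1) :=
  HasLineDerivAt.lineDeriv (hh.hasFDerivAt.hasLineDerivAt (toJ1Vec d.1))

end Rules

/-- The components of a spectral field. -/
def SpectralField.comp (X : SpectralField) : Option (Fin 4) → Jet × ℝ → ℝ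
  | none, w => (X w).2
  | some i, w => (X w).1 i

/-- The coefficients of the field are smooth at `w`. -/
def SpectralField.Smooth (X : SpectralField) (w : Jet × ℝ) : Prop :=
  ∀ o, SmoothAt (X.comp o) w

/-- The value of a spectral field as a tangent vector. -/
def SpectralField.vec (X : SpectralField) (w : Jet × ℝ) : Jet × ℝ :=
  (∑ i, (X w).1 i • totalVec i w.1, (X w).2)

lemma SpectralField.act_eq (X : SpectralField) (g : Jet × ℝ → ℝ) (w : Jet × ℝ) :
    X.act g w = lineDeriv ℝ g w (X.vec w) := rfl

lemma SpectralField.vec_eq_sum (X : SpectralField) (w : Jet × ℝ) :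
    X.vec w = ∑ o, X.comp o w • basisVec o w := by
  rw [Fintype.sum_option]
  ext i <;> simp [SpectralField.vec, SpectralField.comp, basisVec, Prod.fst_sum, Prod.snd_sum]

lemma SmoothAt.eventually_smooth_lines {f : Jet × ℝ → ℝ} {w : Jet × ℝ} (h : SmoothAt f w) :
    ∀ᶠ v in 𝓝 w, ∃ L : Jet × ℝ →ₗ[ℝ] ℝ, ∀ d, lineDeriv ℝ f v d = L d := by
  obtain ⟨s, g, hg, hf⟩ := smoothAt_iff.1 h
  have hd : ∀ᶠ v in 𝓝 w, DifferentiableAt ℝ g (coords s v) := by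
    have h1 : ContDiffAt ℝ 1 g (coords s w) := hg.of_le (by simp)
    exact (continuous_coords s).continuousAt.eventually
      ((h1.eventually (by decide)).mono fun y hy => hy.differentiableAt (by simp))
  filter_upwards [hd, hf.eventually_nhds] with v hv hfv
  refine ⟨(fderiv ℝ g (coords s v)).toLinearMap ∘ₗ
    { toFun := coords s, map_add' := fun _ _ => rfl, map_smul' := fun _ _ => rfl }, fun d => ?_⟩
  exact (lineDeriv_eq_fderiv_coords hv hfv d).lineDeriv

lemma SmoothAt.eventually_act {f : Jet × ℝ → ℝ} {w : Jet × ℝ} (h : SmoothAt f w)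
    (X : SpectralField) :
    X.act f =ᶠ[𝓝 w] fun v => ∑ o, X.comp o v * basisDeriv o f v := by
  filter_upwards [h.eventually_smooth_lines] with v hv
  obtain ⟨L, hL⟩ := hv
  simp only [SpectralField.act_eq, basisDeriv, hL, SpectralField.vec_eq_sum, map_sum, map_smul,
    smul_eq_mul]

lemma SmoothAt.act_eq_sum {f : Jet × ℝ → ℝ} {w : Jet × ℝ} (h : SmoothAt f w)
    (X : SpectralField) : X.act f w = ∑ o, X.comp o w * DispersionlessLax.basisDeriv o f w :=
  (h.eventually_act X).self_of_nhds

lemma SmoothAt.act {f : Jet × ℝ → ℝ} {w : Jet × ℝ} (h : SmoothAt f w) {X : SpectralField}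
    (hX : X.Smooth w) : SmoothAt (X.act f) w :=
  (SmoothAt.sum fun o => (hX o).mul (h.smoothAt_basisDeriv o)).congr (h.eventually_act X)

lemma SpectralField.comp_bracket (X Y : SpectralField) (o : Option (Fin 4)) (w : Jet × ℝ) :
    (X.bracket Y).comp o w = X.act (Y.comp o) w - Y.act (X.comp o) w := by
  cases o <;> rfl

lemma SmoothAt.lineDeriv_finset_sum {ι : Type} {F : ι → Jet × ℝ → ℝ} {w : Jet × ℝ}
    (h : ∀ i, SmoothAt (F i) w) (t : Finset ι) (d : Jet × ℝ) :
    lineDeriv ℝ (fun v => ∑ i ∈ t, F i v) w d = ∑ i ∈ t, lineDeriv ℝ (F i) w d := by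
  have := HasDerivAt.fun_sum (u := t) fun i _ => (h i).hasLineDerivAt d
  exact HasLineDerivAt.lineDeriv this

/-- The action of the commutator of two fields. -/
lemma SpectralField.bracket_act {X Y : SpectralField} {f : Jet × ℝ → ℝ} {w : Jet × ℝ}
    (hX : X.Smooth w) (hY : Y.Smooth w) (hf : SmoothAt f w) :
    (X.bracket Y).act f w = X.act (Y.act f) w - Y.act (X.act f) w := by
  have key : ∀ X Y : SpectralField, X.Smooth w → Y.Smooth w → X.act (Y.act f) w =
      ∑ o, X.act (Y.comp o) w * basisDeriv o f w +
        ∑ o, ∑ o', Y.comp o w * X.comp o' w * basisDeriv o' (basisDeriv o f) w := by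
    intro X Y hX hY
    rw [SpectralField.act_eq, lineDeriv_congr (hf.eventually_act Y),
      SmoothAt.lineDeriv_finset_sum fun o => (hY o).mul (hf.smoothAt_basisDeriv o),
      ← Finset.sum_add_distrib]
    refine Finset.sum_congr rfl fun o _ => ?_
    rw [(hY o).lineDeriv_fun_mul (hf.smoothAt_basisDeriv o), ← SpectralField.act_eq,
      ← SpectralField.act_eq, (hf.smoothAt_basisDeriv o).act_eq_sum, Finset.mul_sum]
    simp only [mul_assoc]
  rw [key X Y hX hY, key Y X hY hX, hf.act_eq_sum]
  have e : ∑ o, ∑ o', Y.comp o w * X.comp o' w * basisDeriv o' (basisDeriv o f) w =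
      ∑ o, ∑ o', X.comp o w * Y.comp o' w * basisDeriv o' (basisDeriv o f) w := by
    rw [Finset.sum_comm]
    refine Finset.sum_congr rfl fun o _ => Finset.sum_congr rfl fun o' _ => ?_
    rw [hf.basisDeriv_comm o o']
    ring
  rw [e, add_sub_add_right_eq_sub, ← Finset.sum_sub_distrib]
  refine Finset.sum_congr rfl fun o _ => ?_
  rw [SpectralField.comp_bracket]
  ring

/-! ### Formal solutions of an equation with a leading derivative -/

/-- Multi-indices ordered by degree and then by weight. -/
def IndexLT (wt : Fin 4 → ℕ) (K I : Multiset (Fin 4)) : Prop :=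
  K.card < I.card ∨ (K.card = I.card ∧ (K.map wt).sum < (I.map wt).sum)

lemma wellFounded_indexLT (wt : Fin 4 → ℕ) : WellFounded (IndexLT wt) := by
  have h : WellFounded (Prod.Lex (· < · : ℕ → ℕ → Prop) (· < · : ℕ → ℕ → Prop)) :=
    WellFounded.prod_lex wellFounded_lt wellFounded_lt
  refine Subrelation.wf ?_ (InvImage.wf (fun I : Multiset (Fin 4) => (I.card, (I.map wt).sum)) h)
  rintro K I (h | ⟨h, h'⟩)
  · exact Prod.Lex.left _ _ h
  · simp only [InvImage, h]
    exact Prod.Lex.right _ h'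

/-- Compatibility of the order with differentiation: the leading coordinate of `D_l F` is the
leading coordinate of `F` differentiated along `l`. -/
lemma IndexLT.cons {wt : Fin 4 → ℕ} {K I : Multiset (Fin 4)} (h : IndexLT wt K I) (i : Fin 4) :
    IndexLT wt (i ::ₘ K) (i ::ₘ I) := by
  rcases h with h | ⟨h, h'⟩
  · left; simpa using h
  · right; simp [h, h']

lemma IndexLT.card_le {wt : Fin 4 → ℕ} {K I : Multiset (Fin 4)} (h : IndexLT wt K I) :
    K.card ≤ I.card := by
  rcases h with h | ⟨h, h'⟩ <;> omega

/-- Two jets agree in the base point and in the coordinates with multi-index in `p`. -/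
def AgreeOn (p : Multiset (Fin 4) → Prop) (j j' : Jet) : Prop :=
  j.1 = j'.1 ∧ ∀ K, p K → j.2 K = j'.2 K

lemma AgreeOn.add_smul {p : Multiset (Fin 4) → Prop} {j j' d d' : Jet} (h : AgreeOn p j j')
    (hd : AgreeOn p d d') (t : ℝ) : AgreeOn p (j + t • d) (j' + t • d') :=
  ⟨by simp [h.1, hd.1], fun K hK => by simp [h.2 K hK, hd.2 K hK]⟩

lemma AgreeOn.symm {p : Multiset (Fin 4) → Prop} {j j' : Jet} (h : AgreeOn p j j') :
    AgreeOn p j' j := ⟨h.1.symm, fun K hK => (h.2 K hK).symm⟩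

lemma AgreeOn.mono {p p' : Multiset (Fin 4) → Prop} {j j' : Jet} (h : AgreeOn p j j')
    (hp : ∀ K, p' K → p K) : AgreeOn p' j j' := ⟨h.1, fun K hK => h.2 K (hp K hK)⟩

lemma AgreeOn.totalVec {p p' : Multiset (Fin 4) → Prop} {j j' : Jet} (h : AgreeOn p' j j')
    (i : Fin 4) (hp : ∀ K, p K → p' (i ::ₘ K)) : AgreeOn p (totalVec i j) (totalVec i j') :=
  ⟨rfl, fun K hK => h.2 _ (hp K hK)⟩

lemma AgreeOn.toJ1_eq {p : Multiset (Fin 4) → Prop} {j j' : Jet} (h : AgreeOn p j j')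
    (hp : ∀ K, K.card ≤ 1 → p K) : toJ1 j = toJ1 j' := by
  simp only [toJ1, h.1, h.2 0 (hp _ (by simp))]
  congr 2
  exact funext fun i => h.2 _ (hp _ (by simp))

lemma AgreeOn.toJ1Vec_eq {p : Multiset (Fin 4) → Prop} {j j' : Jet} (h : AgreeOn p j j')
    (hp : ∀ K, K.card ≤ 1 → p K) : toJ1Vec j = toJ1Vec j' := h.toJ1_eq hp

lemma continuous_toJ1 : Continuous toJ1 := by unfold toJ1; fun_prop

lemma eventually_line_mem {Ω : Set J1} (hΩ : IsOpen Ω) {j : Jet} (hj : toJ1 j ∈ Ω) (d : Jet) :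
    ∀ᶠ t : ℝ in 𝓝 0, toJ1 (j + t • d) ∈ Ω := by
  have hc : ContinuousAt (fun t : ℝ => toJ1 (j + t • d)) 0 :=
    (continuous_toJ1.comp (by fun_prop)).continuousAt
  exact hc.eventually_mem (hΩ.mem_nhds (by simpa using hj))

/-- Derivatives of functions which depend on part of the coordinates only. -/
lemma lineDeriv_congr_agree {Ω : Set J1} (hΩ : IsOpen Ω) {p : Multiset (Fin 4) → Prop}
    {f : Jet → ℝ} (hf : ∀ j j', toJ1 j ∈ Ω → AgreeOn p j j' → f j = f j') {j j' d d' : Jet}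
    (hj : toJ1 j ∈ Ω) (h : AgreeOn p j j') (hd : AgreeOn p d d') :
    lineDeriv ℝ f j d = lineDeriv ℝ f j' d' := by
  refine Filter.EventuallyEq.deriv_eq ?_
  filter_upwards [eventually_line_mem hΩ hj d] with t ht
  exact hf _ _ ht (h.add_smul hd t)

/-- `F = 0` is a second order equation over `Ω` which is solved for the derivative `u_κ`. -/
structure LeadingForm (F : Jet → ℝ) (Ω : Set J1) (κ : Multiset (Fin 4)) (wt : Fin 4 → ℕ)
    (p : J1 → ℝ) : Prop where
  isOpen : IsOpen Ω
  card : κ.card = 2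
  smooth : ∀ w : Jet × ℝ, toJ1 w.1 ∈ Ω → SmoothAt (fun v => F v.1) w
  coef_smooth : ContDiffOn ℝ ∞ p Ω
  coef_ne : ∀ q ∈ Ω, p q ≠ 0
  agree : ∀ j j', toJ1 j ∈ Ω → AgreeOn (fun K => IndexLT wt K κ) j j' →
    F j - p (toJ1 j) * j.2 κ = F j' - p (toJ1 j') * j'.2 κ

/-- The part of the derivative `D_l F` without the leading term. -/
def remainder (F : Jet → ℝ) (κ : Multiset (Fin 4)) (p : J1 → ℝ) (l : List (Fin 4)) (j : Jet) : ℝ :=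
  totalDerivs l F j - p (toJ1 j) * j.2 (κ + l)

open Classical in
/-- The jet coordinates of the formal solution with given free coordinates. -/
def solveCoord (F : Jet → ℝ) (κ : Multiset (Fin 4)) (wt : Fin 4 → ℕ) (p : J1 → ℝ) (c : Jet) :
    Multiset (Fin 4) → ℝ :=
  (wellFounded_indexLT wt).fix fun I rec =>
    -- The equation `D_l F = 0` with `l = I - κ` is linear in `u_I` with coefficient `p`, and its
    -- other terms involve coordinates below `I` only. Padding the remaining coordinates by `0` is
    -- therefore harmless.
    if κ ≤ I then
      -remainder F κ p (I - κ).toList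
        (c.1, fun K => if h : IndexLT wt K I then rec K h else 0) / p (toJ1 c)
    else c.2 I

/-- The jet of the formal solution with given free coordinates. -/
def solve (F : Jet → ℝ) (κ : Multiset (Fin 4)) (wt : Fin 4 → ℕ) (p : J1 → ℝ) (c : Jet) : Jet :=
  (c.1, solveCoord F κ wt p c)

open Classical in
/-- The coordinates of a jet below `I`. -/
def truncate (wt : Fin 4 → ℕ) (I : Multiset (Fin 4)) (j : Jet) : Jet :=
  (j.1, fun K => if IndexLT wt K I then j.2 K else 0)

lemma agreeOn_truncate (wt : Fin 4 → ℕ) (I : Multiset (Fin 4)) (j : Jet) :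
    AgreeOn (fun K => IndexLT wt K I) (truncate wt I j) j :=
  ⟨rfl, fun K hK => by simp [truncate, hK]⟩

namespace LeadingForm

variable {F : Jet → ℝ} {Ω : Set J1} {κ : Multiset (Fin 4)} {wt : Fin 4 → ℕ} {p : J1 → ℝ}

lemma smoothAt_totalDerivs (h : LeadingForm F Ω κ wt p) (l : List (Fin 4)) :
    ∀ w : Jet × ℝ, toJ1 w.1 ∈ Ω → SmoothAt (fun v => totalDerivs l F v.1) w := by
  induction l with
  | nil => exact h.smooth
  | cons i l ih => exact fun w hw => (ih w hw).smoothAt_basisDeriv (some i)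

lemma smoothAt_coef (h : LeadingForm F Ω κ wt p) {w : Jet × ℝ} (hw : toJ1 w.1 ∈ Ω) :
    SmoothAt (fun v => p (toJ1 v.1)) w :=
  SmoothAt.comp_toJ1 (h.coef_smooth.contDiffAt (h.isOpen.mem_nhds hw))

lemma smoothAt_remainder (h : LeadingForm F Ω κ wt p) (l : List (Fin 4)) {w : Jet × ℝ}
    (hw : toJ1 w.1 ∈ Ω) : SmoothAt (fun v => remainder F κ p l v.1) w :=
  (h.smoothAt_totalDerivs l w hw).sub ((h.smoothAt_coef hw).mul (smoothAt_coord _ w))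

/-- Only one ordering of each multi-index is solved for in `solveCoord`; commutation of total
derivatives gives the other orderings. -/
lemma totalDerivs_perm (h : LeadingForm F Ω κ wt p) {l l' : List (Fin 4)} (hl : l.Perm l') :
    ∀ j, toJ1 j ∈ Ω → totalDerivs l F j = totalDerivs l' F j := by
  have congr : ∀ (i : Fin 4) (f g : Jet → ℝ), (∀ j, toJ1 j ∈ Ω → f j = g j) →
      ∀ j, toJ1 j ∈ Ω → totalDeriv i f j = totalDeriv i g j := fun i f g hfg j hj =>
    lineDeriv_congr (Filter.eventually_of_mem
      (continuous_toJ1.continuousAt.preimage_mem_nhds (h.isOpen.mem_nhds hj)) hfg) _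
  induction hl with
  | nil => exact fun _ _ => rfl
  | cons i _ ih => exact congr i _ _ ih
  | swap i k l =>
    exact fun j hj => (h.smoothAt_totalDerivs l (j, 0) hj).basisDeriv_comm (some k) (some i)
  | trans _ _ ih ih' => exact fun j hj => (ih j hj).trans (ih' j hj)

lemma indexLT_of_card_le_one (h : LeadingForm F Ω κ wt p) (l : List (Fin 4))
    {K : Multiset (Fin 4)} (hK : K.card ≤ 1) : IndexLT wt K (κ + l) := by
  left; rw [Multiset.card_add, h.card]; omega

lemma lineDeriv_totalDerivs (h : LeadingForm F Ω κ wt p) (l : List (Fin 4)) {j : Jet}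
    (hj : toJ1 j ∈ Ω) (d : Jet) :
    lineDeriv ℝ (totalDerivs l F) j d = lineDeriv ℝ (remainder F κ p l) j d +
      (fderiv ℝ p (toJ1 j) (toJ1Vec d) * j.2 (κ + l) + p (toJ1 j) * d.2 (κ + l)) := by
  have hw : toJ1 ((j, 0) : Jet × ℝ).1 ∈ Ω := hj
  have h1 := (h.smoothAt_remainder l hw).lineDeriv_fun_add
    ((h.smoothAt_coef hw).mul (smoothAt_coord (κ + l) (j, 0))) (d, 0)
  rw [(h.smoothAt_coef hw).lineDeriv_fun_mul (smoothAt_coord (κ + l) (j, 0)),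
    lineDeriv_coord, lineDeriv_comp_toJ1 (((h.coef_smooth.contDiffAt
      (h.isOpen.mem_nhds hj)).differentiableAt (by simp)))] at h1
  have e : (fun v : Jet × ℝ => remainder F κ p l v.1 + p (toJ1 v.1) * v.1.2 (κ + l)) =
      fun v => totalDerivs l F v.1 := by
    funext v; simp [remainder]
  rw [e] at h1
  exact h1

/-- Induction on `l`. Differentiating `p u_{κ+l}` gives the new leading term and `(D_i p) u_{κ+l}`,
which has lower degree; the derivative of the old remainder stays below by `IndexLT.cons`. -/
lemma remainder_agree (h : LeadingForm F Ω κ wt p) (l : List (Fin 4)) :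
    ∀ j j', toJ1 j ∈ Ω → AgreeOn (fun K => IndexLT wt K (κ + l)) j j' →
      remainder F κ p l j = remainder F κ p l j' := by
  induction l with
  | nil =>
    intro j j' hj hjj
    simpa [remainder, totalDerivs] using h.agree j j' hj (by simpa using hjj)
  | cons i l ih =>
    have hcons : κ + ((i :: l : List (Fin 4)) : Multiset (Fin 4)) = i ::ₘ (κ + l) := by
      rw [← Multiset.cons_coe, Multiset.add_cons]
    intro j j' hj hjj
    have hJ : toJ1 j = toJ1 j' :=
      hjj.toJ1_eq fun K hK => h.indexLT_of_card_le_one (i :: l) hK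
    have hj' : toJ1 j' ∈ Ω := hJ ▸ hj
    rw [hcons] at hjj
    have hl : κ.card = 2 := h.card
    have hexp : ∀ j, toJ1 j ∈ Ω → remainder F κ p (i :: l) j =
        lineDeriv ℝ (remainder F κ p l) j (totalVec i j) +
          fderiv ℝ p (toJ1 j) (toJ1Vec (totalVec i j)) * j.2 (κ + l) := by
      intro j hj
      have e := h.lineDeriv_totalDerivs l hj (totalVec i j)
      have e' : totalDerivs (i :: l) F j = lineDeriv ℝ (totalDerivs l F) j (totalVec i j) := rfl
      rw [remainder, e', e, hcons]
      simp only [totalVec]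
      ring
    rw [hexp j hj, hexp j' hj', hjj.2 (κ + l) (Or.inl (by simp)), hJ]
    have hv : toJ1Vec (totalVec i j) = toJ1Vec (totalVec i j') := by
      refine AgreeOn.toJ1Vec_eq (p := fun K => K.card ≤ 1) (hjj.totalVec i fun K hK => ?_)
        fun K hK => hK
      left
      simp only [Multiset.card_cons, Multiset.card_add, hl]
      omega
    rw [hv, lineDeriv_congr_agree h.isOpen ih hj (hjj.mono fun K hK => ?_)
      (hjj.totalVec i fun K hK => hK.cons i)]
    left
    have := hK.card_le
    simp only [Multiset.card_cons]
    omega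

lemma solve_of_not_le (c : Jet) {I : Multiset (Fin 4)} (hI : ¬κ ≤ I) :
    (solve F κ wt p c).2 I = c.2 I := by
  change solveCoord F κ wt p c I = _
  rw [solveCoord, WellFounded.fix_eq, if_neg hI]

lemma solve_of_le (c : Jet) {I : Multiset (Fin 4)} (hI : κ ≤ I) :
    (solve F κ wt p c).2 I =
      -remainder F κ p (I - κ).toList (truncate wt I (solve F κ wt p c)) / p (toJ1 c) := by
  change solveCoord F κ wt p c I = _
  conv_lhs => rw [solveCoord, WellFounded.fix_eq, if_pos hI]
  rfl

lemma not_le_of_card (h : LeadingForm F Ω κ wt p) {I : Multiset (Fin 4)} (hI : I.card ≤ 1) :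
    ¬κ ≤ I := fun hle => by
  have := Multiset.card_le_card hle
  rw [h.card] at this
  omega

lemma toJ1_solve (h : LeadingForm F Ω κ wt p) (c : Jet) :
    toJ1 (solve F κ wt p c) = toJ1 c :=
  AgreeOn.toJ1_eq (p := fun K => K.card ≤ 1)
    ⟨rfl, fun _ hK => solve_of_not_le c (h.not_le_of_card hK)⟩ fun _ hK => hK

lemma toJ1_truncate (h : LeadingForm F Ω κ wt p) {I : Multiset (Fin 4)} (hI : κ ≤ I) (j : Jet) :
    toJ1 (truncate wt I j) = toJ1 j := by
  refine (agreeOn_truncate wt I j).toJ1_eq fun K hK => Or.inl ?_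
  have := Multiset.card_le_card hI
  rw [h.card] at this
  omega

lemma add_coe_toList_sub {I : Multiset (Fin 4)} (hI : κ ≤ I) :
    κ + ((I - κ).toList : Multiset (Fin 4)) = I := by
  rw [Multiset.coe_toList, add_tsub_cancel_of_le hI]

/-- The equations satisfied by the leading coordinates. -/
lemma totalDerivs_eq (h : LeadingForm F Ω κ wt p) {I : Multiset (Fin 4)} (hI : κ ≤ I) {j : Jet}
    (hj : toJ1 j ∈ Ω) : totalDerivs (I - κ).toList F j =
      p (toJ1 j) * j.2 I + remainder F κ p (I - κ).toList (truncate wt I j) := by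
  have e := h.remainder_agree (I - κ).toList (truncate wt I j) j
    (by rwa [h.toJ1_truncate hI]) (by
      rw [add_coe_toList_sub hI]
      exact agreeOn_truncate wt I j)
  rw [e, remainder, add_coe_toList_sub hI]
  ring

lemma solve_mem (h : LeadingForm F Ω κ wt p) {c : Jet} (hc : toJ1 c ∈ Ω) :
    solve F κ wt p c ∈ prolongation F := by
  intro l
  have hc' : toJ1 (solve F κ wt p c) ∈ Ω := by rwa [h.toJ1_solve]
  have hI : κ ≤ κ + (l : Multiset (Fin 4)) := Multiset.le_add_right _ _
  have hl : (κ + (l : Multiset (Fin 4)) - κ).toList.Perm l := by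
    rw [← Multiset.coe_eq_coe, Multiset.coe_toList, add_tsub_cancel_left]
  have hp : p (toJ1 c) ≠ 0 := h.coef_ne _ hc
  rw [← h.totalDerivs_perm hl _ hc', h.totalDerivs_eq hI hc', solve_of_le c hI, h.toJ1_solve]
  field_simp
  ring

/-- A jet which satisfies the equation and its derivatives up to some order is determined up to
that order by its free coordinates. -/
lemma solve_eq (h : LeadingForm F Ω κ wt p) {c : Jet} (hc : toJ1 c ∈ Ω) (n : ℕ)
    (h0 : ∀ l : List (Fin 4), l.length ≤ n → totalDerivs l F c = 0) (I : Multiset (Fin 4))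
    (hn : I.card ≤ n + 2) : (solve F κ wt p c).2 I = c.2 I := by
  induction I using (wellFounded_indexLT wt).induction with
  | _ I ih =>
    by_cases hI : κ ≤ I
    · have hp : p (toJ1 c) ≠ 0 := h.coef_ne _ hc
      have e1 := h.totalDerivs_eq hI hc
      have hl : (I - κ).toList.length ≤ n := by
        rw [Multiset.length_toList, Multiset.card_sub hI, h.card]
        omega
      have e2 : truncate wt I (solve F κ wt p c) = truncate wt I c := by
        refine Prod.ext rfl (funext fun K => ?_)
        by_cases hK : IndexLT wt K I
        · simp only [truncate, hK, if_true]
          exact ih K hK (hK.card_le.trans hn)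
        · simp [truncate, hK]
      rw [h0 _ hl] at e1
      rw [solve_of_le c hI, e2]
      field_simp
      linarith
    · exact solve_of_not_le c hI

lemma solve_eq_self (h : LeadingForm F Ω κ wt p) {j : Jet} (hj : toJ1 j ∈ Ω)
    (hF : j ∈ prolongation F) : solve F κ wt p j = j :=
  Prod.ext rfl (funext fun I =>
    h.solve_eq hj I.card (fun l _ => hF l) I (Nat.le_add_right _ _))

/-- Each solved coordinate is a smooth function of finitely many earlier ones, so differentiability
in the free data follows by well-founded induction. -/
lemma exists_hasCoordDerivAt_solve (h : LeadingForm F Ω κ wt p) {c : ℝ → Jet} {d : Jet}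
    (hc : HasCoordDerivAt c d) (h0 : toJ1 (c 0) ∈ Ω) :
    ∃ d' : Jet, d'.1 = d.1 ∧ (∀ I, ¬κ ≤ I → d'.2 I = d.2 I) ∧
      HasCoordDerivAt (fun t => solve F κ wt p (c t)) d' := by
  have key : ∀ I, DifferentiableAt ℝ (fun t => (solve F κ wt p (c t)).2 I) 0 := by
    intro I
    induction I using (wellFounded_indexLT wt).induction with
    | _ I ih =>
      by_cases hI : κ ≤ I
      · have e : (fun t => (solve F κ wt p (c t)).2 I) = fun t =>
            -remainder F κ p (I - κ).toList (truncate wt I (solve F κ wt p (c t))) /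
              p (toJ1 (c t)) := funext fun t => solve_of_le (c t) hI
        have hT : HasCoordDerivAt (fun t => truncate wt I (solve F κ wt p (c t)))
            (d.1, fun K => deriv (fun t => (truncate wt I (solve F κ wt p (c t))).2 K) 0) := by
          refine ⟨hc.base, fun K => DifferentiableAt.hasDerivAt ?_⟩
          by_cases hK : IndexLT wt K I
          · simpa only [truncate, hK, if_true] using ih K hK
          · simp [truncate, hK]
        have hT0 : toJ1 (truncate wt I (solve F κ wt p (c 0))) ∈ Ω := by
          rwa [h.toJ1_truncate hI, h.toJ1_solve]
        have h1 := (h.smoothAt_remainder (I - κ).toList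
          (w := (truncate wt I (solve F κ wt p (c 0)), 0)) hT0).hasDerivAt_comp
          (l := fun _ => 0) hT (hasDerivAt_const _ _)
        have h2 := (h.smoothAt_coef (w := (c 0, 0)) h0).hasDerivAt_comp
          (l := fun _ => 0) hc (hasDerivAt_const _ _)
        rw [e]
        exact (h1.neg.div h2 (h.coef_ne _ h0)).differentiableAt
      · simp only [solve_of_not_le _ hI]
        exact (hc.coord I).differentiableAt
  refine ⟨(d.1, fun I => deriv (fun t => (solve F κ wt p (c t)).2 I) 0), rfl, fun I hI => ?_,
    hc.base, fun I => (key I).hasDerivAt⟩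
  simp only [solve_of_not_le _ hI]
  exact (hc.coord I).deriv

/-- Tangency of `D_i` to the prolonged equation. The velocity of the curve and `D_i` have the same
free components, and both are annihilated by the differentials of all `D_l F`: the velocity because
the curve consists of solutions, `D_i` because `D_i D_l F = 0` at `j`. Since `p ≠ 0`, these linear
equations determine the leading components one after another. -/
lemma hasCoordDerivAt_solve_totalVec (h : LeadingForm F Ω κ wt p) {j : Jet} (hj : toJ1 j ∈ Ω)
    (hF : j ∈ prolongation F) (i : Fin 4) :
    HasCoordDerivAt (fun t : ℝ => solve F κ wt p (j + t • totalVec i j)) (totalVec i j) := by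
  obtain ⟨d, hd1, hd2, hd⟩ := h.exists_hasCoordDerivAt_solve
    (hasCoordDerivAt_line j (totalVec i j)) (by simpa using hj)
  suffices hdI : ∀ I, d.2 I = (totalVec i j).2 I by
    have : d = totalVec i j := Prod.ext hd1 (funext hdI)
    rwa [this] at hd
  intro I
  induction I using (wellFounded_indexLT wt).induction with
  | _ I ih =>
    by_cases hI : κ ≤ I
    · set l := (I - κ).toList with hl
      have hs0 : solve F κ wt p (j + (0 : ℝ) • totalVec i j) = j := by
        rw [zero_smul, add_zero, h.solve_eq_self hj hF]
      have h1 := (h.smoothAt_totalDerivs l (solve F κ wt p (j + (0 : ℝ) • totalVec i j), 0)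
        (by rw [hs0]; exact hj)).hasDerivAt_comp (l := fun _ => 0) hd (hasDerivAt_const _ _)
      rw [hs0] at h1
      have h2 : HasDerivAt (fun t : ℝ =>
          totalDerivs l F (solve F κ wt p (j + t • totalVec i j))) 0 0 := by
        refine (hasDerivAt_const (0 : ℝ) (0 : ℝ)).congr_of_eventuallyEq ?_
        filter_upwards [eventually_line_mem h.isOpen hj (totalVec i j)] with t ht
        exact h.solve_mem ht l
      have h3 : lineDeriv ℝ (totalDerivs l F) j d = 0 := h1.unique h2
      have h4 : lineDeriv ℝ (totalDerivs l F) j (totalVec i j) = 0 := hF (i :: l)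
      rw [h.lineDeriv_totalDerivs l hj, hl, add_coe_toList_sub hI, ← hl] at h3 h4
      have hag : AgreeOn (fun K => IndexLT wt K (κ + l)) d (totalVec i j) :=
        ⟨hd1, fun K hK => ih K (by rwa [hl, add_coe_toList_sub hI] at hK)⟩
      have e1 := lineDeriv_congr_agree h.isOpen (h.remainder_agree l) hj
        (AgreeOn.mono (p := fun _ => True) ⟨rfl, fun _ _ => rfl⟩ fun _ _ => trivial) hag
      have e2 : toJ1Vec d = toJ1Vec (totalVec i j) :=
        hag.toJ1Vec_eq fun K hK => h.indexLT_of_card_le_one l hK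
      rw [e1, e2] at h3
      have hp := h.coef_ne _ hj
      have : p (toJ1 j) * d.2 I = p (toJ1 j) * (totalVec i j).2 I := by linarith
      exact mul_left_cancel₀ hp this
    · exact hd2 I hI

/-- A function which vanishes on the prolonged equation has vanishing total derivatives there. -/
lemma basisDeriv_eq_zero (h : LeadingForm F Ω κ wt p) {f : Jet × ℝ → ℝ} {w : Jet × ℝ}
    (hw : toJ1 w.1 ∈ Ω) (hF : w.1 ∈ prolongation F) (hf : SmoothAt f w)
    (h0 : ∀ᶠ v in 𝓝 w, v.1 ∈ prolongation F → f v = 0) (o : Option (Fin 4)) :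
    basisDeriv o f w = 0 := by
  -- A curve inside the prolonged equation through `w` whose velocity is `D_i`, respectively `∂_λ`;
  -- the given function vanishes along it near time `0`.
  obtain ⟨c, d, hc, hc0, hcF, hd⟩ : ∃ (c : ℝ → Jet × ℝ) (d : Jet × ℝ),
      HasCoordDerivAt (fun t => (c t).1) d.1 ∧ c 0 = w ∧
      (∀ᶠ t in 𝓝 0, (c t).1 ∈ prolongation F) ∧ HasDerivAt (fun t => (c t).2) d.2 0 ∧
        d = basisVec o w := by
    cases o with
    | none =>
      refine ⟨fun t => (w.1, w.2 + t), (0, 1), ?_, by simp, .of_forall fun t => hF, ?_, rfl⟩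
      · simpa using hasCoordDerivAt_line w.1 0
      · exact (hasDerivAt_id (0 : ℝ)).const_add w.2
    | some i =>
      refine ⟨fun t => (solve F κ wt p (w.1 + t • totalVec i w.1), w.2), (totalVec i w.1, 0),
        h.hasCoordDerivAt_solve_totalVec hw hF i, ?_, ?_, hasDerivAt_const _ _, rfl⟩
      · beta_reduce
        rw [zero_smul, add_zero, h.solve_eq_self hw hF]
      · filter_upwards [eventually_line_mem h.isOpen hw (totalVec i w.1)] with t ht
        exact h.solve_mem ht
  have h1 := SmoothAt.hasDerivAt_comp (f := f) (c := fun t => (c t).1) (l := fun t => (c t).2)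
    (by simpa [hc0] using hf) hc hd.1
  have h2 : HasDerivAt (fun t => f ((c t).1, (c t).2)) 0 0 := by
    refine (hasDerivAt_const (0 : ℝ) (0 : ℝ)).congr_of_eventuallyEq ?_
    have hcc : ContinuousAt c 0 := hc.continuousAt.prodMk hd.1.continuousAt
    filter_upwards [hcF, hcc.eventually (by rw [hc0]; exact h0)] with t ht ht'
    exact ht' ht
  have h3 := h1.unique h2
  rw [hc0, hd.2] at h3
  exact h3

end LeadingForm

/-! ### Vertical perturbations of jets -/

/-- The vertical tangent vector of order `n` with components `ξ^I`. -/
def powJet (ξ : Fin 4 → ℝ) (n : ℕ) : Jet := (0, fun I => if I.card = n then (I.map ξ).prod else 0)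

lemma symbol_eq (F : Jet → ℝ) (j : Jet) (ξ : Fin 4 → ℝ) :
    symbol F j ξ = lineDeriv ℝ F j (powJet ξ 2) := rfl

lemma lineDeriv_congr_agree_param {Ω : Set J1} (hΩ : IsOpen Ω) {p : Multiset (Fin 4) → Prop}
    {f : Jet × ℝ → ℝ} (hf : ∀ j j' l, toJ1 j ∈ Ω → AgreeOn p j j' → f (j, l) = f (j', l))
    {j j' d d' : Jet} (hj : toJ1 j ∈ Ω) (h : AgreeOn p j j') (hd : AgreeOn p d d') (l r : ℝ) :
    lineDeriv ℝ f (j, l) (d, r) = lineDeriv ℝ f (j', l) (d', r) := by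
  refine Filter.EventuallyEq.deriv_eq ?_
  filter_upwards [eventually_line_mem hΩ hj d] with t ht
  exact hf _ _ _ ht (h.add_smul hd t)

lemma agreeOn_add_powJet {n m : ℕ} (hmn : m < n) (j : Jet) (ξ : Fin 4 → ℝ) (t : ℝ) :
    AgreeOn (fun K => K.card ≤ m) (j + t • powJet ξ n) j := by
  refine ⟨by simp [powJet], fun K hK => ?_⟩
  have : K.card ≠ n := by omega
  simp [powJet, this]

/-- For `f` of order `n`, derivatives of order `n + 1` enter `X f` only linearly, through `D_i` of
the top coordinates. Adding `t ξ^{n+1}` changes `D_i` by `t ξ_i ξ^n`, whence the factor `⟨X, ξ⟩`. -/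
lemma lineDeriv_add_powJet {Ω : Set J1} (hΩ : IsOpen Ω) {n : ℕ} (hn : 1 ≤ n)
    {f : Jet × ℝ → ℝ}
    (hf : ∀ j j' l, toJ1 j ∈ Ω → AgreeOn (fun K => K.card ≤ n) j j' → f (j, l) = f (j', l))
    {j c : Jet} {l t : ℝ} {ξ : Fin 4 → ℝ} (hj : toJ1 j ∈ Ω)
    (hc : AgreeOn (fun K => K.card ≤ n + 1) c (j + t • powJet ξ (n + 1)))
    (hs : SmoothAt f (j, l)) (X : Fin 4 → ℝ) (r : ℝ) :
    lineDeriv ℝ f (c, l) (∑ i, X i • totalVec i c, r) =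
      lineDeriv ℝ f (j, l) (∑ i, X i • totalVec i j, r) +
        t * ((∑ i, X i * ξ i) * lineDeriv ℝ f (j, l) (powJet ξ n, 0)) := by
  have hcj : AgreeOn (fun K => K.card ≤ n) c j := by
    have h1 := hc.mono (p' := fun K => K.card ≤ n) fun K hK => Nat.le_succ_of_le hK
    have h2 := agreeOn_add_powJet (Nat.lt_succ_self n) j ξ t
    exact ⟨h1.1.trans h2.1, fun K hK => (h1.2 K hK).trans (h2.2 K hK)⟩
  have hcΩ : toJ1 c ∈ Ω := by rwa [hcj.toJ1_eq fun K hK => hK.trans hn]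
  have hd : AgreeOn (fun K => K.card ≤ n) (∑ i, X i • totalVec i c)
      (∑ i, X i • totalVec i j + (t * ∑ i, X i * ξ i) • powJet ξ n) := by
    constructor
    · simp [totalVec, powJet, Prod.fst_sum]
    · intro K hK
      have hi : ∀ i, c.2 (i ::ₘ K) =
          j.2 (i ::ₘ K) + t * (ξ i * (powJet ξ n).2 K) := fun i => by
        rw [hc.2 _ (by simpa using hK)]
        by_cases hKn : K.card = n <;> simp [powJet, hKn]
      simp only [Prod.snd_add, Prod.snd_sum, Prod.smul_snd, totalVec, Finset.sum_apply,
        Pi.add_apply, Pi.smul_apply, smul_eq_mul, hi, mul_add, Finset.sum_add_distrib,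
        Finset.mul_sum, Finset.sum_mul]
      congr 1
      exact Finset.sum_congr rfl fun i _ => by ring
  rw [lineDeriv_congr_agree_param hΩ hf hcΩ hcj hd l r]
  have e : ((∑ i, X i • totalVec i j + (t * ∑ i, X i * ξ i) • powJet ξ n, r) : Jet × ℝ) =
      (∑ i, X i • totalVec i j, r) + (t * ∑ i, X i * ξ i) • (powJet ξ n, (0 : ℝ)) := by
    ext <;> simp
  rw [e, hs.lineDeriv_add, hs.lineDeriv_smul]
  ring

/-! ### Deformations of formal solutions along null covectors -/

namespace LeadingForm

variable {F : Jet → ℝ} {Ω : Set J1} {κ : Multiset (Fin 4)} {wt : Fin 4 → ℕ} {p : J1 → ℝ}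

lemma totalDerivs_agree (h : LeadingForm F Ω κ wt p) (l : List (Fin 4)) {j j' : Jet}
    (hj : toJ1 j ∈ Ω) (hjj : AgreeOn (fun K => K.card ≤ l.length + 2) j j') :
    totalDerivs l F j = totalDerivs l F j' := by
  have hc : (κ + (l : Multiset (Fin 4))).card = l.length + 2 := by
    rw [Multiset.card_add, h.card, Multiset.coe_card, add_comm]
  have e := h.remainder_agree l j j' hj (hjj.mono fun K hK => hc ▸ hK.card_le)
  simp only [remainder, hjj.2 _ hc.le, hjj.toJ1_eq fun K hK => hK.trans (by omega)] at e
  linarith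

/-- At fourth order, `D_i D_k F` reacts to `t ξ⁴` by `t ξ_i ξ_k symbol(ξ)`, which vanishes for null
`ξ`; `F` and its first derivatives do not see fourth order coordinates. -/
lemma totalDerivs_add_powJet (h : LeadingForm F Ω κ wt p) {j : Jet} (hj : toJ1 j ∈ Ω)
    (hF : j ∈ prolongation F) {ξ : Fin 4 → ℝ} (hξ : symbol F j ξ = 0) (t : ℝ)
    (l : List (Fin 4)) (hl : l.length ≤ 2) :
    totalDerivs l F (j + t • powJet ξ 4) = 0 := by
  have hJ : toJ1 (j + t • powJet ξ 4) ∈ Ω := by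
    rwa [(agreeOn_add_powJet (m := 1) (by norm_num) j ξ t).toJ1_eq fun K hK => hK]
  by_cases h1 : l.length ≤ 1
  · rw [h.totalDerivs_agree l hJ (agreeOn_add_powJet (by omega) j ξ t)]
    exact hF l
  · obtain ⟨i, k, rfl⟩ : ∃ i k, l = [i, k] := List.length_eq_two.1 (by omega)
    have hsingle : ∀ (i : Fin 4) (c : Jet),
        totalVec i c = ∑ k, (Pi.single i 1 : Fin 4 → ℝ) k • totalVec k c := fun i c => by
      simp [Pi.single_apply, ite_smul, Finset.sum_ite_eq']
    have hsum : ∀ i : Fin 4, ∑ k, (Pi.single i 1 : Fin 4 → ℝ) k * ξ k = ξ i := fun i => by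
      simp [Pi.single_apply]
    have e1 := lineDeriv_add_powJet (l := 0) (t := t) (ξ := ξ) h.isOpen (n := 3) (by norm_num)
      (f := fun v => totalDerivs [k] F v.1)
      (fun j j' _ hj hjj => h.totalDerivs_agree [k] hj hjj) hj
      (c := j + t • powJet ξ 4) ⟨rfl, fun _ _ => rfl⟩ (h.smoothAt_totalDerivs [k] (j, 0) hj)
      (Pi.single i 1) 0
    rw [← hsingle, ← hsingle, hsum] at e1
    have e2 : lineDeriv ℝ (fun v : Jet × ℝ => totalDerivs [k] F v.1) (j, 0) (powJet ξ 3, 0) =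
        0 := by
      refine HasLineDerivAt.lineDeriv (f := fun v : Jet × ℝ => totalDerivs [k] F v.1)
        (x := (j, 0)) (v := (powJet ξ 3, 0)) ?_
      refine (hasDerivAt_const (0 : ℝ) (0 : ℝ)).congr_of_eventuallyEq ?_
      refine .of_forall fun s => ?_
      have e3 := lineDeriv_add_powJet (l := 0) (t := s) (ξ := ξ) h.isOpen (n := 2) (by norm_num)
        (f := fun v => totalDerivs [] F v.1)
        (fun j j' _ hj hjj => h.totalDerivs_agree [] hj hjj) hj
        (c := j + s • powJet ξ 3) ⟨rfl, fun _ _ => rfl⟩ (h.smooth (j, 0) hj)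
        (Pi.single k 1) 0
      rw [← hsingle, ← hsingle, hsum] at e3
      have e4 : lineDeriv ℝ (fun v : Jet × ℝ => totalDerivs [] F v.1) (j, 0) (powJet ξ 2, 0) =
          0 := hξ
      rw [e4, mul_zero, mul_zero, add_zero] at e3
      exact e3.trans (hF [k])
    rw [e2, mul_zero, mul_zero, add_zero] at e1
    exact e1.trans (hF [i, k])

/-- Jets of the prolonged equation which differ from a given one by a null covector to the fourth
power in the fourth order. -/
lemma exists_null_curve (h : LeadingForm F Ω κ wt p) {j : Jet} (hj : toJ1 j ∈ Ω)
    (hF : j ∈ prolongation F) {ξ : Fin 4 → ℝ} (hξ : symbol F j ξ = 0) :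
    ∃ c : ℝ → Jet, ContinuousAt c 0 ∧ c 0 = j ∧ ∀ t, c t ∈ prolongation F ∧
      AgreeOn (fun K => K.card ≤ 3 + 1) (c t) (j + t • powJet ξ (3 + 1)) := by
  -- The perturbed jet satisfies the equation with its total derivatives up to order two, so
  -- completing it to a formal solution changes no coordinate of order at most four.
  refine ⟨fun t => solve F κ wt p (j + t • powJet ξ 4), ?_, ?_, fun t => ?_⟩
  · obtain ⟨d, _, _, hd⟩ := h.exists_hasCoordDerivAt_solve
      (hasCoordDerivAt_line j (powJet ξ 4)) (by simpa using hj)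
    exact hd.continuousAt
  · beta_reduce
    rw [zero_smul, add_zero, h.solve_eq_self hj hF]
  · have hJ : toJ1 (j + t • powJet ξ 4) ∈ Ω := by
      rwa [(agreeOn_add_powJet (m := 1) (by norm_num) j ξ t).toJ1_eq fun K hK => hK]
    exact ⟨h.solve_mem hJ, rfl, fun K hK =>
      h.solve_eq hJ 2 (h.totalDerivs_add_powJet hj hF hξ t) K hK⟩

/-- This is how formulas valid only on the equation are used: they may be differentiated along any
spectral field, although the equality is known only on the prolonged equation. -/
lemma act_congr (h : LeadingForm F Ω κ wt p) {f g : Jet × ℝ → ℝ} {w : Jet × ℝ}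
    (hw : toJ1 w.1 ∈ Ω) (hF : w.1 ∈ prolongation F) (hf : SmoothAt f w) (hg : SmoothAt g w)
    (e : ∀ᶠ v in 𝓝 w, v.1 ∈ prolongation F → f v = g v) (X : SpectralField) :
    X.act f w = X.act g w := by
  have h1 : X.act (fun v => f v - g v) w = 0 := by
    rw [(hf.sub hg).act_eq_sum]
    refine Finset.sum_eq_zero fun o _ => ?_
    rw [h.basisDeriv_eq_zero hw hF (hf.sub hg) (e.mono fun v hv hvF => by rw [hv hvF, sub_self]),
      mul_zero]
  rw [SpectralField.act_eq, hf.lineDeriv_fun_sub hg] at h1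
  exact sub_eq_zero.1 h1

end LeadingForm

/-! ### Normalized Lax pairs -/

/-- The minor of the components `a, b` of two spectral fields. -/
def minor (V W : SpectralField) (a b : Fin 4) (w : Jet × ℝ) : ℝ :=
  (V w).1 a * (W w).1 b - (V w).1 b * (W w).1 a

/-- Commuting fields in involution with the equation, whose components `a, b` are constant. -/
structure NormalPair (F : Jet → ℝ) (O : Set (Jet × ℝ)) (a b : Fin 4) (X Y : SpectralField) :
    Prop where
  smooth_fst : ∀ w ∈ O, X.Smooth w
  smooth_snd : ∀ w ∈ O, Y.Smooth w
  fst_a : ∀ w ∈ O, (X w).1 a = 1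
  fst_b : ∀ w ∈ O, (X w).1 b = 0
  snd_a : ∀ w ∈ O, (Y w).1 a = 0
  snd_b : ∀ w ∈ O, (Y w).1 b = 1
  commute : ∀ w ∈ O, w.1 ∈ regularJets F → ∀ o, X.act (Y.comp o) w = Y.act (X.comp o) w
  commute_act : ∀ w ∈ O, w.1 ∈ regularJets F → ∀ f, SmoothAt f w →
    X.act (Y.act f) w = Y.act (X.act f) w
  null : ∀ w ∈ O, w.1 ∈ regularJets F → ∀ ξ : Fin 4 → ℝ, ∑ i, ξ i * (X w).1 i = 0 →
    ∑ i, ξ i * (Y w).1 i = 0 → symbol F w.1 ξ = 0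
  inj : ∀ j ∈ regularJets F, ∀ l l', (j, l) ∈ O → (j, l') ∈ O → (X (j, l)).1 = (X (j, l')).1 →
    (Y (j, l)).1 = (Y (j, l')).1 → l = l'

lemma act_comb (V W : SpectralField) {X : SpectralField} {w : Jet × ℝ} {r s : ℝ}
    (hX : X w = r • V w + s • W w) {f : Jet × ℝ → ℝ} (hf : SmoothAt f w) :
    X.act f w = r * V.act f w + s * W.act f w := by
  have e : X.vec w = r • V.vec w + s • W.vec w := by
    simp only [SpectralField.vec_eq_sum, Finset.smul_sum, ← Finset.sum_add_distrib, smul_smul,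
      ← add_smul]
    refine Finset.sum_congr rfl fun o _ => ?_
    congr 1
    cases o <;> simp [SpectralField.comp, hX]
  simp only [SpectralField.act_eq, e, hf.lineDeriv_add, hf.lineDeriv_smul]

/-- Change of frame: modulo the span of `V, W` the bracket is multiplied by the determinant of the
change, so involutivity is preserved. -/
lemma bracket_comb {V W : SpectralField} {r s m n : Jet × ℝ → ℝ} {w : Jet × ℝ}
    (hV : V.Smooth w) (hW : W.Smooth w) (hr : SmoothAt r w) (hs : SmoothAt s w)
    (hm : SmoothAt m w) (hn : SmoothAt n w) (X Y : SpectralField)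
    (hX : X = fun v => r v • V v + s v • W v) (hY : Y = fun v => m v • V v + n v • W v) :
    X.bracket Y w = (r w * n w - s w * m w) • V.bracket W w +
      (X.act m w - Y.act r w) • V w + (X.act n w - Y.act s w) • W w := by
  have comp : ∀ o, (X.bracket Y).comp o w = (r w * n w - s w * m w) * (V.bracket W).comp o w +
      (X.act m w - Y.act r w) * V.comp o w + (X.act n w - Y.act s w) * W.comp o w := by
    intro o
    have eX : X.comp o = fun v => r v * V.comp o v + s v * W.comp o v := by
      subst hX; cases o <;> rfl
    have eY : Y.comp o = fun v => m v * V.comp o v + n v * W.comp o v := by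
      subst hY; cases o <;> rfl
    have dX : ∀ f, SmoothAt f w → X.act f w = r w * V.act f w + s w * W.act f w := fun f hf =>
      act_comb V W (by rw [hX]) hf
    have dY : ∀ f, SmoothAt f w → Y.act f w = m w * V.act f w + n w * W.act f w := fun f hf =>
      act_comb V W (by rw [hY]) hf
    have e1 : X.act (Y.comp o) w = X.act m w * V.comp o w + m w * X.act (V.comp o) w +
        (X.act n w * W.comp o w + n w * X.act (W.comp o) w) := by
      rw [eY, SpectralField.act_eq, (hm.mul (hV o)).lineDeriv_fun_add (hn.mul (hW o)),
        hm.lineDeriv_fun_mul (hV o), hn.lineDeriv_fun_mul (hW o)]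
      rfl
    have e2 : Y.act (X.comp o) w = Y.act r w * V.comp o w + r w * Y.act (V.comp o) w +
        (Y.act s w * W.comp o w + s w * Y.act (W.comp o) w) := by
      rw [eX, SpectralField.act_eq, (hr.mul (hV o)).lineDeriv_fun_add (hs.mul (hW o)),
        hr.lineDeriv_fun_mul (hV o), hs.lineDeriv_fun_mul (hW o)]
      rfl
    rw [SpectralField.comp_bracket, SpectralField.comp_bracket, e1, e2, dX _ (hV o), dX _ (hW o),
      dY _ (hV o), dY _ (hW o)]
    ring
  refine Prod.ext (funext fun i => ?_) ?_
  · exact comp (some i)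
  · exact comp none

lemma IsLaxPair.smooth {F : Jet → ℝ} {U : Set Jet} {Λ : Set ℝ} {V W : SpectralField}
    (h : IsLaxPair F U Λ V W) {w : Jet × ℝ} (hw : w ∈ U ×ˢ Λ) : V.Smooth w ∧ W.Smooth w := by
  constructor
  · rintro (_ | i)
    · exact (h.smooth_spectral w hw).1
    · exact (h.smooth_base w hw i).1
  · rintro (_ | i)
    · exact (h.smooth_spectral w hw).2
    · exact (h.smooth_base w hw i).2

/-- A Lax pair can be normalized where one of its minors does not vanish. -/
lemma IsLaxPair.exists_normalPair {F : Jet → ℝ} {U : Set Jet} {Λ : Set ℝ} {V W : SpectralField}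
    (h : IsLaxPair F U Λ V W) {a b : Fin 4} {O : Set (Jet × ℝ)} (hO : IsOpen O)
    (hOU : O ⊆ U ×ˢ Λ) (hdet : ∀ w ∈ O, minor V W a b w ≠ 0) :
    ∃ X Y : SpectralField, NormalPair F O a b X Y ∧
      ∀ w ∈ O, ∀ c d, minor X Y c d w * minor V W a b w = minor V W c d w := by
  -- Cramer's rule: `r, s, m, n` are the entries of the inverse of the matrix of components `a, b`
  -- of `V, W`.
  set r : Jet × ℝ → ℝ := fun w => (W w).1 b / minor V W a b w with hr
  set s : Jet × ℝ → ℝ := fun w => -(V w).1 b / minor V W a b w with hs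
  set m : Jet × ℝ → ℝ := fun w => -(W w).1 a / minor V W a b w with hm
  set n : Jet × ℝ → ℝ := fun w => (V w).1 a / minor V W a b w with hn
  set X : SpectralField := fun v => r v • V v + s v • W v with hX
  set Y : SpectralField := fun v => m v • V v + n v • W v with hY
  have sV : ∀ w ∈ O, V.Smooth w := fun w hw => (h.smooth (hOU hw)).1
  have sW : ∀ w ∈ O, W.Smooth w := fun w hw => (h.smooth (hOU hw)).2
  have sdet : ∀ w ∈ O, SmoothAt (minor V W a b) w := fun w hw =>
    ((sV w hw (some a)).mul (sW w hw (some b))).sub ((sV w hw (some b)).mul (sW w hw (some a)))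
  have sr : ∀ w ∈ O, SmoothAt r w := fun w hw => (sW w hw (some b)).div (sdet w hw) (hdet w hw)
  have ss : ∀ w ∈ O, SmoothAt s w := fun w hw =>
    (sV w hw (some b)).neg.div (sdet w hw) (hdet w hw)
  have sm : ∀ w ∈ O, SmoothAt m w := fun w hw =>
    (sW w hw (some a)).neg.div (sdet w hw) (hdet w hw)
  have sn : ∀ w ∈ O, SmoothAt n w := fun w hw => (sV w hw (some a)).div (sdet w hw) (hdet w hw)
  have sX : ∀ w ∈ O, X.Smooth w := by
    intro w hw o
    have := ((sr w hw).mul (sV w hw o)).add ((ss w hw).mul (sW w hw o))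
    cases o <;> exact this
  have sY : ∀ w ∈ O, Y.Smooth w := by
    intro w hw o
    have := ((sm w hw).mul (sV w hw o)).add ((sn w hw).mul (sW w hw o))
    cases o <;> exact this
  have Xa : ∀ w ∈ O, (X w).1 a = 1 := fun w hw => by
    have := hdet w hw
    simp only [hX, hr, hs, Prod.fst_add, Prod.smul_fst, Pi.add_apply, Pi.smul_apply, smul_eq_mul]
    field_simp
    simp only [minor]; ring
  have Xb : ∀ w ∈ O, (X w).1 b = 0 := fun w hw => by
    simp only [hX, hr, hs, Prod.fst_add, Prod.smul_fst, Pi.add_apply, Pi.smul_apply, smul_eq_mul]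
    ring
  have Ya : ∀ w ∈ O, (Y w).1 a = 0 := fun w hw => by
    simp only [hY, hm, hn, Prod.fst_add, Prod.smul_fst, Pi.add_apply, Pi.smul_apply, smul_eq_mul]
    ring
  have Yb : ∀ w ∈ O, (Y w).1 b = 1 := fun w hw => by
    have := hdet w hw
    simp only [hY, hm, hn, Prod.fst_add, Prod.smul_fst, Pi.add_apply, Pi.smul_apply, smul_eq_mul]
    field_simp
    simp only [minor]; ring
  have eV : ∀ w ∈ O, V w = (V w).1 a • X w + (V w).1 b • Y w := fun w hw => by
    have h0 := hdet w hw
    have h1 : (V w).1 a * r w + (V w).1 b * m w = 1 := by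
      simp only [hr, hm]; field_simp; simp only [minor]; ring
    have h2 : (V w).1 a * s w + (V w).1 b * n w = 0 := by
      simp only [hs, hn]; field_simp; ring
    have : (V w).1 a • X w + (V w).1 b • Y w =
        ((V w).1 a * r w + (V w).1 b * m w) • V w + ((V w).1 a * s w + (V w).1 b * n w) • W w := by
      simp only [hX, hY]; module
    rw [this, h1, h2]; simp
  have eW : ∀ w ∈ O, W w = (W w).1 a • X w + (W w).1 b • Y w := fun w hw => by
    have h0 := hdet w hw
    have h1 : (W w).1 a * r w + (W w).1 b * m w = 0 := by
      simp only [hr, hm]; field_simp; ring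
    have h2 : (W w).1 a * s w + (W w).1 b * n w = 1 := by
      simp only [hs, hn]; field_simp; simp only [minor]; ring
    have : (W w).1 a • X w + (W w).1 b • Y w =
        ((W w).1 a * r w + (W w).1 b * m w) • V w + ((W w).1 a * s w + (W w).1 b * n w) • W w := by
      simp only [hX, hY]; module
    rw [this, h1, h2]; simp
  have act_const : ∀ (Z : SpectralField) (o : Option (Fin 4)) (T : SpectralField) (k : ℝ)
      (w : Jet × ℝ), w ∈ O → (∀ v ∈ O, T.comp o v = k) → Z.act (T.comp o) w = 0 := by
    intro Z o T k w hw hT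
    rw [SpectralField.act_eq, lineDeriv_congr (g := fun _ => k)
      (Filter.eventually_of_mem (hO.mem_nhds hw) hT), lineDeriv_fun_const]
  -- The bracket is a combination of `X` and `Y`. Its components `a, b` are the coefficients of that
  -- combination and at the same time derivatives of constants, so it vanishes.
  have hbr : ∀ w ∈ O, w.1 ∈ regularJets F → X.bracket Y w = 0 := by
    intro w hw hreg
    obtain ⟨p, q, hpq⟩ := Submodule.mem_span_pair.1 (h.frobenius w.1 ⟨(hOU hw).1, hreg⟩ w.2 (hOU hw).2)
    have e := bracket_comb (sV w hw) (sW w hw) (sr w hw) (ss w hw) (sm w hw) (sn w hw) X Y hX hY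
    obtain ⟨A, B, hAB⟩ : ∃ A B : ℝ, X.bracket Y w = A • X w + B • Y w := by
      refine ⟨((r w * n w - s w * m w) * p + (X.act m w - Y.act r w)) * (V w).1 a +
        ((r w * n w - s w * m w) * q + (X.act n w - Y.act s w)) * (W w).1 a,
        ((r w * n w - s w * m w) * p + (X.act m w - Y.act r w)) * (V w).1 b +
        ((r w * n w - s w * m w) * q + (X.act n w - Y.act s w)) * (W w).1 b, ?_⟩
      have hpq' : V.bracket W w = p • V w + q • W w := hpq.symm
      rw [e, hpq']
      have e1 := eV w hw
      have e2 := eW w hw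
      generalize (V w).1 a = x1 at *
      generalize (V w).1 b = x2 at *
      generalize (W w).1 a = x3 at *
      generalize (W w).1 b = x4 at *
      rw [e1, e2]
      module
    have ha : (X.bracket Y w).1 a = 0 := by
      have e1 : (X.bracket Y w).1 a = X.act (Y.comp (some a)) w - Y.act (X.comp (some a)) w := rfl
      rw [e1, act_const X (some a) Y 0 w hw Ya, act_const Y (some a) X 1 w hw Xa, sub_zero]
    have hb : (X.bracket Y w).1 b = 0 := by
      have e1 : (X.bracket Y w).1 b = X.act (Y.comp (some b)) w - Y.act (X.comp (some b)) w := rfl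
      rw [e1, act_const X (some b) Y 1 w hw Yb, act_const Y (some b) X 0 w hw Xb, sub_zero]
    rw [hAB] at ha hb
    simp only [Prod.fst_add, Prod.smul_fst, Pi.add_apply, Pi.smul_apply, smul_eq_mul, Xa w hw,
      Xb w hw, Ya w hw, Yb w hw] at ha hb
    have hA : A = 0 := by linarith
    have hB : B = 0 := by linarith
    rw [hAB, hA, hB]; simp
  refine ⟨X, Y, ⟨sX, sY, Xa, Xb, Ya, Yb, fun w hw hreg o => ?_, fun w hw hreg f hf => ?_,
    fun w hw hreg ξ h1 h2 => ?_, fun j hj l l' hl hl' h1 h2 => ?_⟩, fun w hw c d => ?_⟩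
  · have := SpectralField.comp_bracket X Y o w
    have e0 : (X.bracket Y).comp o w = 0 := by
      cases o <;> simp [SpectralField.comp, hbr w hw hreg]
    rw [e0] at this
    exact (sub_eq_zero.1 this.symm)
  · have := SpectralField.bracket_act (sX w hw) (sY w hw) hf
    have e0 : (X.bracket Y).act f w = 0 := by
      rw [hf.act_eq_sum]
      refine Finset.sum_eq_zero fun o _ => ?_
      cases o <;> simp [SpectralField.comp, hbr w hw hreg]
    rw [e0] at this
    exact (sub_eq_zero.1 this.symm)
  · refine h.characteristic w.1 ⟨(hOU hw).1, hreg⟩ w.2 (hOU hw).2 ξ fun v hv => ?_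
    obtain ⟨p, q, rfl⟩ := Submodule.mem_span_pair.1 hv
    have hlin : ∀ (x y : ℝ) (A B : Fin 4 → ℝ), ∑ i, ξ i * (x • A + y • B) i =
        x * ∑ i, ξ i * A i + y * ∑ i, ξ i * B i := fun x y A B => by
      simp only [Finset.mul_sum, ← Finset.sum_add_distrib, Pi.add_apply, Pi.smul_apply, smul_eq_mul]
      exact Finset.sum_congr rfl fun i _ => by ring
    have zV : ∑ i, ξ i * (V w).1 i = 0 := by
      have : (V w).1 = (V w).1 a • (X w).1 + (V w).1 b • (Y w).1 := congrArg Prod.fst (eV w hw)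
      rw [this, hlin, h1, h2]; ring
    have zW : ∑ i, ξ i * (W w).1 i = 0 := by
      have : (W w).1 = (W w).1 a • (X w).1 + (W w).1 b • (Y w).1 := congrArg Prod.fst (eW w hw)
      rw [this, hlin, h1, h2]; ring
    have := hlin p q (V w).1 (W w).1
    rw [zV, zW] at this
    simpa using this
  · have span_eq : ∀ w ∈ O, projectedPlane V W w = Submodule.span ℝ {(X w).1, (Y w).1} := by
      intro w hw
      refine le_antisymm (Submodule.span_le.2 ?_) (Submodule.span_le.2 ?_)
      · rintro x (rfl | rfl)
        · exact Submodule.mem_span_pair.2 ⟨(V w).1 a, (V w).1 b, (congrArg Prod.fst (eV w hw)).symm⟩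
        · exact Submodule.mem_span_pair.2 ⟨(W w).1 a, (W w).1 b, (congrArg Prod.fst (eW w hw)).symm⟩
      · rintro x (rfl | rfl)
        · exact Submodule.mem_span_pair.2 ⟨r w, s w, rfl⟩
        · exact Submodule.mem_span_pair.2 ⟨m w, n w, rfl⟩
    refine h.parametrized j ⟨(hOU hl).1, hj⟩ (hOU hl).2 (hOU hl').2 ?_
    beta_reduce
    rw [span_eq _ hl, span_eq _ hl', h1, h2]
  · have h0 := hdet w hw
    have e1 : minor X Y c d w = (r w * n w - s w * m w) * minor V W c d w := by
      simp only [minor, hX, hY, Prod.fst_add, Prod.smul_fst, Pi.add_apply, Pi.smul_apply,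
        smul_eq_mul]
      ring
    have e2 : (r w * n w - s w * m w) * minor V W a b w = 1 := by
      simp only [hr, hs, hm, hn]
      field_simp
      simp only [minor]; ring
    rw [e1, mul_right_comm, e2, one_mul]

/-! ### Generic values of the spectral parameter -/

/-- A function which is injective in the parameter takes a common value near a jet. -/
lemma exists_common_value {f : Jet × ℝ → ℝ} {O : Set (Jet × ℝ)} (hO : IsOpen O) {j : Jet} {l₀ : ℝ}
    (h0 : (j, l₀) ∈ O) (hf : ∀ w ∈ O, ContinuousAt f w)
    (hinj : ∀ l l', (j, l) ∈ O → (j, l') ∈ O → f (j, l) = f (j, l') → l = l') :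
    ∃ l, (j, l) ∈ O ∧ ∀ c : ℝ → Jet, ContinuousAt c 0 → c 0 = j →
      ∀ᶠ t in 𝓝 0, ∃ l', (c t, l') ∈ O ∧ f (c t, l') = f (j, l) := by
  obtain ⟨N, hN, M, hM, hNM⟩ := mem_nhds_prod_iff.1 (hO.mem_nhds h0)
  obtain ⟨ε, hε, hεM⟩ := Metric.mem_nhds_iff.1 hM
  have hsub : ∀ j' ∈ N, ∀ l ∈ Metric.ball l₀ ε, (j', l) ∈ O := fun j' hj' l hl =>
    hNM ⟨hj', hεM hl⟩
  have hjN : j ∈ N := mem_of_mem_nhds hN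
  -- A value strictly between two others persists: under a small perturbation of the jet the strict
  -- inequalities survive and the intermediate value theorem in the parameter applies.
  have main : ∀ a m b, a ∈ Metric.ball l₀ ε → m ∈ Metric.ball l₀ ε → b ∈ Metric.ball l₀ ε →
      f (j, a) < f (j, m) → f (j, m) < f (j, b) →
      ∃ l, (j, l) ∈ O ∧ ∀ c : ℝ → Jet, ContinuousAt c 0 → c 0 = j →
        ∀ᶠ t in 𝓝 0, ∃ l', (c t, l') ∈ O ∧ f (c t, l') = f (j, l) := by
    intro a m b ha hm hb h1 h2
    refine ⟨m, hsub j hjN m hm, fun c hc hc0 => ?_⟩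
    have hcl : ∀ l ∈ Metric.ball l₀ ε, ContinuousAt (fun t => f (c t, l)) 0 := by
      intro l hl
      refine ContinuousAt.comp (f := fun t => (c t, l)) ?_ (hc.prodMk continuousAt_const)
      simpa [hc0] using hf _ (hsub j hjN l hl)
    have e1 : ∀ᶠ t in 𝓝 0, f (c t, a) < f (j, m) :=
      (hcl a ha).eventually_lt continuousAt_const (by simpa [hc0] using h1)
    have e2 : ∀ᶠ t in 𝓝 0, f (j, m) < f (c t, b) :=
      continuousAt_const.eventually_lt (hcl b hb) (by simpa [hc0] using h2)
    have e3 : ∀ᶠ t in 𝓝 0, c t ∈ N := hc.eventually_mem (by simpa [hc0] using hN)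
    filter_upwards [e1, e2, e3] with t h1 h2 h3
    have hseg : Set.uIcc a b ⊆ Metric.ball l₀ ε :=
      (convex_ball l₀ ε).ordConnected.uIcc_subset ha hb
    have hcont : ContinuousOn (fun l => f (c t, l)) (Set.uIcc a b) := fun l hl =>
      (ContinuousAt.comp (f := fun l => (c t, l)) (hf _ (hsub _ h3 l (hseg hl)))
        (by fun_prop)).continuousWithinAt
    obtain ⟨l', hl', he⟩ := intermediate_value_uIcc hcont
      (Set.mem_uIcc.2 (Or.inl ⟨h1.le, h2.le⟩))
    exact ⟨l', hsub _ h3 l' (hseg hl'), he⟩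
  have m0 : l₀ ∈ Metric.ball l₀ ε := Metric.mem_ball_self hε
  have m1 : l₀ - ε / 2 ∈ Metric.ball l₀ ε := by
    rw [Metric.mem_ball, Real.dist_eq, abs_lt]; constructor <;> linarith
  have m2 : l₀ + ε / 2 ∈ Metric.ball l₀ ε := by
    rw [Metric.mem_ball, Real.dist_eq, abs_lt]; constructor <;> linarith
  -- By injectivity the values at three parameters are distinct, and one of them lies between the
  -- other two.
  have n01 : f (j, l₀) ≠ f (j, l₀ - ε / 2) := fun e => by
    have := hinj _ _ (hsub j hjN _ m0) (hsub j hjN _ m1) e; linarith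
  have n02 : f (j, l₀) ≠ f (j, l₀ + ε / 2) := fun e => by
    have := hinj _ _ (hsub j hjN _ m0) (hsub j hjN _ m2) e; linarith
  have n12 : f (j, l₀ - ε / 2) ≠ f (j, l₀ + ε / 2) := fun e => by
    have := hinj _ _ (hsub j hjN _ m1) (hsub j hjN _ m2) e; linarith
  rcases lt_or_gt_of_ne n01 with h1 | h1 <;> rcases lt_or_gt_of_ne n02 with h2 | h2 <;>
    rcases lt_or_gt_of_ne n12 with h3 | h3
  · exact main _ _ _ m0 m1 m2 h1 h3
  · exact main _ _ _ m0 m2 m1 h2 h3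
  · linarith
  · exact main _ _ _ m2 m0 m1 h2 h1
  · exact main _ _ _ m1 m0 m2 h1 h2
  · linarith
  · exact main _ _ _ m1 m2 m0 h3 h2
  · exact main _ _ _ m2 m1 m0 h3 h1

/-- The vectors annihilated by two covectors. -/
def annihilatedBy (η η' : Fin 4 → ℝ) : Submodule ℝ (Fin 4 → ℝ) where
  carrier := {v | ∑ i, η i * v i = 0 ∧ ∑ i, η' i * v i = 0}
  add_mem' := by
    rintro v w ⟨h1, h2⟩ ⟨h3, h4⟩
    simp [mul_add, Finset.sum_add_distrib, h1, h2, h3, h4]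
  zero_mem' := by simp
  smul_mem' := by
    rintro a v ⟨h1, h2⟩
    have : ∀ ζ : Fin 4 → ℝ, ∑ i, ζ i * (a • v) i = a * ∑ i, ζ i * v i := fun ζ => by
      rw [Finset.mul_sum]; exact Finset.sum_congr rfl fun i _ => by simp; ring
    simp only [Set.mem_ofPred_eq, this, h1, h2, mul_zero, and_self]

lemma mem_annihilatedBy {η η' v : Fin 4 → ℝ} :
    v ∈ annihilatedBy η η' ↔ ∑ i, η i * v i = 0 ∧ ∑ i, η' i * v i = 0 := Iff.rfl

lemma finrank_annihilatedBy {η η' : Fin 4 → ℝ} {a b : Fin 4}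
    (h : η a * η' b - η b * η' a ≠ 0) : Module.finrank ℝ (annihilatedBy η η') = 2 := by
  let φ : (Fin 4 → ℝ) →ₗ[ℝ] ℝ × ℝ := (dotProductBilin ℝ ℝ η).prod (dotProductBilin ℝ ℝ η')
  have hφ : ∀ v, φ v = (∑ i, η i * v i, ∑ i, η' i * v i) := fun v => rfl
  have hker : LinearMap.ker φ = annihilatedBy η η' := by
    ext v
    rw [LinearMap.mem_ker, hφ, mem_annihilatedBy, Prod.mk_eq_zero]
  have hsurj : Function.Surjective φ := by
    rintro ⟨x, y⟩
    set D := η a * η' b - η b * η' a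
    refine ⟨Pi.single a ((x * η' b - y * η b) / D) + Pi.single b ((y * η a - x * η' a) / D), ?_⟩
    have hs : ∀ ζ : Fin 4 → ℝ, ∀ r s : ℝ,
        ∑ i, ζ i * ((Pi.single a r + Pi.single b s : Fin 4 → ℝ) i) = ζ a * r + ζ b * s := by
      intro ζ r s
      simp [mul_add, Finset.sum_add_distrib, Pi.single_apply]
    rw [hφ, hs, hs]
    ext
    · simp only; field_simp; ring
    · simp only; field_simp; ring
  have h1 := LinearMap.finrank_range_add_finrank_ker φ
  rw [LinearMap.range_eq_top.2 hsurj, finrank_top, hker] at h1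
  simp at h1
  omega

/-- Pigeonhole: `Λ` is infinite, different parameters give different planes, and inclusion in a
given 2-plane means equality. -/
lemma IsLaxPair.exists_not_le {F : Jet → ℝ} {U : Set Jet} {Λ : Set ℝ} {V W : SpectralField}
    (h : IsLaxPair F U Λ V W) {j : Jet} (hj : j ∈ U ∩ regularJets F)
    {P : Fin 3 → Submodule ℝ (Fin 4 → ℝ)} (hP : ∀ i, Module.finrank ℝ (P i) = 2) :
    ∃ l ∈ Λ, ∀ i, ¬((V (j, l)).1 ∈ P i ∧ (W (j, l)).1 ∈ P i) := by
  by_contra! hcon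
  choose! i hi using hcon
  obtain ⟨l₀, hl₀⟩ := h.nonempty_param
  have hinf : Λ.Infinite := infinite_of_mem_nhds l₀ (h.isOpen_param.mem_nhds hl₀)
  obtain ⟨l, hl, l', hl', hne, he⟩ := hinf.exists_ne_map_eq_of_mapsTo
    (f := i) (t := Set.univ) (fun _ _ => trivial) Set.finite_univ
  refine hne (h.parametrized j hj hl hl' ?_)
  have hplane : ∀ l ∈ Λ, projectedPlane V W (j, l) = P (i l) := by
    intro l hl
    refine Submodule.eq_of_le_of_finrank_eq (Submodule.span_le.2 ?_) ?_
    · rintro x (rfl | rfl)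
      · exact (hi l hl).1
      · exact (hi l hl).2
    · rw [hP]
      have := finrank_span_eq_card (h.rank_two j hj l hl)
      rw [Matrix.range_cons, Matrix.range_cons, Matrix.range_empty, Set.union_empty] at this
      rwa [Fintype.card_fin, Set.singleton_union] at this
  change projectedPlane V W (j, l) = projectedPlane V W (j, l')
  rw [hplane l hl, hplane l' hl', he]

/-! ### The two equations -/

/-- The total derivative `D_i Q` of a function on `J¹`. -/
def dtot (i : Fin 4) (Q : J1 → ℝ) (j : Jet) : ℝ :=
  fderiv ℝ Q (toJ1 j) (toJ1Vec (totalVec i j))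

lemma lineDeriv_toJ1_const (Q : J1 → ℝ) (j : Jet) {d : Jet} (hd : toJ1Vec d = 0) :
    HasDerivAt (fun t : ℝ => Q (toJ1 (j + t • d))) 0 0 := by
  simp only [toJ1_add_smul, hd, smul_zero, add_zero]
  exact hasDerivAt_const _ _

lemma toJ1Vec_powJet (ξ : Fin 4 → ℝ) {n : ℕ} (hn : 2 ≤ n) : toJ1Vec (powJet ξ n) = 0 := by
  have h0 : (0 : ℕ) ≠ n := by omega
  have h1 : (1 : ℕ) ≠ n := by omega
  refine Prod.ext rfl (Prod.ext ?_ (funext fun i => ?_)) <;> simp [toJ1Vec, powJet, h0, h1]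

lemma powJet_two (ξ : Fin 4 → ℝ) (a b : Fin 4) : (powJet ξ 2).2 {a, b} = ξ a * ξ b := by
  simp [powJet]

lemma symbol_eqIII (Q : J1 → ℝ) (j : Jet) (ξ : Fin 4 → ℝ) :
    symbol (eqIII Q) j ξ = ξ 1 * ξ 3 - (ξ 0 * ξ 3 * j.2 {2, 2} + j.2 {0, 3} * ξ 2 ^ 2) +
      (ξ 0 * ξ 2 * j.2 {2, 3} + j.2 {0, 2} * (ξ 2 * ξ 3)) - Q (toJ1 j) * (ξ 2 * ξ 3) := by
  have hc := (hasCoordDerivAt_line j (powJet ξ 2)).coord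
  have h := (((hc {1, 3}).sub ((hc {0, 3}).mul (hc {2, 2}))).add
    ((hc {0, 2}).mul (hc {2, 3}))).sub
    ((lineDeriv_toJ1_const Q j (toJ1Vec_powJet ξ le_rfl)).mul (hc {2, 3}))
  have h' : HasLineDerivAt ℝ (eqIII Q) _ j (powJet ξ 2) := h
  rw [symbol_eq, h'.lineDeriv]
  simp only [powJet_two, zero_smul, add_zero]
  ring

lemma symbol_eqII (Q : J1 → ℝ) (j : Jet) (ξ : Fin 4 → ℝ) :
    symbol (eqII Q) j ξ = ξ 0 * ξ 1 * j.2 {2, 3} + j.2 {0, 1} * (ξ 2 * ξ 3) -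
      (ξ 0 * ξ 2 * j.2 {1, 3} + j.2 {0, 2} * (ξ 1 * ξ 3)) - Q (toJ1 j) * (ξ 0 * ξ 3) := by
  have hc := (hasCoordDerivAt_line j (powJet ξ 2)).coord
  have h := (((hc {0, 1}).mul (hc {2, 3})).sub
    ((hc {0, 2}).mul (hc {1, 3}))).sub
    ((lineDeriv_toJ1_const Q j (toJ1Vec_powJet ξ le_rfl)).mul (hc {0, 3}))
  have h' : HasLineDerivAt ℝ (eqII Q) _ j (powJet ξ 2) := h
  rw [symbol_eq, h'.lineDeriv]
  simp only [powJet_two, zero_smul, add_zero]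
  ring

lemma nondegenerate_eqIII (Q : J1 → ℝ) (j : Jet) :
    SymbolNondegenerate (eqIII Q) j ↔ j.2 {2, 3} ≠ 0 := by
  simp only [SymbolNondegenerate, symbol_eqIII, Pi.add_apply]
  generalize j.2 {2, 3} = b
  generalize j.2 {2, 2} = c
  generalize j.2 {0, 3} = a
  generalize j.2 {0, 2} = e
  constructor
  · rintro h rfl
    -- For `u₃₄ = 0` this covector lies in the kernel of the symbol.
    have := h ![1, c, 0, 0] (fun η => by simp; ring)
    simpa using congrFun this 0
  · intro hb ξ h
    have h1 := h (Pi.single 1 1)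
    have h0 := h (Pi.single 0 1)
    have h3 := h (Pi.single 3 1)
    have h2 := h (Pi.single 2 1)
    simp at h0 h1 h2 h3
    have z3 : ξ 3 = 0 := by linarith
    rw [z3] at h0 h2 h3
    have z2 : ξ 2 = 0 := by
      have : ξ 2 * b = 0 := by linarith
      simpa [hb] using this
    rw [z2] at h0 h2 h3
    have z0 : ξ 0 = 0 := by
      have : ξ 0 * b = 0 := by linarith
      simpa [hb] using this
    rw [z0] at h3
    have z1 : ξ 1 = 0 := by linarith
    ext i; fin_cases i <;> simp [z0, z1, z2, z3]

lemma nondegenerate_eqII (Q : J1 → ℝ) (j : Jet) :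
    SymbolNondegenerate (eqII Q) j ↔
      j.2 {0, 1} * j.2 {2, 3} - j.2 {0, 2} * j.2 {1, 3} ≠ 0 := by
  simp only [SymbolNondegenerate, symbol_eqII, Pi.add_apply]
  generalize j.2 {2, 3} = a
  generalize j.2 {1, 3} = b
  generalize j.2 {0, 1} = c
  generalize j.2 {0, 2} = d
  constructor
  · intro h hD
    by_cases h1 : b = 0 ∧ a = 0
    · have := h ![0, c, d, 0] (fun η => by simp [h1]; ring)
      have h01 : c = 0 := by simpa using congrFun this 1
      have h02 : d = 0 := by simpa using congrFun this 2
      have := h ![0, 1, 0, 0] (fun η => by simp [h1, h01, h02])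
      simpa using congrFun this 1
    -- A kernel covector when `u₁₂ u₃₄ = u₁₃ u₂₄`; it is nonzero in the case at hand.
    · have := h ![0, b, a, 0] (fun η => by simp; linear_combination (η 3) * hD)
      exact h1 ⟨by simpa using congrFun this 1, by simpa using congrFun this 2⟩
  · intro hD ξ h
    have h1 := h (Pi.single 1 1)
    have h0 := h (Pi.single 0 1)
    have h3 := h (Pi.single 3 1)
    have h2 := h (Pi.single 2 1)
    simp at h0 h1 h2 h3
    have z0 : ξ 0 = 0 := by
      refine (mul_eq_zero.1 (?_ : (c * a - d * b) * ξ 0 = 0)).resolve_left hD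
      linear_combination c * h1 + d * h2
    have z3 : ξ 3 = 0 := by
      refine (mul_eq_zero.1 (?_ : (c * a - d * b) * ξ 3 = 0)).resolve_left hD
      linear_combination b * h1 + a * h2
    rw [z0, z3] at h0 h3
    have z1 : ξ 1 = 0 := by
      refine (mul_eq_zero.1 (?_ : (c * a - d * b) * ξ 1 = 0)).resolve_left hD
      linear_combination c * h0 + b * h3
    have z2 : ξ 2 = 0 := by
      refine (mul_eq_zero.1 (?_ : (c * a - d * b) * ξ 2 = 0)).resolve_left hD
      linear_combination d * h0 + a * h3
    ext i; fin_cases i <;> simp [z0, z1, z2, z3]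

lemma smoothAt_eqIII {Ω : Set J1} (hΩ : IsOpen Ω) {Q : J1 → ℝ} (hQ : ContDiffOn ℝ ∞ Q Ω)
    (w : Jet × ℝ) (hw : toJ1 w.1 ∈ Ω) : SmoothAt (fun v => eqIII Q v.1) w :=
  (((smoothAt_coord {1, 3} w).sub ((smoothAt_coord {0, 3} w).mul (smoothAt_coord {2, 2} w))).add
    ((smoothAt_coord {0, 2} w).mul (smoothAt_coord {2, 3} w))).sub
    ((SmoothAt.comp_toJ1 (hQ.contDiffAt (hΩ.mem_nhds hw))).mul (smoothAt_coord {2, 3} w))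

lemma smoothAt_eqII {Ω : Set J1} (hΩ : IsOpen Ω) {Q : J1 → ℝ} (hQ : ContDiffOn ℝ ∞ Q Ω)
    (w : Jet × ℝ) (hw : toJ1 w.1 ∈ Ω) : SmoothAt (fun v => eqII Q v.1) w :=
  (((smoothAt_coord {0, 1} w).mul (smoothAt_coord {2, 3} w)).sub
    ((smoothAt_coord {0, 2} w).mul (smoothAt_coord {1, 3} w))).sub
    ((SmoothAt.comp_toJ1 (hQ.contDiffAt (hΩ.mem_nhds hw))).mul (smoothAt_coord {0, 3} w))

/-- The weight counts the derivatives by `y` and `t`. Among the second derivatives in the equation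
only `u₂₄` has weight two, and its coefficient is `1`. -/
lemma leadingForm_eqIII {Ω : Set J1} (hΩ : IsOpen Ω) {Q : J1 → ℝ} (hQ : ContDiffOn ℝ ∞ Q Ω) :
    LeadingForm (eqIII Q) Ω {1, 3} ![0, 1, 0, 1] (fun _ => 1) where
  isOpen := hΩ
  card := rfl
  smooth := smoothAt_eqIII hΩ hQ
  coef_smooth := contDiffOn_const
  coef_ne _ _ := one_ne_zero
  agree j j' _ h := by
    have h1 : toJ1 j = toJ1 j' := h.toJ1_eq fun K hK => Or.inl (Nat.lt_succ_of_le hK)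
    simp only [eqIII, h1, h.2 {0, 3} (by simp [IndexLT]), h.2 {2, 2} (by simp [IndexLT]),
      h.2 {0, 2} (by simp [IndexLT]), h.2 {2, 3} (by simp [IndexLT])]
    ring

/-- The weight counts the derivatives by `x` and `t`, which singles out `u₁₄`. Its coefficient is
`-Q`, so the equation can be solved only where `Q ≠ 0`. -/
lemma leadingForm_eqII {Ω : Set J1} (hΩ : IsOpen Ω) {Q : J1 → ℝ} (hQ : ContDiffOn ℝ ∞ Q Ω)
    (h0 : ∀ q ∈ Ω, Q q ≠ 0) :
    LeadingForm (eqII Q) Ω {0, 3} ![1, 0, 0, 1] (fun q => -Q q) where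
  isOpen := hΩ
  card := rfl
  smooth := smoothAt_eqII hΩ hQ
  coef_smooth := hQ.neg
  coef_ne q hq := neg_ne_zero.2 (h0 q hq)
  agree j j' _ h := by
    have h1 : toJ1 j = toJ1 j' := h.toJ1_eq fun K hK => Or.inl (Nat.lt_succ_of_le hK)
    simp only [eqII, h1, h.2 {0, 1} (by simp [IndexLT]), h.2 {1, 3} (by simp [IndexLT]),
      h.2 {0, 2} (by simp [IndexLT]), h.2 {2, 3} (by simp [IndexLT])]
    ring

lemma hasDerivAt_toJ1_totalVec {Q : J1 → ℝ} {j : Jet} (hQ : DifferentiableAt ℝ Q (toJ1 j))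
    (i : Fin 4) : HasDerivAt (fun t : ℝ => Q (toJ1 (j + t • totalVec i j))) (dtot i Q j) 0 :=
  hQ.hasFDerivAt.hasLineDerivAt (toJ1Vec (totalVec i j))

lemma totalDeriv_eqIII {Q : J1 → ℝ} {j : Jet} (hQ : DifferentiableAt ℝ Q (toJ1 j)) (i : Fin 4) :
    totalDeriv i (eqIII Q) j = j.2 (i ::ₘ {1, 3}) -
      (j.2 (i ::ₘ {0, 3}) * j.2 {2, 2} + j.2 {0, 3} * j.2 (i ::ₘ {2, 2})) +
      (j.2 (i ::ₘ {0, 2}) * j.2 {2, 3} + j.2 {0, 2} * j.2 (i ::ₘ {2, 3})) -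
      (dtot i Q j * j.2 {2, 3} + Q (toJ1 j) * j.2 (i ::ₘ {2, 3})) := by
  have hc := (hasCoordDerivAt_line j (totalVec i j)).coord
  have h := (((hc {1, 3}).sub ((hc {0, 3}).mul (hc {2, 2}))).add
    ((hc {0, 2}).mul (hc {2, 3}))).sub
    ((hasDerivAt_toJ1_totalVec hQ i).mul (hc {2, 3}))
  have h' : HasLineDerivAt ℝ (eqIII Q) _ j (totalVec i j) := h
  rw [totalDeriv, h'.lineDeriv]
  simp [totalVec]

lemma totalDeriv_eqII {Q : J1 → ℝ} {j : Jet} (hQ : DifferentiableAt ℝ Q (toJ1 j)) (i : Fin 4) :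
    totalDeriv i (eqII Q) j = (j.2 (i ::ₘ {0, 1}) * j.2 {2, 3} + j.2 {0, 1} * j.2 (i ::ₘ {2, 3})) -
      (j.2 (i ::ₘ {0, 2}) * j.2 {1, 3} + j.2 {0, 2} * j.2 (i ::ₘ {1, 3})) -
      (dtot i Q j * j.2 {0, 3} + Q (toJ1 j) * j.2 (i ::ₘ {0, 3})) := by
  have hc := (hasCoordDerivAt_line j (totalVec i j)).coord
  have h := (((hc {0, 1}).mul (hc {2, 3})).sub
    ((hc {0, 2}).mul (hc {1, 3}))).sub
    ((hasDerivAt_toJ1_totalVec hQ i).mul (hc {0, 3}))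
  have h' : HasLineDerivAt ℝ (eqII Q) _ j (totalVec i j) := h
  rw [totalDeriv, h'.lineDeriv]
  simp [totalVec]

/-! ### Rules for the action of spectral fields -/

namespace SpectralField

variable {f g : Jet × ℝ → ℝ} {w : Jet × ℝ} (X : SpectralField)

lemma act_add (hf : SmoothAt f w) (hg : SmoothAt g w) :
    X.act (fun v => f v + g v) w = X.act f w + X.act g w := hf.lineDeriv_fun_add hg _

lemma act_sub (hf : SmoothAt f w) (hg : SmoothAt g w) :
    X.act (fun v => f v - g v) w = X.act f w - X.act g w := hf.lineDeriv_fun_sub hg _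

lemma act_neg (hf : SmoothAt f w) : X.act (fun v => -f v) w = -X.act f w := hf.lineDeriv_fun_neg _

lemma act_mul (hf : SmoothAt f w) (hg : SmoothAt g w) :
    X.act (fun v => f v * g v) w = X.act f w * g w + f w * X.act g w := hf.lineDeriv_fun_mul hg _

lemma act_div (hf : SmoothAt f w) (hg : SmoothAt g w) (h0 : g w ≠ 0) :
    X.act (fun v => f v / g v) w = (X.act f w * g w - f w * X.act g w) / g w ^ 2 :=
  hf.lineDeriv_fun_div hg h0 _

lemma act_const (a : ℝ) (w : Jet × ℝ) : X.act (fun _ => a) w = 0 := lineDeriv_fun_const _ _ _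

lemma act_param (w : Jet × ℝ) : X.act (fun v => v.2) w = (X w).2 := lineDeriv_param _ _

lemma act_jet {f : Jet → ℝ} {w : Jet × ℝ} (hf : SmoothAt (fun v => f v.1) w) :
    X.act (fun v => f v.1) w = ∑ i, (X w).1 i * totalDeriv i f w.1 := by
  rw [hf.act_eq_sum, Fintype.sum_option]
  have h0 : basisDeriv none (fun v : Jet × ℝ => f v.1) w = 0 := by
    have : (fun t : ℝ => f (w + t • (0, 1)).1) = fun _ => f w.1 := by
      funext t; simp
    simp [basisDeriv, basisVec, lineDeriv]
  rw [h0, mul_zero, zero_add]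
  rfl

lemma act_coord (I : Multiset (Fin 4)) (w : Jet × ℝ) :
    X.act (fun v => v.1.2 I) w = ∑ i, (X w).1 i * w.1.2 (i ::ₘ I) := by
  rw [X.act_jet (f := fun j => j.2 I) (smoothAt_coord I w)]
  refine Finset.sum_congr rfl fun i _ => ?_
  have : totalDeriv i (fun j => j.2 I) w.1 = w.1.2 (i ::ₘ I) :=
    lineDeriv_coord I w (totalVec i w.1, 0)
  rw [this]

lemma act_toJ1 {Q : J1 → ℝ} {w : Jet × ℝ} (hQ : ContDiffAt ℝ ∞ Q (toJ1 w.1)) :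
    X.act (fun v => Q (toJ1 v.1)) w = ∑ i, (X w).1 i * dtot i Q w.1 := by
  rw [X.act_jet (f := fun j => Q (toJ1 j)) (SmoothAt.comp_toJ1 hQ)]
  refine Finset.sum_congr rfl fun i _ => ?_
  have : totalDeriv i (fun j => Q (toJ1 j)) w.1 = dtot i Q w.1 :=
    lineDeriv_comp_toJ1 (w := w) (hQ.differentiableAt (by simp)) (totalVec i w.1, 0)
  rw [this]

lemma act_congr_of_eventuallyEq (h : f =ᶠ[𝓝 w] g) : X.act f w = X.act g w := lineDeriv_congr h _

end SpectralField

lemma dtot_eq_basisDeriv {Q : J1 → ℝ} {w : Jet × ℝ} (hQ : ContDiffAt ℝ ∞ Q (toJ1 w.1))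
    (i : Fin 4) : (fun v => dtot i Q v.1) =ᶠ[𝓝 w]
      basisDeriv (some i) (fun v : Jet × ℝ => Q (toJ1 v.1)) := by
  have h1 : ContDiffAt ℝ 1 Q (toJ1 w.1) := hQ.of_le (by simp)
  have hc : ContinuousAt (fun v : Jet × ℝ => toJ1 v.1) w :=
    (continuous_toJ1.comp continuous_fst).continuousAt
  filter_upwards [hc.eventually (h1.eventually (by decide))] with v hv
  exact (lineDeriv_comp_toJ1 (hv.differentiableAt (by simp)) (totalVec i v.1, 0)).symm

lemma smoothAt_dtot {Q : J1 → ℝ} {w : Jet × ℝ} (hQ : ContDiffAt ℝ ∞ Q (toJ1 w.1)) (i : Fin 4) :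
    SmoothAt (fun v => dtot i Q v.1) w :=
  ((SmoothAt.comp_toJ1 hQ).smoothAt_basisDeriv (some i)).congr (dtot_eq_basisDeriv hQ i)

lemma totalDeriv_dtot_comm {Q : J1 → ℝ} {j : Jet} (hQ : ContDiffAt ℝ ∞ Q (toJ1 j))
    (i k : Fin 4) : totalDeriv i (dtot k Q) j = totalDeriv k (dtot i Q) j := by
  have h := (SmoothAt.comp_toJ1 (w := (j, 0)) hQ).basisDeriv_comm (some i) (some k)
  have e : ∀ i k, basisDeriv (some i)
      (basisDeriv (some k) fun v : Jet × ℝ => Q (toJ1 v.1)) (j, 0) = totalDeriv i (dtot k Q) j :=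
    fun i k => (lineDeriv_congr (dtot_eq_basisDeriv (w := (j, 0)) hQ k) _).symm
  rwa [e, e] at h

/-! ### Type III: Lax pairs on self-dual planes -/

/-- The integrability condition of type III in terms of total derivatives of `Q`. -/
def condIII (Q : J1 → ℝ) (j : Jet) : ℝ :=
  -j.2 {2, 3} * totalDeriv 0 (dtot 2 Q) j + j.2 {0, 3} * totalDeriv 2 (dtot 2 Q) j +
    j.2 {2, 2} * totalDeriv 0 (dtot 3 Q) j - totalDeriv 1 (dtot 3 Q) j -
    (j.2 {0, 2} - Q (toJ1 j)) * totalDeriv 2 (dtot 3 Q) j + dtot 2 Q j * dtot 3 Q j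

section TypeIII

variable {Ω : Set J1} {Q : J1 → ℝ} {O : Set (Jet × ℝ)} {X Y : SpectralField}

lemma regular_eqIII_iff {j : Jet} :
    j ∈ regularJets (eqIII Q) ↔ j ∈ prolongation (eqIII Q) ∧ j.2 {2, 3} ≠ 0 := by
  rw [← nondegenerate_eqIII Q]; rfl

lemma eventually_regular_eqIII {w : Jet × ℝ} (hw : w.1 ∈ regularJets (eqIII Q)) :
    ∀ᶠ v : Jet × ℝ in 𝓝 w, v.1 ∈ prolongation (eqIII Q) → v.1 ∈ regularJets (eqIII Q) := by
  have hb := (regular_eqIII_iff.1 hw).2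
  filter_upwards [(smoothAt_coord {2, 3} w).continuousAt.eventually_ne hb] with v hv h
  exact regular_eqIII_iff.2 ⟨h, hv⟩

/-- Normal form of the self-dual null planes of type III. -/
lemma normalPair_alphaIII (h : NormalPair (eqIII Q) O 0 1 X Y) {w : Jet × ℝ} (hw : w ∈ O)
    (hreg : w.1 ∈ regularJets (eqIII Q)) :
    (X w).1 2 = -(w.1.2 {0, 3} / w.1.2 {2, 3}) ∧
      (Y w).1 2 = w.1.2 {0, 2} - Q (toJ1 w.1) -
        w.1.2 {2, 2} * (w.1.2 {0, 3} / w.1.2 {2, 3}) - w.1.2 {2, 3} * (X w).1 3 ∧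
      (Y w).1 3 = w.1.2 {2, 2} * (X w).1 3 := by
  have hb := (regular_eqIII_iff.1 hreg).2
  -- The covectors annihilating the normalized plane are parametrized by their `z`- and
  -- `t`-components `r, s`. The symbol is a quadratic form in `r, s` that vanishes identically; the
  -- values at `(1,0)`, `(0,1)`, `(1,1)` give all its coefficients.
  have hnull : ∀ r s : ℝ, _ := fun r s => h.null w hw hreg
    ![-(X w).1 2 * r - (X w).1 3 * s, -(Y w).1 2 * r - (Y w).1 3 * s, r, s]
    (by simp [Fin.sum_univ_four, h.fst_a w hw, h.fst_b w hw]; ring)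
    (by simp [Fin.sum_univ_four, h.snd_a w hw, h.snd_b w hw]; ring)
  simp only [symbol_eqIII] at hnull
  have h1 := hnull 1 0
  have h2 := hnull 0 1
  have h3 := hnull 1 1
  simp only [Matrix.cons_val] at h1 h2 h3
  have e1 : (X w).1 2 = -(w.1.2 {0, 3} / w.1.2 {2, 3}) := by
    field_simp; linarith
  have e3 : (Y w).1 3 = w.1.2 {2, 2} * (X w).1 3 := by linarith
  refine ⟨e1, ?_, e3⟩
  have e4 : w.1.2 {2, 2} * (w.1.2 {0, 3} / w.1.2 {2, 3}) = -w.1.2 {2, 2} * (X w).1 2 := by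
    rw [e1]; ring
  rw [e4]
  linarith

/-- Here `v = (X w).1 3` parametrizes the planes. The `z`- and `t`-components of `[X, Y] = 0`,
combined with `D_x` and `D_z` of the equation, express `X m` and `Y m` for `m = u₃₄ v` through `v`,
second derivatives of `u` and total derivatives of `Q`, with no third derivatives of `u`. The
condition `X Y m = Y X m` then reads `v * condIII = 0`. -/
lemma condIII_eq_zero (hΩ : IsOpen Ω) (hQ : ContDiffOn ℝ ∞ Q Ω) (hO : IsOpen O)
    (hOΩ : ∀ w ∈ O, toJ1 w.1 ∈ Ω) (h : NormalPair (eqIII Q) O 0 1 X Y) {w : Jet × ℝ}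
    (hw : w ∈ O) (hreg : w.1 ∈ regularJets (eqIII Q)) (hv : (X w).1 3 ≠ 0) :
    condIII Q w.1 = 0 := by
  have hL := leadingForm_eqIII hΩ hQ
  have hQc : ∀ w ∈ O, ContDiffAt ℝ ∞ Q (toJ1 w.1) := fun w hw =>
    hQ.contDiffAt (hΩ.mem_nhds (hOΩ w hw))
  have ev : ∀ w ∈ O, w.1 ∈ regularJets (eqIII Q) → ∀ {p : Jet × ℝ → Prop},
      (∀ v ∈ O, v.1 ∈ regularJets (eqIII Q) → p v) →
      ∀ᶠ v : Jet × ℝ in 𝓝 w, v.1 ∈ prolongation (eqIII Q) → p v := by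
    intro w hw hreg p hp
    filter_upwards [hO.mem_nhds hw, eventually_regular_eqIII hreg] with v hv hr hF
    exact hp v hv (hr hF)
  have sX : ∀ w ∈ O, ∀ i, SmoothAt (X.comp (some i)) w := fun w hw i => h.smooth_fst w hw _
  have sY : ∀ w ∈ O, ∀ i, SmoothAt (Y.comp (some i)) w := fun w hw i => h.smooth_snd w hw _
  -- the derivatives of `m = u₃₄ v`
  have first : ∀ w ∈ O, w.1 ∈ regularJets (eqIII Q) →
      X.act (fun v => v.1.2 {2, 3} * X.comp (some 3) v) w =
        -(X.comp (some 3) w * dtot 3 Q w.1) ∧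
      Y.act (fun v => v.1.2 {2, 3} * X.comp (some 3) v) w =
        w.1.2 {2, 3} * X.comp (some 3) w * dtot 2 Q w.1 -
          w.1.2 {2, 2} * (X.comp (some 3) w * dtot 3 Q w.1) := by
    intro w hw hreg
    have hb := (regular_eqIII_iff.1 hreg).2
    have hF := hreg.1
    have hQw := hQc w hw
    have c3 := h.commute w hw hreg (some 3)
    have c2 := h.commute w hw hreg (some 2)
    have sa := smoothAt_coord {0, 3} w
    have sb := smoothAt_coord {2, 3} w
    have sc := smoothAt_coord {2, 2} w
    have se := smoothAt_coord {0, 2} w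
    have sq := SmoothAt.comp_toJ1 hQw
    have sv := sX w hw 3
    have y3 : X.act (Y.comp (some 3)) w = X.act (fun v => v.1.2 {2, 2} * X.comp (some 3) v) w :=
      hL.act_congr (hOΩ w hw) hF (sY w hw 3) (sc.mul sv)
        (ev w hw hreg fun v hv hr => (normalPair_alphaIII h hv hr).2.2) X
    have y2 : X.act (Y.comp (some 2)) w = X.act (fun v => v.1.2 {0, 2} - Q (toJ1 v.1) -
        v.1.2 {2, 2} * (v.1.2 {0, 3} / v.1.2 {2, 3}) - v.1.2 {2, 3} * X.comp (some 3) v) w :=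
      hL.act_congr (hOΩ w hw) hF (sY w hw 2)
        (((se.sub sq).sub (sc.mul (sa.div sb hb))).sub (sb.mul sv))
        (ev w hw hreg fun v hv hr => (normalPair_alphaIII h hv hr).2.1) X
    have x2 : Y.act (X.comp (some 2)) w = Y.act (fun v => -(v.1.2 {0, 3} / v.1.2 {2, 3})) w :=
      hL.act_congr (hOΩ w hw) hF (sX w hw 2) (sa.div sb hb).neg
        (ev w hw hreg fun v hv hr => (normalPair_alphaIII h hv hr).1) Y
    rw [y3, X.act_mul sc sv] at c3
    rw [y2, x2, X.act_sub ((se.sub sq).sub (sc.mul (sa.div sb hb))) (sb.mul sv),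
      X.act_sub (se.sub sq) (sc.mul (sa.div sb hb)), X.act_sub se sq,
      X.act_mul sc (sa.div sb hb), X.act_div sa sb hb, Y.act_neg (sa.div sb hb),
      Y.act_div sa sb hb, X.act_mul sb sv] at c2
    rw [X.act_mul sb sv, Y.act_mul sb sv]
    have D0 := hF [0]
    have D2 := hF [2]
    simp only [totalDerivs, List.foldr, totalDeriv_eqIII (hQw.differentiableAt (by simp))] at D0 D2
    obtain ⟨n1, n2, n3⟩ := normalPair_alphaIII h hw hreg
    simp only [SpectralField.act_coord, X.act_toJ1 hQw, Fin.sum_univ_four, h.fst_a w hw,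
      h.fst_b w hw, h.snd_a w hw, h.snd_b w hw, n1, n2, n3] at c2 c3 ⊢
    simp only [SpectralField.comp] at c2 c3 ⊢
    simp only [Multiset.insert_eq_cons, ← Multiset.cons_zero, Multiset.cons_swap] at c2 c3 D0 D2 hb ⊢
    generalize w.1.2 (2 ::ₘ 3 ::ₘ 0) = b at *
    generalize w.1.2 (0 ::ₘ 3 ::ₘ 0) = a at *
    -- The expanded form of `X m`: it is the `z`-component of the commutator, from which the
    -- unwanted third derivatives are removed by `D_x` and `D_z` of the equation.
    have e1 : (1 * w.1.2 (0 ::ₘ 2 ::ₘ 3 ::ₘ 0) + 0 * w.1.2 (1 ::ₘ 2 ::ₘ 3 ::ₘ 0) +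
              -(a / b) * w.1.2 (2 ::ₘ 2 ::ₘ 3 ::ₘ 0) +
            (X w).1 3 * w.1.2 (2 ::ₘ 3 ::ₘ 3 ::ₘ 0)) *
          (X w).1 3 + b * X.act (X.comp (some 3)) w = -((X w).1 3 * dtot 3 Q w.1) := by
      linear_combination (norm := (field_simp; ring)) -c2 + D0 / b - a / b ^ 2 * D2
    refine ⟨e1, ?_⟩
    linear_combination (norm := (field_simp; ring)) -b * c3 + w.1.2 (2 ::ₘ 2 ::ₘ 0) * e1 +
      (X w).1 3 * D2
  obtain ⟨fX, fY⟩ := first w hw hreg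
  have hb := (regular_eqIII_iff.1 hreg).2
  have hF := hreg.1
  have hQw := hQc w hw
  have sb := smoothAt_coord {2, 3} w
  have sc := smoothAt_coord {2, 2} w
  have sv := sX w hw 3
  have s2 := smoothAt_dtot hQw 2
  have s3 := smoothAt_dtot hQw 3
  have sm := sb.mul sv
  have fin := h.commute_act w hw hreg _ sm
  have eX : Y.act (X.act fun v => v.1.2 {2, 3} * X.comp (some 3) v) w =
      Y.act (fun v => -(X.comp (some 3) v * dtot 3 Q v.1)) w :=
    hL.act_congr (hOΩ w hw) hF (sm.act (h.smooth_fst w hw)) (sv.mul s3).neg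
      (ev w hw hreg fun v hv hr => (first v hv hr).1) Y
  have eY : X.act (Y.act fun v => v.1.2 {2, 3} * X.comp (some 3) v) w =
      X.act (fun v => v.1.2 {2, 3} * X.comp (some 3) v * dtot 2 Q v.1 -
          v.1.2 {2, 2} * (X.comp (some 3) v * dtot 3 Q v.1)) w :=
    hL.act_congr (hOΩ w hw) hF (sm.act (h.smooth_snd w hw))
      ((sm.mul s2).sub (sc.mul (sv.mul s3))) (ev w hw hreg fun v hv hr => (first v hv hr).2) X
  rw [eX, eY, X.act_sub (sm.mul s2) (sc.mul (sv.mul s3)), X.act_mul sm s2,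
    X.act_mul sc (sv.mul s3), X.act_mul sv s3, Y.act_neg (sv.mul s3), Y.act_mul sv s3, fX] at fin
  rw [X.act_mul sb sv] at fX
  rw [Y.act_mul sb sv] at fY
  have D2 := hF [2]
  simp only [totalDerivs, List.foldr, totalDeriv_eqIII (hQw.differentiableAt (by simp))] at D2
  obtain ⟨n1, n2, n3⟩ := normalPair_alphaIII h hw hreg
  simp only [SpectralField.act_coord, X.act_jet s2, X.act_jet s3, Y.act_jet s3, Fin.sum_univ_four,
    h.fst_a w hw, h.fst_b w hw, h.snd_a w hw, h.snd_b w hw, n1, n2, n3] at fin fX fY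
  have q23 : totalDeriv 3 (dtot 2 Q) w.1 = totalDeriv 2 (dtot 3 Q) w.1 :=
    totalDeriv_dtot_comm hQw 3 2
  rw [q23] at fin
  refine (mul_eq_zero.1 (?_ : (X w).1 3 * condIII Q w.1 = 0)).resolve_left hv
  simp only [SpectralField.comp, condIII] at fin fX fY ⊢
  simp only [Multiset.insert_eq_cons, ← Multiset.cons_zero, Multiset.cons_swap]
    at fin fX fY D2 hb ⊢
  generalize w.1.2 (2 ::ₘ 3 ::ₘ 0) = b at *
  generalize w.1.2 (0 ::ₘ 3 ::ₘ 0) = a at *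
  generalize w.1.2 (2 ::ₘ 2 ::ₘ 0) = c at *
  generalize w.1.2 (0 ::ₘ 2 ::ₘ 0) = e at *
  generalize Q (toJ1 w.1) = r at *
  generalize X.act (X.comp (some 3)) w = A at *
  generalize Y.act (X.comp (some 3)) w = B at *
  linear_combination (norm := (field_simp; ring)) -fin + dtot 3 Q w.1 / b * fY -
    c * dtot 3 Q w.1 / b * fX - dtot 3 Q w.1 * (X w).1 3 / b * D2

end TypeIII

/-! ### Compatibility at the level of fourth derivatives -/

lemma SmoothAt.comp_param {f m : Jet × ℝ → ℝ} {w : Jet × ℝ} (hf : SmoothAt f (w.1, m w))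
    (hm : SmoothAt m w) : SmoothAt (fun v => f (v.1, m v)) w := by
  obtain ⟨s, g, hg, hfg⟩ := hf
  have key := SmoothAt.comp_family (ι := Fin 4 ⊕ s ⊕ Unit) (w := w)
    (f := Sum.elim (fun i v => v.1.1 i) (Sum.elim (fun I v => v.1.2 I) (fun _ v => m v)))
    (φ := fun y => g ((fun i => y (.inl i), fun I => y (.inr (.inl I))), y (.inr (.inr ()))))
    (by
      rintro (i | I | i)
      · exact smoothAt_base i w
      · exact smoothAt_coord _ w
      · exact hm)
    (ContDiffAt.comp (f := fun y : Fin 4 ⊕ s ⊕ Unit → ℝ =>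
      ((fun i => y (.inl i), fun I => y (.inr (.inl I))), y (.inr (.inr ())))) _ hg
      (by fun_prop))
  refine key.congr ?_
  have hc : ContinuousAt (fun v : Jet × ℝ => (v.1, m v)) w :=
    continuousAt_fst.prodMk hm.continuousAt
  exact hc.eventually hfg

lemma SpectralField.act_comp_param (X : SpectralField) {f m : Jet × ℝ → ℝ} {w : Jet × ℝ}
    (hf : SmoothAt f (w.1, m w)) (hm : SmoothAt m w) :
    X.act (fun v => f (v.1, m v)) w =
      lineDeriv ℝ f (w.1, m w) (∑ i, (X w).1 i • totalVec i w.1, X.act m w) := by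
  refine HasLineDerivAt.lineDeriv ?_
  have h := SmoothAt.hasDerivAt_comp (f := f)
    (c := fun t : ℝ => w.1 + t • ∑ i, (X w).1 i • totalVec i w.1)
    (l := fun t : ℝ => m (w + t • (∑ i, (X w).1 i • totalVec i w.1, (X w).2)))
    (by simpa using hf) (hasCoordDerivAt_line _ _) (hm.hasLineDerivAt _)
  simp only [zero_smul, add_zero] at h
  exact h

/-- If the equations of a normalized pair close up on a function `m` which parametrizes the null
planes, their compatibility condition is independent of the fourth derivatives. -/
lemma NormalPair.compat {F : Jet → ℝ} {O : Set (Jet × ℝ)} {a b : Fin 4} {X Y : SpectralField}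
    {Ω : Set J1} {κ : Multiset (Fin 4)} {wt : Fin 4 → ℕ} {p : J1 → ℝ}
    (h : NormalPair F O a b X Y) (hF : LeadingForm F Ω κ wt p) (hO : IsOpen O)
    (hOΩ : ∀ w ∈ O, toJ1 w.1 ∈ Ω)
    (hreg : ∀ w ∈ O, w.1 ∈ regularJets F → ∀ᶠ v : Jet × ℝ in 𝓝 w, v.1 ∈ prolongation F →
      v.1 ∈ regularJets F)
    {m f g : Jet × ℝ → ℝ} {x y : Jet × ℝ → Fin 4 → ℝ} (hm : ∀ w ∈ O, SmoothAt m w)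
    (hf : ∀ j j' l, toJ1 j ∈ Ω → AgreeOn (fun K => K.card ≤ 3) j j' → f (j, l) = f (j', l))
    (hg : ∀ j j' l, toJ1 j ∈ Ω → AgreeOn (fun K => K.card ≤ 3) j j' → g (j, l) = g (j', l))
    (hx : ∀ j j' l, toJ1 j ∈ Ω → AgreeOn (fun K => K.card ≤ 3) j j' → x (j, l) = x (j', l))
    (hy : ∀ j j' l, toJ1 j ∈ Ω → AgreeOn (fun K => K.card ≤ 3) j j' → y (j, l) = y (j', l))
    (sf : ∀ w ∈ O, w.1 ∈ regularJets F → SmoothAt f (w.1, m w))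
    (sg : ∀ w ∈ O, w.1 ∈ regularJets F → SmoothAt g (w.1, m w))
    (eX : ∀ w ∈ O, w.1 ∈ regularJets F → (X w).1 = x (w.1, m w))
    (eY : ∀ w ∈ O, w.1 ∈ regularJets F → (Y w).1 = y (w.1, m w))
    (eXm : ∀ w ∈ O, w.1 ∈ regularJets F → X.act m w = f (w.1, m w))
    (eYm : ∀ w ∈ O, w.1 ∈ regularJets F → Y.act m w = g (w.1, m w))
    {j : Jet} {l₀ : ℝ} (hj : (j, l₀) ∈ O) (hjF : j ∈ regularJets F) :
    ∃ l, (j, l) ∈ O ∧ ∀ ξ, symbol F j ξ = 0 →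
      (∑ i, x (j, m (j, l)) i * ξ i) * lineDeriv ℝ g (j, m (j, l)) (powJet ξ 3, 0) =
      (∑ i, y (j, m (j, l)) i * ξ i) * lineDeriv ℝ f (j, m (j, l)) (powJet ξ 3, 0) := by
  -- The value `m (j, l)` has to be attained also at the deformed jets, so that both jets can be
  -- compared at the same null-plane parameter. By `inj`, `m` is injective in `l` because it
  -- determines the planes.
  obtain ⟨l, hl, hcom⟩ := exists_common_value (f := m) hO hj (fun w hw => (hm w hw).continuousAt)
    fun l l' hl hl' e => h.inj j hjF l l' hl hl'
      (by rw [eX _ hl hjF, eX _ hl' hjF, e]) (by rw [eY _ hl hjF, eY _ hl' hjF, e])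
  refine ⟨l, hl, fun ξ hξ => ?_⟩
  -- The identity `X Y m = Y X m`, rewritten so that only the jet and the value of `m` occur; the
  -- component `X^λ` of the pair has disappeared.
  have main : ∀ w ∈ O, w.1 ∈ regularJets F →
      lineDeriv ℝ g (w.1, m w) (∑ i, x (w.1, m w) i • totalVec i w.1, f (w.1, m w)) =
      lineDeriv ℝ f (w.1, m w) (∑ i, y (w.1, m w) i • totalVec i w.1, g (w.1, m w)) := by
    intro w hw hr
    have e := h.commute_act w hw hr m (hm w hw)
    have e1 : X.act (Y.act m) w = X.act (fun v => g (v.1, m v)) w :=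
      hF.act_congr (hOΩ w hw) hr.1 ((hm w hw).act (h.smooth_snd w hw))
        ((sg w hw hr).comp_param (hm w hw)) (by
          filter_upwards [hO.mem_nhds hw, hreg w hw hr] with v hv hvr hvF
          exact eYm v hv (hvr hvF)) X
    have e2 : Y.act (X.act m) w = Y.act (fun v => f (v.1, m v)) w :=
      hF.act_congr (hOΩ w hw) hr.1 ((hm w hw).act (h.smooth_fst w hw))
        ((sf w hw hr).comp_param (hm w hw)) (by
          filter_upwards [hO.mem_nhds hw, hreg w hw hr] with v hv hvr hvF
          exact eXm v hv (hvr hvF)) Y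
    rwa [e1, e2, X.act_comp_param (sg w hw hr) (hm w hw), Y.act_comp_param (sf w hw hr) (hm w hw),
      eX w hw hr, eY w hw hr, eXm w hw hr, eYm w hw hr] at e
  have hjΩ : toJ1 j ∈ Ω := hOΩ _ hl
  obtain ⟨c, hc, hc0, hcF⟩ := hF.exists_null_curve hjΩ hjF.1 hξ
  have hcr : ∀ᶠ t in 𝓝 0, c t ∈ regularJets F := by
    have hc' : Filter.Tendsto (fun t => (c t, l)) (𝓝 0) (𝓝 (j, l)) := by
      have := hc.prodMk (continuousAt_const (y := l) (x := (0 : ℝ)))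
      rwa [ContinuousAt, hc0] at this
    filter_upwards [hc'.eventually (hreg _ hl hjF)] with t ht
    exact ht (hcF t).1
  -- A small nonzero time, so that the factor `t` can be cancelled at the end.
  obtain ⟨t, ⟨⟨l', hl', he⟩, hr⟩, ht⟩ := (((hcom c hc hc0).and hcr).filter_mono
    nhdsWithin_le_nhds |>.and (self_mem_nhdsWithin (s := {(0 : ℝ)}ᶜ))).exists
  have e0 := main _ hl hjF
  have e1 := main _ hl' hr
  simp only [he] at e1
  have h4 := (hcF t).2
  have h3 : AgreeOn (fun K => K.card ≤ 3) j (c t) := by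
    have h1 := h4.mono (p' := fun K => K.card ≤ 3) fun K hK => Nat.le_succ_of_le hK
    have h2 := agreeOn_add_powJet (Nat.lt_succ_self 3) j ξ t
    exact AgreeOn.symm ⟨h1.1.trans h2.1, fun K hK => (h1.2 K hK).trans (h2.2 K hK)⟩
  -- The two jets agree up to order three, so the two instances of the identity differ only in the
  -- terms linear in the fourth derivatives.
  rw [← hf _ _ _ hjΩ h3, ← hg _ _ _ hjΩ h3, ← hx _ _ _ hjΩ h3, ← hy _ _ _ hjΩ h3,
    lineDeriv_add_powJet hF.isOpen (by norm_num) hg hjΩ h4 (sg _ hl hjF),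
    lineDeriv_add_powJet hF.isOpen (by norm_num) hf hjΩ h4 (sf _ hl hjF), e0] at e1
  exact mul_left_cancel₀ ht (add_left_cancel e1)

lemma dtot_agree (Q : J1 → ℝ) {j j' : Jet} (h : AgreeOn (fun K => K.card ≤ 2) j j') (i : Fin 4) :
    dtot i Q j = dtot i Q j' := by
  rw [dtot, dtot, h.toJ1_eq fun K hK => hK.trans (by norm_num),
    (h.totalVec (p := fun K => K.card ≤ 1) i (fun K hK => by simpa using hK)).toJ1Vec_eq
      fun K hK => hK]

/-! ### Type III: exclusion of anti-self-dual planes -/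

section TypeIII

variable {Ω : Set J1} {Q : J1 → ℝ} {O : Set (Jet × ℝ)} {X Y : SpectralField}

/-- The derivative of the parameter `v` along `∂_t + v ∂_z`. -/
def betaIII₁ (w : Jet × ℝ) : ℝ :=
  w.2 / w.1.2 {2, 3} * (w.1.2 (3 ::ₘ {2, 3}) + w.2 * w.1.2 (2 ::ₘ {2, 3}) +
    w.2 * (w.1.2 (3 ::ₘ {2, 2}) + w.2 * w.1.2 (2 ::ₘ {2, 2})))

/-- The derivative of the parameter `v` along the second field. -/
def betaIII₂ (Q : J1 → ℝ) (w : Jet × ℝ) : ℝ :=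
  w.1.2 (3 ::ₘ {0, 2}) - dtot 3 Q w.1 + w.2 * (w.1.2 (2 ::ₘ {0, 2}) - dtot 2 Q w.1) +
    (w.1.2 (3 ::ₘ {0, 3}) + w.2 * w.1.2 (2 ::ₘ {0, 3})) / w.2 -
    w.1.2 {0, 3} * betaIII₁ w / w.2 ^ 2

/-- Normal form of the anti-self-dual null planes of type III. -/
lemma normalPair_betaIII (h : NormalPair (eqIII Q) O 3 1 X Y) {w : Jet × ℝ} (hw : w ∈ O)
    (hreg : w.1 ∈ regularJets (eqIII Q)) (h0 : (X w).1 0 = 0) :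
    (X w).1 2 ≠ 0 ∧ (X w).1 = ![0, 0, (X w).1 2, 1] ∧
      (Y w).1 = ![-(w.1.2 {2, 3} / (X w).1 2 + w.1.2 {2, 2}), 1,
        w.1.2 {0, 2} - Q (toJ1 w.1) + w.1.2 {0, 3} / (X w).1 2, 0] := by
  have hb := (regular_eqIII_iff.1 hreg).2
  have hnull : ∀ r s : ℝ, _ := fun r s => h.null w hw hreg
    ![r, -(Y w).1 0 * r - (Y w).1 2 * s, s, -(X w).1 2 * s]
    (by simp [Fin.sum_univ_four, h0, h.fst_a w hw, h.fst_b w hw]; ring)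
    (by simp [Fin.sum_univ_four, h.snd_a w hw, h.snd_b w hw]; ring)
  simp only [symbol_eqIII] at hnull
  have h1 := hnull 0 1
  have h3 := hnull 1 1
  simp only [Matrix.cons_val] at h1 h3
  have e1 : (X w).1 2 * ((Y w).1 0 + w.1.2 {2, 2}) = -w.1.2 {2, 3} := by linarith
  have hv : (X w).1 2 ≠ 0 := fun hv => by
    rw [hv, zero_mul] at e1; exact hb (by linarith)
  refine ⟨hv, ?_, ?_⟩
  · ext i; fin_cases i <;> simp [h0, h.fst_a w hw, h.fst_b w hw]
  · have e0 : (Y w).1 0 = -(w.1.2 {2, 3} / (X w).1 2 + w.1.2 {2, 2}) := by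
      field_simp; linarith
    have e2 : (Y w).1 2 = w.1.2 {0, 2} - Q (toJ1 w.1) + w.1.2 {0, 3} / (X w).1 2 := by
      field_simp; linarith
    ext i; fin_cases i
    · exact e0
    · exact h.snd_b w hw
    · exact e2
    · exact h.snd_a w hw

lemma smoothAt_betaIII₁ {w : Jet × ℝ} (hb : w.1.2 {2, 3} ≠ 0) : SmoothAt betaIII₁ w :=
  ((smoothAt_param w).div (smoothAt_coord _ w) hb).mul
    (((smoothAt_coord _ w).add ((smoothAt_param w).mul (smoothAt_coord _ w))).add
      ((smoothAt_param w).mul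
        ((smoothAt_coord _ w).add ((smoothAt_param w).mul (smoothAt_coord _ w)))))

lemma smoothAt_betaIII₂ {w : Jet × ℝ} (hQ : ContDiffAt ℝ ∞ Q (toJ1 w.1)) (hb : w.1.2 {2, 3} ≠ 0)
    (hv : w.2 ≠ 0) : SmoothAt (betaIII₂ Q) w :=
  ((((smoothAt_coord _ w).sub (smoothAt_dtot hQ 3)).add
    ((smoothAt_param w).mul ((smoothAt_coord _ w).sub (smoothAt_dtot hQ 2)))).add
    (((smoothAt_coord _ w).add ((smoothAt_param w).mul (smoothAt_coord _ w))).div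
      (smoothAt_param w) hv)).sub
    (((smoothAt_coord _ w).mul (smoothAt_betaIII₁ hb)).div ((smoothAt_param w).pow 2)
      (pow_ne_zero 2 hv))

lemma betaIII₁_agree {j j' : Jet} (h : AgreeOn (fun K => K.card ≤ 3) j j') (l : ℝ) :
    betaIII₁ (j, l) = betaIII₁ (j', l) := by
  simp only [betaIII₁, h.2 {2, 3} (by simp), h.2 (3 ::ₘ {2, 3}) (by simp),
    h.2 (2 ::ₘ {2, 3}) (by simp), h.2 (3 ::ₘ {2, 2}) (by simp), h.2 (2 ::ₘ {2, 2}) (by simp)]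

lemma betaIII₂_agree {j j' : Jet} (h : AgreeOn (fun K => K.card ≤ 3) j j') (l : ℝ) :
    betaIII₂ Q (j, l) = betaIII₂ Q (j', l) := by
  have h2 := h.mono (p' := fun K => K.card ≤ 2) fun K hK => hK.trans (by norm_num)
  simp only [betaIII₂, betaIII₁_agree h, dtot_agree Q h2, h.2 {0, 3} (by simp),
    h.2 (3 ::ₘ {0, 2}) (by simp), h.2 (2 ::ₘ {0, 2}) (by simp), h.2 (3 ::ₘ {0, 3}) (by simp),
    h.2 (2 ::ₘ {0, 3}) (by simp)]

lemma powJet_three (ξ : Fin 4 → ℝ) (a b c : Fin 4) :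
    (powJet ξ 3).2 (a ::ₘ {b, c}) = ξ a * (ξ b * ξ c) := by
  simp [powJet]

lemma powJet_three_two (ξ : Fin 4 → ℝ) (b c : Fin 4) : (powJet ξ 3).2 {b, c} = 0 := by
  simp [powJet]

lemma lineDeriv_affine {f : Jet × ℝ → ℝ} {w d : Jet × ℝ} {k : ℝ}
    (h : ∀ t : ℝ, f (w + t • d) = f w + t * k) : lineDeriv ℝ f w d = k := by
  refine HasLineDerivAt.lineDeriv ?_
  have : HasDerivAt (fun t : ℝ => f w + t * k) (1 * k) 0 :=
    ((hasDerivAt_id (0 : ℝ)).mul_const k).const_add (f w)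
  rw [one_mul] at this
  exact this.congr_of_eventuallyEq (.of_forall h)

lemma lineDeriv_betaIII₁ (w : Jet × ℝ) (ξ : Fin 4 → ℝ) :
    lineDeriv ℝ betaIII₁ w (powJet ξ 3, 0) =
      w.2 / w.1.2 {2, 3} * ξ 2 * (ξ 3 + w.2 * ξ 2) ^ 2 := by
  refine lineDeriv_affine fun t => ?_
  simp only [betaIII₁, Prod.fst_add, Prod.snd_add, Prod.smul_fst, Prod.smul_snd, Pi.add_apply,
    Pi.smul_apply, powJet_three, powJet_three_two, smul_eq_mul, mul_zero, add_zero]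
  ring

lemma lineDeriv_betaIII₂ {w : Jet × ℝ} (hb : w.1.2 {2, 3} ≠ 0) (hv : w.2 ≠ 0) (ξ : Fin 4 → ℝ) :
    lineDeriv ℝ (betaIII₂ Q) w (powJet ξ 3, 0) =
      (ξ 3 + w.2 * ξ 2) ^ 2 / (w.2 * w.1.2 {2, 3}) *
        (w.1.2 {2, 3} * ξ 0 - w.1.2 {0, 3} * ξ 2) := by
  refine lineDeriv_affine fun t => ?_
  have hd : ∀ i, dtot i Q (w.1 + t • powJet ξ 3) = dtot i Q w.1 :=
    dtot_agree Q (agreeOn_add_powJet (by norm_num) w.1 ξ t)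
  simp only [betaIII₂, betaIII₁, Prod.fst_add, Prod.snd_add, Prod.smul_fst, Prod.smul_snd,
    Pi.add_apply, Pi.smul_apply, powJet_three, powJet_three_two, smul_eq_mul, mul_zero, add_zero,
    hd]
  generalize w.1.2 {2, 3} = b at *
  field_simp
  ring

/-- The anti-self-dual null planes do not carry a Lax pair of the equation of type III. -/
lemma not_normalPair_betaIII (hΩ : IsOpen Ω) (hQ : ContDiffOn ℝ ∞ Q Ω) (hO : IsOpen O)
    (hOΩ : ∀ w ∈ O, toJ1 w.1 ∈ Ω) (h : NormalPair (eqIII Q) O 3 1 X Y)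
    (h0 : ∀ w ∈ O, w.1 ∈ regularJets (eqIII Q) → (X w).1 0 = 0) {j : Jet} {l₀ : ℝ}
    (hj : (j, l₀) ∈ O) (hjF : j ∈ regularJets (eqIII Q)) : False := by
  have hL := leadingForm_eqIII hΩ hQ
  have hQc : ∀ w ∈ O, ContDiffAt ℝ ∞ Q (toJ1 w.1) := fun w hw =>
    hQ.contDiffAt (hΩ.mem_nhds (hOΩ w hw))
  have sX : ∀ w ∈ O, ∀ i, SmoothAt (X.comp (some i)) w := fun w hw i => h.smooth_fst w hw _
  have sY : ∀ w ∈ O, ∀ i, SmoothAt (Y.comp (some i)) w := fun w hw i => h.smooth_snd w hw _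
  have nf : ∀ w ∈ O, w.1 ∈ regularJets (eqIII Q) → _ := fun w hw hr =>
    normalPair_betaIII h hw hr (h0 w hw hr)
  have ev : ∀ w ∈ O, w.1 ∈ regularJets (eqIII Q) → ∀ {p : Jet × ℝ → Prop},
      (∀ v ∈ O, v.1 ∈ regularJets (eqIII Q) → p v) →
      ∀ᶠ v : Jet × ℝ in 𝓝 w, v.1 ∈ prolongation (eqIII Q) → p v := by
    intro w hw hreg p hp
    filter_upwards [hO.mem_nhds hw, eventually_regular_eqIII hreg] with v hv hr hF
    exact hp v hv (hr hF)
  -- With `X = ∂_t + v ∂_z` and no `x`-component in `X`, the `x`-component of `[X, Y] = 0` gives `X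
  -- v`, and the `z`-component then gives `Y v`. Both are functions of the third order jet and of
  -- `v`.
  have act0 : ∀ w ∈ O, w.1 ∈ regularJets (eqIII Q) →
      X.act (X.comp (some 2)) w = betaIII₁ (w.1, X.comp (some 2) w) ∧
      Y.act (X.comp (some 2)) w = betaIII₂ Q (w.1, X.comp (some 2) w) := by
    intro w hw hr
    obtain ⟨hv, n1, n2⟩ := nf w hw hr
    have hb := (regular_eqIII_iff.1 hr).2
    have sv := sX w hw 2
    have sa := smoothAt_coord {0, 3} w
    have sb := smoothAt_coord {2, 3} w
    have sc := smoothAt_coord {2, 2} w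
    have se := smoothAt_coord {0, 2} w
    have sq := SmoothAt.comp_toJ1 (hQc w hw)
    have y0 : X.act (Y.comp (some 0)) w =
        X.act (fun v => -(v.1.2 {2, 3} / X.comp (some 2) v + v.1.2 {2, 2})) w :=
      hL.act_congr (hOΩ w hw) hr.1 (sY w hw 0) ((sb.div sv hv).add sc).neg
        (ev w hw hr fun v hv hr => by
          have := congrFun (nf v hv hr).2.2 0
          simpa [SpectralField.comp] using this) X
    have y2 : X.act (Y.comp (some 2)) w = X.act (fun v => v.1.2 {0, 2} - Q (toJ1 v.1) +
        v.1.2 {0, 3} / X.comp (some 2) v) w :=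
      hL.act_congr (hOΩ w hw) hr.1 (sY w hw 2) ((se.sub sq).add (sa.div sv hv))
        (ev w hw hr fun v hv hr => by
          have := congrFun (nf v hv hr).2.2 2
          simpa [SpectralField.comp] using this) X
    have x0 : Y.act (X.comp (some 0)) w = 0 := by
      rw [hL.act_congr (hOΩ w hw) hr.1 (sX w hw 0) (smoothAt_const 0 w)
        (ev w hw hr fun v hv hr => h0 v hv hr) Y, Y.act_const]
    have c0 := h.commute w hw hr (some 0)
    have c2 := h.commute w hw hr (some 2)
    rw [y0, x0, X.act_neg ((sb.div sv hv).add sc), X.act_add (sb.div sv hv) sc,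
      X.act_div sb sv hv] at c0
    rw [y2, X.act_add (se.sub sq) (sa.div sv hv), X.act_sub se sq, X.act_div sa sv hv] at c2
    simp only [SpectralField.act_coord, X.act_toJ1 (hQc w hw), Fin.sum_univ_four] at c0 c2
    simp only [congrFun n1 0, congrFun n1 1, congrFun n1 3, Matrix.cons_val, zero_mul, zero_add,
      one_mul] at c0 c2
    simp only [SpectralField.comp] at c0 c2 hv ⊢
    have e1 : X.act (X.comp (some 2)) w = betaIII₁ (w.1, (X w).1 2) := by
      simp only [betaIII₁]
      generalize w.1.2 {2, 3} = b at *
      field_simp at c0 ⊢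
      linarith
    refine ⟨e1, ?_⟩
    rw [← c2, betaIII₂, ← e1]
    simp only
    field_simp
    ring
  obtain ⟨l, hl, key⟩ := h.compat (m := X.comp (some 2)) (f := betaIII₁) (g := betaIII₂ Q)
    (x := fun w => ![0, 0, w.2, 1])
    (y := fun w => ![-(w.1.2 {2, 3} / w.2 + w.1.2 {2, 2}), 1,
        w.1.2 {0, 2} - Q (toJ1 w.1) + w.1.2 {0, 3} / w.2, 0])
    hL hO hOΩ (fun w _ hr => eventually_regular_eqIII hr) (fun w hw => sX w hw 2)
    (fun j j' l _ hjj => betaIII₁_agree hjj l) (fun j j' l _ hjj => betaIII₂_agree hjj l)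
    (fun _ _ _ _ _ => rfl)
    (fun j j' l _ hjj => by
      simp only [hjj.toJ1_eq fun K hK => hK.trans (by norm_num), hjj.2 {2, 3} (by simp),
        hjj.2 {2, 2} (by simp), hjj.2 {0, 2} (by simp), hjj.2 {0, 3} (by simp)])
    (fun w hw hr => smoothAt_betaIII₁ (regular_eqIII_iff.1 hr).2)
    (fun w hw hr => smoothAt_betaIII₂ (hQc w hw) (regular_eqIII_iff.1 hr).2 (nf w hw hr).1)
    (fun w hw hr => (nf w hw hr).2.1) (fun w hw hr => (nf w hw hr).2.2)
    (fun w hw hr => (act0 w hw hr).1) (fun w hw hr => (act0 w hw hr).2) hj hjF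
  have hv := (nf _ hl hjF).1
  have hb := (regular_eqIII_iff.1 hjF).2
  -- The covector has `u₃₄ ξ₁ = u₁₄ ξ₃` and `ξ₄ = 0`, so it is null whatever `ξ₂` is, and the
  -- derivative of `betaIII₂` along `ξ³` vanishes. The component `ξ₂` is chosen to make `⟨Y, ξ⟩ =
  -- 1`, so the identity becomes `v³ / u₃₄ = 0`.
  have e := key ![j.2 {0, 3} / j.2 {2, 3}, 1 + j.2 {2, 2} * (j.2 {0, 3} / j.2 {2, 3}) -
    (j.2 {0, 2} - Q (toJ1 j)), 1, 0] (by
      simp only [symbol_eqIII, Matrix.cons_val]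
      field_simp
      ring)
  rw [lineDeriv_betaIII₁, lineDeriv_betaIII₂ (by exact hb) hv] at e
  simp only [Fin.sum_univ_four, Matrix.cons_val, SpectralField.comp] at e
  generalize j.2 {2, 3} = b at *
  field_simp at e
  ring_nf at e
  exact hv (by simpa [hb] using e)

end TypeIII

/-! ### The integrability condition of type III is necessary -/

lemma isOpen_sep_ne_zero {f : Jet × ℝ → ℝ} {S : Set (Jet × ℝ)} (hS : IsOpen S)
    (hf : ∀ w ∈ S, SmoothAt f w) : IsOpen {w ∈ S | f w ≠ 0} := by
  rw [isOpen_iff_mem_nhds]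
  rintro w ⟨hw, h0⟩
  filter_upwards [hS.mem_nhds hw, (hf w hw).continuousAt.eventually_ne h0] with v h1 h2
  exact ⟨h1, h2⟩

lemma IsLaxPair.smoothAt_minor {F : Jet → ℝ} {U : Set Jet} {Λ : Set ℝ} {V W : SpectralField}
    (h : IsLaxPair F U Λ V W) (a b : Fin 4) {w : Jet × ℝ} (hw : w ∈ U ×ˢ Λ) :
    SmoothAt (minor V W a b) w :=
  (((h.smooth hw).1 (some a)).mul ((h.smooth hw).2 (some b))).sub
    (((h.smooth hw).1 (some b)).mul ((h.smooth hw).2 (some a)))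

lemma IsLaxPair.symbol_comb_eq_zero {F : Jet → ℝ} {U : Set Jet} {Λ : Set ℝ} {V W : SpectralField}
    (h : IsLaxPair F U Λ V W) {j : Jet} (hj : j ∈ U ∩ regularJets F) {l : ℝ} (hl : l ∈ Λ)
    {ξ : Fin 4 → ℝ} (hV : ∑ i, ξ i * (V (j, l)).1 i = 0) (hW : ∑ i, ξ i * (W (j, l)).1 i = 0) :
    symbol F j ξ = 0 := by
  refine h.characteristic j hj l hl ξ fun v hv => ?_
  obtain ⟨p, q, rfl⟩ := Submodule.mem_span_pair.1 hv
  have : ∑ i, ξ i * (p • (V (j, l)).1 + q • (W (j, l)).1) i =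
      p * ∑ i, ξ i * (V (j, l)).1 i + q * ∑ i, ξ i * (W (j, l)).1 i := by
    simp only [Finset.mul_sum, ← Finset.sum_add_distrib, Pi.add_apply, Pi.smul_apply, smul_eq_mul]
    exact Finset.sum_congr rfl fun i _ => by ring
  rw [this, hV, hW]; ring

lemma IsLaxPair.eq_zero_of_smul_eq {F : Jet → ℝ} {U : Set Jet} {Λ : Set ℝ} {V W : SpectralField}
    (h : IsLaxPair F U Λ V W) {j : Jet} (hj : j ∈ U ∩ regularJets F) {l : ℝ} (hl : l ∈ Λ)
    {r s : ℝ} (e : ∀ i, r * (V (j, l)).1 i = s * (W (j, l)).1 i) : r = 0 ∧ s = 0 := by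
  have h2 := LinearIndependent.pair_iff.1 (h.rank_two j hj l hl) r (-s) (by
    ext i; simp [e i])
  exact ⟨h2.1, by linarith [h2.2]⟩

lemma exists_ne_mem_slice {O : Set (Jet × ℝ)} (hO : IsOpen O) {j : Jet} {l : ℝ}
    (h : (j, l) ∈ O) : ∃ l', l' ≠ l ∧ (j, l') ∈ O := by
  have hs : {l' | (j, l') ∈ O} ∈ 𝓝 l :=
    (hO.preimage (by fun_prop : Continuous fun l' : ℝ => (j, l'))).mem_nhds h
  obtain ⟨l', h1, h2⟩ := ((eventually_nhdsWithin_of_eventually_nhds hs).and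
    (self_mem_nhdsWithin (s := {l}ᶜ))).exists
  exact ⟨l', h2, h1⟩

section TypeIII

variable {Ω : Set J1} {Q : J1 → ℝ}

lemma smoothAt_totalDeriv {f : Jet → ℝ} {w : Jet × ℝ} (hf : SmoothAt (fun v => f v.1) w)
    (i : Fin 4) : SmoothAt (fun v => totalDeriv i f v.1) w :=
  hf.smoothAt_basisDeriv (some i)

lemma smoothAt_condIII {w : Jet × ℝ} (hQ : ContDiffAt ℝ ∞ Q (toJ1 w.1)) :
    SmoothAt (fun v => condIII Q v.1) w := by
  have s2 := smoothAt_dtot hQ 2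
  have s3 := smoothAt_dtot hQ 3
  exact ((((((smoothAt_coord _ w).neg.mul (smoothAt_totalDeriv s2 0)).add
    ((smoothAt_coord _ w).mul (smoothAt_totalDeriv s2 2))).add
    ((smoothAt_coord _ w).mul (smoothAt_totalDeriv s3 0))).sub (smoothAt_totalDeriv s3 1)).sub
    (((smoothAt_coord _ w).sub (SmoothAt.comp_toJ1 hQ)).mul (smoothAt_totalDeriv s3 2))).add
    (s2.mul s3)

/-- The three null planes of type III on which the minors `01` and `31` vanish. -/
def exceptionalIII (j : Jet) : Fin 3 → Submodule ℝ (Fin 4 → ℝ) :=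
  ![annihilatedBy ![1, 0, 0, 0] ![0, 1, 0, 0],
    annihilatedBy ![0, 1, 0, 0] ![j.2 {0, 3}, 0, j.2 {2, 3}, 0],
    annihilatedBy ![0, 0, 0, 1] ![1, j.2 {2, 2}, 0, 0]]

/-- If both `y`-components vanish, the annihilator contains `dy` and a second covector, and nullity
leaves two planes. Otherwise the vanishing minors make the `x`- and `t`-components multiples of the
`y`-component, and nullity fixes the factors. -/
lemma IsLaxPair.mem_exceptionalIII {U : Set Jet} {Λ : Set ℝ} {V W : SpectralField}
    (h : IsLaxPair (eqIII Q) U Λ V W) {j : Jet} (hj : j ∈ U ∩ regularJets (eqIII Q)) {l : ℝ}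
    (hl : l ∈ Λ) (h01 : minor V W 0 1 (j, l) = 0) (h31 : minor V W 3 1 (j, l) = 0) :
    ∃ i, (V (j, l)).1 ∈ exceptionalIII j i ∧ (W (j, l)).1 ∈ exceptionalIII j i := by
  have hb := (regular_eqIII_iff.1 hj.2).2
  have null : ∀ ξ : Fin 4 → ℝ, _ := fun ξ h1 h2 => h.symbol_comb_eq_zero hj hl (ξ := ξ) h1 h2
  have indep : ∀ r s : ℝ, _ := fun r s e => h.eq_zero_of_smul_eq hj hl (r := r) (s := s) e
  simp only [symbol_eqIII, Fin.forall_fin_succ, Fin.sum_univ_four, minor] at null indep h01 h31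
  generalize (V (j, l)).1 = v at *
  generalize (W (j, l)).1 = w at *
  suffices H : ((v 0 = 0 ∧ v 1 = 0) ∧ w 0 = 0 ∧ w 1 = 0) ∨
      ((v 1 = 0 ∧ j.2 {0, 3} * v 0 + j.2 {2, 3} * v 2 = 0) ∧
        w 1 = 0 ∧ j.2 {0, 3} * w 0 + j.2 {2, 3} * w 2 = 0) ∨
      ((v 3 = 0 ∧ v 0 + j.2 {2, 2} * v 1 = 0) ∧ w 3 = 0 ∧ w 0 + j.2 {2, 2} * w 1 = 0) by
    rcases H with H | H | H
    · exact ⟨0, by simpa [exceptionalIII, mem_annihilatedBy, Fin.sum_univ_four] using H⟩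
    · refine ⟨1, ?_⟩
      simp only [exceptionalIII, Matrix.cons_val, mem_annihilatedBy]
      generalize j.2 {2, 3} = b at *
      generalize j.2 {0, 3} = a at *
      simpa [Fin.sum_univ_four] using H
    · refine ⟨2, ?_⟩
      simp only [exceptionalIII, Matrix.cons_val, mem_annihilatedBy]
      generalize j.2 {2, 2} = c at *
      simpa [Fin.sum_univ_four] using H
  simp only [Fin.isValue, Fin.succ_zero_eq_one, Fin.succ_one_eq_two, Fin.reduceSucc,
    IsEmpty.forall_iff, and_true] at indep
  generalize j.2 {2, 3} = b at *
  generalize j.2 {0, 3} = a at *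
  generalize j.2 {2, 2} = c at *

  by_cases h1 : v 1 = 0 ∧ w 1 = 0
  · obtain ⟨z1, z2⟩ := h1
    -- The components `0, 2, 3` form the cross product of those of the two vectors; since the
    -- `y`-components vanish, the entry at `dy` is free, and `0` and `1` are both used.
    have n0 := null ![v 2 * w 3 - v 3 * w 2, 0, v 3 * w 0 - v 0 * w 3, v 0 * w 2 - v 2 * w 0]
      (by simp; ring) (by simp; ring)
    have n1 := null ![v 2 * w 3 - v 3 * w 2, 1, v 3 * w 0 - v 0 * w 3, v 0 * w 2 - v 2 * w 0]
      (by simp [z1]; ring) (by simp [z2]; ring)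
    simp only [Matrix.cons_val] at n0 n1
    have e3 : v 0 * w 2 - v 2 * w 0 = 0 := by linarith
    rw [e3] at n0
    have n2 : (v 3 * w 0 - v 0 * w 3) *
        (b * (v 2 * w 3 - v 3 * w 2) - a * (v 3 * w 0 - v 0 * w 3)) = 0 := by linarith
    rcases mul_eq_zero.1 n2 with e2 | e2
    · left
      have := indep (w 0) (v 0) ⟨by ring, by rw [z1, z2]; ring, by linarith, by linarith⟩
      simp [this, z1, z2]
    · by_cases e4 : v 3 * w 0 - v 0 * w 3 = 0
      · left
        have := indep (w 0) (v 0) ⟨by ring, by rw [z1, z2]; ring, by linarith, by linarith⟩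
        simp [this, z1, z2]
      · right; left
        refine ⟨⟨z1, ?_⟩, z2, ?_⟩
        · refine (mul_eq_zero.1 (?_ : (v 3 * w 0 - v 0 * w 3) * (a * v 0 + b * v 2) = 0)).resolve_left e4
          linear_combination -v 0 * e2 - b * v 3 * e3
        · refine (mul_eq_zero.1 (?_ : (v 3 * w 0 - v 0 * w 3) * (a * w 0 + b * w 2) = 0)).resolve_left e4
          linear_combination -w 0 * e2 - b * w 3 * e3
  · right; right
    obtain ⟨p, hp0, hp1⟩ : ∃ p, v 0 = p * v 1 ∧ w 0 = p * w 1 := by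
      by_cases hv : v 1 = 0
      · have hw : w 1 ≠ 0 := fun hw => h1 ⟨hv, hw⟩
        have : v 0 = 0 := by
          rw [hv] at h01
          simpa [hw] using h01
        exact ⟨w 0 / w 1, by rw [hv, this, mul_zero], by field_simp⟩
      · exact ⟨v 0 / v 1, by field_simp, by field_simp; linarith⟩
    obtain ⟨q, hq0, hq1⟩ : ∃ q, v 3 = q * v 1 ∧ w 3 = q * w 1 := by
      by_cases hv : v 1 = 0
      · have hw : w 1 ≠ 0 := fun hw => h1 ⟨hv, hw⟩
        have : v 3 = 0 := by
          rw [hv] at h31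
          simpa [hw] using h31
        exact ⟨w 3 / w 1, by rw [hv, this, mul_zero], by field_simp⟩
      · exact ⟨v 3 / v 1, by field_simp, by field_simp; linarith⟩
    have n0 := null ![0, -q, 0, 1] (by simp [hq0]) (by simp [hq1])
    have n1 := null ![1, -p - q, 0, 1] (by simp [hq0, hp0]; ring) (by simp [hq1, hp1]; ring)
    simp only [Matrix.cons_val] at n0 n1
    have hq : q = 0 := by linarith
    have hp : p = -c := by linarith
    subst hq hp
    exact ⟨⟨by linarith, by linarith⟩, by linarith, by linarith⟩

lemma finrank_exceptionalIII {j : Jet} (hb : j.2 {2, 3} ≠ 0) (i : Fin 3) :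
    Module.finrank ℝ (exceptionalIII j i) = 2 := by
  fin_cases i
  · exact finrank_annihilatedBy (a := 0) (b := 1) (by simp)
  · refine finrank_annihilatedBy (a := 1) (b := 2) ?_
    simp only [Matrix.cons_val]
    simpa using hb
  · exact finrank_annihilatedBy (a := 3) (b := 0) (by simp)

/-- Suppose `condIII ≠ 0`; this is an open condition. If the minor `01` is nonzero at some regular
point there, then `v = 0` for all nearby `λ` over the same jet; but `v` determines the plane,
against injectivity. If the minor vanishes at all such points, a non-exceptional `λ` has nonzero
minor `31`, the planes are anti-self-dual, and `not_normalPair_betaIII` applies. -/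
theorem LaxIntegrable.condIII_eq_zero (hΩ : IsOpen Ω) (hQ : ContDiffOn ℝ ∞ Q Ω)
    (h : LaxIntegrable (eqIII Q) (toJ1 ⁻¹' Ω)) {j : Jet} (hj : toJ1 j ∈ Ω)
    (hreg : j ∈ regularJets (eqIII Q)) : condIII Q j = 0 := by
  by_contra hne
  obtain ⟨U, Λ, V, W, hjU, hLax⟩ := h j ⟨hj, hreg⟩
  have hQc : ∀ q ∈ Ω, ContDiffAt ℝ ∞ Q q := fun q hq => hQ.contDiffAt (hΩ.mem_nhds hq)
  set S : Set (Jet × ℝ) := {w ∈ U ×ˢ Λ ∩ (fun w => toJ1 w.1) ⁻¹' Ω | condIII Q w.1 ≠ 0}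
  have hS : IsOpen S := isOpen_sep_ne_zero
    ((hLax.isOpen_jets.prod hLax.isOpen_param).inter
      (hΩ.preimage (continuous_toJ1.comp continuous_fst)))
    fun w hw => smoothAt_condIII (hQc _ hw.2)
  have hSm : ∀ a b, IsOpen {w ∈ S | minor V W a b w ≠ 0} := fun a b =>
    isOpen_sep_ne_zero hS fun w hw => hLax.smoothAt_minor a b hw.1.1
  by_cases hA : ∃ w ∈ S, w.1 ∈ regularJets (eqIII Q) ∧ minor V W 0 1 w ≠ 0
  · obtain ⟨⟨i, l⟩, hw, hr, hmin⟩ := hA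
    obtain ⟨X, Y, hN, -⟩ := hLax.exists_normalPair (hSm 0 1) (fun w hw => hw.1.1.1)
      fun w hw => hw.2
    have zero : ∀ l, (i, l) ∈ {w ∈ S | minor V W 0 1 w ≠ 0} → (X (i, l)).1 3 = 0 := by
      intro l hl
      by_contra hv
      exact hl.1.2 (DispersionlessLax.condIII_eq_zero hΩ hQ (hSm 0 1) (fun w hw => hw.1.1.2) hN hl hr hv)
    obtain ⟨l', hne', hl'⟩ := exists_ne_mem_slice (hSm 0 1) (j := i) (l := l) ⟨hw, hmin⟩
    have z := zero l ⟨hw, hmin⟩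
    have z' := zero l' hl'
    obtain ⟨n1, n2, n3⟩ := normalPair_alphaIII hN (w := (i, l)) ⟨hw, hmin⟩ hr
    obtain ⟨n1', n2', n3'⟩ := normalPair_alphaIII hN (w := (i, l')) hl' hr
    refine hne' (hN.inj i hr l' l hl' ⟨hw, hmin⟩ (funext fun k => ?_) (funext fun k => ?_))
    · fin_cases k
      · exact (hN.fst_a _ hl').trans (hN.fst_a _ ⟨hw, hmin⟩).symm
      · exact (hN.fst_b _ hl').trans (hN.fst_b _ ⟨hw, hmin⟩).symm
      · exact n1'.trans n1.symm
      · exact z'.trans z.symm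
    · fin_cases k
      · exact (hN.snd_a _ hl').trans (hN.snd_a _ ⟨hw, hmin⟩).symm
      · exact (hN.snd_b _ hl').trans (hN.snd_b _ ⟨hw, hmin⟩).symm
      · change (Y (i, l')).1 2 = (Y (i, l)).1 2
        rw [n2, n2', z, z']
      · change (Y (i, l')).1 3 = (Y (i, l)).1 3
        rw [n3, n3', z, z']
  · push Not at hA
    obtain ⟨l, hl, hP⟩ := hLax.exists_not_le ⟨hjU, hreg⟩
      (finrank_exceptionalIII (regular_eqIII_iff.1 hreg).2)
    have hjS : (j, l) ∈ S := ⟨⟨⟨hjU, hl⟩, hj⟩, hne⟩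
    have hm : minor V W 3 1 (j, l) ≠ 0 := fun h0 => by
      obtain ⟨i, hi⟩ := hLax.mem_exceptionalIII ⟨hjU, hreg⟩ hl (hA _ hjS hreg) h0
      exact hP i hi
    obtain ⟨X, Y, hN, hmin⟩ := hLax.exists_normalPair (hSm 3 1) (fun w hw => hw.1.1.1)
      fun w hw => hw.2
    -- The ratio of the minors `01` and `31` is an invariant of the plane, and in the normalized
    -- frame the minor `01` is the `x`-component of `X`; so this component vanishes.
    refine not_normalPair_betaIII hΩ hQ (hSm 3 1) (fun w hw => hw.1.1.2) hN (fun w hw hr => ?_)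
      (j := j) (l₀ := l) ⟨hjS, hm⟩ hreg
    have e := hmin w hw 0 1
    rw [hA w hw.1 hr, minor, hN.snd_b w hw, hN.fst_b w hw] at e
    have := (mul_eq_zero.1 e).resolve_right hw.2
    linarith

end TypeIII

/-! ### The integrability conditions as differential equations on `J¹` -/

/-- The direction `∂/∂x^i` on `J¹`. -/
def bx (i : Fin 4) : J1 := (Pi.single i 1, 0, 0)

/-- The direction `∂/∂u` on `J¹`. -/
def bu : J1 := (0, 1, 0)

/-- The direction `∂/∂u_i` on `J¹`. -/
def bp (i : Fin 4) : J1 := (0, 0, Pi.single i 1)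

/-- The second derivative. -/
def hess (Q : J1 → ℝ) (q : J1) : J1 →L[ℝ] J1 →L[ℝ] ℝ := fderiv ℝ (fderiv ℝ Q) q

lemma hess_symm {Q : J1 → ℝ} {q : J1} (hQ : ContDiffAt ℝ ∞ Q q) (d d' : J1) :
    hess Q q d d' = hess Q q d' d :=
  (hQ.isSymmSndFDerivAt (by rw [minSmoothness_of_isRCLikeNormedField]; decide)) d d'

lemma toJ1Vec_totalVec (i : Fin 4) (j : Jet) :
    toJ1Vec (totalVec i j) = bx i + j.2 {i} • bu + ∑ k, j.2 (i ::ₘ {k}) • bp k := by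
  refine Prod.ext ?_ (Prod.ext ?_ ?_)
  · simp [toJ1Vec, totalVec, bx, bu, bp, Prod.fst_sum]
  · simp [toJ1Vec, totalVec, bx, bu, bp, Prod.fst_sum, Prod.snd_sum]
  · ext k
    simp [toJ1Vec, totalVec, bx, bu, bp, Prod.snd_sum, Pi.single_apply]

lemma dtot_eq (Q : J1 → ℝ) (i : Fin 4) (j : Jet) :
    dtot i Q j = fderiv ℝ Q (toJ1 j) (bx i) + j.2 {i} * fderiv ℝ Q (toJ1 j) bu +
      ∑ k, j.2 (i ::ₘ {k}) * fderiv ℝ Q (toJ1 j) (bp k) := by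
  rw [dtot, toJ1Vec_totalVec]
  simp only [map_add, map_sum, map_smul, smul_eq_mul]

lemma totalDeriv_dtot {Q : J1 → ℝ} {j : Jet} (hQ : ContDiffAt ℝ ∞ Q (toJ1 j)) (i k : Fin 4) :
    totalDeriv i (dtot k Q) j =
      hess Q (toJ1 j) (toJ1Vec (totalVec i j)) (toJ1Vec (totalVec k j)) +
      (j.2 (i ::ₘ {k}) * fderiv ℝ Q (toJ1 j) bu +
        ∑ m, j.2 (i ::ₘ k ::ₘ {m}) * fderiv ℝ Q (toJ1 j) (bp m)) := by
  have hd : DifferentiableAt ℝ (fderiv ℝ Q) (toJ1 j) :=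
    (hQ.fderiv_right (m := 1) (by decide)).differentiableAt (by simp)
  have h1 : HasDerivAt (fun t : ℝ => fderiv ℝ Q (toJ1 j + t • toJ1Vec (totalVec i j)))
      (hess Q (toJ1 j) (toJ1Vec (totalVec i j))) 0 :=
    hd.hasFDerivAt.hasLineDerivAt (toJ1Vec (totalVec i j))
  set T : J1 := j.2 (i ::ₘ {k}) • bu + ∑ m, j.2 (i ::ₘ k ::ₘ {m}) • bp m with hT
  have h2 : HasDerivAt (fun t : ℝ => toJ1Vec (totalVec k j) + t • T) T 0 := by
    simpa using ((hasDerivAt_id (0 : ℝ)).smul_const T).const_add (toJ1Vec (totalVec k j))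
  have h3 := h1.clm_apply h2
  refine HasLineDerivAt.lineDeriv ?_
  have e : (fun t : ℝ => dtot k Q (j + t • totalVec i j)) = fun t =>
      fderiv ℝ Q (toJ1 j + t • toJ1Vec (totalVec i j)) (toJ1Vec (totalVec k j) + t • T) := by
    funext t
    have : toJ1Vec (totalVec k (j + t • totalVec i j)) = toJ1Vec (totalVec k j) + t • T := by
      rw [toJ1Vec_totalVec, toJ1Vec_totalVec, hT]
      simp only [Prod.snd_add, Prod.smul_snd, Pi.add_apply, Pi.smul_apply, totalVec, smul_eq_mul,
        add_smul, Finset.sum_add_distrib, smul_add, Finset.smul_sum, smul_smul]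
      abel
    rw [dtot, toJ1_add_smul, this]
  change HasDerivAt (fun t : ℝ => dtot k Q (j + t • totalVec i j)) _ 0
  rw [e]
  simp only [zero_smul, add_zero] at h3
  have hv : fderiv ℝ Q (toJ1 j) T = j.2 (i ::ₘ {k}) * fderiv ℝ Q (toJ1 j) bu +
      ∑ m, j.2 (i ::ₘ k ::ₘ {m}) * fderiv ℝ Q (toJ1 j) (bp m) := by
    simp only [hT, map_add, map_sum, map_smul, smul_eq_mul]
  rw [hv] at h3
  exact h3

/-- `Q` does not depend on `t`, `u`, `u₄`. -/
def IsInvariantIII (Ω : Set J1) (Q : J1 → ℝ) : Prop :=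
  ∀ q ∈ Ω, fderiv ℝ Q q (bx 3) = 0 ∧ fderiv ℝ Q q bu = 0 ∧ fderiv ℝ Q q (bp 3) = 0

lemma hess_eq_zero {Ω : Set J1} (hΩ : IsOpen Ω) {Q : J1 → ℝ} (hQ : ContDiffOn ℝ ∞ Q Ω) {d : J1}
    (h : ∀ q ∈ Ω, fderiv ℝ Q q d = 0) {q : J1} (hq : q ∈ Ω) (d' : J1) :
    hess Q q d' d = 0 ∧ hess Q q d d' = 0 := by
  have hQc := hQ.contDiffAt (hΩ.mem_nhds hq)
  have hd : DifferentiableAt ℝ (fderiv ℝ Q) q :=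
    (hQc.fderiv_right (m := 1) (by decide)).differentiableAt (by simp)
  have e : hess Q q d' d = 0 := by
    have h1 : fderiv ℝ (fun r => fderiv ℝ Q r d) q d' = hess Q q d' d := by
      rw [fderiv_clm_apply hd (differentiableAt_const d)]
      simp [hess]
    have h2 : (fun r => fderiv ℝ Q r d) =ᶠ[𝓝 q] fun _ => 0 :=
      Filter.eventually_of_mem (hΩ.mem_nhds hq) h
    rw [← h1, h2.fderiv_eq]; simp
  exact ⟨e, by rwa [hess_symm hQc]⟩

/-- The integrability conditions of type III at a 1-jet. -/
structure CondIII (Q : J1 → ℝ) (q : J1) : Prop where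
  h00 : hess Q q (bp 0) (bp 0) = 0
  h01 : hess Q q (bp 0) (bp 1) = 0
  h11 : hess Q q (bp 1) (bp 1) = 0
  hz0 : hess Q q (bx 2) (bp 0) = -fderiv ℝ Q q (bp 0) ^ 2
  hz1 : hess Q q (bx 2) (bp 1) = -(fderiv ℝ Q q (bp 0) * fderiv ℝ Q q (bp 1))
  h02 : hess Q q (bp 0) (bp 2) = -(fderiv ℝ Q q (bp 0) * fderiv ℝ Q q (bp 1))
  h12 : hess Q q (bp 1) (bp 2) = -fderiv ℝ Q q (bp 1) ^ 2
  e1 : hess Q q (bx 0) (bp 1) + hess Q q (bp 2) (bp 2) +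
    fderiv ℝ Q q (bp 1) * fderiv ℝ Q q (bp 2) - Q q * fderiv ℝ Q q (bp 1) ^ 2 = 0
  e2 : 2 * hess Q q (bx 2) (bp 2) + hess Q q (bx 0) (bp 0) - hess Q q (bx 1) (bp 1) +
    fderiv ℝ Q q (bp 1) * fderiv ℝ Q q (bx 2) + fderiv ℝ Q q (bp 0) * fderiv ℝ Q q (bp 2) -
    2 * Q q * fderiv ℝ Q q (bp 0) * fderiv ℝ Q q (bp 1) = 0
  e3 : hess Q q (bx 2) (bx 2) - hess Q q (bx 1) (bp 0) +
    fderiv ℝ Q q (bp 0) * fderiv ℝ Q q (bx 2) - Q q * fderiv ℝ Q q (bp 0) ^ 2 = 0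
  e4 : -(fderiv ℝ Q q (bp 0) * fderiv ℝ Q q (bx 0)) - fderiv ℝ Q q (bp 1) * fderiv ℝ Q q (bx 1) +
    Q q * fderiv ℝ Q q (bp 1) * fderiv ℝ Q q (bx 2) - hess Q q (bx 0) (bx 2) -
    Q q * hess Q q (bx 1) (bp 1) - hess Q q (bx 1) (bp 2) -
    Q q ^ 2 * fderiv ℝ Q q (bp 0) * fderiv ℝ Q q (bp 1) + Q q * hess Q q (bx 2) (bp 2) = 0

section TypeIII

variable {Ω : Set J1} {Q : J1 → ℝ}

/-- `D_i Q` with the terms which vanish by invariance left out. -/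
lemma dtot_eqIII {j : Jet} (hi : IsInvariantIII Ω Q) (hj : toJ1 j ∈ Ω) (i : Fin 4) :
    dtot i Q j = fderiv ℝ Q (toJ1 j) (bx i) + j.2 {i, 0} * fderiv ℝ Q (toJ1 j) (bp 0) +
      j.2 {i, 1} * fderiv ℝ Q (toJ1 j) (bp 1) + j.2 {i, 2} * fderiv ℝ Q (toJ1 j) (bp 2) := by
  obtain ⟨h1, h2, h3⟩ := hi _ hj
  rw [dtot_eq, h2, Fin.sum_univ_four, h3]
  simp only [Multiset.insert_eq_cons]
  ring

/-- The integrability condition on the equation as a polynomial in the second derivatives. -/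
lemma condIII_eq (hΩ : IsOpen Ω) (hQ : ContDiffOn ℝ ∞ Q Ω) (hi : IsInvariantIII Ω Q) {j : Jet}
    (hj : toJ1 j ∈ Ω) (hF : j ∈ prolongation (eqIII Q)) :
    condIII Q j =
      -j.2 {2, 3} * hess Q (toJ1 j) (toJ1Vec (totalVec 0 j)) (toJ1Vec (totalVec 2 j)) +
      j.2 {0, 3} * hess Q (toJ1 j) (toJ1Vec (totalVec 2 j)) (toJ1Vec (totalVec 2 j)) +
      j.2 {2, 2} * hess Q (toJ1 j) (toJ1Vec (totalVec 0 j)) (toJ1Vec (totalVec 3 j)) -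
      hess Q (toJ1 j) (toJ1Vec (totalVec 1 j)) (toJ1Vec (totalVec 3 j)) -
      (j.2 {0, 2} - Q (toJ1 j)) *
        hess Q (toJ1 j) (toJ1Vec (totalVec 2 j)) (toJ1Vec (totalVec 3 j)) -
      j.2 {2, 3} * (dtot 0 Q j * fderiv ℝ Q (toJ1 j) (bp 0) +
        dtot 1 Q j * fderiv ℝ Q (toJ1 j) (bp 1) + dtot 2 Q j * fderiv ℝ Q (toJ1 j) (bp 2)) +
      dtot 2 Q j * dtot 3 Q j := by
  have hQc := hQ.contDiffAt (hΩ.mem_nhds hj)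
  obtain ⟨h1, h2, h3⟩ := hi _ hj
  have D := fun i => hF [i]
  simp only [totalDerivs, List.foldr, totalDeriv_eqIII (hQc.differentiableAt (by simp))] at D
  have D0 := D 0
  have D1 := D 1
  have D2 := D 2
  simp only [condIII, totalDeriv_dtot hQc, h2, h3, Fin.sum_univ_four, mul_zero, add_zero, zero_add]
  simp only [Multiset.insert_eq_cons, ← Multiset.cons_zero, Multiset.cons_swap] at D0 D1 D2 ⊢
  -- The third derivatives of `u` enter `condIII` with the factors `Q_{u_i}` exactly as they enter
  -- `D_i` of the equation, so they cancel.
  linear_combination -fderiv ℝ Q (toJ1 j) (bp 0) * D0 - fderiv ℝ Q (toJ1 j) (bp 1) * D1 -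
    fderiv ℝ Q (toJ1 j) (bp 2) * D2

end TypeIII

/-- A jet over `q` with prescribed derivatives of order at least two. -/
def extendJet (q : J1) (M : Multiset (Fin 4) → ℝ) : Jet :=
  (q.1, fun I => if I.card = 0 then q.2.1 else if I.card = 1 then (I.map q.2.2).sum else M I)

lemma toJ1_extendJet (q : J1) (M : Multiset (Fin 4) → ℝ) : toJ1 (extendJet q M) = q := by
  refine Prod.ext rfl (Prod.ext ?_ (funext fun i => ?_)) <;> simp [toJ1, extendJet]

lemma extendJet_apply (q : J1) (M : Multiset (Fin 4) → ℝ) {I : Multiset (Fin 4)}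
    (h : 2 ≤ I.card) : (extendJet q M).2 I = M I := by
  have h0 : I.card ≠ 0 := by omega
  have h1 : I.card ≠ 1 := by omega
  exact (if_neg h0).trans (if_neg h1)

section TypeIII

variable {Ω : Set J1} {Q : J1 → ℝ}

/-- The integrability condition of type III as a polynomial in the second derivatives
`u₁₄, u₃₄, u₁₁, u₁₂, u₁₃, u₂₂, u₂₃, u₃₃`. -/
def polyIII (Q : J1 → ℝ) (q : J1) (a b r s e v m c : ℝ) : ℝ :=
  let H := hess Q q
  let f := fderiv ℝ Q q
  let g := a * c - (e - Q q) * b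
  let T0 : J1 := bx 0 + r • bp 0 + s • bp 1 + e • bp 2
  let T1 : J1 := bx 1 + s • bp 0 + v • bp 1 + m • bp 2
  let T2 : J1 := bx 2 + e • bp 0 + m • bp 1 + c • bp 2
  let T3 : J1 := a • bp 0 + g • bp 1 + b • bp 2
  a * H T2 T2 - b * H T0 T2 + c * H T0 T3 - H T1 T3 - (e - Q q) * H T2 T3 -
    b * (f T0 * f (bp 0) + f T1 * f (bp 1) + f T2 * f (bp 2)) + f T2 * f T3

lemma condIII_eq_polyIII (hΩ : IsOpen Ω) (hQ : ContDiffOn ℝ ∞ Q Ω) (hi : IsInvariantIII Ω Q)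
    {j : Jet} (hj : toJ1 j ∈ Ω) (hF : j ∈ prolongation (eqIII Q)) :
    condIII Q j = polyIII Q (toJ1 j) (j.2 {0, 3}) (j.2 {2, 3}) (j.2 {0, 0}) (j.2 {0, 1})
      (j.2 {0, 2}) (j.2 {1, 1}) (j.2 {1, 2}) (j.2 {2, 2}) := by
  have hE : j.2 {1, 3} = j.2 {0, 3} * j.2 {2, 2} - (j.2 {0, 2} - Q (toJ1 j)) * j.2 {2, 3} := by
    have : eqIII Q j = 0 := hF []
    rw [eqIII] at this
    linarith
  have z : ∀ d ∈ ({bx 3, bu, bp 3} : Set J1), fderiv ℝ Q (toJ1 j) d = 0 ∧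
      ∀ d', hess Q (toJ1 j) d' d = 0 ∧ hess Q (toJ1 j) d d' = 0 := by
    rintro d (rfl | rfl | rfl)
    · exact ⟨(hi _ hj).1, hess_eq_zero hΩ hQ (fun q hq => (hi q hq).1) hj⟩
    · exact ⟨(hi _ hj).2.1, hess_eq_zero hΩ hQ (fun q hq => (hi q hq).2.1) hj⟩
    · exact ⟨(hi _ hj).2.2, hess_eq_zero hΩ hQ (fun q hq => (hi q hq).2.2) hj⟩
  have zx := z (bx 3) (by simp)
  have zu := z bu (by simp)
  have zp := z (bp 3) (by simp)
  have hT : ∀ i, ∃ T, (∀ d, hess Q (toJ1 j) d (toJ1Vec (totalVec i j)) = hess Q (toJ1 j) d T ∧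
      hess Q (toJ1 j) (toJ1Vec (totalVec i j)) d = hess Q (toJ1 j) T d) ∧
      fderiv ℝ Q (toJ1 j) (toJ1Vec (totalVec i j)) = fderiv ℝ Q (toJ1 j) T ∧
      T = (if i = 3 then 0 else bx i) + j.2 {i, 0} • bp 0 + j.2 {i, 1} • bp 1 +
        j.2 {i, 2} • bp 2 := by
    intro i
    refine ⟨_, fun d => ⟨?_, ?_⟩, ?_, rfl⟩
    all_goals
      rw [toJ1Vec_totalVec, Fin.sum_univ_four]
      split_ifs with h
      · simp [h, zx.1, zx.2, zu.1, zu.2, zp.1, zp.2]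
        try ring
      · simp [zu.1, zu.2, zp.1, zp.2]
        try ring
  obtain ⟨T0, h0, f0, e0⟩ := hT 0
  obtain ⟨T1, h1, f1, e1⟩ := hT 1
  obtain ⟨T2, h2, f2, e2⟩ := hT 2
  obtain ⟨T3, h3, f3, e3⟩ := hT 3
  rw [condIII_eq hΩ hQ hi hj hF]
  simp only [dtot, h0, h1, h2, h3, f0, f1, f2, f3, polyIII, ← hE]
  have p10 : ({1, 0} : Multiset (Fin 4)) = {0, 1} := by decide
  have p20 : ({2, 0} : Multiset (Fin 4)) = {0, 2} := by decide
  have p21 : ({2, 1} : Multiset (Fin 4)) = {1, 2} := by decide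
  have p30 : ({3, 0} : Multiset (Fin 4)) = {0, 3} := by decide
  have p31 : ({3, 1} : Multiset (Fin 4)) = {1, 3} := by decide
  have p32 : ({3, 2} : Multiset (Fin 4)) = {2, 3} := by decide
  have n0 : (0 : Fin 4) ≠ 3 := by decide
  have n1 : (1 : Fin 4) ≠ 3 := by decide
  have n2 : (2 : Fin 4) ≠ 3 := by decide
  simp only [p10, p20, p21, p30, p31, p32, if_neg n0, if_neg n1, if_neg n2, if_true, zero_add]
    at e0 e1 e2 e3
  rw [e0, e1, e2, e3]
  ring

/-- The equation fixes `u₂₄` and no other second derivative, so arbitrary values of the others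
extend to a formal solution; `b ≠ 0` is the nondegeneracy of the symbol. -/
lemma polyIII_eq_zero (hΩ : IsOpen Ω) (hQ : ContDiffOn ℝ ∞ Q Ω) (hi : IsInvariantIII Ω Q)
    (hC : ∀ j, toJ1 j ∈ Ω → j ∈ regularJets (eqIII Q) → condIII Q j = 0) {q : J1} (hq : q ∈ Ω)
    (a b r s e v m c : ℝ) (hb : b ≠ 0) : polyIII Q q a b r s e v m c = 0 := by
  have hL := leadingForm_eqIII hΩ hQ
  -- The default value `c` supplies `u₃₃`; the other coordinates receiving it do not enter the
  -- polynomial.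
  set M : Multiset (Fin 4) → ℝ := fun I =>
    if I = {0, 3} then a else if I = {2, 3} then b else if I = {0, 0} then r else
    if I = {0, 1} then s else if I = {0, 2} then e else if I = {1, 1} then v else
    if I = {1, 2} then m else c with hM
  set j := solve (eqIII Q) {1, 3} ![0, 1, 0, 1] (fun _ => 1) (extendJet q M) with hj
  have hjq : toJ1 j = q := by rw [hj, hL.toJ1_solve, toJ1_extendJet]
  have hF : j ∈ prolongation (eqIII Q) := hL.solve_mem (by rwa [toJ1_extendJet])
  have hval : ∀ i k : Fin 4, ¬({1, 3} : Multiset (Fin 4)) ≤ {i, k} → j.2 {i, k} = M {i, k} :=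
    fun i k h => by rw [hj, LeadingForm.solve_of_not_le _ h, extendJet_apply _ _ (by simp)]
  have hjb : j.2 {2, 3} = b := by
    rw [hval 2 3 (by decide), hM]; exact (if_neg (by decide)).trans (if_pos rfl)
  have e1 := condIII_eq_polyIII hΩ hQ hi (j := j) (by rwa [hjq]) hF
  rw [hC j (by rwa [hjq]) (regular_eqIII_iff.2 ⟨hF, by rwa [hjb]⟩), hjq, hjb,
    hval 0 3 (by decide), hval 0 0 (by decide), hval 0 1 (by decide), hval 0 2 (by decide),
    hval 1 1 (by decide), hval 1 2 (by decide), hval 2 2 (by decide)] at e1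
  exact e1.symm

/-- After substitution of the seven conditions without names `e1`–`e4`, the coefficients of `a` and
`b` are combinations of `e1`–`e4` with coefficients polynomial in `e, m, c` and `Q`. -/
lemma CondIII.polyIII_eq_zero {q : J1} (hQ : ContDiffAt ℝ ∞ Q q) (h : CondIII Q q)
    (a b r s e v m c : ℝ) : polyIII Q q a b r s e v m c = 0 := by
  simp only [polyIII, map_add, map_smul, _root_.add_apply,
    _root_.smul_apply, smul_eq_mul, hess_symm hQ (bp 1) (bp 0),
    hess_symm hQ (bp 2) (bp 0), hess_symm hQ (bp 2) (bp 1), hess_symm hQ (bp 0) (bx _),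
    hess_symm hQ (bp 1) (bx _), hess_symm hQ (bp 2) (bx _), h.h00, h.h01, h.h11, h.hz0, h.hz1,
    h.h02, h.h12]
  linear_combination a * (h.e3 + c * h.e2 + c ^ 2 * h.e1) +
    b * (h.e4 - e * h.e2 + (Q q * c - e * c - m) * h.e1)

-- The polynomial is homogeneous linear in `(a, b)`. As only `b ≠ 0` is allowed, the coefficient of
-- `b` is taken at `(0, 1)` and that of `a` as the difference of the values at `(1, 1)` and `(0,
-- 1)`. Values of the remaining variables in `{0, 1, -1}` isolate the conditions one after another.
set_option maxHeartbeats 2000000 in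
lemma condIII_of_polyIII {q : J1} (hQ : ContDiffAt ℝ ∞ Q q)
    (h : ∀ a b r s e v m c : ℝ, b ≠ 0 → polyIII Q q a b r s e v m c = 0) : CondIII Q q := by
  have h3 : ∀ r s e v m c : ℝ, _ := fun r s e v m c => h 0 1 r s e v m c one_ne_zero
  have h1 : ∀ r s e v m c : ℝ, _ := fun r s e v m c =>
    (h 1 1 r s e v m c one_ne_zero).trans (h3 r s e v m c).symm
  simp only [polyIII, map_add, map_smul, _root_.add_apply,
    _root_.smul_apply, smul_eq_mul, hess_symm hQ (bp 1) (bp 0),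
    hess_symm hQ (bp 2) (bp 0), hess_symm hQ (bp 2) (bp 1), hess_symm hQ (bp 0) (bx _),
    hess_symm hQ (bp 1) (bx _), hess_symm hQ (bp 2) (bx _)] at h1 h3
  have p3 := h3 0 0 0 0 0 0
  have p1 := h1 0 0 0 0 0 0
  have h00 : hess Q q (bp 0) (bp 0) = 0 := by linear_combination p1 - h1 0 1 0 0 0 0
  have h01 : hess Q q (bp 0) (bp 1) = 0 := by linear_combination p1 - h1 0 0 0 1 0 0
  simp only [h00, h01] at h1 h3 p1 p3
  have h11 : hess Q q (bp 1) (bp 1) = 0 := by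
    linear_combination h1 0 0 0 0 0 1 - h1 0 0 0 1 0 1
  simp only [h11] at h1 h3 p1 p3
  have hz0 : hess Q q (bx 2) (bp 0) = -fderiv ℝ Q q (bp 0) ^ 2 := by
    linear_combination h1 0 0 1 0 0 0 - p1
  have z1 : fderiv ℝ Q q (bp 0) * fderiv ℝ Q q (bp 1) + 2 * hess Q q (bx 2) (bp 1) -
      hess Q q (bp 0) (bp 2) = 0 := by
    linear_combination h1 0 0 0 0 1 0 - p1
  have z2 : fderiv ℝ Q q (bp 0) * fderiv ℝ Q q (bp 1) + 2 * hess Q q (bp 0) (bp 2) -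
      hess Q q (bx 2) (bp 1) = 0 := by
    linear_combination h1 0 0 1 0 0 1 - h1 0 0 1 0 0 0 - h1 0 0 0 0 0 1 + p1
  -- `z1` and `z2` are two linear equations for `Q_{z u₂}` and `Q_{u₁ u₃}` whose matrix has
  -- determinant `3`.
  have hz1 : hess Q q (bx 2) (bp 1) = -(fderiv ℝ Q q (bp 0) * fderiv ℝ Q q (bp 1)) := by
    linear_combination (2 * z1 + z2) / 3
  have h02 : hess Q q (bp 0) (bp 2) = -(fderiv ℝ Q q (bp 0) * fderiv ℝ Q q (bp 1)) := by
    linear_combination (2 * z2 + z1) / 3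
  have h12 : hess Q q (bp 1) (bp 2) = -fderiv ℝ Q q (bp 1) ^ 2 := by
    linear_combination h1 0 0 0 0 1 1 - h1 0 0 0 0 1 0 - h1 0 0 0 0 0 1 + p1
  simp only [hz0, hz1, h02, h12] at h1 h3 p1 p3
  exact
  { h00 := h00
    h01 := h01
    h11 := h11
    hz0 := hz0
    hz1 := hz1
    h02 := h02
    h12 := h12
    e1 := by linear_combination (h1 0 0 0 0 0 1 + h1 0 0 0 0 0 (-1)) / 2 - p1
    e2 := by linear_combination (h1 0 0 0 0 0 1 - h1 0 0 0 0 0 (-1)) / 2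
    e3 := by linear_combination p1
    e4 := by linear_combination p3 }

theorem LaxIntegrable.condIII (hΩ : IsOpen Ω) (hQ : ContDiffOn ℝ ∞ Q Ω)
    (hi : IsInvariantIII Ω Q) (h : LaxIntegrable (eqIII Q) (toJ1 ⁻¹' Ω)) {q : J1} (hq : q ∈ Ω) :
    CondIII Q q :=
  condIII_of_polyIII (hQ.contDiffAt (hΩ.mem_nhds hq)) fun a b r s e v m c hb =>
    DispersionlessLax.polyIII_eq_zero hΩ hQ hi (fun _ hj hr => h.condIII_eq_zero hΩ hQ hj hr) hq
      a b r s e v m c hb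

end TypeIII

/-! ### The integrability condition of type II is necessary -/

/-- `Q` does not depend on `x`, `t`, `u`, `u₁`, `u₄`. -/
def IsInvariantII (Ω : Set J1) (Q : J1 → ℝ) : Prop :=
  ∀ q ∈ Ω, fderiv ℝ Q q (bx 0) = 0 ∧ fderiv ℝ Q q (bx 3) = 0 ∧ fderiv ℝ Q q bu = 0 ∧
    fderiv ℝ Q q (bp 0) = 0 ∧ fderiv ℝ Q q (bp 3) = 0

/-- The integrability condition of type II. -/
def condII (Q : J1 → ℝ) (j : Jet) : ℝ :=
  hess Q (toJ1 j) (bx 2) (bp 2) + hess Q (toJ1 j) (bx 1) (bp 1) +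
    (2 * j.2 {1, 2} - (j.2 {0, 2} * j.2 {1, 3} + j.2 {0, 1} * j.2 {2, 3}) / j.2 {0, 3}) *
      hess Q (toJ1 j) (bp 1) (bp 2) +
    (j.2 {2, 2} - j.2 {0, 2} * j.2 {2, 3} / j.2 {0, 3}) * hess Q (toJ1 j) (bp 2) (bp 2) +
    (j.2 {1, 1} - j.2 {0, 1} * j.2 {1, 3} / j.2 {0, 3}) * hess Q (toJ1 j) (bp 1) (bp 1)

section TypeII

variable {Ω : Set J1} {Q : J1 → ℝ} {O : Set (Jet × ℝ)} {X Y : SpectralField}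

lemma regular_eqII_iff {j : Jet} :
    j ∈ regularJets (eqII Q) ↔ j ∈ prolongation (eqII Q) ∧ Q (toJ1 j) ≠ 0 ∧ j.2 {0, 3} ≠ 0 := by
  have h : j ∈ regularJets (eqII Q) ↔ j ∈ prolongation (eqII Q) ∧
      j.2 {0, 1} * j.2 {2, 3} - j.2 {0, 2} * j.2 {1, 3} ≠ 0 := by
    rw [← nondegenerate_eqII Q]; rfl
  rw [h, and_congr_right_iff]
  intro hF
  have : eqII Q j = 0 := hF []
  rw [eqII, sub_eq_zero] at this
  rw [this, mul_ne_zero_iff]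

lemma eventually_regular_eqII {w : Jet × ℝ} (hQ : ContDiffAt ℝ ∞ Q (toJ1 w.1))
    (hw : w.1 ∈ regularJets (eqII Q)) :
    ∀ᶠ v : Jet × ℝ in 𝓝 w, v.1 ∈ prolongation (eqII Q) → v.1 ∈ regularJets (eqII Q) := by
  obtain ⟨-, h1, h2⟩ := regular_eqII_iff.1 hw
  filter_upwards [(smoothAt_coord {0, 3} w).continuousAt.eventually_ne h2,
    (SmoothAt.comp_toJ1 hQ).continuousAt.eventually_ne h1] with v hv hv' h
  exact regular_eqII_iff.2 ⟨h, hv', hv⟩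

lemma eqII_eq_zero {j : Jet} (hj : j ∈ regularJets (eqII Q)) :
    j.2 {0, 1} * j.2 {2, 3} - j.2 {0, 2} * j.2 {1, 3} = Q (toJ1 j) * j.2 {0, 3} := by
  have : eqII Q j = 0 := hj.1 []
  rwa [eqII, sub_eq_zero] at this

lemma _root_.DispersionlessLax.SpectralField.act_fderiv (X : SpectralField) {w : Jet × ℝ}
    (hQ : ContDiffAt ℝ ∞ Q (toJ1 w.1)) (d : J1) :
    X.act (fun v => fderiv ℝ Q (toJ1 v.1) d) w =
      ∑ i, (X w).1 i * hess Q (toJ1 w.1) (toJ1Vec (totalVec i w.1)) d := by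
  have hd := hQ.fderiv_right (m := ∞) (by decide)
  rw [X.act_toJ1 (Q := fun q => fderiv ℝ Q q d) (hd.clm_apply contDiffAt_const)]
  refine Finset.sum_congr rfl fun i _ => ?_
  rw [dtot, fderiv_clm_apply (hd.differentiableAt (by simp)) (differentiableAt_const d)]
  simp [hess]

/-- The parameter of the self-dual null planes of type II. -/
def paramII (Q : J1 → ℝ) (X Y : SpectralField) (w : Jet × ℝ) : ℝ :=
  (Y.comp (some 0) w * w.1.2 {0, 2} - X.comp (some 0) w * w.1.2 {0, 1}) / Q (toJ1 w.1)

/-- Normal form of the self-dual null planes of type II. -/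
lemma normalPair_alphaII (h : NormalPair (eqII Q) O 2 1 X Y) {w : Jet × ℝ} (hw : w ∈ O)
    (hreg : w.1 ∈ regularJets (eqII Q)) :
    (X w).1 0 = -(paramII Q X Y w * (w.1.2 {2, 3} / w.1.2 {0, 3})) ∧
      (X w).1 3 = (paramII Q X Y w - 1) * (w.1.2 {0, 2} / w.1.2 {0, 3}) ∧
      (Y w).1 0 = -(paramII Q X Y w * (w.1.2 {1, 3} / w.1.2 {0, 3})) ∧
      (Y w).1 3 = (paramII Q X Y w - 1) * (w.1.2 {0, 1} / w.1.2 {0, 3}) := by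
  obtain ⟨-, hq, he⟩ := regular_eqII_iff.1 hreg
  have hE := eqII_eq_zero hreg
  have hnull : ∀ r s : ℝ, _ := fun r s => h.null w hw hreg
    ![r, -(Y w).1 0 * r - (Y w).1 3 * s, -(X w).1 0 * r - (X w).1 3 * s, s]
    (by simp [Fin.sum_univ_four, h.fst_a w hw, h.fst_b w hw]; ring)
    (by simp [Fin.sum_univ_four, h.snd_a w hw, h.snd_b w hw]; ring)
  simp only [symbol_eqII] at hnull
  have h1 := hnull 1 0
  have h2 := hnull 0 1
  have h3 := hnull 1 1
  simp only [Matrix.cons_val] at h1 h2 h3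
  simp only [paramII, SpectralField.comp]
  generalize w.1.2 {2, 3} = a at *
  generalize w.1.2 {1, 3} = b at *
  generalize w.1.2 {0, 1} = c at *
  generalize w.1.2 {0, 2} = d at *
  generalize w.1.2 {0, 3} = e at *
  generalize Q (toJ1 w.1) = r at *
  have n1 : b * (X w).1 0 = a * (Y w).1 0 := by linarith
  have n2 : c * (X w).1 3 = d * (Y w).1 3 := by linarith
  have n3 : b * (X w).1 3 - a * (Y w).1 3 + d * (Y w).1 0 - c * (X w).1 0 = r := by linarith
  refine ⟨?_, ?_, ?_, ?_⟩ <;> field_simp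
  · linear_combination -(X w).1 0 * hE - d * n1
  · linear_combination -(X w).1 3 * hE + a * n2 - d * n3
  · linear_combination -(Y w).1 0 * hE - c * n1
  · linear_combination -(Y w).1 3 * hE + b * n2 - c * n3

/-- The parameter `m` satisfies `X m = -m (1 - m) Q_{u₂}` and `Y m = m (1 - m) Q_{u₃}`. In `X Y m =
Y X m` the products of first derivatives of `Q` cancel, and `m (1 - m)` times `X Q_{u₃} + Y Q_{u₂}`
remains; the latter is `condII`. -/
lemma condII_eq_zero (hΩ : IsOpen Ω) (hQ : ContDiffOn ℝ ∞ Q Ω) (h0 : ∀ q ∈ Ω, Q q ≠ 0)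
    (hi : IsInvariantII Ω Q) (hO : IsOpen O) (hOΩ : ∀ w ∈ O, toJ1 w.1 ∈ Ω)
    (h : NormalPair (eqII Q) O 2 1 X Y) {w : Jet × ℝ} (hw : w ∈ O)
    (hreg : w.1 ∈ regularJets (eqII Q)) (hm0 : paramII Q X Y w ≠ 0) (hm1 : paramII Q X Y w ≠ 1) :
    condII Q w.1 = 0 := by
  have hL := leadingForm_eqII hΩ hQ h0
  have hQc : ∀ w ∈ O, ContDiffAt ℝ ∞ Q (toJ1 w.1) := fun w hw =>
    hQ.contDiffAt (hΩ.mem_nhds (hOΩ w hw))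
  have ev : ∀ w ∈ O, w.1 ∈ regularJets (eqII Q) → ∀ {p : Jet × ℝ → Prop},
      (∀ v ∈ O, v.1 ∈ regularJets (eqII Q) → p v) →
      ∀ᶠ v : Jet × ℝ in 𝓝 w, v.1 ∈ prolongation (eqII Q) → p v := by
    intro w hw hreg p hp
    filter_upwards [hO.mem_nhds hw, eventually_regular_eqII (hQc w hw) hreg] with v hv hr hF
    exact hp v hv (hr hF)
  have sX : ∀ w ∈ O, ∀ i, SmoothAt (X.comp (some i)) w := fun w hw i => h.smooth_fst w hw _
  have sY : ∀ w ∈ O, ∀ i, SmoothAt (Y.comp (some i)) w := fun w hw i => h.smooth_snd w hw _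
  have sm : ∀ w ∈ O, SmoothAt (paramII Q X Y) w := fun w hw =>
    (((sY w hw 0).mul (smoothAt_coord _ w)).sub ((sX w hw 0).mul (smoothAt_coord _ w))).div
      (SmoothAt.comp_toJ1 (hQc w hw)) (h0 _ (hOΩ w hw))
  have sq : ∀ w ∈ O, ∀ d, SmoothAt (fun v => fderiv ℝ Q (toJ1 v.1) d) w := fun w hw d =>
    SmoothAt.comp_toJ1 (h := fun q => fderiv ℝ Q q d)
      (((hQc w hw).fderiv_right (m := ∞) (by decide)).clm_apply contDiffAt_const)
  have hq3 : ∀ w ∈ O, dtot 3 Q w.1 = w.1.2 {1, 3} * fderiv ℝ Q (toJ1 w.1) (bp 1) +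
      w.1.2 {2, 3} * fderiv ℝ Q (toJ1 w.1) (bp 2) := by
    intro w hw
    obtain ⟨z1, z2, z3, z4, z5⟩ := hi _ (hOΩ w hw)
    rw [dtot_eq, Fin.sum_univ_four, z2, z3, z4, z5]
    simp only [Multiset.insert_eq_cons, ← Multiset.cons_zero, Multiset.cons_swap]
    ring
  have hq0 : ∀ w ∈ O, dtot 0 Q w.1 = w.1.2 {0, 1} * fderiv ℝ Q (toJ1 w.1) (bp 1) +
      w.1.2 {0, 2} * fderiv ℝ Q (toJ1 w.1) (bp 2) := by
    intro w hw
    obtain ⟨z1, z2, z3, z4, z5⟩ := hi _ (hOΩ w hw)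
    rw [dtot_eq, Fin.sum_univ_four, z1, z3, z4, z5]
    simp only [Multiset.insert_eq_cons, ← Multiset.cons_zero]
    ring
  have first : ∀ w ∈ O, w.1 ∈ regularJets (eqII Q) →
      X.act (paramII Q X Y) w = -(paramII Q X Y w * (1 - paramII Q X Y w) *
        fderiv ℝ Q (toJ1 w.1) (bp 1)) ∧
      Y.act (paramII Q X Y) w = paramII Q X Y w * (1 - paramII Q X Y w) *
        fderiv ℝ Q (toJ1 w.1) (bp 2) := by
    intro w hw hreg
    obtain ⟨-, hq, he⟩ := regular_eqII_iff.1 hreg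
    have hE := eqII_eq_zero hreg
    have hF := hreg.1
    have hQw := hQc w hw
    have c0 := h.commute w hw hreg (some 0)
    have c3 := h.commute w hw hreg (some 3)
    have sa := smoothAt_coord {2, 3} w
    have sb := smoothAt_coord {1, 3} w
    have sc := smoothAt_coord {0, 1} w
    have sd := smoothAt_coord {0, 2} w
    have se := smoothAt_coord {0, 3} w
    have smw := sm w hw
    have sm1 := smw.sub (smoothAt_const 1 w)
    have y0 : X.act (Y.comp (some 0)) w = X.act (fun v => -(paramII Q X Y v *
        (v.1.2 {1, 3} / v.1.2 {0, 3}))) w :=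
      hL.act_congr (hOΩ w hw) hF (sY w hw 0) (smw.mul (sb.div se he)).neg
        (ev w hw hreg fun v hv hr => (normalPair_alphaII h hv hr).2.2.1) X
    have x0 : Y.act (X.comp (some 0)) w = Y.act (fun v => -(paramII Q X Y v *
        (v.1.2 {2, 3} / v.1.2 {0, 3}))) w :=
      hL.act_congr (hOΩ w hw) hF (sX w hw 0) (smw.mul (sa.div se he)).neg
        (ev w hw hreg fun v hv hr => (normalPair_alphaII h hv hr).1) Y
    have y3 : X.act (Y.comp (some 3)) w = X.act (fun v => (paramII Q X Y v - 1) *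
        (v.1.2 {0, 1} / v.1.2 {0, 3})) w :=
      hL.act_congr (hOΩ w hw) hF (sY w hw 3) (sm1.mul (sc.div se he))
        (ev w hw hreg fun v hv hr => (normalPair_alphaII h hv hr).2.2.2) X
    have x3 : Y.act (X.comp (some 3)) w = Y.act (fun v => (paramII Q X Y v - 1) *
        (v.1.2 {0, 2} / v.1.2 {0, 3})) w :=
      hL.act_congr (hOΩ w hw) hF (sX w hw 3) (sm1.mul (sd.div se he))
        (ev w hw hreg fun v hv hr => (normalPair_alphaII h hv hr).2.1) Y
    rw [y0, x0, X.act_neg (smw.mul (sb.div se he)), Y.act_neg (smw.mul (sa.div se he)),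
      X.act_mul smw (sb.div se he), Y.act_mul smw (sa.div se he), X.act_div sb se he,
      Y.act_div sa se he] at c0
    rw [y3, x3, X.act_mul sm1 (sc.div se he), Y.act_mul sm1 (sd.div se he),
      X.act_sub smw (smoothAt_const 1 w), Y.act_sub smw (smoothAt_const 1 w), X.act_const,
      Y.act_const, X.act_div sc se he, Y.act_div sd se he] at c3
    have D0 := hF [0]
    have D3 := hF [3]
    simp only [totalDerivs, List.foldr, totalDeriv_eqII (hQw.differentiableAt (by simp)),
      hq0 w hw, hq3 w hw] at D0 D3
    obtain ⟨n1, n2, n3, n4⟩ := normalPair_alphaII h hw hreg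
    simp only [SpectralField.act_coord, Fin.sum_univ_four, h.fst_a w hw,
      h.fst_b w hw, h.snd_a w hw, h.snd_b w hw, n1, n2, n3, n4] at c0 c3
    simp only [Multiset.insert_eq_cons, ← Multiset.cons_zero, Multiset.cons_swap]
      at c0 c3 D0 D3 hE he
    generalize w.1.2 (2 ::ₘ 3 ::ₘ 0) = a at *
    generalize w.1.2 (1 ::ₘ 3 ::ₘ 0) = b at *
    generalize w.1.2 (0 ::ₘ 1 ::ₘ 0) = c at *
    generalize w.1.2 (0 ::ₘ 2 ::ₘ 0) = d at *
    generalize w.1.2 (0 ::ₘ 3 ::ₘ 0) = e at *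
    generalize paramII Q X Y w = m at *
    generalize X.act (paramII Q X Y) w = A at *
    generalize Y.act (paramII Q X Y) w = B at *
    generalize fderiv ℝ Q (toJ1 w.1) (bp 1) = q1 at *
    generalize fderiv ℝ Q (toJ1 w.1) (bp 2) = q2 at *
    generalize Q (toJ1 w.1) = r at *
    -- The `x`- and `t`-components of the commutator, simplified by `D_t` and `D_x` of the equation,
    -- are two linear equations for `X m` and `Y m`. Their determinant is `u₁₂ u₃₄ - u₁₃ u₂₄ = Q
    -- u₁₄`, which is nonzero.
    have k0 : A * b - B * a + m * (1 - m) * (b * q1 + a * q2) = 0 := by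
      linear_combination (norm := (field_simp; ring1)) -e * c0 + (m * (m - 1)) / e * D3 -
          m * (m - 1) / e ^ 2 * w.1.2 (0 ::ₘ 3 ::ₘ 3 ::ₘ 0) * hE
    have k3 : A * c - B * d + m * (1 - m) * (c * q1 + d * q2) = 0 := by
      linear_combination (norm := (field_simp; ring1)) e * c3 + (m * (m - 1)) / e * D0 -
          m * (m - 1) / e ^ 2 * w.1.2 (0 ::ₘ 0 ::ₘ 3 ::ₘ 0) * hE
    have hre : r * e ≠ 0 := mul_ne_zero hq he
    constructor
    · refine mul_left_cancel₀ hre ?_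
      linear_combination -(d * k0 - a * k3) - (A + m * (1 - m) * q1) * hE
    · refine mul_left_cancel₀ hre ?_
      linear_combination -(c * k0 - b * k3) - (B - m * (1 - m) * q2) * hE
  obtain ⟨fX, fY⟩ := first w hw hreg
  obtain ⟨-, hq, he⟩ := regular_eqII_iff.1 hreg
  have hE := eqII_eq_zero hreg
  have hF := hreg.1
  have hQw := hQc w hw
  have smw := sm w hw
  have s1 := sq w hw (bp 1)
  have s2 := sq w hw (bp 2)
  have su := (smoothAt_const 1 w).sub smw
  have fin := h.commute_act w hw hreg _ smw
  have eX : Y.act (X.act (paramII Q X Y)) w = Y.act (fun v => -(paramII Q X Y v *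
      (1 - paramII Q X Y v) * fderiv ℝ Q (toJ1 v.1) (bp 1))) w :=
    hL.act_congr (hOΩ w hw) hF (smw.act (h.smooth_fst w hw)) ((smw.mul su).mul s1).neg
      (ev w hw hreg fun v hv hr => (first v hv hr).1) Y
  have eY : X.act (Y.act (paramII Q X Y)) w = X.act (fun v => paramII Q X Y v *
      (1 - paramII Q X Y v) * fderiv ℝ Q (toJ1 v.1) (bp 2)) w :=
    hL.act_congr (hOΩ w hw) hF (smw.act (h.smooth_snd w hw)) ((smw.mul su).mul s2)
      (ev w hw hreg fun v hv hr => (first v hv hr).2) X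
  rw [eX, eY, X.act_mul (smw.mul su) s2, X.act_mul smw su, X.act_sub (smoothAt_const 1 w) smw,
    X.act_const, Y.act_neg ((smw.mul su).mul s1), Y.act_mul (smw.mul su) s1, Y.act_mul smw su,
    Y.act_sub (smoothAt_const 1 w) smw, Y.act_const, fX, fY] at fin
  have key : X.act (fun v => fderiv ℝ Q (toJ1 v.1) (bp 2)) w +
      Y.act (fun v => fderiv ℝ Q (toJ1 v.1) (bp 1)) w = 0 := by
    refine (mul_eq_zero.1 (?_ : paramII Q X Y w * (1 - paramII Q X Y w) * _ = 0)).resolve_left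
      (mul_ne_zero hm0 (sub_ne_zero.2 hm1.symm))
    linear_combination fin
  obtain ⟨n1, n2, n3, n4⟩ := normalPair_alphaII h hw hreg
  have hz : ∀ d ∈ ({bx 0, bx 3, bu, bp 0, bp 3} : Set J1), ∀ d',
      hess Q (toJ1 w.1) d d' = 0 := by
    rintro d (rfl | rfl | rfl | rfl | rfl) d'
    · exact (hess_eq_zero hΩ hQ (fun q hq => (hi q hq).1) (hOΩ w hw) d').2
    · exact (hess_eq_zero hΩ hQ (fun q hq => (hi q hq).2.1) (hOΩ w hw) d').2
    · exact (hess_eq_zero hΩ hQ (fun q hq => (hi q hq).2.2.1) (hOΩ w hw) d').2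
    · exact (hess_eq_zero hΩ hQ (fun q hq => (hi q hq).2.2.2.1) (hOΩ w hw) d').2
    · exact (hess_eq_zero hΩ hQ (fun q hq => (hi q hq).2.2.2.2) (hOΩ w hw) d').2
  simp only [X.act_fderiv hQw, Y.act_fderiv hQw, toJ1Vec_totalVec, Fin.sum_univ_four, map_add,
    map_smul, _root_.add_apply, _root_.smul_apply, smul_eq_mul, h.fst_a w hw,
    h.fst_b w hw, h.snd_a w hw, h.snd_b w hw, n1, n2, n3, n4, hz (bx 0) (by simp),
    hz (bx 3) (by simp), hz bu (by simp), hz (bp 0) (by simp), hz (bp 3) (by simp),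
    hess_symm hQw (bp 2) (bp 1)] at key
  rw [condII]
  simp only [Multiset.insert_eq_cons, ← Multiset.cons_zero, Multiset.cons_swap] at key hE he ⊢
  linear_combination (norm := (field_simp; ring)) key

end TypeII

/-! ### Type II: exclusion of anti-self-dual planes -/

section TypeII

variable {Ω : Set J1} {Q : J1 → ℝ} {O : Set (Jet × ℝ)} {X Y : SpectralField}

/-- `S = u₁₃ - μ u₁₂`. -/
def sII (w : Jet × ℝ) : ℝ := w.1.2 {0, 2} - w.2 * w.1.2 {0, 1}

/-- `R = u₃₄ - μ u₂₄`. -/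
def rII (w : Jet × ℝ) : ℝ := w.1.2 {2, 3} - w.2 * w.1.2 {1, 3}

/-- The derivative of `S` by `x^i` with `μ` fixed. -/
def dsII (i : Fin 4) (w : Jet × ℝ) : ℝ := w.1.2 (i ::ₘ {0, 2}) - w.2 * w.1.2 (i ::ₘ {0, 1})

/-- The derivative of `R` by `x^i` with `μ` fixed. -/
def drII (i : Fin 4) (w : Jet × ℝ) : ℝ := w.1.2 (i ::ₘ {2, 3}) - w.2 * w.1.2 (i ::ₘ {1, 3})

/-- The components of the first field in the basis of anti-self-dual null planes. -/
def fstII (w : Jet × ℝ) : Fin 4 → ℝ := ![1, 0, 0, -(sII w / rII w)]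

/-- The components of the second field in the basis of anti-self-dual null planes. -/
def sndII (w : Jet × ℝ) : Fin 4 → ℝ := ![0, -w.2, 1, -(sII w / w.1.2 {0, 3})]

/-- The derivative of `μ` along the second field. -/
def betaII (w : Jet × ℝ) : ℝ :=
  (((dsII 2 w - w.2 * dsII 1 w - sII w / w.1.2 {0, 3} * dsII 3 w) * rII w -
      sII w * (drII 2 w - w.2 * drII 1 w - sII w / w.1.2 {0, 3} * drII 3 w)) -
    ((dsII 0 w - sII w / rII w * dsII 3 w) * w.1.2 {0, 3} -
      sII w * (w.1.2 (0 ::ₘ {0, 3}) - sII w / rII w * w.1.2 (3 ::ₘ {0, 3}))) *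
        (rII w / w.1.2 {0, 3}) ^ 2) /
    (w.1.2 {0, 1} * w.1.2 {2, 3} - w.1.2 {0, 2} * w.1.2 {1, 3})

/-- Normal form of the anti-self-dual null planes of type II. -/
lemma normalPair_betaII (h : NormalPair (eqII Q) O 0 2 X Y) {w : Jet × ℝ} (hw : w ∈ O)
    (hreg : w.1 ∈ regularJets (eqII Q)) (h0 : (X w).1 1 = 0) :
    rII (w.1, -(Y w).1 1) ≠ 0 ∧ (X w).1 = fstII (w.1, -(Y w).1 1) ∧
      (Y w).1 = sndII (w.1, -(Y w).1 1) := by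
  obtain ⟨-, hq, he⟩ := regular_eqII_iff.1 hreg
  have hE := eqII_eq_zero hreg
  have hnull : ∀ r s : ℝ, _ := fun r s => h.null w hw hreg
    ![-(X w).1 3 * s, r, -(Y w).1 1 * r - (Y w).1 3 * s, s]
    (by simp [Fin.sum_univ_four, h0, h.fst_a w hw, h.fst_b w hw]; ring)
    (by simp [Fin.sum_univ_four, h.snd_a w hw, h.snd_b w hw]; ring)
  simp only [symbol_eqII] at hnull
  have h2 := hnull 0 1
  have h3 := hnull 1 1
  simp only [Matrix.cons_val] at h2 h3
  have key : rII (w.1, -(Y w).1 1) ≠ 0 ∧ (X w).1 3 * rII (w.1, -(Y w).1 1) =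
      -sII (w.1, -(Y w).1 1) ∧ (Y w).1 3 * w.1.2 {0, 3} = -sII (w.1, -(Y w).1 1) := by
    simp only [rII, sII]
    generalize w.1.2 {2, 3} = a at *
    generalize w.1.2 {1, 3} = b at *
    generalize w.1.2 {0, 1} = c at *
    generalize w.1.2 {0, 2} = d at *
    generalize w.1.2 {0, 3} = e at *
    generalize Q (toJ1 w.1) = r at *
    generalize (X w).1 3 = x at *
    generalize (Y w).1 3 = y at *
    generalize (Y w).1 1 = m at *
    have e1 : x * (a - -m * b) = -(d - -m * c) := by linarith
    have hr : a - -m * b ≠ 0 := fun hr => by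
      rw [hr, mul_zero] at e1
      have : r * e = 0 := by linear_combination -hE + c * hr - b * e1
      exact mul_ne_zero hq he this
    have e2 : x * y * b + c * y - r * x = 0 := by linarith
    refine ⟨hr, e1, ?_⟩
    refine mul_left_cancel₀ hq ?_
    linear_combination -y * hE + (a - -m * b) * e2 + (r - b * y) * e1
  obtain ⟨hr, e1, e2⟩ := key
  refine ⟨hr, ?_, ?_⟩
  · have e3 : (X w).1 3 = -(sII (w.1, -(Y w).1 1) / rII (w.1, -(Y w).1 1)) := by
      rw [← neg_div, ← e1, mul_div_cancel_right₀ _ hr]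
    ext i; fin_cases i
    · exact h.fst_a w hw
    · exact h0
    · exact h.fst_b w hw
    · exact e3
  · have e3 : (Y w).1 3 = -(sII (w.1, -(Y w).1 1) / w.1.2 {0, 3}) := by
      rw [← neg_div, ← e2, mul_div_cancel_right₀ _ he]
    ext i; fin_cases i
    · exact h.snd_a w hw
    · exact (neg_neg _).symm
    · exact h.snd_b w hw
    · exact e3

lemma smoothAt_sII (w : Jet × ℝ) : SmoothAt sII w :=
  (smoothAt_coord _ w).sub ((smoothAt_param w).mul (smoothAt_coord _ w))

lemma smoothAt_rII (w : Jet × ℝ) : SmoothAt rII w :=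
  (smoothAt_coord _ w).sub ((smoothAt_param w).mul (smoothAt_coord _ w))

lemma smoothAt_dsII (i : Fin 4) (w : Jet × ℝ) : SmoothAt (dsII i) w :=
  (smoothAt_coord _ w).sub ((smoothAt_param w).mul (smoothAt_coord _ w))

lemma smoothAt_drII (i : Fin 4) (w : Jet × ℝ) : SmoothAt (drII i) w :=
  (smoothAt_coord _ w).sub ((smoothAt_param w).mul (smoothAt_coord _ w))

lemma smoothAt_betaII {w : Jet × ℝ} (he : w.1.2 {0, 3} ≠ 0) (hr : rII w ≠ 0)
    (hd : w.1.2 {0, 1} * w.1.2 {2, 3} - w.1.2 {0, 2} * w.1.2 {1, 3} ≠ 0) : SmoothAt betaII w := by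
  have s := smoothAt_sII w
  have r := smoothAt_rII w
  have se := smoothAt_coord {0, 3} w
  have p := smoothAt_param w
  have ds := fun i => smoothAt_dsII i w
  have dr := fun i => smoothAt_drII i w
  have sc := fun I => smoothAt_coord I w
  exact SmoothAt.div (((((((ds 2).sub (p.mul (ds 1))).sub ((s.div se he).mul (ds 3))).mul r).sub
    (s.mul (((dr 2).sub (p.mul (dr 1))).sub ((s.div se he).mul (dr 3)))))).sub
    (((((ds 0).sub ((s.div r hr).mul (ds 3))).mul se).sub
      (s.mul ((sc _).sub ((s.div r hr).mul (sc _))))).mul ((r.div se he).pow 2)))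
    (((sc _).mul (sc _)).sub ((sc _).mul (sc _))) hd

lemma sII_agree {j j' : Jet} (h : AgreeOn (fun K => K.card ≤ 3) j j') (l : ℝ) :
    sII (j, l) = sII (j', l) := by
  simp only [sII, h.2 {0, 2} (by simp), h.2 {0, 1} (by simp)]

lemma rII_agree {j j' : Jet} (h : AgreeOn (fun K => K.card ≤ 3) j j') (l : ℝ) :
    rII (j, l) = rII (j', l) := by
  simp only [rII, h.2 {2, 3} (by simp), h.2 {1, 3} (by simp)]

lemma betaII_agree {j j' : Jet} (h : AgreeOn (fun K => K.card ≤ 3) j j') (l : ℝ) :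
    betaII (j, l) = betaII (j', l) := by
  have h3 : ∀ i k m : Fin 4, j.2 (i ::ₘ {k, m}) = j'.2 (i ::ₘ {k, m}) := fun i k m =>
    h.2 _ (by simp)
  have h2 : ∀ i k : Fin 4, j.2 {i, k} = j'.2 {i, k} := fun i k => h.2 _ (by simp)
  simp only [betaII, sII_agree h, rII_agree h, dsII, drII, h3, h2]

lemma lineDeriv_betaII {w : Jet × ℝ} (he : w.1.2 {0, 3} ≠ 0) (hr : rII w ≠ 0)
    (hd : w.1.2 {0, 1} * w.1.2 {2, 3} - w.1.2 {0, 2} * w.1.2 {1, 3} ≠ 0) (ξ : Fin 4 → ℝ) :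
    lineDeriv ℝ betaII w (powJet ξ 3, 0) =
      rII w ^ 2 / (w.1.2 {0, 1} * w.1.2 {2, 3} - w.1.2 {0, 2} * w.1.2 {1, 3}) *
      ((ξ 0 - sII w / rII w * ξ 3) * (ξ 2 - w.2 * ξ 1 - sII w / w.1.2 {0, 3} * ξ 3)) *
      ((ξ 2 - w.2 * ξ 1) / rII w - ξ 0 / w.1.2 {0, 3}) := by
  refine lineDeriv_affine fun t => ?_
  have es : sII (w + t • (powJet ξ 3, 0)) = sII w := by
    simp [sII, powJet]
  have er : rII (w + t • (powJet ξ 3, 0)) = rII w := by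
    simp [rII, powJet]
  have eds : ∀ i, dsII i (w + t • (powJet ξ 3, 0)) =
      dsII i w + t * (ξ i * (ξ 0 * (ξ 2 - w.2 * ξ 1))) := fun i => by
    simp [dsII, powJet]; ring
  have edr : ∀ i, drII i (w + t • (powJet ξ 3, 0)) =
      drII i w + t * (ξ i * (ξ 3 * (ξ 2 - w.2 * ξ 1))) := fun i => by
    simp [drII, powJet]; ring
  simp only [betaII, es, er, eds, edr]
  simp only [Prod.fst_add, Prod.snd_add, Prod.smul_fst, Prod.smul_snd, Pi.add_apply, Pi.smul_apply,
    powJet_three, powJet_three_two, smul_eq_mul, mul_zero, add_zero]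
  generalize w.1.2 {0, 1} * w.1.2 {2, 3} - w.1.2 {0, 2} * w.1.2 {1, 3} = δ at *
  generalize w.1.2 {0, 3} = e at *
  field_simp
  ring

/-- The anti-self-dual null planes do not carry a Lax pair of the equation of type II. -/
lemma not_normalPair_betaII (hΩ : IsOpen Ω) (hQ : ContDiffOn ℝ ∞ Q Ω) (hQ0 : ∀ q ∈ Ω, Q q ≠ 0)
    (hO : IsOpen O) (hOΩ : ∀ w ∈ O, toJ1 w.1 ∈ Ω) (h : NormalPair (eqII Q) O 0 2 X Y)
    (h0 : ∀ w ∈ O, w.1 ∈ regularJets (eqII Q) → (X w).1 1 = 0) {j : Jet} {l₀ : ℝ}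
    (hj : (j, l₀) ∈ O) (hjF : j ∈ regularJets (eqII Q)) : False := by
  have hL := leadingForm_eqII hΩ hQ hQ0
  have hQc : ∀ w ∈ O, ContDiffAt ℝ ∞ Q (toJ1 w.1) := fun w hw =>
    hQ.contDiffAt (hΩ.mem_nhds (hOΩ w hw))
  have sX : ∀ w ∈ O, ∀ i, SmoothAt (X.comp (some i)) w := fun w hw i => h.smooth_fst w hw _
  have sY : ∀ w ∈ O, ∀ i, SmoothAt (Y.comp (some i)) w := fun w hw i => h.smooth_snd w hw _
  have nf : ∀ w ∈ O, w.1 ∈ regularJets (eqII Q) → _ := fun w hw hr =>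
    normalPair_betaII h hw hr (h0 w hw hr)
  have ev : ∀ w ∈ O, w.1 ∈ regularJets (eqII Q) → ∀ {p : Jet × ℝ → Prop},
      (∀ v ∈ O, v.1 ∈ regularJets (eqII Q) → p v) →
      ∀ᶠ v : Jet × ℝ in 𝓝 w, v.1 ∈ prolongation (eqII Q) → p v := by
    intro w hw hreg p hp
    filter_upwards [hO.mem_nhds hw, eventually_regular_eqII (hQc w hw) hreg] with v hv hr hF
    exact hp v hv (hr hF)
  set m : Jet × ℝ → ℝ := fun v => -Y.comp (some 1) v with hm
  have sm : ∀ w ∈ O, SmoothAt m w := fun w hw => (sY w hw 1).neg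
  have hδ : ∀ w : Jet × ℝ, w.1 ∈ regularJets (eqII Q) →
      w.1.2 {0, 1} * w.1.2 {2, 3} - w.1.2 {0, 2} * w.1.2 {1, 3} ≠ 0 := fun w hr => by
    obtain ⟨-, hq, he⟩ := regular_eqII_iff.1 hr
    rw [eqII_eq_zero hr]
    exact mul_ne_zero hq he
  have act0 : ∀ w ∈ O, w.1 ∈ regularJets (eqII Q) →
      X.act m w = 0 ∧ Y.act m w = betaII (w.1, m w) := by
    intro w hw hr
    obtain ⟨hR, n1, n2⟩ := nf w hw hr
    obtain ⟨-, hq, he⟩ := regular_eqII_iff.1 hr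
    have smw := sm w hw
    have sc := fun I => smoothAt_coord I w
    have sS := (sc {0, 2}).sub (smw.mul (sc {0, 1}))
    have sR := (sc {2, 3}).sub (smw.mul (sc {1, 3}))
    have x1 : Y.act (X.comp (some 1)) w = 0 := by
      rw [hL.act_congr (hOΩ w hw) hr.1 (sX w hw 1) (smoothAt_const 0 w)
        (ev w hw hr fun v hv hr => h0 v hv hr) Y, Y.act_const]
    -- The `y`-component of `[X, Y] = 0`: the field `X` has no `y`-component on solutions, and that
    -- of `Y` is `-μ`.
    have eXm : X.act m w = 0 := by
      rw [hm, X.act_neg (sY w hw 1), h.commute w hw hr (some 1), x1, neg_zero]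
    refine ⟨eXm, ?_⟩
    -- The `t`-component is linear in `Y μ` with coefficient `(u₁₂ R - S u₂₄) / R²`, and `u₁₂ R - S
    -- u₂₄` is again the determinant `u₁₂ u₃₄ - u₁₃ u₂₄`.
    have y3 : X.act (Y.comp (some 3)) w =
        X.act (fun v => -((v.1.2 {0, 2} - m v * v.1.2 {0, 1}) / v.1.2 {0, 3})) w :=
      hL.act_congr (hOΩ w hw) hr.1 (sY w hw 3) (sS.div (sc _) he).neg
        (ev w hw hr fun v hv hr => congrFun (nf v hv hr).2.2 3) X
    have x3 : Y.act (X.comp (some 3)) w =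
        Y.act (fun v => -((v.1.2 {0, 2} - m v * v.1.2 {0, 1}) /
          (v.1.2 {2, 3} - m v * v.1.2 {1, 3}))) w :=
      hL.act_congr (hOΩ w hw) hr.1 (sX w hw 3) (sS.div sR hR).neg
        (ev w hw hr fun v hv hr => congrFun (nf v hv hr).2.1 3) Y
    have c3 := h.commute w hw hr (some 3)
    rw [y3, x3, X.act_neg (sS.div (sc _) he), Y.act_neg (sS.div sR hR), X.act_div sS (sc _) he,
      Y.act_div sS sR hR, X.act_sub (sc _) (smw.mul (sc _)), Y.act_sub (sc _) (smw.mul (sc _)),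
      Y.act_sub (sc _) (smw.mul (sc _)), X.act_mul smw (sc _), Y.act_mul smw (sc _),
      Y.act_mul smw (sc _), eXm] at c3
    have x0 : (X w).1 0 = 1 := congrFun n1 0
    have x1 : (X w).1 1 = 0 := congrFun n1 1
    have x2 : (X w).1 2 = 0 := congrFun n1 2
    have x3 : (X w).1 3 = -(sII (w.1, -(Y w).1 1) / rII (w.1, -(Y w).1 1)) := congrFun n1 3
    have y0 : (Y w).1 0 = 0 := congrFun n2 0
    have y2 : (Y w).1 2 = 1 := congrFun n2 2
    have y3 : (Y w).1 3 = -(sII (w.1, -(Y w).1 1) / w.1.2 {0, 3}) := congrFun n2 3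
    simp only [SpectralField.act_coord, Fin.sum_univ_four, x0, x1, x2, x3, y0, y2, y3] at c3
    have hd := hδ w hr
    have eR : w.1.2 {2, 3} - m w * w.1.2 {1, 3} = rII (w.1, -(Y w).1 1) := rfl
    have eS : w.1.2 {0, 2} - m w * w.1.2 {0, 1} = sII (w.1, -(Y w).1 1) := rfl
    have em : m w = -(Y w).1 1 := rfl
    rw [eR, eS, em] at c3
    rw [betaII, em]
    simp only [dsII, drII]
    rw [eq_div_iff hd]
    have hSR : w.1.2 {0, 1} * w.1.2 {2, 3} - w.1.2 {0, 2} * w.1.2 {1, 3} =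
        w.1.2 {0, 1} * rII (w.1, -(Y w).1 1) - sII (w.1, -(Y w).1 1) * w.1.2 {1, 3} := by
      simp only [rII, sII]; ring
    rw [hSR]
    generalize rII (w.1, -(Y w).1 1) = R at *
    generalize sII (w.1, -(Y w).1 1) = S at *
    generalize w.1.2 {0, 3} = e at *
    generalize (Y w).1 1 = y at *
    linear_combination (norm := (field_simp; ring1)) -R ^ 2 * c3
  obtain ⟨l, hl, key⟩ := h.compat (m := m) (f := fun _ => 0) (g := betaII) (x := fstII) (y := sndII)
    hL hO hOΩ (fun w hw hr => eventually_regular_eqII (hQc w hw) hr) sm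
    (fun _ _ _ _ _ => rfl) (fun j j' l _ hjj => betaII_agree hjj l)
    (fun j j' l _ hjj => by simp only [fstII, sII_agree hjj, rII_agree hjj])
    (fun j j' l _ hjj => by simp only [sndII, sII_agree hjj, hjj.2 {0, 3} (by simp)])
    (fun w _ _ => smoothAt_const 0 _)
    (fun w hw hr => smoothAt_betaII (regular_eqII_iff.1 hr).2.2 (nf w hw hr).1 (hδ w hr))
    (fun w hw hr => (nf w hw hr).2.1) (fun w hw hr => (nf w hw hr).2.2)
    (fun w hw hr => (act0 w hw hr).1) (fun w hw hr => (act0 w hw hr).2) hj hjF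
  have hR : rII (j, m (j, l)) ≠ 0 := (nf _ hl hjF).1
  have hd := hδ (j, l) hjF
  have he := (regular_eqII_iff.1 hjF).2.2
  -- With `ξ₄ = 0`, nullity means `u₃₄ ξ₂ = u₂₄ ξ₃`. Moreover `⟨X, ξ⟩ = 1`, and the factor `2` keeps
  -- the last factor of `lineDeriv_betaII` nonzero, where the factor `1` would make it vanish.
  have e := key ![1, 2 * j.2 {1, 3} / j.2 {0, 3}, 2 * j.2 {2, 3} / j.2 {0, 3}, 0] (by
    simp only [symbol_eqII, Matrix.cons_val]; ring)
  rw [lineDeriv_fun_const, lineDeriv_betaII (by exact he) hR hd] at e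
  have hRm : j.2 {2, 3} - m (j, l) * j.2 {1, 3} = rII (j, m (j, l)) := rfl
  simp only [Fin.sum_univ_four, Matrix.cons_val, fstII, mul_zero, zero_mul, sub_zero, add_zero,
    one_mul]
    at e
  have e3 : 2 * j.2 {2, 3} / j.2 {0, 3} - m (j, l) * (2 * j.2 {1, 3} / j.2 {0, 3}) =
      2 * rII (j, m (j, l)) / j.2 {0, 3} := by rw [← hRm]; ring
  rw [e3] at e
  have e4 : 2 * rII (j, m (j, l)) / j.2 {0, 3} / rII (j, m (j, l)) - 1 / j.2 {0, 3} =
      1 / j.2 {0, 3} := by field_simp; norm_num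
  rw [e4] at e
  exact mul_ne_zero (mul_ne_zero (div_ne_zero (pow_ne_zero 2 hR) hd)
    (div_ne_zero (mul_ne_zero two_ne_zero hR) he)) (one_div_ne_zero he) e

end TypeII

/-! ### Type II: exceptional planes and necessity of the condition -/

section TypeII

variable {Ω : Set J1} {Q : J1 → ℝ}

/-- The three null planes of type II on which the minors `12` and `02` vanish. -/
def exceptionalII (j : Jet) : Fin 3 → Submodule ℝ (Fin 4 → ℝ) :=
  ![annihilatedBy ![0, 1, 0, 0] ![0, 0, 1, 0],
    annihilatedBy ![0, 0, 1, 0] ![j.2 {0, 1} * j.2 {0, 3}, j.2 {0, 1} * j.2 {1, 3}, 0,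
      j.2 {1, 3} * j.2 {0, 3}],
    annihilatedBy ![1, 0, 0, 0] ![0, j.2 {1, 3}, j.2 {2, 3}, 0]]

lemma IsLaxPair.mem_exceptionalII {U : Set Jet} {Λ : Set ℝ} {V W : SpectralField}
    (h : IsLaxPair (eqII Q) U Λ V W) {j : Jet} (hj : j ∈ U ∩ regularJets (eqII Q)) {l : ℝ}
    (hl : l ∈ Λ) (h12 : minor V W 1 2 (j, l) = 0) (h02 : minor V W 0 2 (j, l) = 0) :
    ∃ i, (V (j, l)).1 ∈ exceptionalII j i ∧ (W (j, l)).1 ∈ exceptionalII j i := by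
  obtain ⟨-, hq, he⟩ := regular_eqII_iff.1 hj.2
  have hE := eqII_eq_zero hj.2
  have null : ∀ ξ : Fin 4 → ℝ, _ := fun ξ h1 h2 => h.symbol_comb_eq_zero hj hl (ξ := ξ) h1 h2
  have indep : ∀ r s : ℝ, _ := fun r s e => h.eq_zero_of_smul_eq hj hl (r := r) (s := s) e
  simp only [symbol_eqII, Fin.forall_fin_succ, Fin.sum_univ_four, minor] at null indep h12 h02
  generalize (V (j, l)).1 = v at *
  generalize (W (j, l)).1 = w at *
  suffices H : ((v 1 = 0 ∧ v 2 = 0) ∧ w 1 = 0 ∧ w 2 = 0) ∨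
      ((v 2 = 0 ∧ j.2 {0, 1} * j.2 {0, 3} * v 0 + j.2 {0, 1} * j.2 {1, 3} * v 1 +
        j.2 {1, 3} * j.2 {0, 3} * v 3 = 0) ∧
        w 2 = 0 ∧ j.2 {0, 1} * j.2 {0, 3} * w 0 + j.2 {0, 1} * j.2 {1, 3} * w 1 +
        j.2 {1, 3} * j.2 {0, 3} * w 3 = 0) ∨
      ((v 0 = 0 ∧ j.2 {1, 3} * v 1 + j.2 {2, 3} * v 2 = 0) ∧
        w 0 = 0 ∧ j.2 {1, 3} * w 1 + j.2 {2, 3} * w 2 = 0) by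
    rcases H with H | H | H
    · exact ⟨0, by simpa [exceptionalII, mem_annihilatedBy, Fin.sum_univ_four] using H⟩
    · refine ⟨1, ?_⟩
      simp only [exceptionalII, Matrix.cons_val, mem_annihilatedBy]
      generalize j.2 {0, 1} = c at *
      generalize j.2 {1, 3} = b at *
      generalize j.2 {0, 3} = e at *
      simpa [Fin.sum_univ_four] using H
    · refine ⟨2, ?_⟩
      simp only [exceptionalII, Matrix.cons_val, mem_annihilatedBy]
      generalize j.2 {1, 3} = b at *
      generalize j.2 {2, 3} = a at *
      simpa [Fin.sum_univ_four] using H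
  simp only [Fin.isValue, Fin.succ_zero_eq_one, Fin.succ_one_eq_two, Fin.reduceSucc,
    IsEmpty.forall_iff, and_true] at indep
  generalize j.2 {2, 3} = a at *
  generalize j.2 {1, 3} = b at *
  generalize j.2 {0, 1} = c at *
  generalize j.2 {0, 2} = d at *
  generalize j.2 {0, 3} = e at *
  generalize Q (toJ1 j) = r at *
  by_cases h2 : v 2 = 0 ∧ w 2 = 0
  · obtain ⟨z1, z2⟩ := h2
    have n0 := null ![v 1 * w 3 - v 3 * w 1, v 3 * w 0 - v 0 * w 3, 0, v 0 * w 1 - v 1 * w 0]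
      (by simp; ring) (by simp; ring)
    have n1 := null ![v 1 * w 3 - v 3 * w 1, v 3 * w 0 - v 0 * w 3, 1, v 0 * w 1 - v 1 * w 0]
      (by simp [z1]; ring) (by simp [z2]; ring)
    have t1 : (v 1 * w 3 - v 3 * w 1) * v 0 + (v 3 * w 0 - v 0 * w 3) * v 1 +
      (v 0 * w 1 - v 1 * w 0) * v 3 = 0 := by ring
    have t2 : (v 1 * w 3 - v 3 * w 1) * w 0 + (v 3 * w 0 - v 0 * w 3) * w 1 +
      (v 0 * w 1 - v 1 * w 0) * w 3 = 0 := by ring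
    simp only [Matrix.cons_val] at n0 n1
    by_cases hz : v 1 * w 3 - v 3 * w 1 = 0 ∧ v 0 * w 1 - v 1 * w 0 = 0
    · left
      have := indep (w 1) (v 1)
        ⟨by linarith [hz.2], by ring, by rw [z1, z2]; ring, by linarith [hz.1]⟩
      simp [this, z1, z2]
    · right; left
      generalize v 1 * w 3 - v 3 * w 1 = k0 at *
      generalize v 3 * w 0 - v 0 * w 3 = k1 at *
      generalize v 0 * w 1 - v 1 * w 0 = k3 at *
      -- Here `(k0, k1, k3)` is the cross product of the components `0, 1, 3`. Nullity makes it
      -- proportional to the covector defining the second exceptional plane; the degenerate case `k0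
      -- = k3 = 0` was settled before.
      have e3 : c * k3 = b * k0 := by linarith
      have e0 : k0 * (k1 * e - k0 * b) = 0 := by
        refine (mul_eq_zero.1 (?_ : r * _ = 0)).resolve_left hq
        linear_combination c * n0 - k0 * k1 * hE + (d * k1 + r * k0) * e3
      have e1 : k3 * (k1 * e - c * k3) = 0 := by
        refine (mul_eq_zero.1 (?_ : r * _ = 0)).resolve_left hq
        linear_combination b * n0 - k3 * k1 * hE + (a * k1 - r * k3) * e3
      have e2 : k1 * e = c * k3 := by
        by_cases hk : k0 = 0
        · have hk3 : k3 ≠ 0 := fun hk3 => hz ⟨hk, hk3⟩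
          linarith [(mul_eq_zero.1 e1).resolve_left hk3]
        · linarith [(mul_eq_zero.1 e0).resolve_left hk]
      have fin : ∀ x : Fin 4 → ℝ, k0 * x 0 + k1 * x 1 + k3 * x 3 = 0 →
          c * e * x 0 + c * b * x 1 + b * e * x 3 = 0 := by
        intro x hx
        have y0 : k0 * (c * e * x 0 + c * b * x 1 + b * e * x 3) = 0 := by
          linear_combination c * e * hx - (c * x 1 + e * x 3) * e3 - c * x 1 * e2
        have y3 : k3 * (c * e * x 0 + c * b * x 1 + b * e * x 3) = 0 := by
          linear_combination b * e * hx + e * x 0 * e3 - b * x 1 * e2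
        by_contra hne
        exact hz ⟨(mul_eq_zero.1 y0).resolve_right hne, (mul_eq_zero.1 y3).resolve_right hne⟩
      exact ⟨⟨z1, fin v t1⟩, z2, fin w t2⟩
  · right; right
    obtain ⟨p, hp0, hp1⟩ : ∃ p, v 1 = p * v 2 ∧ w 1 = p * w 2 := by
      by_cases hv : v 2 = 0
      · have hw : w 2 ≠ 0 := fun hw => h2 ⟨hv, hw⟩
        have : v 1 = 0 := by
          rw [hv] at h12
          simpa [hw] using h12
        exact ⟨w 1 / w 2, by rw [hv, this, mul_zero], by field_simp⟩
      · exact ⟨v 1 / v 2, by field_simp, by field_simp; linarith⟩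
    obtain ⟨q, hq0, hq1⟩ : ∃ q, v 0 = q * v 2 ∧ w 0 = q * w 2 := by
      by_cases hv : v 2 = 0
      · have hw : w 2 ≠ 0 := fun hw => h2 ⟨hv, hw⟩
        have : v 0 = 0 := by
          rw [hv] at h02
          simpa [hw] using h02
        exact ⟨w 0 / w 2, by rw [hv, this, mul_zero], by field_simp⟩
      · exact ⟨v 0 / v 2, by field_simp, by field_simp; linarith⟩
    have n0 := null ![1, 0, -q, 0] (by simp [hq0]) (by simp [hq1])
    have n1 := null ![1, 1, -p - q, 0] (by simp [hq0, hp0]; ring) (by simp [hq1, hp1]; ring)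
    simp only [Matrix.cons_val] at n0 n1
    have e1 : q * b = 0 := by linarith
    have e2 : a + p * b = 0 := by linarith
    have hb : b ≠ 0 := fun hb => by
      have : r * e = 0 := by linear_combination -hE + c * e2 - (c * p + d) * hb
      exact mul_ne_zero hq he this
    have hq : q = 0 := (mul_eq_zero.1 e1).resolve_right hb
    subst hq
    exact ⟨⟨by linarith, by linear_combination b * hp0 + v 2 * e2⟩, by linarith,
      by linear_combination b * hp1 + w 2 * e2⟩

lemma finrank_exceptionalII {j : Jet} (hj : j ∈ regularJets (eqII Q)) (i : Fin 3) :
    Module.finrank ℝ (exceptionalII j i) = 2 := by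
  obtain ⟨-, hq, he⟩ := regular_eqII_iff.1 hj
  have hE := eqII_eq_zero hj
  have hd := mul_ne_zero hq he
  rw [← hE] at hd
  fin_cases i
  · exact finrank_annihilatedBy (a := 1) (b := 2) (by simp)
  · by_cases hc : j.2 {0, 1} = 0
    · refine finrank_annihilatedBy (a := 2) (b := 3) ?_
      simp only [Matrix.cons_val]
      rw [zero_mul, sub_zero, one_mul]
      refine mul_ne_zero (fun hb => hd ?_) he
      rw [hc, hb]; ring
    · refine finrank_annihilatedBy (a := 2) (b := 0) ?_
      simp only [Matrix.cons_val]
      rw [zero_mul, sub_zero, one_mul]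
      exact mul_ne_zero hc he
  · by_cases hb : j.2 {1, 3} = 0
    · refine finrank_annihilatedBy (a := 0) (b := 2) ?_
      simp only [Matrix.cons_val]
      rw [zero_mul, sub_zero, one_mul]
      intro ha
      refine hd ?_
      rw [ha, hb]; ring
    · refine finrank_annihilatedBy (a := 0) (b := 1) ?_
      simp only [Matrix.cons_val]
      rw [zero_mul, sub_zero, one_mul]
      exact hb

lemma smoothAt_condII {w : Jet × ℝ} (hQ : ContDiffAt ℝ ∞ Q (toJ1 w.1)) (he : w.1.2 {0, 3} ≠ 0) :
    SmoothAt (fun v => condII Q v.1) w := by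
  have sh : ∀ d d', SmoothAt (fun v => hess Q (toJ1 v.1) d d') w := fun d d' =>
    SmoothAt.comp_toJ1 (h := fun q => hess Q q d d')
      ((((hQ.fderiv_right (m := ∞) (by decide)).fderiv_right (m := ∞) (by decide)).clm_apply
        contDiffAt_const).clm_apply contDiffAt_const)
  have sc := fun I => smoothAt_coord I w
  have se := sc {0, 3}
  exact ((((sh _ _).add (sh _ _)).add ((((smoothAt_const 2 w).mul (sc _)).sub
    ((((sc _).mul (sc _)).add ((sc _).mul (sc _))).div se he)).mul (sh _ _))).add
    (((sc _).sub (((sc _).mul (sc _)).div se he)).mul (sh _ _))).add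
    (((sc _).sub (((sc _).mul (sc _)).div se he)).mul (sh _ _))

/-- The dichotomy is that of type III. The self-dual parameter now has two exceptional values `0`
and `1`, so two values of `λ` do not suffice; an interval of them does. -/
theorem LaxIntegrable.condII_eq_zero (hΩ : IsOpen Ω) (hQ : ContDiffOn ℝ ∞ Q Ω)
    (hQ0 : ∀ q ∈ Ω, Q q ≠ 0) (hi : IsInvariantII Ω Q)
    (h : LaxIntegrable (eqII Q) (toJ1 ⁻¹' Ω)) {j : Jet} (hj : toJ1 j ∈ Ω)
    (hreg : j ∈ regularJets (eqII Q)) : condII Q j = 0 := by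
  by_contra hne
  obtain ⟨U, Λ, V, W, hjU, hLax⟩ := h j ⟨hj, hreg⟩
  have hQc : ∀ q ∈ Ω, ContDiffAt ℝ ∞ Q q := fun q hq => hQ.contDiffAt (hΩ.mem_nhds hq)
  set S' : Set (Jet × ℝ) := {w ∈ U ×ˢ Λ ∩ (fun w => toJ1 w.1) ⁻¹' Ω | w.1.2 {0, 3} ≠ 0}
  have hS' : IsOpen S' := isOpen_sep_ne_zero
    ((hLax.isOpen_jets.prod hLax.isOpen_param).inter
      (hΩ.preimage (continuous_toJ1.comp continuous_fst)))
    fun w _ => smoothAt_coord {0, 3} w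
  set S : Set (Jet × ℝ) := {w ∈ S' | condII Q w.1 ≠ 0}
  have hS : IsOpen S := isOpen_sep_ne_zero hS' fun w hw => smoothAt_condII (hQc _ hw.1.2) hw.2
  have hSm : ∀ a b, IsOpen {w ∈ S | minor V W a b w ≠ 0} := fun a b =>
    isOpen_sep_ne_zero hS fun w hw => hLax.smoothAt_minor a b hw.1.1.1
  by_cases hA : ∃ w ∈ S, w.1 ∈ regularJets (eqII Q) ∧ minor V W 2 1 w ≠ 0
  · obtain ⟨⟨i, l⟩, hw, hr, hmin⟩ := hA
    obtain ⟨X, Y, hN, -⟩ := hLax.exists_normalPair (hSm 2 1) (fun w hw => hw.1.1.1.1)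
      fun w hw => hw.2
    have param : ∀ l, (i, l) ∈ {w ∈ S | minor V W 2 1 w ≠ 0} →
        paramII Q X Y (i, l) = 0 ∨ paramII Q X Y (i, l) = 1 := by
      intro l hl
      by_contra hv
      push Not at hv
      exact hl.1.2 (DispersionlessLax.condII_eq_zero hΩ hQ hQ0 hi (hSm 2 1)
        (fun w hw => hw.1.1.1.2) hN hl hr hv.1 hv.2)
    have inj : ∀ l l', (i, l) ∈ {w ∈ S | minor V W 2 1 w ≠ 0} →
        (i, l') ∈ {w ∈ S | minor V W 2 1 w ≠ 0} →
        paramII Q X Y (i, l) = paramII Q X Y (i, l') → l = l' := by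
      intro l l' hl hl' e
      obtain ⟨n1, n2, n3, n4⟩ := normalPair_alphaII hN (w := (i, l)) hl hr
      obtain ⟨n1', n2', n3', n4'⟩ := normalPair_alphaII hN (w := (i, l')) hl' hr
      refine hN.inj i hr l l' hl hl' (funext fun k => ?_) (funext fun k => ?_)
      · fin_cases k
        · change (X (i, l)).1 0 = (X (i, l')).1 0
          rw [n1, n1', e]
        · exact (hN.fst_b _ hl).trans (hN.fst_b _ hl').symm
        · exact (hN.fst_a _ hl).trans (hN.fst_a _ hl').symm
        · change (X (i, l)).1 3 = (X (i, l')).1 3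
          rw [n2, n2', e]
      · fin_cases k
        · change (Y (i, l)).1 0 = (Y (i, l')).1 0
          rw [n3, n3', e]
        · exact (hN.snd_b _ hl).trans (hN.snd_b _ hl').symm
        · exact (hN.snd_a _ hl).trans (hN.snd_a _ hl').symm
        · change (Y (i, l)).1 3 = (Y (i, l')).1 3
          rw [n4, n4', e]
    -- Infinitely many `λ` would be mapped injectively into `{0, 1}`.
    have hinf : {l | (i, l) ∈ {w ∈ S | minor V W 2 1 w ≠ 0}}.Infinite :=
      infinite_of_mem_nhds l (((hSm 2 1).preimage
        (by fun_prop : Continuous fun l' : ℝ => (i, l'))).mem_nhds ⟨hw, hmin⟩)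
    refine hinf (Set.Finite.of_finite_image
      (f := fun l => paramII Q X Y (i, l)) ?_ fun l hl l' hl' e => inj l l' hl hl' e)
    refine (Set.toFinite {(0 : ℝ), 1}).subset ?_
    rintro _ ⟨l, hl, rfl⟩
    simpa using param l hl
  · push Not at hA
    obtain ⟨l, hl, hP⟩ := hLax.exists_not_le ⟨hjU, hreg⟩ (finrank_exceptionalII hreg)
    have hjS : (j, l) ∈ S := ⟨⟨⟨⟨hjU, hl⟩, hj⟩, (regular_eqII_iff.1 hreg).2.2⟩, hne⟩
    have hm : minor V W 0 2 (j, l) ≠ 0 := fun h0 => by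
      have h21 := hA _ hjS hreg
      obtain ⟨i, hi⟩ := hLax.mem_exceptionalII ⟨hjU, hreg⟩ hl
        (by simp only [minor] at h21 ⊢; linarith) h0
      exact hP i hi
    obtain ⟨X, Y, hN, hmin⟩ := hLax.exists_normalPair (hSm 0 2) (fun w hw => hw.1.1.1.1)
      fun w hw => hw.2
    refine not_normalPair_betaII hΩ hQ hQ0 (hSm 0 2) (fun w hw => hw.1.1.1.2) hN
      (fun w hw hr => ?_) (j := j) (l₀ := l) ⟨hjS, hm⟩ hreg
    have e := hmin w hw 2 1
    rw [hA w hw.1 hr, minor, hN.snd_b w hw, hN.fst_b w hw] at e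
    have := (mul_eq_zero.1 e).resolve_right hw.2
    linarith

/-- The integrability conditions of type II at a 1-jet. -/
structure CondII (Q : J1 → ℝ) (q : J1) : Prop where
  h11 : hess Q q (bp 1) (bp 1) = 0
  h12 : hess Q q (bp 1) (bp 2) = 0
  h22 : hess Q q (bp 2) (bp 2) = 0
  div : hess Q q (bx 2) (bp 2) + hess Q q (bx 1) (bp 1) = 0

lemma LaxIntegrable.condII_of_ne_zero (hΩ : IsOpen Ω) (hQ : ContDiffOn ℝ ∞ Q Ω)
    (hQ0 : ∀ q ∈ Ω, Q q ≠ 0) (hi : IsInvariantII Ω Q)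
    (h : LaxIntegrable (eqII Q) (toJ1 ⁻¹' Ω)) {q : J1} (hq : q ∈ Ω) : CondII Q q := by
  have hL := leadingForm_eqII hΩ hQ hQ0
  have main : ∀ v m c : ℝ, hess Q q (bx 2) (bp 2) + hess Q q (bx 1) (bp 1) +
      (2 * m - Q q) * hess Q q (bp 1) (bp 2) + c * hess Q q (bp 2) (bp 2) +
      v * hess Q q (bp 1) (bp 1) = 0 := by
    intro v m c
    -- With `u₁₂ = 1`, `u₁₃ = u₂₄ = 0` and `u₃₄ = Q` the equation reads `Q = Q u₁₄`, so `u₁₄ = 1`;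
    -- `u₂₂`, `u₂₃`, `u₃₃` stay free.
    set M : Multiset (Fin 4) → ℝ := fun I =>
      if I = {0, 1} then 1 else if I = {2, 3} then Q q else if I = {0, 2} then 0 else
      if I = {1, 3} then 0 else if I = {1, 1} then v else
      if I = {1, 2} then m else c with hM
    set j := solve (eqII Q) {0, 3} ![1, 0, 0, 1] (fun q => -Q q) (extendJet q M) with hj
    have hjq : toJ1 j = q := by rw [hj, hL.toJ1_solve, toJ1_extendJet]
    have hF : j ∈ prolongation (eqII Q) := hL.solve_mem (by rwa [toJ1_extendJet])
    have hval : ∀ i k : Fin 4, ¬({0, 3} : Multiset (Fin 4)) ≤ {i, k} → j.2 {i, k} = M {i, k} :=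
      fun i k h => by rw [hj, LeadingForm.solve_of_not_le _ h, extendJet_apply _ _ (by simp)]
    have v01 : j.2 {0, 1} = 1 := hval 0 1 (by decide)
    have v23 : j.2 {2, 3} = Q q := by
      rw [hval 2 3 (by decide), hM]; exact (if_neg (by decide)).trans (if_pos rfl)
    have v02 : j.2 {0, 2} = 0 := hval 0 2 (by decide)
    have v13 : j.2 {1, 3} = 0 := hval 1 3 (by decide)
    have v11 : j.2 {1, 1} = v := hval 1 1 (by decide)
    have v12 : j.2 {1, 2} = m := hval 1 2 (by decide)
    have v22 : j.2 {2, 2} = c := hval 2 2 (by decide)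
    have hE : eqII Q j = 0 := hF []
    rw [eqII, v01, v23, v02, v13, hjq] at hE
    have h0 := hQ0 q hq
    have he : j.2 {0, 3} = 1 := mul_left_cancel₀ h0 (by linarith)
    have e := h.condII_eq_zero hΩ hQ hQ0 hi (j := j) (by rwa [hjq])
      (regular_eqII_iff.2 ⟨hF, by rwa [hjq], by rw [he]; exact one_ne_zero⟩)
    rw [condII, hjq, v01, v02, v11, v12, v13, v22, v23, he] at e
    linear_combination e
  have h11 : hess Q q (bp 1) (bp 1) = 0 := by linear_combination main 1 0 0 - main 0 0 0
  have h22 : hess Q q (bp 2) (bp 2) = 0 := by linear_combination main 0 0 1 - main 0 0 0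
  have h12 : hess Q q (bp 1) (bp 2) = 0 := by
    linear_combination (main 0 1 0 - main 0 0 0) / 2
  refine ⟨h11, h12, h22, ?_⟩
  have := main 0 0 0
  rw [h12] at this
  linarith

/-- Regular jets exist only over `Q ≠ 0`, which gives the conditions there and, by continuity, on
its closure in `Ω`. At the other points `Q` vanishes nearby and so does its second derivative. -/
theorem LaxIntegrable.condII (hΩ : IsOpen Ω) (hQ : ContDiffOn ℝ ∞ Q Ω) (hi : IsInvariantII Ω Q)
    (h : LaxIntegrable (eqII Q) (toJ1 ⁻¹' Ω)) {q : J1} (hq : q ∈ Ω) : CondII Q q := by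
  have hc : ∀ d d', ContinuousOn (fun r => hess Q r d d') Ω := fun d d' r hr =>
    ((((((hQ.contDiffAt (hΩ.mem_nhds hr)).fderiv_right (m := ∞) (by decide)).fderiv_right
      (m := ∞) (by decide)).clm_apply contDiffAt_const).clm_apply
        contDiffAt_const).continuousAt).continuousWithinAt
  set Ω₀ : Set J1 := Ω ∩ Q ⁻¹' {0}ᶜ
  have hΩ₀ : IsOpen Ω₀ := hQ.continuousOn.isOpen_inter_preimage hΩ isOpen_compl_singleton
  have h₀ : ∀ r ∈ Ω₀, CondII Q r := fun r hr =>
    LaxIntegrable.condII_of_ne_zero hΩ₀ (hQ.mono Set.inter_subset_left) (fun _ h => h.2)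
      (fun r hr => hi r hr.1) (fun j hj => h j ⟨hj.1.1, hj.2⟩) hr
  have key : ∀ g : J1 → ℝ, ContinuousOn g Ω → (∀ r ∈ Ω₀, g r = 0) →
      ((∀ᶠ r in 𝓝 q, Q r = 0) → g q = 0) → g q = 0 := by
    intro g hg h1 h2
    by_contra hne
    refine hne (h2 ?_)
    filter_upwards [hΩ.mem_nhds hq,
      (hg.continuousAt (hΩ.mem_nhds hq)).eventually_ne hne] with r hr hgr
    by_contra hQr
    exact hgr (h1 r ⟨hr, hQr⟩)
  have hz : (∀ᶠ r in 𝓝 q, Q r = 0) → ∀ d d', hess Q q d d' = 0 := by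
    intro hQz d d'
    have h1 : fderiv ℝ Q =ᶠ[𝓝 q] fun _ => 0 := by
      filter_upwards [hQz.eventually_nhds] with r hr
      rw [Filter.EventuallyEq.fderiv_eq (f := fun _ => (0 : ℝ)) hr]; simp
    rw [hess, h1.fderiv_eq]; simp
  exact
  { h11 := key _ (hc _ _) (fun r hr => (h₀ r hr).h11) fun hq => hz hq _ _
    h12 := key _ (hc _ _) (fun r hr => (h₀ r hr).h12) fun hq => hz hq _ _
    h22 := key _ (hc _ _) (fun r hr => (h₀ r hr).h22) fun hq => hz hq _ _
    div := key _ ((hc _ _).add (hc _ _)) (fun r hr => (h₀ r hr).div) fun hq => by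
      simp [hz hq] }

end TypeII

/-! ### The Lax pairs -/

lemma SpectralField.bracket_fst (X Y : SpectralField) (i : Fin 4) (w : Jet × ℝ) :
    (X.bracket Y w).1 i = X.act (fun v => (Y v).1 i) w - Y.act (fun v => (X v).1 i) w := rfl

lemma SpectralField.bracket_snd (X Y : SpectralField) (w : Jet × ℝ) :
    (X.bracket Y w).2 = X.act (fun v => (Y v).2) w - Y.act (fun v => (X v).2) w := rfl

lemma projectedPlane_fst_mem (V W : SpectralField) (w : Jet × ℝ) :
    (V w).1 ∈ projectedPlane V W w := Submodule.subset_span (by simp)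

lemma projectedPlane_snd_mem (V W : SpectralField) (w : Jet × ℝ) :
    (W w).1 ∈ projectedPlane V W w := Submodule.subset_span (by simp)

section TypeIII

variable {Ω : Set J1} {Q : J1 → ℝ}

lemma laxVIII_snd {w : Jet × ℝ} (hi : IsInvariantIII Ω Q) (hw : toJ1 w.1 ∈ Ω) :
    (laxVIII Q w).2 = dtot 3 Q w.1 * w.2 := by
  rw [dtot_eqIII hi hw, (hi _ hw).1]
  have p30 : ({3, 0} : Multiset (Fin 4)) = {0, 3} := by decide
  have p31 : ({3, 1} : Multiset (Fin 4)) = {1, 3} := by decide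
  have p32 : ({3, 2} : Multiset (Fin 4)) = {2, 3} := by decide
  rw [p30, p31, p32, zero_add]
  rfl

lemma laxWIII_snd {w : Jet × ℝ} (hi : IsInvariantIII Ω Q) (hw : toJ1 w.1 ∈ Ω) :
    (laxWIII Q w).2 = dtot 2 Q w.1 * w.2 := by
  rw [dtot_eqIII hi hw]
  have p20 : ({2, 0} : Multiset (Fin 4)) = {0, 2} := by decide
  have p21 : ({2, 1} : Multiset (Fin 4)) = {1, 2} := by decide
  rw [p20, p21]
  rfl

/-- On solutions `[V, W] = -(D_z Q) V`. The `x`- and `z`-components of this identity are `D_z` and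
`D_x` of the equation, the `t`-component holds by the form of `W`, and the `∂_λ`-component is `λ *
condIII = 0`. -/
theorem isLaxPair_eqIII (hΩ : IsOpen Ω) (hQ : ContDiffOn ℝ ∞ Q Ω) (hi : IsInvariantIII Ω Q)
    (hC : ∀ q ∈ Ω, CondIII Q q) :
    IsLaxPair (eqIII Q) (toJ1 ⁻¹' Ω) Set.univ (laxVIII Q) (laxWIII Q) := by
  have hQc : ∀ j, toJ1 j ∈ Ω → ContDiffAt ℝ ∞ Q (toJ1 j) := fun j hj =>
    hQ.contDiffAt (hΩ.mem_nhds hj)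
  have hU : IsOpen (toJ1 ⁻¹' Ω) := hΩ.preimage continuous_toJ1
  have hev : ∀ w : Jet × ℝ, toJ1 w.1 ∈ Ω → ∀ᶠ v : Jet × ℝ in 𝓝 w, toJ1 v.1 ∈ Ω := fun w hw =>
    continuous_fst.continuousAt.eventually_mem (hU.mem_nhds hw)
  have eV : ∀ w : Jet × ℝ, toJ1 w.1 ∈ Ω →
      (fun v => (laxVIII Q v).2) =ᶠ[𝓝 w] fun v => dtot 3 Q v.1 * v.2 := fun w hw =>
    (hev w hw).mono fun v hv => laxVIII_snd hi hv
  have eW : ∀ w : Jet × ℝ, toJ1 w.1 ∈ Ω →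
      (fun v => (laxWIII Q v).2) =ᶠ[𝓝 w] fun v => dtot 2 Q v.1 * v.2 := fun w hw =>
    (hev w hw).mono fun v hv => laxWIII_snd hi hv
  have sd : ∀ w : Jet × ℝ, toJ1 w.1 ∈ Ω → SmoothAt (fun v => v.2 + v.1.2 {0, 2} - Q (toJ1 v.1)) w :=
    fun w hw => ((smoothAt_param w).add (smoothAt_coord _ w)).sub (SmoothAt.comp_toJ1 (hQc _ hw))
  refine
  { isOpen_jets := hU
    isOpen_param := isOpen_univ
    nonempty_param := Set.univ_nonempty
    smooth_base := ?_
    smooth_spectral := ?_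
    rank_two := ?_
    characteristic := ?_
    parametrized := ?_
    frobenius := ?_ }
  · rintro w ⟨hw, -⟩ i
    fin_cases i
    · exact ⟨(smoothAt_coord _ w).neg, (smoothAt_coord _ w).neg⟩
    · exact ⟨smoothAt_const 0 w, smoothAt_const 1 w⟩
    · exact ⟨smoothAt_coord _ w, sd w hw⟩
    · exact ⟨smoothAt_param w, smoothAt_const 0 w⟩
  · rintro w ⟨hw, -⟩
    exact ⟨((smoothAt_dtot (hQc _ hw) 3).mul (smoothAt_param w)).congr (eV w hw),
      ((smoothAt_dtot (hQc _ hw) 2).mul (smoothAt_param w)).congr (eW w hw)⟩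
  · rintro j ⟨-, hj⟩ l -
    have hb := (regular_eqIII_iff.1 hj).2
    rw [LinearIndependent.pair_iff]
    intro s t h
    have h1 := congrFun h 1
    have h0 := congrFun h 0
    simp [laxVIII, laxWIII] at h1
    simp only [laxVIII, laxWIII, Pi.add_apply, Pi.smul_apply, h1, smul_eq_mul, Matrix.cons_val,
      zero_mul, neg_zero, add_zero, Pi.zero_apply, mul_neg, neg_eq_zero, mul_eq_zero, hb, or_false] at h0
    exact ⟨h0, h1⟩
  · rintro j ⟨-, hj⟩ l - ξ hξ
    have h1 := hξ _ (projectedPlane_fst_mem _ _ _)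
    have h2 := hξ _ (projectedPlane_snd_mem _ _ _)
    simp only [laxVIII, laxWIII, Fin.sum_univ_four, Matrix.cons_val] at h1 h2
    rw [symbol_eqIII]
    -- The symbol is identically `ξ₄ ⟨ξ, W⟩ - ξ₃ ⟨ξ, V⟩`.
    linear_combination ξ 3 * h2 - ξ 2 * h1
  · rintro j ⟨-, hj⟩ l - l' - h
    have hb := (regular_eqIII_iff.1 hj).2
    have hm : (laxVIII Q (j, l)).1 ∈ projectedPlane (laxVIII Q) (laxWIII Q) (j, l') := by
      have : projectedPlane (laxVIII Q) (laxWIII Q) (j, l) =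
        projectedPlane (laxVIII Q) (laxWIII Q) (j, l') := h
      rw [← this]
      exact projectedPlane_fst_mem _ _ _
    obtain ⟨s, t, h⟩ := Submodule.mem_span_pair.1 hm
    have h1 := congrFun h 1
    have h0 := congrFun h 0
    have h3 := congrFun h 3
    simp [laxVIII, laxWIII] at h1
    simp only [laxVIII, laxWIII, Pi.add_apply, Pi.smul_apply, h1, smul_eq_mul, Matrix.cons_val,
      zero_mul, add_zero] at h0 h3
    have : s = 1 := mul_right_cancel₀ (neg_ne_zero.2 hb) (by rw [h0, one_mul])
    rw [this, one_mul] at h3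
    exact h3.symm
  · rintro j ⟨hjΩ, hj⟩ l -
    have hF := hj.1
    have hc0 : condIII Q j = 0 := by
      rw [condIII_eq_polyIII hΩ hQ hi hjΩ hF]
      exact (hC _ hjΩ).polyIII_eq_zero (hQc _ hjΩ) _ _ _ _ _ _ _ _
    have hD : totalDeriv 2 (eqIII Q) j = 0 := hF [2]
    rw [totalDeriv_eqIII ((hQc j hjΩ).differentiableAt (by simp))] at hD
    refine Submodule.mem_span_pair.2 ⟨-dtot 2 Q j, 0, ?_⟩
    rw [zero_smul, add_zero]
    have hw : toJ1 ((j, l) : Jet × ℝ).1 ∈ Ω := hjΩ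
    have aq : ∀ (X : SpectralField), X.act (fun v => v.2 + v.1.2 {0, 2} - Q (toJ1 v.1)) (j, l) =
        (X (j, l)).2 + ∑ i, (X (j, l)).1 i * j.2 (i ::ₘ {0, 2}) -
          ∑ i, (X (j, l)).1 i * dtot i Q j := by
      intro X
      rw [X.act_sub ((smoothAt_param _).add (smoothAt_coord _ _)) (SmoothAt.comp_toJ1 (hQc _ hw)),
        X.act_add (smoothAt_param _) (smoothAt_coord _ _), X.act_param, X.act_coord,
        X.act_toJ1 (hQc _ hw)]
    have ad : ∀ (X : SpectralField) (k : Fin 4), X.act (fun v => dtot k Q v.1 * v.2) (j, l) =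
        (∑ i, (X (j, l)).1 i * totalDeriv i (dtot k Q) j) * l + dtot k Q j * (X (j, l)).2 := by
      intro X k
      rw [X.act_mul (smoothAt_dtot (hQc _ hw) k) (smoothAt_param _), X.act_param,
        X.act_jet (smoothAt_dtot (hQc _ hw) k)]
    have an : ∀ (X : SpectralField) (I : Multiset (Fin 4)), X.act (fun v => -v.1.2 I) (j, l) =
        -∑ i, (X (j, l)).1 i * j.2 (i ::ₘ I) := by
      intro X I
      rw [X.act_neg (smoothAt_coord _ _), X.act_coord]
    refine Prod.ext (funext fun i => ?_) ?_
    · rw [SpectralField.bracket_fst]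
      fin_cases i
      · change -dtot 2 Q j * -j.2 {2, 3} =
          (laxVIII Q).act (fun v => -v.1.2 {2, 2}) (j, l) -
            (laxWIII Q).act (fun v => -v.1.2 {2, 3}) (j, l)
        rw [an, an]
        simp only [laxVIII, laxWIII, Fin.sum_univ_four, Matrix.cons_val]
        simp only [Multiset.insert_eq_cons, ← Multiset.cons_zero, Multiset.cons_swap] at hD ⊢
        linear_combination -hD
      · change -dtot 2 Q j * 0 = (laxVIII Q).act (fun v => 1) (j, l) -
            (laxWIII Q).act (fun v => 0) (j, l)
        rw [SpectralField.act_const, SpectralField.act_const]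
        ring
      · change -dtot 2 Q j * j.2 {0, 3} =
          (laxVIII Q).act (fun v => v.2 + v.1.2 {0, 2} - Q (toJ1 v.1)) (j, l) -
            (laxWIII Q).act (fun v => v.1.2 {0, 3}) (j, l)
        rw [aq, SpectralField.act_coord, laxVIII_snd hi hw]
        have hD : totalDeriv 0 (eqIII Q) j = 0 := hF [0]
        rw [totalDeriv_eqIII ((hQc j hjΩ).differentiableAt (by simp))] at hD
        simp only [laxVIII, laxWIII, Fin.sum_univ_four, Matrix.cons_val]
        simp only [Multiset.insert_eq_cons, ← Multiset.cons_zero, Multiset.cons_swap] at hD ⊢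
        linear_combination hD
      · change -dtot 2 Q j * l = (laxVIII Q).act (fun v => 0) (j, l) -
            (laxWIII Q).act (fun v => v.2) (j, l)
        rw [SpectralField.act_const, SpectralField.act_param, laxWIII_snd hi hw]
        ring
    · rw [SpectralField.bracket_snd, SpectralField.act_congr_of_eventuallyEq _ (eV _ hw),
        SpectralField.act_congr_of_eventuallyEq _ (eW _ hw), ad, ad, laxVIII_snd hi hw,
        laxWIII_snd hi hw, Prod.smul_snd, smul_eq_mul, laxVIII_snd hi hw]
      rw [condIII] at hc0
      have h30 := totalDeriv_dtot_comm (hQc j hjΩ) 3 2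
      simp only [laxVIII, laxWIII, Fin.sum_univ_four, Matrix.cons_val]
      linear_combination -l * hc0 - l ^ 2 * h30

lemma IsLaxPair.laxIntegrable {F : Jet → ℝ} {U : Set Jet} {Λ : Set ℝ} {V W : SpectralField}
    (h : IsLaxPair F U Λ V W) : LaxIntegrable F U := fun _ hj => ⟨U, Λ, V, W, hj.1, h⟩

end TypeIII

/-! ### Directional derivatives -/

section LineDeriv

variable {E : Type*} [NormedAddCommGroup E] [NormedSpace ℝ E] {f g : E → ℝ} {f' g' : ℝ} {q d : E}

lemma hasLineDerivAt_const (a : ℝ) (q d : E) : HasLineDerivAt ℝ (fun _ => a) 0 q d :=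
  hasDerivAt_const 0 a

lemma hasLineDerivAt_clm (L : E →L[ℝ] ℝ) (q d : E) : HasLineDerivAt ℝ (fun r => L r) (L d) q d :=
  L.hasFDerivAt.hasLineDerivAt d

lemma _root_.HasLineDerivAt.add (hf : HasLineDerivAt ℝ f f' q d) (hg : HasLineDerivAt ℝ g g' q d) :
    HasLineDerivAt ℝ (fun r => f r + g r) (f' + g') q d := HasDerivAt.add hf hg

lemma _root_.HasLineDerivAt.sub (hf : HasLineDerivAt ℝ f f' q d) (hg : HasLineDerivAt ℝ g g' q d) :
    HasLineDerivAt ℝ (fun r => f r - g r) (f' - g') q d := HasDerivAt.sub hf hg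

lemma _root_.HasLineDerivAt.neg (hf : HasLineDerivAt ℝ f f' q d) :
    HasLineDerivAt ℝ (fun r => -f r) (-f') q d := HasDerivAt.neg hf

lemma _root_.HasLineDerivAt.mul (hf : HasLineDerivAt ℝ f f' q d) (hg : HasLineDerivAt ℝ g g' q d) :
    HasLineDerivAt ℝ (fun r => f r * g r) (f' * g q + f q * g') q d := by
  have := HasDerivAt.fun_mul hf hg
  simp only [zero_smul, add_zero] at this
  exact this

lemma _root_.HasLineDerivAt.div (hf : HasLineDerivAt ℝ f f' q d) (hg : HasLineDerivAt ℝ g g' q d)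
    (h : g q ≠ 0) :
    HasLineDerivAt ℝ (fun r => f r / g r) ((f' * g q - f q * g') / g q ^ 2) q d := by
  have := HasDerivAt.fun_div hf hg (by simpa using h)
  simp only [zero_smul, add_zero] at this
  exact this

lemma _root_.HasLineDerivAt.const_mul (a : ℝ) (hf : HasLineDerivAt ℝ f f' q d) :
    HasLineDerivAt ℝ (fun r => a * f r) (a * f') q d := HasDerivAt.const_mul a hf

lemma _root_.ContDiffAt.hasLineDerivAt (hf : ContDiffAt ℝ ∞ f q) (d : E) :
    HasLineDerivAt ℝ f (fderiv ℝ f q d) q d :=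
  (hf.differentiableAt (by simp)).hasFDerivAt.hasLineDerivAt d

lemma _root_.HasLineDerivAt.fderiv_eq (hf : HasLineDerivAt ℝ f f' q d)
    (h : DifferentiableAt ℝ f q) : fderiv ℝ f q d = f' :=
  (h.hasFDerivAt.hasLineDerivAt d).unique hf

lemma _root_.ContDiffAt.fderiv_dir {n : WithTop ℕ∞} (hn : n + 1 ≤ ∞) (hf : ContDiffAt ℝ ∞ f q)
    (d : E) : ContDiffAt ℝ n (fun r => fderiv ℝ f r d) q :=
  (hf.fderiv_right hn).clm_apply contDiffAt_const

end LineDeriv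

lemma hess_eq_fderiv {Q : J1 → ℝ} {q : J1} (hQ : ContDiffAt ℝ ∞ Q q) (d d' : J1) :
    hess Q q d d' = fderiv ℝ (fun r => fderiv ℝ Q r d') q d := by
  have hd := (hQ.fderiv_right (m := ∞) (by decide)).differentiableAt (by simp)
  rw [fderiv_clm_apply hd (differentiableAt_const d')]
  simp [hess]

lemma hasLineDerivAt_fderiv {Q : J1 → ℝ} {q : J1} (hQ : ContDiffAt ℝ ∞ Q q) (d d' : J1) :
    HasLineDerivAt ℝ (fun r => fderiv ℝ Q r d') (hess Q q d d') q d := by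
  rw [hess_eq_fderiv hQ]
  exact (hQ.fderiv_dir (n := ∞) (by decide) d').hasLineDerivAt d

/-- Second derivatives from a local formula for a first derivative. -/
lemma hess_of_eventuallyEq {Q P : J1 → ℝ} {q d d' : J1} {P' : ℝ} (hQ : ContDiffAt ℝ ∞ Q q)
    (h : (fun r => fderiv ℝ Q r d') =ᶠ[𝓝 q] P) (hP : HasLineDerivAt ℝ P P' q d) :
    hess Q q d d' = P' := by
  have h1 := hasLineDerivAt_fderiv hQ d d'
  have hc : Filter.Tendsto (fun t : ℝ => q + t • d) (𝓝 0) (𝓝 q) := by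
    have : Continuous fun t : ℝ => q + t • d := by fun_prop
    simpa using this.tendsto 0
  exact h1.unique (HasDerivAt.congr_of_eventuallyEq hP (hc.eventually h))

/-! ### Functions of two variables -/

lemma fderiv_eq_pd (f : ℝ × ℝ → ℝ) (a d : ℝ × ℝ) :
    fderiv ℝ f a d = pd1 f a * d.1 + pd2 f a * d.2 := by
  have : d = d.1 • (1, 0) + d.2 • (0, 1) := by simp
  conv_lhs => rw [this]
  rw [map_add, map_smul, map_smul, pd1, pd2, smul_eq_mul, smul_eq_mul]
  ring

lemma _root_.ContDiffAt.pd1 {f : ℝ × ℝ → ℝ} {a : ℝ × ℝ} (h : ContDiffAt ℝ ∞ f a) :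
    ContDiffAt ℝ ∞ (pd1 f) a := h.fderiv_dir (by decide) _

lemma _root_.ContDiffAt.pd2 {f : ℝ × ℝ → ℝ} {a : ℝ × ℝ} (h : ContDiffAt ℝ ∞ f a) :
    ContDiffAt ℝ ∞ (pd2 f) a := h.fderiv_dir (by decide) _

lemma pd1_pd2 {f : ℝ × ℝ → ℝ} {a : ℝ × ℝ} (h : ContDiffAt ℝ ∞ f a) :
    pd1 (pd2 f) a = pd2 (pd1 f) a := by
  have hd := (h.fderiv_right (m := ∞) (by decide)).differentiableAt (by simp)
  have hs : IsSymmSndFDerivAt ℝ f a :=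
    h.isSymmSndFDerivAt (by rw [minSmoothness_of_isRCLikeNormedField]; decide)
  have e : ∀ d d' : ℝ × ℝ, fderiv ℝ (fun r => fderiv ℝ f r d) a d' =
      fderiv ℝ (fderiv ℝ f) a d' d := fun d d' => by
    rw [fderiv_clm_apply hd (differentiableAt_const d)]; simp
  change fderiv ℝ (fun r => fderiv ℝ f r (0, 1)) a (1, 0) =
    fderiv ℝ (fun r => fderiv ℝ f r (1, 0)) a (0, 1)
  rw [e, e]
  exact hs _ _

lemma _root_.HasLineDerivAt.pd1_eq {f : ℝ × ℝ → ℝ} {a : ℝ × ℝ} {c : ℝ}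
    (h : HasLineDerivAt ℝ f c a (1, 0)) (hf : ContDiffAt ℝ ∞ f a) : pd1 f a = c :=
  h.fderiv_eq (hf.differentiableAt (by simp))

lemma _root_.HasLineDerivAt.pd2_eq {f : ℝ × ℝ → ℝ} {a : ℝ × ℝ} {c : ℝ}
    (h : HasLineDerivAt ℝ f c a (0, 1)) (hf : ContDiffAt ℝ ∞ f a) : pd2 f a = c :=
  h.fderiv_eq (hf.differentiableAt (by simp))

/-- A closed form on a convex open subset of the plane is exact. -/
lemma exists_potential {S : Set (ℝ × ℝ)} (hS : Convex ℝ S) (hSo : IsOpen S) {A B : ℝ × ℝ → ℝ}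
    (hA : ContDiffOn ℝ ∞ A S) (hB : ContDiffOn ℝ ∞ B S) (h : ∀ a ∈ S, pd2 A a = pd1 B a) :
    ∃ f, ContDiffOn ℝ ∞ f S ∧ ∀ a ∈ S, pd1 f a = A a ∧ pd2 f a = B a := by
  set θ : ℝ × ℝ → ℝ × ℝ →L[ℝ] ℝ := fun a =>
    A a • ContinuousLinearMap.fst ℝ ℝ ℝ + B a • ContinuousLinearMap.snd ℝ ℝ ℝ with hθ
  have hθs : ContDiffOn ℝ ∞ θ S := (hA.smul contDiffOn_const).add (hB.smul contDiffOn_const)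
  obtain ⟨f, hf⟩ := hS.exists_forall_hasFDerivAt_of_fderiv_symmetric hSo
    (hθs.differentiableOn (by simp)) (by
      intro a ha d d'
      have dA := ((hA.contDiffAt (hSo.mem_nhds ha)).differentiableAt (by simp))
      have dB := ((hB.contDiffAt (hSo.mem_nhds ha)).differentiableAt (by simp))
      have : HasFDerivAt θ ((fderiv ℝ A a).smulRight (ContinuousLinearMap.fst ℝ ℝ ℝ) +
          (fderiv ℝ B a).smulRight (ContinuousLinearMap.snd ℝ ℝ ℝ)) a :=
        (dA.hasFDerivAt.smul_const (ContinuousLinearMap.fst ℝ ℝ ℝ)).add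
          (dB.hasFDerivAt.smul_const (ContinuousLinearMap.snd ℝ ℝ ℝ))
      rw [this.fderiv]
      simp [fderiv_eq_pd, h a ha]
      ring)
  refine ⟨f, ?_, fun a ha => ?_⟩
  · rw [contDiffOn_infty_iff_fderiv_of_isOpen hSo]
    exact ⟨fun a ha => (hf a ha).differentiableAt.differentiableWithinAt,
      hθs.congr fun a ha => (hf a ha).fderiv⟩
  · rw [pd1, pd2, (hf a ha).fderiv]
    simp [hθ]

/-! ### Descent of functions on `J¹` along projections -/

lemma J1_eq_sum (d : J1) :
    d = ∑ i, d.1 i • bx i + d.2.1 • bu + ∑ i, d.2.2 i • bp i := by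
  refine Prod.ext ?_ (Prod.ext ?_ ?_)
  · ext k; simp [bx, bu, bp, Prod.fst_sum, Pi.single_apply]
  · simp [bx, bu, bp, Prod.fst_sum, Prod.snd_sum]
  · ext k; simp [bx, bu, bp, Prod.snd_sum, Pi.single_apply]

/-- A function with vanishing derivatives along the kernel of a projection descends. -/
lemma exists_descent {E : Type*} [NormedAddCommGroup E] [NormedSpace ℝ E] (π : J1 →L[ℝ] E)
    (ι : E →L[ℝ] J1) (hπι : ∀ e, π (ι e) = e) (hι : ∀ e, ‖ι e‖ ≤ ‖e‖) (hπ : ∀ d, ‖π d‖ ≤ ‖d‖)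
    {g : J1 → ℝ} {q : J1} {ε : ℝ} (hg : ContDiffOn ℝ ∞ g (Metric.ball q ε))
    (h : ∀ r ∈ Metric.ball q ε, ∀ d, π d = 0 → fderiv ℝ g r d = 0) :
    ∃ g' : E → ℝ, ContDiffOn ℝ ∞ g' (Metric.ball (π q) ε) ∧
      ∀ r ∈ Metric.ball q ε, g r = g' (π r) := by
  have hσ : ∀ e ∈ Metric.ball (π q) ε, q + ι (e - π q) ∈ Metric.ball q ε := by
    intro e he
    rw [mem_ball_iff_norm] at he ⊢
    simpa using (hι _).trans_lt he
  refine ⟨fun e => g (q + ι (e - π q)), ?_, fun r hr => ?_⟩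
  · exact hg.comp (by fun_prop) hσ
  · have hπr : π r ∈ Metric.ball (π q) ε := by
      rw [mem_ball_iff_norm] at hr ⊢
      rw [← map_sub]
      exact (hπ _).trans_lt hr
    set s := q + ι (π r - π q) with hs
    have hsB := hσ _ hπr
    have hπs : π (r - s) = 0 := by simp [hs, hπι]
    -- The segment from the section point `s` to `r` lies in the ball, which is convex, and its
    -- direction is in the kernel of the projection, so `g` is constant along it.
    have hd : ∀ t ∈ Set.Icc (0 : ℝ) 1, HasDerivAt (fun t : ℝ => g (s + t • (r - s))) 0 t := by
      intro t ht
      have hmem := (convex_ball q ε).add_smul_sub_mem hsB hr ht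
      have h1 := ((hg.contDiffAt (Metric.isOpen_ball.mem_nhds hmem)).differentiableAt
        (by simp)).hasFDerivAt
      have h2 : HasDerivAt (fun t : ℝ => s + t • (r - s)) (r - s) t := by
        simpa using ((hasDerivAt_id t).smul_const (r - s)).const_add s
      have h3 := h1.comp_hasDerivAt t h2
      rwa [h _ hmem _ hπs] at h3
    have := constant_of_has_deriv_right_zero (a := 0) (b := 1)
      (fun t ht => (hd t ht).continuousAt.continuousWithinAt)
      (fun t ht => (hd t (Set.Ico_subset_Icc_self ht)).hasDerivWithinAt) 1 (by simp)
    simpa only [one_smul, add_sub_cancel, zero_smul, add_zero] using this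

/-! ### Integrals depending on a parameter -/

section Parametric

variable {E : Type} [NormedAddCommGroup E] [NormedSpace ℝ E] [FiniteDimensional ℝ E]

lemma hasFDerivAt_integral {F : Type} [NormedAddCommGroup F] [NormedSpace ℝ F] [CompleteSpace F]
    {G : E × ℝ → F} {W : Set (E × ℝ)} (hW : IsOpen W) (hG : ContDiffOn ℝ ∞ G W) {S : Set E}
    (hS : IsOpen S) (hSW : S ×ˢ Set.Icc 0 1 ⊆ W) {a : E} (ha : a ∈ S) :
    HasFDerivAt (fun x => ∫ t in (0 : ℝ)..1, G (x, t))
      (∫ t in (0 : ℝ)..1, (fderiv ℝ G (a, t)).comp (ContinuousLinearMap.inl ℝ E ℝ)) a := by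
  have : ProperSpace E := FiniteDimensional.proper ℝ E
  obtain ⟨r, hr, hrS⟩ := Metric.nhds_basis_closedBall.mem_iff.1 (hS.mem_nhds ha)
  have hKW : Metric.closedBall a r ×ˢ Set.Icc (0 : ℝ) 1 ⊆ W :=
    (Set.prod_mono hrS subset_rfl).trans hSW
  have hG' : ContinuousOn
      (fun w => (fderiv ℝ G w).comp (ContinuousLinearMap.inl ℝ E ℝ)) W :=
    (hG.continuousOn_fderiv_of_isOpen hW (by simp)).clm_comp continuousOn_const
  obtain ⟨C, hC⟩ := ((isCompact_closedBall a r).prod isCompact_Icc).exists_bound_of_continuousOn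
    (hG'.mono hKW)
  have hI : Set.uIoc (0 : ℝ) 1 ⊆ Set.Icc 0 1 := by
    rw [Set.uIoc_of_le zero_le_one]; exact Set.Ioc_subset_Icc_self
  have slice : ∀ x ∈ S, Set.MapsTo (fun t : ℝ => (x, t)) (Set.Icc 0 1) W := fun x hx t ht =>
    hSW ⟨hx, ht⟩
  have hGc : ∀ x ∈ S, ContinuousOn (fun t => G (x, t)) (Set.Icc 0 1) := fun x hx =>
    hG.continuousOn.comp (by fun_prop) (slice x hx)
  refine intervalIntegral.hasFDerivAt_integral_of_dominated_of_fderiv_le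
    (F := fun x t => G (x, t)) (bound := fun _ => C)
    (F' := fun x t => (fderiv ℝ G (x, t)).comp (ContinuousLinearMap.inl ℝ E ℝ))
    (Metric.closedBall_mem_nhds a hr) ?_ ?_ ?_ ?_ (by simp) ?_
  · filter_upwards [hS.mem_nhds ha] with x hx
    exact ((hGc x hx).mono hI).aestronglyMeasurable measurableSet_uIoc
  · refine ContinuousOn.intervalIntegrable ?_
    rw [Set.uIcc_of_le zero_le_one]
    exact hGc a ha
  · have : ContinuousOn (fun t => (fderiv ℝ G (a, t)).comp (ContinuousLinearMap.inl ℝ E ℝ))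
        (Set.Icc 0 1) := ContinuousOn.comp hG' (f := fun t : ℝ => (a, t)) (by fun_prop) (slice a ha)
    exact (this.mono hI).aestronglyMeasurable measurableSet_uIoc
  · exact Filter.Eventually.of_forall fun t ht x hx => hC (x, t) ⟨hx, hI ht⟩
  · refine Filter.Eventually.of_forall fun t ht x hx => ?_
    have h1 := ((hG.contDiffAt (hW.mem_nhds (hKW (a := (x, t)) ⟨hx, hI ht⟩))).differentiableAt
      (by simp)).hasFDerivAt
    exact h1.comp x (hasFDerivAt_prodMk_left x t)

/-- Induction on the order of differentiability, with the target space generalized: the derivative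
of the integral is again such an integral, with values in linear maps. -/
lemma contDiffOn_integral {W : Set (E × ℝ)} (hW : IsOpen W) {S : Set E}
    (hS : IsOpen S) (hSW : S ×ˢ Set.Icc 0 1 ⊆ W) {F : Type} [NormedAddCommGroup F]
    [NormedSpace ℝ F] [CompleteSpace F] {G : E × ℝ → F} (hG : ContDiffOn ℝ ∞ G W) :
    ContDiffOn ℝ ∞ (fun x => ∫ t in (0 : ℝ)..1, G (x, t)) S := by
  rw [contDiffOn_infty]
  intro n
  induction n generalizing F with
  | zero =>
    rw [Nat.cast_zero, contDiffOn_zero]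
    exact fun a ha => (hasFDerivAt_integral hW hG hS hSW ha).continuousAt.continuousWithinAt
  | succ n ih =>
    rw [Nat.cast_succ, contDiffOn_succ_iff_fderiv_of_isOpen hS]
    refine ⟨fun a ha =>
      (hasFDerivAt_integral hW hG hS hSW ha).differentiableAt.differentiableWithinAt,
      fun h => absurd h (by simp), ?_⟩
    refine (ih (G := fun w => (fderiv ℝ G w).comp (ContinuousLinearMap.inl ℝ E ℝ))
      ((hG.fderiv_of_isOpen hW (by decide)).clm_comp contDiffOn_const)).congr fun a ha => ?_
    exact (hasFDerivAt_integral hW hG hS hSW ha).fderiv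

end Parametric

/-- Smooth antiderivatives in the second variable. -/
lemma exists_pd2_eq {a₀ : ℝ × ℝ} {ε : ℝ} {h : ℝ × ℝ → ℝ}
    (hh : ContDiffOn ℝ ∞ h (Metric.ball a₀ ε)) :
    ∃ f, ContDiffOn ℝ ∞ f (Metric.ball a₀ ε) ∧ ∀ a ∈ Metric.ball a₀ ε, pd2 f a = h a := by
  -- The integral from `a₀.2` to `a.2` is rescaled to `[0, 1]`, so that the parameters occur only in
  -- the integrand and smoothness follows by differentiating under the integral sign.
  set m : (ℝ × ℝ) × ℝ → ℝ × ℝ := fun w => (w.1.1, a₀.2 + w.2 * (w.1.2 - a₀.2)) with hm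
  have hms : ContDiff ℝ ∞ m := by rw [hm]; fun_prop
  have hball : ∀ a : ℝ × ℝ, a ∈ Metric.ball a₀ ε ↔ |a.1 - a₀.1| < ε ∧ |a.2 - a₀.2| < ε := by
    intro a
    rw [mem_ball_iff_norm, Prod.norm_def, max_lt_iff]
    rfl
  have hmem : ∀ a ∈ Metric.ball a₀ ε, ∀ t ∈ Set.Icc (0 : ℝ) 1, m (a, t) ∈ Metric.ball a₀ ε := by
    intro a ha t ht
    rw [hball] at ha ⊢
    refine ⟨ha.1, ?_⟩
    simp only [hm, add_sub_cancel_left, abs_mul, abs_of_nonneg ht.1]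
    nlinarith [abs_nonneg (a.2 - a₀.2), ht.2]
  have hI := contDiffOn_integral (Metric.isOpen_ball.preimage hms.continuous)
    (S := Metric.ball a₀ ε) Metric.isOpen_ball (fun w hw => hmem w.1 hw.1 w.2 hw.2)
    (G := fun w => h (m w)) (hh.comp hms.contDiffOn fun _ hw => hw)
  have hf : ContDiffOn ℝ ∞ (fun a : ℝ × ℝ => (a.2 - a₀.2) * ∫ t in (0 : ℝ)..1, h (m (a, t)))
      (Metric.ball a₀ ε) := (by fun_prop : ContDiff ℝ ∞ fun a : ℝ × ℝ => a.2 - a₀.2).contDiffOn.mul hI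
  refine ⟨_, hf, fun a ha => ?_⟩
  have e : ∀ y, (y - a₀.2) * ∫ t in (0 : ℝ)..1, h (m ((a.1, y), t)) =
      ∫ s in a₀.2..y, h (a.1, s) := by
    intro y
    have := intervalIntegral.smul_integral_comp_add_mul (a := 0) (b := 1)
      (fun s => h (a.1, s)) (y - a₀.2) a₀.2
    simp only [smul_eq_mul, mul_zero, add_zero, mul_one, add_sub_cancel] at this
    rw [← this]
    simp only [hm, mul_comm]
  refine HasLineDerivAt.pd2_eq ?_ (hf.contDiffAt (Metric.isOpen_ball.mem_nhds ha))
  have hU : IsOpen ((fun s : ℝ => (a.1, s)) ⁻¹' Metric.ball a₀ ε) :=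
    Metric.isOpen_ball.preimage (by fun_prop)
  have hc : ContinuousOn (fun s => h (a.1, s)) ((fun s : ℝ => (a.1, s)) ⁻¹' Metric.ball a₀ ε) :=
    hh.continuousOn.comp (by fun_prop) fun _ hs => hs
  have haU : a.2 ∈ (fun s : ℝ => (a.1, s)) ⁻¹' Metric.ball a₀ ε := ha
  have hsub : Set.uIcc a₀.2 a.2 ⊆ (fun s : ℝ => (a.1, s)) ⁻¹' Metric.ball a₀ ε := by
    intro s hs
    rw [Set.mem_preimage, hball]
    rw [hball] at ha
    exact ⟨ha.1, (Set.abs_sub_left_of_mem_uIcc hs).trans_lt ha.2⟩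
  have hd : HasDerivAt (fun y => ∫ s in a₀.2..y, h (a.1, s)) (h (a.1, a.2)) a.2 :=
    intervalIntegral.integral_hasDerivAt_right ((hc.mono hsub).intervalIntegrable)
      (hc.stronglyMeasurableAtFilter hU _ haU) (hc.continuousAt (hU.mem_nhds haU))
  have hl : HasDerivAt (fun t : ℝ => a.2 + t) 1 0 := by
    simpa using (hasDerivAt_id (0 : ℝ)).const_add a.2
  have := HasDerivAt.comp (0 : ℝ) (h₂ := fun y => ∫ s in a₀.2..y, h (a.1, s)) (by simpa using hd) hl
  rw [mul_one] at this
  refine this.congr_of_eventuallyEq (Filter.Eventually.of_forall fun t => ?_)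
  have ht : a + t • ((0, 1) : ℝ × ℝ) = (a.1, a.2 + t) := by ext <;> simp
  simp only [Function.comp_apply, ← e, ht]

/-- Smooth antiderivatives in the first variable. -/
lemma exists_pd1_eq {a₀ : ℝ × ℝ} {ε : ℝ} {h : ℝ × ℝ → ℝ}
    (hh : ContDiffOn ℝ ∞ h (Metric.ball a₀ ε)) :
    ∃ f, ContDiffOn ℝ ∞ f (Metric.ball a₀ ε) ∧ ∀ a ∈ Metric.ball a₀ ε, pd1 f a = h a := by
  have hs : ∀ b : ℝ × ℝ, ∀ c ∈ Metric.ball b ε, c.swap ∈ Metric.ball b.swap ε := by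
    intro b c hc
    rw [mem_ball_iff_norm, Prod.norm_def, max_lt_iff] at hc ⊢
    exact hc.symm
  have hsw : ContDiff ℝ ∞ (Prod.swap : ℝ × ℝ → ℝ × ℝ) := contDiff_snd.prodMk contDiff_fst
  obtain ⟨f, hf, hf'⟩ := exists_pd2_eq (a₀ := a₀.swap) (ε := ε) (h := fun a => h a.swap)
    (hh.comp hsw.contDiffOn fun b hb => by simpa using hs _ b hb)
  refine ⟨fun a => f a.swap, hf.comp hsw.contDiffOn fun b hb => hs _ b hb, fun a ha => ?_⟩
  have hfa := hf.contDiffAt (Metric.isOpen_ball.mem_nhds (hs _ a ha))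
  have h1 : HasLineDerivAt ℝ (fun a : ℝ × ℝ => f a.swap) (fderiv ℝ f a.swap (0, 1)) a (1, 0) :=
    hfa.hasLineDerivAt (0, 1)
  rw [HasLineDerivAt.pd1_eq h1 (hfa.comp a hsw.contDiffAt)]
  exact hf' _ (hs _ a ha)

/-! ### Functions of two base coordinates -/

/-- The projection to two base coordinates. -/
def pairL (i k : Fin 4) : J1 →L[ℝ] ℝ × ℝ :=
  ((ContinuousLinearMap.proj i).comp (ContinuousLinearMap.fst ℝ (Fin 4 → ℝ) (ℝ × (Fin 4 → ℝ)))).prod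
    ((ContinuousLinearMap.proj k).comp (ContinuousLinearMap.fst ℝ (Fin 4 → ℝ) (ℝ × (Fin 4 → ℝ))))

/-- The projection to a coordinate `u_i`. -/
def momL (i : Fin 4) : J1 →L[ℝ] ℝ :=
  ((ContinuousLinearMap.proj i).comp (ContinuousLinearMap.snd ℝ ℝ (Fin 4 → ℝ))).comp
    (ContinuousLinearMap.snd ℝ (Fin 4 → ℝ) (ℝ × (Fin 4 → ℝ)))

/-- The projection to a base coordinate. -/
def baseL (i : Fin 4) : J1 →L[ℝ] ℝ :=
  (ContinuousLinearMap.proj i).comp (ContinuousLinearMap.fst ℝ (Fin 4 → ℝ) (ℝ × (Fin 4 → ℝ)))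

lemma hasLineDerivAt_mom (i : Fin 4) (q d : J1) :
    HasLineDerivAt ℝ (fun r : J1 => r.2.2 i) (d.2.2 i) q d := hasLineDerivAt_clm (momL i) q d

lemma hasLineDerivAt_base (i : Fin 4) (q d : J1) :
    HasLineDerivAt ℝ (fun r : J1 => r.1 i) (d.1 i) q d := hasLineDerivAt_clm (baseL i) q d

lemma hasLineDerivAt_pair {f : ℝ × ℝ → ℝ} (i k : Fin 4) {q : J1}
    (hf : ContDiffAt ℝ ∞ f (pairL i k q)) (d : J1) :
    HasLineDerivAt ℝ (fun r => f (pairL i k r))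
      (pd1 f (pairL i k q) * d.1 i + pd2 f (pairL i k q) * d.1 k) q d := by
  have h1 := ((hf.differentiableAt (by simp)).hasFDerivAt.comp q
    (pairL i k).hasFDerivAt).hasLineDerivAt d
  have e : ((fderiv ℝ f (pairL i k q)).comp (pairL i k)) d =
      pd1 f (pairL i k q) * d.1 i + pd2 f (pairL i k q) * d.1 k := fderiv_eq_pd _ _ _
  rwa [e] at h1

lemma contDiffAt_pair {f : ℝ × ℝ → ℝ} {i k : Fin 4} {q : J1}
    (hf : ContDiffAt ℝ ∞ f (pairL i k q)) : ContDiffAt ℝ ∞ (fun r => f (pairL i k r)) q :=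
  hf.comp q (pairL i k).contDiff.contDiffAt

lemma norm_pairL_le (i k : Fin 4) (d : J1) : ‖pairL i k d‖ ≤ ‖d‖ := by
  rw [Prod.norm_def]
  exact max_le ((norm_le_pi_norm d.1 i).trans (norm_fst_le d))
    ((norm_le_pi_norm d.1 k).trans (norm_fst_le d))

/-- A function of the base coordinates `x^i`, `x^k` only. -/
lemma exists_descent_pair {i k : Fin 4} (hik : i ≠ k) {g : J1 → ℝ} {q : J1} {ε : ℝ}
    (hg : ContDiffOn ℝ ∞ g (Metric.ball q ε))
    (hx : ∀ r ∈ Metric.ball q ε, ∀ m, m ≠ i → m ≠ k → fderiv ℝ g r (bx m) = 0)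
    (hu : ∀ r ∈ Metric.ball q ε, fderiv ℝ g r bu = 0)
    (hp : ∀ r ∈ Metric.ball q ε, ∀ m, fderiv ℝ g r (bp m) = 0) :
    ∃ g' : ℝ × ℝ → ℝ, ContDiffOn ℝ ∞ g' (Metric.ball (pairL i k q) ε) ∧
      ∀ r ∈ Metric.ball q ε, g r = g' (pairL i k r) := by
  set ι : ℝ × ℝ →L[ℝ] J1 := (ContinuousLinearMap.inl ℝ (Fin 4 → ℝ) (ℝ × (Fin 4 → ℝ))).comp
    ((ContinuousLinearMap.single ℝ (fun _ => ℝ) i).comp (ContinuousLinearMap.fst ℝ ℝ ℝ) +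
      (ContinuousLinearMap.single ℝ (fun _ => ℝ) k).comp (ContinuousLinearMap.snd ℝ ℝ ℝ)) with hι
  have hιe : ∀ e, ι e = (Pi.single i e.1 + Pi.single k e.2, 0) := fun e => by simp [hι]
  refine exists_descent (pairL i k) ι (fun e => ?_) (fun e => ?_) (norm_pairL_le i k) hg
    fun r hr d hd => ?_
  · rw [hιe]
    simp [pairL, hik, hik.symm]
  · rw [hιe, Prod.norm_def, norm_zero, max_le_iff, pi_norm_le_iff_of_nonneg (norm_nonneg e)]
    refine ⟨fun m => ?_, norm_nonneg e⟩
    by_cases h1 : m = i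
    · subst h1; simpa [hik] using norm_fst_le e
    · by_cases h2 : m = k
      · subst h2; simpa [h1] using norm_snd_le e
      · simp [h1, h2]
  · rw [J1_eq_sum d]
    have h1 : d.1 i = 0 := congrArg Prod.fst hd
    have h2 : d.1 k = 0 := congrArg Prod.snd hd
    simp only [map_add, map_sum, map_smul, smul_eq_mul, hu r hr, hp r hr, mul_zero,
      Finset.sum_const_zero, add_zero]
    refine Finset.sum_eq_zero fun m _ => ?_
    by_cases hm : m = i
    · rw [hm, h1, zero_mul]
    · by_cases hm' : m = k
      · rw [hm', h2, zero_mul]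
      · rw [hx r hr m hm hm', mul_zero]

/-- The point of a ball in `J¹` over a point of the projected ball. -/
lemma exists_lift_pair {i k : Fin 4} (hik : i ≠ k) {q : J1} {ε : ℝ} {a : ℝ × ℝ}
    (ha : a ∈ Metric.ball (pairL i k q) ε) : ∃ r ∈ Metric.ball q ε, pairL i k r = a := by
  rw [mem_ball_iff_norm, Prod.norm_def, max_lt_iff] at ha
  have hε : 0 < ε := (norm_nonneg _).trans_lt ha.1
  refine ⟨(Function.update (Function.update q.1 i a.1) k a.2, q.2), ?_, ?_⟩
  · rw [mem_ball_iff_norm, Prod.norm_def, max_lt_iff]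
    refine ⟨(pi_norm_lt_iff hε).2 fun m => ?_, by simpa using hε⟩
    by_cases h2 : m = k
    · subst h2; simpa [pairL] using ha.2
    · by_cases h1 : m = i
      · subst h1; simpa [pairL, h2] using ha.1
      · simpa [h1, h2] using hε
  · simp [pairL, hik]

lemma mem_ball_pairL {i k : Fin 4} {q r : J1} {ε : ℝ} (h : r ∈ Metric.ball q ε) :
    pairL i k r ∈ Metric.ball (pairL i k q) ε := by
  rw [mem_ball_iff_norm] at h ⊢
  rw [← map_sub]
  exact (norm_pairL_le i k _).trans_lt h

/-! ### The branch of type II -/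

section TypeII

variable {Ω : Set J1} {Q : J1 → ℝ} {O : Set (ℝ × ℝ)} {f h : ℝ × ℝ → ℝ}

lemma contDiffAt_branchII {q : J1} (hf : ContDiffAt ℝ ∞ f (yz q)) (hh : ContDiffAt ℝ ∞ h (yz q)) :
    ContDiffAt ℝ ∞ (branchII f h) q :=
  (((contDiffAt_pair (i := 1) (k := 2) hf.pd1).mul (momL 2).contDiff.contDiffAt).sub
    ((contDiffAt_pair (i := 1) (k := 2) hf.pd2).mul (momL 1).contDiff.contDiffAt)).add
      (contDiffAt_pair (i := 1) (k := 2) hh)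

lemma fderiv_branchII {q : J1} (hf : ContDiffAt ℝ ∞ f (yz q)) (hh : ContDiffAt ℝ ∞ h (yz q))
    (d : J1) : fderiv ℝ (branchII f h) q d =
      (pd1 (pd1 f) (yz q) * d.1 1 + pd2 (pd1 f) (yz q) * d.1 2) * q.2.2 2 +
        pd1 f (yz q) * d.2.2 2 -
        ((pd1 (pd2 f) (yz q) * d.1 1 + pd2 (pd2 f) (yz q) * d.1 2) * q.2.2 1 +
          pd2 f (yz q) * d.2.2 1) +
        (pd1 h (yz q) * d.1 1 + pd2 h (yz q) * d.1 2) :=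
  HasLineDerivAt.fderiv_eq
    ((((hasLineDerivAt_pair 1 2 hf.pd1 d).mul (hasLineDerivAt_mom 2 q d)).sub
      ((hasLineDerivAt_pair 1 2 hf.pd2 d).mul (hasLineDerivAt_mom 1 q d))).add
        (hasLineDerivAt_pair 1 2 hh d))
    ((contDiffAt_branchII hf hh).differentiableAt (by simp))

/-- `Q` satisfies the conditions of type II where it is of the form of the branch. -/
lemma IsBranchIINear.cond {q : J1} (hb : IsBranchIINear Q q) :
    (fderiv ℝ Q q (bx 0) = 0 ∧ fderiv ℝ Q q (bx 3) = 0 ∧ fderiv ℝ Q q bu = 0 ∧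
      fderiv ℝ Q q (bp 0) = 0 ∧ fderiv ℝ Q q (bp 3) = 0) := by
  obtain ⟨O, f, h, N, hO, hN, hf, hh, hQ⟩ := hb
  have hq := mem_of_mem_nhds hN
  have hy := (hQ q hq).1
  have e : Q =ᶠ[𝓝 q] branchII f h := Filter.eventually_of_mem hN fun r hr => (hQ r hr).2
  have hfa := hf.contDiffAt (hO.mem_nhds hy)
  have hha := hh.contDiffAt (hO.mem_nhds hy)
  simp only [e.fderiv_eq, fderiv_branchII hfa hha]
  simp [bx, bu, bp]

/-- A right hand side satisfying the conditions of type II near a point is of the form of the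
branch. -/
lemma isBranchIINear (hΩ : IsOpen Ω) (hQ : ContDiffOn ℝ ∞ Q Ω) (hi : IsInvariantII Ω Q)
    (hC : ∀ q ∈ Ω, CondII Q q) {q : J1} (hq : q ∈ Ω) : IsBranchIINear Q q := by
  obtain ⟨ε, hε, hεΩ⟩ := Metric.isOpen_iff.1 hΩ q hq
  have hc : ∀ r ∈ Metric.ball q ε, ContDiffAt ℝ ∞ Q r := fun r hr =>
    hQ.contDiffAt (hΩ.mem_nhds (hεΩ hr))
  have z : ∀ d ∈ ({bx 0, bx 3, bu, bp 0, bp 3} : Set J1), ∀ r ∈ Metric.ball q ε,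
      ∀ d', hess Q r d d' = 0 := by
    intro d hd r hr d'
    refine (hess_eq_zero hΩ hQ (d := d) (fun s hs => ?_) (hεΩ hr) d').2
    obtain ⟨h1, h2, h3, h4, h5⟩ := hi s hs
    rcases hd with rfl | rfl | rfl | rfl | rfl <;> assumption
  have zx0 := z (bx 0) (by simp)
  have zx3 := z (bx 3) (by simp)
  have zu := z bu (by simp)
  have zp0 := z (bp 0) (by simp)
  have zp3 := z (bp 3) (by simp)
  have dir : ∀ d' : J1, ContDiffOn ℝ ∞ (fun r => fderiv ℝ Q r d') (Metric.ball q ε) :=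
    fun d' r hr => ((hc r hr).fderiv_dir (by decide) d').contDiffWithinAt
  -- The vanishing second derivatives make `Q_{u₂}` and `Q_{u₃}` functions of `(y, z)` alone.
  have desc : ∀ k : Fin 4, k = 1 ∨ k = 2 → ∃ g' : ℝ × ℝ → ℝ,
      ContDiffOn ℝ ∞ g' (Metric.ball (pairL 1 2 q) ε) ∧
      ∀ r ∈ Metric.ball q ε, fderiv ℝ Q r (bp k) = g' (pairL 1 2 r) := by
    intro k hk
    refine exists_descent_pair (by decide) (dir _) (fun r hr m h1 h2 => ?_) (fun r hr => ?_)
      fun r hr m => ?_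
    · rw [← hess_eq_fderiv (hc r hr)]
      have : m = 0 ∨ m = 3 := by omega
      rcases this with rfl | rfl
      · exact zx0 r hr _
      · exact zx3 r hr _
    · rw [← hess_eq_fderiv (hc r hr)]
      exact zu r hr _
    · rw [← hess_eq_fderiv (hc r hr)]
      have C := hC r (hεΩ hr)
      rcases hk with rfl | rfl <;> fin_cases m
      · exact zp0 r hr _
      · exact C.h11
      · exact (hess_symm (hc r hr) _ _).trans C.h12
      · exact zp3 r hr _
      · exact zp0 r hr _
      · exact C.h12
      · exact C.h22
      · exact zp3 r hr _
  obtain ⟨A, hA, hAQ⟩ := desc 2 (Or.inr rfl)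
  obtain ⟨B, hB, hBQ⟩ := desc 1 (Or.inl rfl)
  have mem12 := fun {r : J1} => mem_ball_pairL (i := 1) (k := 2) (q := q) (r := r) (ε := ε)
  have at12 : ∀ {g : ℝ × ℝ → ℝ}, ContDiffOn ℝ ∞ g (Metric.ball (pairL 1 2 q) ε) →
      ∀ {r}, r ∈ Metric.ball q ε → ContDiffAt ℝ ∞ g (pairL 1 2 r) := fun hg r hr =>
    hg.contDiffAt (Metric.isOpen_ball.mem_nhds (mem12 hr))
  have evA : ∀ r ∈ Metric.ball q ε, (fun s => fderiv ℝ Q s (bp 2)) =ᶠ[𝓝 r]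
      fun s => A (pairL 1 2 s) := fun r hr =>
    Filter.eventually_of_mem (Metric.isOpen_ball.mem_nhds hr) hAQ
  have evB : ∀ r ∈ Metric.ball q ε, (fun s => fderiv ℝ Q s (bp 1)) =ᶠ[𝓝 r]
      fun s => B (pairL 1 2 s) := fun r hr =>
    Filter.eventually_of_mem (Metric.isOpen_ball.mem_nhds hr) hBQ
  -- The part of `Q` of degree zero in `u₂, u₃`; it will be `h`.
  set P : J1 → ℝ := fun r => Q r - A (pairL 1 2 r) * r.2.2 2 - B (pairL 1 2 r) * r.2.2 1 with hP
  have hPc : ∀ r ∈ Metric.ball q ε, ContDiffAt ℝ ∞ P r := fun r hr =>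
    ((hc r hr).sub ((contDiffAt_pair (at12 hA hr)).mul (momL 2).contDiff.contDiffAt)).sub
      ((contDiffAt_pair (at12 hB hr)).mul (momL 1).contDiff.contDiffAt)
  have hPd : ∀ r ∈ Metric.ball q ε, ∀ d, fderiv ℝ P r d = fderiv ℝ Q r d -
      ((pd1 A (pairL 1 2 r) * d.1 1 + pd2 A (pairL 1 2 r) * d.1 2) * r.2.2 2 +
        A (pairL 1 2 r) * d.2.2 2) -
      ((pd1 B (pairL 1 2 r) * d.1 1 + pd2 B (pairL 1 2 r) * d.1 2) * r.2.2 1 +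
        B (pairL 1 2 r) * d.2.2 1) := fun r hr d =>
    HasLineDerivAt.fderiv_eq
      ((((hc r hr).hasLineDerivAt d).sub
        ((hasLineDerivAt_pair 1 2 (at12 hA hr) d).mul (hasLineDerivAt_mom 2 r d))).sub
        ((hasLineDerivAt_pair 1 2 (at12 hB hr) d).mul (hasLineDerivAt_mom 1 r d)))
      ((hPc r hr).differentiableAt (by simp))
  obtain ⟨h, hh, hhP⟩ := exists_descent_pair (i := 1) (k := 2) (by decide)
    (fun r hr => (hPc r hr).contDiffWithinAt) (fun r hr m h1 h2 => by
      obtain ⟨i1, i2, -⟩ := hi r (hεΩ hr)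
      have : m = 0 ∨ m = 3 := by omega
      rw [hPd r hr]
      rcases this with rfl | rfl
      · rw [i1]; simp [bx]
      · rw [i2]; simp [bx]) (fun r hr => by
      rw [hPd r hr, (hi r (hεΩ hr)).2.2.1]; simp [bu]) (fun r hr m => by
      obtain ⟨-, -, -, i4, i5⟩ := hi r (hεΩ hr)
      rw [hPd r hr]
      fin_cases m
      · simp [i4]; simp [bp]
      · simp [hBQ r hr]; simp [bp]
      · simp [hAQ r hr]; simp [bp]
      · simp [i5]; simp [bp])
  -- The divergence condition `A_z + B_y = 0` says that `A dy - B dz` is closed.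
  obtain ⟨f, hf, hfd⟩ := exists_potential (convex_ball (pairL 1 2 q) ε) Metric.isOpen_ball hA
    (B := fun a => -B a) hB.neg (fun a ha => by
      obtain ⟨r, hr, rfl⟩ := exists_lift_pair (i := 1) (k := 2) (by decide) ha
      have e := (hC r (hεΩ hr)).div
      rw [hess_of_eventuallyEq (hc r hr) (evA r hr) (hasLineDerivAt_pair 1 2 (at12 hA hr) _),
        hess_of_eventuallyEq (hc r hr) (evB r hr) (hasLineDerivAt_pair 1 2 (at12 hB hr) _)] at e
      have e1 : pd1 (fun a => -B a) (pairL 1 2 r) = -pd1 B (pairL 1 2 r) := by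
        simp only [pd1, fderiv_fun_neg]; rfl
      rw [e1]
      simp [bx] at e
      linarith)
  refine ⟨_, f, h, Metric.ball q ε, Metric.isOpen_ball, Metric.ball_mem_nhds q hε, hf, hh,
    fun r hr => ⟨mem12 hr, ?_⟩⟩
  have e1 := hhP r hr
  have e2 := hfd _ (mem12 hr)
  change Q r = pd1 f (pairL 1 2 r) * r.2.2 2 - pd2 f (pairL 1 2 r) * r.2.2 1 + h (pairL 1 2 r)
  rw [← e1, e2.1, e2.2, hP]
  ring

end TypeII

/-! ### The Lax pair of type II -/

section TypeII

variable {Ω : Set J1} {Q : J1 → ℝ} {O : Set (ℝ × ℝ)} {f h : ℝ × ℝ → ℝ}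

lemma dtot_pair {g : ℝ × ℝ → ℝ} {j : Jet} (i k m : Fin 4)
    (hg : ContDiffAt ℝ ∞ g (pairL i k (toJ1 j))) :
    dtot m (fun r => g (pairL i k r)) j =
      pd1 g (pairL i k (toJ1 j)) * (Pi.single m 1 : Fin 4 → ℝ) i +
        pd2 g (pairL i k (toJ1 j)) * (Pi.single m 1 : Fin 4 → ℝ) k :=
  (hasLineDerivAt_pair i k hg _).fderiv_eq ((contDiffAt_pair hg).differentiableAt (by simp))

/-- The bracket is a combination of `V` and `W` on solutions: the `x`- and `t`-components of this
identity use `D_t` and `D_x` of the equation, and the `∂_λ`-component uses the symmetry of the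
second derivatives of `f`. -/
theorem isLaxPair_eqII (hΩ : IsOpen Ω) (hO : IsOpen O) (hf : ContDiffOn ℝ ∞ f O)
    (hh : ContDiffOn ℝ ∞ h O) (hQ : ∀ q ∈ Ω, yz q ∈ O ∧ Q q = branchII f h q) :
    IsLaxPair (eqII Q) (toJ1 ⁻¹' Ω) {1}ᶜ (laxVII f) (laxWII f) := by
  have hfa : ∀ q ∈ Ω, ContDiffAt ℝ ∞ f (pairL 1 2 q) := fun q hq =>
    hf.contDiffAt (hO.mem_nhds (hQ q hq).1)
  have hha : ∀ q ∈ Ω, ContDiffAt ℝ ∞ h (pairL 1 2 q) := fun q hq =>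
    hh.contDiffAt (hO.mem_nhds (hQ q hq).1)
  have hQe : ∀ q ∈ Ω, Q =ᶠ[𝓝 q] branchII f h := fun q hq =>
    Filter.eventually_of_mem (hΩ.mem_nhds hq) fun r hr => (hQ r hr).2
  have hQd : ∀ q ∈ Ω, DifferentiableAt ℝ Q q := fun q hq =>
    (((contDiffAt_branchII (hfa q hq) (hha q hq)).congr_of_eventuallyEq
      (hQe q hq)).differentiableAt (by simp))
  have hU : IsOpen (toJ1 ⁻¹' Ω) := hΩ.preimage continuous_toJ1
  have sd : ∀ (w : Jet × ℝ), w.2 ≠ 1 → SmoothAt (fun v => v.2 - 1) w ∧ w.2 - 1 ≠ 0 := fun w hw =>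
    ⟨(smoothAt_param w).sub (smoothAt_const 1 w), sub_ne_zero.2 hw⟩
  have sm : ∀ (w : Jet × ℝ), w.2 ≠ 1 → SmoothAt (fun v => v.2 / (v.2 - 1)) w := fun w hw =>
    (smoothAt_param w).div (sd w hw).1 (sd w hw).2
  have se : ∀ (w : Jet × ℝ), w.2 ≠ 1 → SmoothAt (fun v => v.1.2 {0, 3} / (v.2 - 1)) w :=
    fun w hw => (smoothAt_coord _ w).div (sd w hw).1 (sd w hw).2
  have s1 : ∀ w : Jet × ℝ, toJ1 w.1 ∈ Ω → SmoothAt (fun v => pd1 f (yz (toJ1 v.1))) w :=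
    fun w hw => SmoothAt.comp_toJ1 (h := fun r => pd1 f (pairL 1 2 r))
      (contDiffAt_pair (hfa _ hw).pd1)
  have s2 : ∀ w : Jet × ℝ, toJ1 w.1 ∈ Ω → SmoothAt (fun v => pd2 f (yz (toJ1 v.1))) w :=
    fun w hw => SmoothAt.comp_toJ1 (h := fun r => pd2 f (pairL 1 2 r))
      (contDiffAt_pair (hfa _ hw).pd2)
  refine
  { isOpen_jets := hU
    isOpen_param := isOpen_compl_singleton
    nonempty_param := ⟨0, by simp⟩
    smooth_base := ?_
    smooth_spectral := ?_
    rank_two := ?_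
    characteristic := ?_
    parametrized := ?_
    frobenius := ?_ }
  · rintro w ⟨hw, hl⟩ i
    fin_cases i
    · exact ⟨(sm w hl).mul (smoothAt_coord _ w), (sm w hl).mul (smoothAt_coord _ w)⟩
    · exact ⟨smoothAt_const 0 w, (se w hl).neg⟩
    · exact ⟨(se w hl).neg, smoothAt_const 0 w⟩
    · exact ⟨(smoothAt_coord _ w).neg, (smoothAt_coord _ w).neg⟩
  · rintro w ⟨hw, hl⟩
    exact ⟨((s2 w hw).mul (smoothAt_coord _ w)).mul (smoothAt_param w),
      ((s1 w hw).mul (smoothAt_coord _ w)).mul (smoothAt_param w)⟩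
  · rintro j ⟨-, hj⟩ l hl
    obtain ⟨-, -, he⟩ := regular_eqII_iff.1 hj
    have hl' : l - 1 ≠ 0 := sub_ne_zero.2 hl
    rw [LinearIndependent.pair_iff]
    intro s t h
    have h1 := congrFun h 1
    have h2 := congrFun h 2
    simp only [laxVII, laxWII, Pi.add_apply, Pi.smul_apply, smul_eq_mul, Matrix.cons_val,
      mul_zero, zero_add, add_zero, Pi.zero_apply, mul_neg, neg_eq_zero, mul_eq_zero,
      div_eq_zero_iff, he, hl', or_false] at h1 h2
    exact ⟨h2, h1⟩
  · rintro j ⟨-, hj⟩ l hl ξ hξ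
    have hl' : l - 1 ≠ 0 := sub_ne_zero.2 hl
    obtain ⟨-, -, he⟩ := regular_eqII_iff.1 hj
    have hE := eqII_eq_zero hj
    have h1 := hξ _ (projectedPlane_fst_mem _ _ _)
    have h2 := hξ _ (projectedPlane_snd_mem _ _ _)
    simp only [laxVII, laxWII, Fin.sum_univ_four, Matrix.cons_val] at h1 h2
    rw [symbol_eqII]
    field_simp at h1 h2
    refine mul_left_cancel₀ he ?_
    generalize j.2 {0, 3} = e at *
    generalize j.2 {0, 1} = c at *
    generalize j.2 {0, 2} = d at *
    generalize j.2 {1, 3} = b at *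
    generalize j.2 {2, 3} = a at *
    linear_combination -(ξ 0 * a - d * ξ 3) * h2 - (c * ξ 3 - ξ 0 * b) * h1 + ξ 0 * ξ 3 * hE
  · rintro j ⟨-, hj⟩ l hl l' hl' h
    obtain ⟨-, hq, he⟩ := regular_eqII_iff.1 hj
    have hE := eqII_eq_zero hj
    have n1 : l - 1 ≠ 0 := sub_ne_zero.2 hl
    have n2 : l' - 1 ≠ 0 := sub_ne_zero.2 hl'
    have hm : (laxVII f (j, l)).1 ∈ projectedPlane (laxVII f) (laxWII f) (j, l') := by
      have : projectedPlane (laxVII f) (laxWII f) (j, l) =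
        projectedPlane (laxVII f) (laxWII f) (j, l') := h
      rw [← this]
      exact projectedPlane_fst_mem _ _ _
    obtain ⟨s, t, h⟩ := Submodule.mem_span_pair.1 hm
    have h0 := congrFun h 0
    have h1 := congrFun h 1
    have h2 := congrFun h 2
    have h3 := congrFun h 3
    simp only [laxVII, laxWII, Pi.add_apply, Pi.smul_apply, smul_eq_mul, Matrix.cons_val,
      mul_zero, zero_add, add_zero, mul_neg, neg_eq_zero, mul_eq_zero, neg_inj,
      div_eq_zero_iff, he, n2, or_false] at h0 h1 h2 h3
    subst h1
    field_simp at h2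
    simp only [zero_mul, neg_zero, add_zero, neg_inj] at h0 h3
    -- The `y`-components have removed `W` from the combination. If `u₁₃ ≠ 0`, the `t`-component
    -- gives `s = 1` and the `z`-component compares the parameters. If `u₁₃ = 0`, then `u₃₄ ≠ 0`
    -- because the determinant is nonzero, and the `x`-component takes over.
    by_cases hd : j.2 {0, 2} = 0
    · have ha : j.2 {2, 3} ≠ 0 := fun ha => by
        rw [hd, ha] at hE
        simp only [mul_zero, zero_mul, sub_zero] at hE
        exact mul_ne_zero hq he hE.symm
      field_simp at h0
      have e : (l' - 1) * (l - l') = 0 := by linear_combination -h0 + l' * h2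
      exact sub_eq_zero.1 ((mul_eq_zero.1 e).resolve_left n2)
    · have hs : s = 1 := mul_right_cancel₀ hd (by rw [h3, one_mul])
      rw [hs] at h2
      linarith
  · rintro j ⟨hjΩ, hj⟩ l hl
    obtain ⟨-, -, he⟩ := regular_eqII_iff.1 hj
    have hE := eqII_eq_zero hj
    have hl' : l - 1 ≠ 0 := sub_ne_zero.2 hl
    have hw : toJ1 ((j, l) : Jet × ℝ).1 ∈ Ω := hjΩ
    have hw1 : ((j, l) : Jet × ℝ).2 ≠ 1 := hl
    have D := fun i => hj.1 [i]
    simp only [totalDerivs, List.foldr, totalDeriv_eqII (hQd _ hjΩ)] at D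
    have d0 : dtot 0 Q j = pd1 f (yz (toJ1 j)) * j.2 {0, 2} - pd2 f (yz (toJ1 j)) * j.2 {0, 1} := by
      rw [dtot, (hQe _ hjΩ).fderiv_eq, fderiv_branchII (hfa _ hjΩ) (hha _ hjΩ)]
      simp [toJ1Vec, totalVec]
    have d3 : dtot 3 Q j = pd1 f (yz (toJ1 j)) * j.2 {2, 3} - pd2 f (yz (toJ1 j)) * j.2 {1, 3} := by
      have p31 : ({3, 1} : Multiset (Fin 4)) = {1, 3} := by decide
      have p32 : ({3, 2} : Multiset (Fin 4)) = {2, 3} := by decide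
      rw [← p31, ← p32, dtot, (hQe _ hjΩ).fderiv_eq, fderiv_branchII (hfa _ hjΩ) (hha _ hjΩ)]
      simp [toJ1Vec, totalVec]
    have D0 := D 0
    have D3 := D 3
    rw [d0] at D0
    rw [d3] at D3
    have am : ∀ (X : SpectralField) (I : Multiset (Fin 4)),
        X.act (fun v => v.2 / (v.2 - 1) * v.1.2 I) (j, l) =
          -((X (j, l)).2 / (l - 1) ^ 2) * j.2 I +
            l / (l - 1) * ∑ i, (X (j, l)).1 i * j.2 (i ::ₘ I) := by
      intro X I
      rw [X.act_mul (sm _ hw1) (smoothAt_coord _ _), X.act_coord,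
        X.act_div (smoothAt_param _) (sd _ hw1).1 (sd _ hw1).2, X.act_param,
        X.act_sub (smoothAt_param _) (smoothAt_const _ _), X.act_param, X.act_const]
      congr 2
      ring
    have ae : ∀ (X : SpectralField), X.act (fun v => -(v.1.2 {0, 3} / (v.2 - 1))) (j, l) =
        -((∑ i, (X (j, l)).1 i * j.2 (i ::ₘ {0, 3})) / (l - 1) -
          j.2 {0, 3} * (X (j, l)).2 / (l - 1) ^ 2) := by
      intro X
      rw [X.act_neg (se _ hw1), X.act_div (smoothAt_coord _ _) (sd _ hw1).1 (sd _ hw1).2,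
        X.act_coord, X.act_sub (smoothAt_param _) (smoothAt_const _ _), X.act_param, X.act_const]
      field_simp
      ring
    have an : ∀ (X : SpectralField) (I : Multiset (Fin 4)), X.act (fun v => -v.1.2 I) (j, l) =
        -∑ i, (X (j, l)).1 i * j.2 (i ::ₘ I) := by
      intro X I
      rw [X.act_neg (smoothAt_coord _ _), X.act_coord]
    have as : ∀ (X : SpectralField) (g : ℝ × ℝ → ℝ), ContDiffAt ℝ ∞ g (pairL 1 2 (toJ1 j)) →
        X.act (fun v => g (yz (toJ1 v.1)) * v.1.2 {0, 3} * v.2) (j, l) =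
          ((X (j, l)).1 1 * pd1 g (yz (toJ1 j)) + (X (j, l)).1 2 * pd2 g (yz (toJ1 j))) *
              j.2 {0, 3} * l +
            g (yz (toJ1 j)) * ((∑ i, (X (j, l)).1 i * j.2 (i ::ₘ {0, 3})) * l +
              j.2 {0, 3} * (X (j, l)).2) := by
      intro X g hg
      have hs : SmoothAt (fun v : Jet × ℝ => g (yz (toJ1 v.1))) (j, l) :=
        SmoothAt.comp_toJ1 (h := fun r => g (pairL 1 2 r)) (contDiffAt_pair hg)
      have hg' : X.act (fun v => g (yz (toJ1 v.1))) (j, l) =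
          (X (j, l)).1 1 * pd1 g (yz (toJ1 j)) + (X (j, l)).1 2 * pd2 g (yz (toJ1 j)) := by
        refine (X.act_toJ1 (Q := fun r => g (pairL 1 2 r)) (w := (j, l))
          (contDiffAt_pair hg)).trans ?_
        simp only [dtot_pair 1 2 _ hg, Fin.sum_univ_four]
        simp
        rfl
      rw [X.act_mul (hs.mul (smoothAt_coord _ _)) (smoothAt_param _),
        X.act_mul hs (smoothAt_coord _ _), X.act_coord, X.act_param, hg']
      ring
    set fy := pd1 f (yz (toJ1 j)) with hfy
    set fz := pd2 f (yz (toJ1 j)) with hfz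
    have hsym : pd1 (pd2 f) (yz (toJ1 j)) = pd2 (pd1 f) (yz (toJ1 j)) := pd1_pd2 (hfa _ hjΩ)
    set V := laxVII f
    set W := laxWII f
    have V0 : (V (j, l)).1 0 = l / (l - 1) * j.2 {2, 3} := rfl
    have V1 : (V (j, l)).1 1 = 0 := rfl
    have V2 : (V (j, l)).1 2 = -(j.2 {0, 3} / (l - 1)) := rfl
    have V3 : (V (j, l)).1 3 = -j.2 {0, 2} := rfl
    have V4 : (V (j, l)).2 = fz * j.2 {0, 3} * l := rfl
    have W0 : (W (j, l)).1 0 = l / (l - 1) * j.2 {1, 3} := rfl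
    have W1 : (W (j, l)).1 1 = -(j.2 {0, 3} / (l - 1)) := rfl
    have W2 : (W (j, l)).1 2 = 0 := rfl
    have W3 : (W (j, l)).1 3 = -j.2 {0, 1} := rfl
    have W4 : (W (j, l)).2 = fy * j.2 {0, 3} * l := rfl
    set Ve := ∑ i, (V (j, l)).1 i * j.2 (i ::ₘ {0, 3}) with hVe
    set We := ∑ i, (W (j, l)).1 i * j.2 (i ::ₘ {0, 3}) with hWe
    -- The coefficients are read off from the `z`- and `y`-components, in each of which only one of
    -- the two fields is nonzero.
    refine Submodule.mem_span_pair.2 ⟨-(We / j.2 {0, 3} - fy * j.2 {0, 3} * l / (l - 1)),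
      Ve / j.2 {0, 3} - fz * j.2 {0, 3} * l / (l - 1), ?_⟩
    refine Prod.ext (funext fun i => ?_) ?_
    · rw [SpectralField.bracket_fst]
      simp only [Prod.fst_add, Prod.smul_fst, Pi.add_apply, Pi.smul_apply, smul_eq_mul]
      fin_cases i
      · change _ * (V (j, l)).1 0 + _ * (W (j, l)).1 0 =
          V.act (fun v => v.2 / (v.2 - 1) * v.1.2 {1, 3}) (j, l) -
            W.act (fun v => v.2 / (v.2 - 1) * v.1.2 {2, 3}) (j, l)
        rw [am, am, hVe, hWe]
        simp only [Fin.sum_univ_four, V0, V1, V2, V3, V4, W0, W1, W2, W3, W4]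
        simp only [Multiset.insert_eq_cons, ← Multiset.cons_zero, Multiset.cons_swap] at D3 hE he ⊢
        field_simp
        linear_combination (l - l ^ 2) * (j.2 (0 ::ₘ 3 ::ₘ 0) * D3 - j.2 (0 ::ₘ 3 ::ₘ 3 ::ₘ 0) * hE)
      · change _ * (V (j, l)).1 1 + _ * (W (j, l)).1 1 =
          V.act (fun v => -(v.1.2 {0, 3} / (v.2 - 1))) (j, l) - W.act (fun v => 0) (j, l)
        rw [ae, SpectralField.act_const, ← hVe, V1, W1, V4]
        field_simp
        ring
      · change _ * (V (j, l)).1 2 + _ * (W (j, l)).1 2 =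
          V.act (fun v => 0) (j, l) - W.act (fun v => -(v.1.2 {0, 3} / (v.2 - 1))) (j, l)
        rw [ae, SpectralField.act_const, ← hWe, V2, W2, W4]
        field_simp
        ring
      · change _ * (V (j, l)).1 3 + _ * (W (j, l)).1 3 =
          V.act (fun v => -v.1.2 {0, 1}) (j, l) - W.act (fun v => -v.1.2 {0, 2}) (j, l)
        rw [an, an, hVe, hWe]
        simp only [Fin.sum_univ_four, V0, V1, V2, V3, W0, W1, W2, W3]
        simp only [Multiset.insert_eq_cons, ← Multiset.cons_zero, Multiset.cons_swap] at D0 hE he ⊢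
        field_simp
        linear_combination l * (j.2 (0 ::ₘ 3 ::ₘ 0) * D0 - j.2 (0 ::ₘ 0 ::ₘ 3 ::ₘ 0) * hE)
    · rw [SpectralField.bracket_snd]
      change _ * (V (j, l)).2 + _ * (W (j, l)).2 =
          V.act (fun v => pd1 f (yz (toJ1 v.1)) * v.1.2 {0, 3} * v.2) (j, l) -
            W.act (fun v => pd2 f (yz (toJ1 v.1)) * v.1.2 {0, 3} * v.2) (j, l)
      rw [as _ _ (hfa _ hjΩ).pd1, as _ _ (hfa _ hjΩ).pd2, ← hVe, ← hWe, V1, V2, V4, W1, W2, W4,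
        hsym]
      field_simp
      ring

lemma laxIntegrable_eqII (hb : ∀ q ∈ Ω, IsBranchIINear Q q) :
    LaxIntegrable (eqII Q) (toJ1 ⁻¹' Ω) := by
  rintro j ⟨hjΩ, hj⟩
  obtain ⟨O, f, h, N, hO, hN, hf, hh, hQ⟩ := hb _ hjΩ
  exact ⟨toJ1 ⁻¹' interior N, {1}ᶜ, laxVII f, laxWII f, mem_interior_iff_mem_nhds.2 hN,
    isLaxPair_eqII isOpen_interior hO hf hh fun q hq => hQ q (interior_subset hq)⟩

end TypeII

/-! ### Contact symmetries -/

lemma totalDeriv_comp_toJ1 {f : J1 → ℝ} (hf : ContDiff ℝ ∞ f) (i : Fin 4) :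
    totalDeriv i (f ∘ toJ1) = dtot i f := funext fun _ =>
  HasLineDerivAt.lineDeriv (hasDerivAt_toJ1_totalVec (hf.differentiable (by simp) _) i)

/-- The contact vector field on `J¹`. -/
lemma toJ1Vec_contactVec {f : J1 → ℝ} (hf : ContDiff ℝ ∞ f) (j : Jet) :
    toJ1Vec (contactVec f j) = (fun k => -fderiv ℝ f (toJ1 j) (bp k),
      f (toJ1 j) - ∑ k, fderiv ℝ f (toJ1 j) (bp k) * j.2 {k},
      fun i => fderiv ℝ f (toJ1 j) (bx i) + j.2 {i} * fderiv ℝ f (toJ1 j) bu) := by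
  refine Prod.ext rfl (Prod.ext ?_ (funext fun i => ?_))
  · simp [toJ1Vec, contactVec, totalDerivs, dp, bp]
  · have h : totalDerivs [i] (f ∘ toJ1) j = dtot i f j := by
      rw [← totalDeriv_comp_toJ1 hf]; rfl
    have e : (toJ1Vec (contactVec f j)).2.2 i = totalDerivs ({i} : Multiset (Fin 4)).toList
        (f ∘ toJ1) j - ∑ k, fderiv ℝ f (toJ1 j) (bp k) * j.2 (k ::ₘ {i}) := rfl
    rw [e, Multiset.toList_singleton, h, dtot_eq, sub_eq_iff_eq_add]
    congr 1
    exact Finset.sum_congr rfl fun k _ => by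
      rw [mul_comm]
      exact congrArg (fun I => fderiv ℝ f (toJ1 j) (bp k) * j.2 I) (Multiset.pair_comm i k)

/-- The second order part of the prolonged contact vector field. -/
lemma contactVec_pair {f : J1 → ℝ} (hf : ContDiff ℝ ∞ f) (j : Jet) (i k : Fin 4) :
    (contactVec f j).2 {i, k} = hess f (toJ1 j) (toJ1Vec (totalVec i j)) (toJ1Vec (totalVec k j)) +
      j.2 {i, k} * fderiv ℝ f (toJ1 j) bu := by
  have key : ∀ i k : Fin 4, totalDerivs [i, k] (f ∘ toJ1) j = totalDeriv i (dtot k f) j := by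
    intro i k
    rw [← totalDeriv_comp_toJ1 hf]; rfl
  have h : totalDerivs ({i, k} : Multiset (Fin 4)).toList (f ∘ toJ1) j =
      totalDeriv i (dtot k f) j := by
    have hp : ({i, k} : Multiset (Fin 4)).toList.Perm [i, k] := by
      rw [← Multiset.coe_eq_coe, Multiset.coe_toList]; rfl
    rcases List.perm_pair.1 hp with e | e <;> rw [e, key]
    exact totalDeriv_dtot_comm hf.contDiffAt k i
  have e : (contactVec f j).2 {i, k} = totalDerivs ({i, k} : Multiset (Fin 4)).toList
        (f ∘ toJ1) j - ∑ m, fderiv ℝ f (toJ1 j) (bp m) * j.2 (m ::ₘ {i, k}) := rfl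
  rw [e, h, totalDeriv_dtot hf.contDiffAt, sub_eq_iff_eq_add, ← add_assoc, add_assoc, add_assoc]
  congr 2
  refine Finset.sum_congr rfl fun m _ => ?_
  rw [mul_comm]
  congr 2
  simp only [Multiset.insert_eq_cons, ← Multiset.cons_zero]
  rw [Multiset.cons_swap m i, Multiset.cons_swap m k]

/-! ### Action of the two ideals of generating functions -/

/-- The projection to the plane `(x^i, u_i)`. -/
def planeL (i : Fin 4) : J1 →L[ℝ] ℝ × ℝ := (baseL i).prod (momL i)

/-- The generating function `A(x, u₁) + B(t, u₄)`. -/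
def generating (A B : ℝ × ℝ → ℝ) (q : J1) : ℝ := A (planeL 0 q) + B (planeL 3 q)

section Generating

variable {A B : ℝ × ℝ → ℝ}

lemma contDiff_generating (hA : ContDiff ℝ ∞ A) (hB : ContDiff ℝ ∞ B) :
    ContDiff ℝ ∞ (generating A B) :=
  (hA.comp (planeL 0).contDiff).add (hB.comp (planeL 3).contDiff)

lemma hasLineDerivAt_plane {A : ℝ × ℝ → ℝ} (hA : ContDiff ℝ ∞ A) (i : Fin 4) (q d : J1) :
    HasLineDerivAt ℝ (fun r => A (planeL i r))
      (pd1 A (planeL i q) * d.1 i + pd2 A (planeL i q) * d.2.2 i) q d := by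
  have h1 := ((hA.differentiable (by simp) _).hasFDerivAt.comp q
    (planeL i).hasFDerivAt).hasLineDerivAt d
  have e : ((fderiv ℝ A (planeL i q)).comp (planeL i)) d =
      pd1 A (planeL i q) * d.1 i + pd2 A (planeL i q) * d.2.2 i := fderiv_eq_pd _ _ _
  rwa [e] at h1

lemma fderiv_generating (hA : ContDiff ℝ ∞ A) (hB : ContDiff ℝ ∞ B) (q d : J1) :
    fderiv ℝ (generating A B) q d =
      pd1 A (planeL 0 q) * d.1 0 + pd2 A (planeL 0 q) * d.2.2 0 +
        (pd1 B (planeL 3 q) * d.1 3 + pd2 B (planeL 3 q) * d.2.2 3) :=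
  ((hasLineDerivAt_plane hA 0 q d).add (hasLineDerivAt_plane hB 3 q d)).fderiv_eq
    ((contDiff_generating hA hB).differentiable (by simp) q)

lemma contDiff_pd1 (hA : ContDiff ℝ ∞ A) : ContDiff ℝ ∞ (pd1 A) :=
  contDiff_iff_contDiffAt.2 fun _ => hA.contDiffAt.pd1

lemma contDiff_pd2 (hA : ContDiff ℝ ∞ A) : ContDiff ℝ ∞ (pd2 A) :=
  contDiff_iff_contDiffAt.2 fun _ => hA.contDiffAt.pd2

lemma hess_generating (hA : ContDiff ℝ ∞ A) (hB : ContDiff ℝ ∞ B) (q d d' : J1) :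
    hess (generating A B) q d d' =
      ((pd1 (pd1 A) (planeL 0 q) * d.1 0 + pd2 (pd1 A) (planeL 0 q) * d.2.2 0) * d'.1 0 +
        (pd2 (pd1 A) (planeL 0 q) * d.1 0 + pd2 (pd2 A) (planeL 0 q) * d.2.2 0) * d'.2.2 0) +
      ((pd1 (pd1 B) (planeL 3 q) * d.1 3 + pd2 (pd1 B) (planeL 3 q) * d.2.2 3) * d'.1 3 +
        (pd2 (pd1 B) (planeL 3 q) * d.1 3 + pd2 (pd2 B) (planeL 3 q) * d.2.2 3) * d'.2.2 3) := by
  have c := fun (a : ℝ) => hasLineDerivAt_const a q d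
  rw [hess_of_eventuallyEq (contDiff_generating hA hB).contDiffAt
    (Filter.Eventually.of_forall fun r => fderiv_generating hA hB r d')
    ((((hasLineDerivAt_plane (contDiff_pd1 hA) 0 q d).mul (c (d'.1 0))).add
      ((hasLineDerivAt_plane (contDiff_pd2 hA) 0 q d).mul (c (d'.2.2 0)))).add
    (((hasLineDerivAt_plane (contDiff_pd1 hB) 3 q d).mul (c (d'.1 3))).add
      ((hasLineDerivAt_plane (contDiff_pd2 hB) 3 q d).mul (c (d'.2.2 3))))),
    pd1_pd2 hA.contDiffAt, pd1_pd2 hB.contDiffAt]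
  ring

/-- The derivative of `Q` along the contact vector field. -/
lemma fderiv_contactVec (hA : ContDiff ℝ ∞ A) (hB : ContDiff ℝ ∞ B) (Q : J1 → ℝ) (j : Jet) :
    fderiv ℝ Q (toJ1 j) (toJ1Vec (contactVec (generating A B) j)) =
      -pd2 A (planeL 0 (toJ1 j)) * fderiv ℝ Q (toJ1 j) (bx 0) -
        pd2 B (planeL 3 (toJ1 j)) * fderiv ℝ Q (toJ1 j) (bx 3) +
        (A (planeL 0 (toJ1 j)) + B (planeL 3 (toJ1 j)) - pd2 A (planeL 0 (toJ1 j)) * j.2 {0} -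
          pd2 B (planeL 3 (toJ1 j)) * j.2 {3}) * fderiv ℝ Q (toJ1 j) bu +
        pd1 A (planeL 0 (toJ1 j)) * fderiv ℝ Q (toJ1 j) (bp 0) +
        pd1 B (planeL 3 (toJ1 j)) * fderiv ℝ Q (toJ1 j) (bp 3) := by
  rw [toJ1Vec_contactVec (contDiff_generating hA hB), J1_eq_sum (_, _, _)]
  simp only [fderiv_generating hA hB, map_add, map_smul, smul_eq_mul,
    Fin.sum_univ_four, generating]
  simp [bx, bu, bp]
  ring

lemma toJ1Vec_totalVec_fst (i k : Fin 4) (j : Jet) :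
    (toJ1Vec (totalVec i j)).1 k = (Pi.single i 1 : Fin 4 → ℝ) k := rfl

lemma toJ1Vec_totalVec_mom (i k : Fin 4) (j : Jet) :
    (toJ1Vec (totalVec i j)).2.2 k = j.2 {i, k} := rfl

lemma pd1_const (c : ℝ) : pd1 (fun _ => c) = fun _ => 0 := by funext a; simp [pd1]

lemma pd2_const (c : ℝ) : pd2 (fun _ => c) = fun _ => 0 := by funext a; simp [pd2]

lemma hasDerivAt_toJ1_line {Q : J1 → ℝ} {j : Jet} (hQ : DifferentiableAt ℝ Q (toJ1 j)) (d : Jet) :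
    HasDerivAt (fun t : ℝ => Q (toJ1 (j + t • d))) (fderiv ℝ Q (toJ1 j) (toJ1Vec d)) 0 :=
  hQ.hasFDerivAt.hasLineDerivAt (toJ1Vec d)

/-- The field multiplies `u₂₄, u₁₄, u₃₄` by the common factor `B_{t u₄} + u₄₄ B_{u₄ u₄}`, while its
contributions through `u₃₃` and `u₁₃` cancel. Hence the left hand side is only rescaled, and the
variation of `Q` remains. -/
lemma lineDeriv_contact_eqIII (hB : ContDiff ℝ ∞ B) {Q : J1 → ℝ} {j : Jet}
    (hQ : DifferentiableAt ℝ Q (toJ1 j)) (hF : eqIII Q j = 0) :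
    lineDeriv ℝ (eqIII Q) j (contactVec (generating (fun _ => 0) B) j) =
      -(fderiv ℝ Q (toJ1 j) (toJ1Vec (contactVec (generating (fun _ => 0) B) j)) * j.2 {2, 3}) := by
  have hA : ContDiff ℝ ∞ (fun _ : ℝ × ℝ => (0 : ℝ)) := contDiff_const
  set d := contactVec (generating (fun _ => 0) B) j with hd
  have hc := (hasCoordDerivAt_line j d).coord
  have h := (((hc {1, 3}).sub ((hc {0, 3}).mul (hc {2, 2}))).add
    ((hc {0, 2}).mul (hc {2, 3}))).sub ((hasDerivAt_toJ1_line hQ d).mul (hc {2, 3}))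
  have h' : HasLineDerivAt ℝ (eqIII Q) _ j d := h
  rw [h'.lineDeriv]
  have hv : ∀ i k, d.2 {i, k} = _ := fun i k => by
    rw [hd, contactVec_pair (contDiff_generating hA hB), hess_generating hA hB,
      fderiv_generating hA hB]
  simp only [hv, pd1_const, pd2_const, toJ1Vec_totalVec_fst, toJ1Vec_totalVec_mom, zero_smul,
    add_zero]
  rw [eqIII] at hF
  have p32 : ({3, 2} : Multiset (Fin 4)) = {2, 3} := by decide
  have p10 : ({1, 0} : Multiset (Fin 4)) = {0, 1} := by decide
  have p20 : ({2, 0} : Multiset (Fin 4)) = {0, 2} := by decide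
  simp [bu, p10, p20]
  linear_combination (pd2 (pd1 B) (planeL 3 (toJ1 j)) +
    pd2 (pd2 B) (planeL 3 (toJ1 j)) * j.2 {3, 3}) * hF

/-- As in type III, with the sum of the factors from `A` and `B`; the terms with `u₁₄` produced by
the mixed second derivatives cancel in the determinant. -/
lemma lineDeriv_contact_eqII (hA : ContDiff ℝ ∞ A) (hB : ContDiff ℝ ∞ B) {Q : J1 → ℝ} {j : Jet}
    (hQ : DifferentiableAt ℝ Q (toJ1 j)) (hF : eqII Q j = 0) :
    lineDeriv ℝ (eqII Q) j (contactVec (generating A B) j) =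
      -(fderiv ℝ Q (toJ1 j) (toJ1Vec (contactVec (generating A B) j)) * j.2 {0, 3}) := by
  set d := contactVec (generating A B) j with hd
  have hc := (hasCoordDerivAt_line j d).coord
  have h := (((hc {0, 1}).mul (hc {2, 3})).sub ((hc {0, 2}).mul (hc {1, 3}))).sub
    ((hasDerivAt_toJ1_line hQ d).mul (hc {0, 3}))
  have h' : HasLineDerivAt ℝ (eqII Q) _ j d := h
  rw [h'.lineDeriv]
  have hv : ∀ i k, d.2 {i, k} = _ := fun i k => by
    rw [hd, contactVec_pair (contDiff_generating hA hB), hess_generating hA hB,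
      fderiv_generating hA hB]
  simp only [hv, toJ1Vec_totalVec_fst, toJ1Vec_totalVec_mom, zero_smul, add_zero]
  rw [eqII] at hF
  have p30 : ({3, 0} : Multiset (Fin 4)) = {0, 3} := by decide
  have p10 : ({1, 0} : Multiset (Fin 4)) = {0, 1} := by decide
  have p20 : ({2, 0} : Multiset (Fin 4)) = {0, 2} := by decide
  simp [bu, p10, p20, p30]
  linear_combination (pd2 (pd1 A) (planeL 0 (toJ1 j)) +
    pd2 (pd2 A) (planeL 0 (toJ1 j)) * j.2 {0, 0} + pd2 (pd1 B) (planeL 3 (toJ1 j)) +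
    pd2 (pd2 B) (planeL 3 (toJ1 j)) * j.2 {3, 3}) * hF

end Generating

section Symmetric

variable {Ω : Set J1} {Q : J1 → ℝ}

lemma mem_poissonIdeal_three {f : J1 → ℝ} : f ∈ poissonIdeal 3 ↔
    ∃ B, ContDiff ℝ ∞ B ∧ f = generating (fun _ => 0) B := by
  refine exists_congr fun B => and_congr_right fun _ => ?_
  have : (fun q : J1 => B (q.1 3, q.2.2 3)) = generating (fun _ => 0) B := by
    funext q; simp [generating]; rfl
  rw [this]

lemma mem_poissonIdeal_add {f : J1 → ℝ} : f ∈ poissonIdeal 0 + poissonIdeal 3 ↔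
    ∃ A B, ContDiff ℝ ∞ A ∧ ContDiff ℝ ∞ B ∧ f = generating A B := by
  rw [Set.mem_add]
  constructor
  · rintro ⟨_, ⟨A, hA, rfl⟩, _, ⟨B, hB, rfl⟩, rfl⟩
    exact ⟨A, B, hA, hB, rfl⟩
  · rintro ⟨A, B, hA, hB, rfl⟩
    exact ⟨_, ⟨A, hA, rfl⟩, _, ⟨B, hB, rfl⟩, rfl⟩

/-- For necessity, the generating functions `1`, `t`, `u₄` yield `Q_u = 0`, `Q_{u₄} = 0` and `Q_t =
0`. They are tested at a jet with `u₃₄ = 1`, `u₂₄ = Q` and all other higher coordinates `0`, which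
satisfies the equation. -/
lemma isSymmetric_eqIII_iff (hΩ : IsOpen Ω) (hQ : ContDiffOn ℝ ∞ Q Ω) :
    IsSymmetric (poissonIdeal 3) (eqIII Q) (toJ1 ⁻¹' Ω) ↔ IsInvariantIII Ω Q := by
  have hd : ∀ q ∈ Ω, DifferentiableAt ℝ Q q := fun q hq =>
    (hQ.contDiffAt (hΩ.mem_nhds hq)).differentiableAt (by simp)
  have hA : ContDiff ℝ ∞ (fun _ : ℝ × ℝ => (0 : ℝ)) := contDiff_const
  constructor
  · intro h q hq
    set j := extendJet q fun I => if I = {1, 3} then Q q else if I = {2, 3} then 1 else 0 with hj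
    have hjq : toJ1 j = q := toJ1_extendJet _ _
    have v13 : j.2 {1, 3} = Q q := (extendJet_apply _ _ (by simp)).trans (if_pos rfl)
    have v23 : j.2 {2, 3} = 1 := (extendJet_apply _ _ (by simp)).trans
      ((if_neg (by decide)).trans (if_pos rfl))
    have v03 : j.2 {0, 3} = 0 := (extendJet_apply _ _ (by simp)).trans
      ((if_neg (by decide)).trans (if_neg (by decide)))
    have v02 : j.2 {0, 2} = 0 := (extendJet_apply _ _ (by simp)).trans
      ((if_neg (by decide)).trans (if_neg (by decide)))
    have hF : eqIII Q j = 0 := by rw [eqIII, v13, v23, v03, v02, hjq]; ring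
    have key : ∀ B : ℝ × ℝ → ℝ, ContDiff ℝ ∞ B →
        fderiv ℝ Q (toJ1 j) (toJ1Vec (contactVec (generating (fun _ => 0) B) j)) = 0 := by
      intro B hB
      have h1 := h _ (mem_poissonIdeal_three.2 ⟨B, hB, rfl⟩) j (by rwa [Set.mem_preimage, hjq]) hF
      rwa [lineDeriv_contact_eqIII hB (by rw [hjq]; exact hd q hq) hF, v23, mul_one,
        neg_eq_zero] at h1
    simp only [hjq] at key
    have k1 := key (fun _ => 1) contDiff_const
    have k2 := key Prod.fst contDiff_fst
    have k3 := key Prod.snd contDiff_snd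
    rw [← hjq, fderiv_contactVec hA contDiff_const, hjq] at k1
    rw [← hjq, fderiv_contactVec hA contDiff_fst, hjq] at k2
    rw [← hjq, fderiv_contactVec hA contDiff_snd, hjq] at k3
    have q3 : j.2 {3} = q.2.2 3 := by
      conv_rhs => rw [← hjq]
      rfl
    simp [pd1_const, pd2_const] at k1
    simp [pd1, pd2, fderiv_fst, k1] at k2
    simp [pd1, pd2, fderiv_snd, k1] at k3
    exact ⟨k3, k1, k2⟩
  · rintro h f hf j hj hF
    obtain ⟨B, hB, rfl⟩ := mem_poissonIdeal_three.1 hf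
    obtain ⟨h1, h2, h3⟩ := h _ hj
    rw [lineDeriv_contact_eqIII hB (hd _ hj) hF, fderiv_contactVec hA hB, h1, h2, h3]
    simp [pd1_const, pd2_const]

/-- The generating functions `x` and `u₁` add `Q_{u₁} = 0` and `Q_x = 0` to the three conditions of
type III; the test jet has `u₁₄ = u₃₄ = 1` and `u₁₂ = Q`. -/
lemma isSymmetric_eqII_iff (hΩ : IsOpen Ω) (hQ : ContDiffOn ℝ ∞ Q Ω) :
    IsSymmetric (poissonIdeal 0 + poissonIdeal 3) (eqII Q) (toJ1 ⁻¹' Ω) ↔ IsInvariantII Ω Q := by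
  have hd : ∀ q ∈ Ω, DifferentiableAt ℝ Q q := fun q hq =>
    (hQ.contDiffAt (hΩ.mem_nhds hq)).differentiableAt (by simp)
  have hA : ContDiff ℝ ∞ (fun _ : ℝ × ℝ => (0 : ℝ)) := contDiff_const
  constructor
  · intro h q hq
    set j := extendJet q fun I => if I = {0, 1} then Q q else if I = {2, 3} then 1 else
      if I = {0, 3} then 1 else 0 with hj
    have hjq : toJ1 j = q := toJ1_extendJet _ _
    have v01 : j.2 {0, 1} = Q q := (extendJet_apply _ _ (by simp)).trans (if_pos rfl)
    have v23 : j.2 {2, 3} = 1 := (extendJet_apply _ _ (by simp)).trans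
      ((if_neg (by decide)).trans (if_pos rfl))
    have v03 : j.2 {0, 3} = 1 := (extendJet_apply _ _ (by simp)).trans
      ((if_neg (by decide)).trans ((if_neg (by decide)).trans (if_pos rfl)))
    have v02 : j.2 {0, 2} = 0 := (extendJet_apply _ _ (by simp)).trans
      ((if_neg (by decide)).trans ((if_neg (by decide)).trans (if_neg (by decide))))
    have hF : eqII Q j = 0 := by rw [eqII, v01, v23, v03, v02, hjq]; ring
    have key : ∀ A B : ℝ × ℝ → ℝ, ContDiff ℝ ∞ A → ContDiff ℝ ∞ B →
        fderiv ℝ Q (toJ1 j) (toJ1Vec (contactVec (generating A B) j)) = 0 := by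
      intro A B hA hB
      have h1 := h _ (mem_poissonIdeal_add.2 ⟨A, B, hA, hB, rfl⟩) j
        (by rwa [Set.mem_preimage, hjq]) hF
      rwa [lineDeriv_contact_eqII hA hB (by rw [hjq]; exact hd q hq) hF, v03, mul_one,
        neg_eq_zero] at h1
    have k1 := key _ _ hA (contDiff_const (c := (1 : ℝ)))
    have k2 := key _ _ hA contDiff_fst
    have k3 := key _ _ hA contDiff_snd
    have k4 := key _ _ contDiff_fst hA
    have k5 := key _ _ contDiff_snd hA
    rw [fderiv_contactVec hA contDiff_const] at k1
    rw [fderiv_contactVec hA contDiff_fst] at k2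
    rw [fderiv_contactVec hA contDiff_snd] at k3
    rw [fderiv_contactVec contDiff_fst hA] at k4
    rw [fderiv_contactVec contDiff_snd hA] at k5
    simp [pd1_const, pd2_const] at k1
    simp [pd1, pd2, fderiv_fst, k1] at k2
    simp [pd1, pd2, fderiv_snd, k1] at k3
    simp [pd1, pd2, fderiv_fst, k1] at k4
    simp [pd1, pd2, fderiv_snd, k1] at k5
    rw [← hjq]
    exact ⟨k5, k3, k1, k4, k2⟩
  · rintro h f hf j hj hF
    obtain ⟨A, B, hA, hB, rfl⟩ := mem_poissonIdeal_add.1 hf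
    obtain ⟨h1, h2, h3, h4, h5⟩ := h _ hj
    rw [lineDeriv_contact_eqII hA hB (hd _ hj) hF, fderiv_contactVec hA hB, h1, h2, h3, h4, h5]
    simp

end Symmetric

/-! ### The general branch of type III satisfies the integrability conditions -/

/-- The derivative of a function of two variables in the direction `d`, as a function of the base
coordinates `x, y`. -/
def dirXY (f : ℝ × ℝ → ℝ) (q d : J1) : ℝ :=
  pd1 f (xy q) * d.1 0 + pd2 f (xy q) * d.1 1

lemma hasLineDerivAt_xy {f : ℝ × ℝ → ℝ} {q : J1} (hf : ContDiffAt ℝ ∞ f (xy q)) (d : J1) :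
    HasLineDerivAt ℝ (fun r => f (xy r)) (dirXY f q d) q d := hasLineDerivAt_pair 0 1 hf d

/-- The derivative of `Δ`. -/
def dirDelta (F G : ℝ × ℝ → ℝ) (q d : J1) : ℝ :=
  dirXY F q d * q.2.2 2 + F (xy q) * d.2.2 2 + dirXY G q d + d.1 2

lemma bx_fst (i : Fin 4) : (bx i).1 = Pi.single i 1 := rfl

lemma bx_mom (i : Fin 4) : (bx i).2.2 = 0 := rfl

lemma bu_fst : bu.1 = 0 := rfl

lemma bu_mom : bu.2.2 = 0 := rfl

lemma bp_fst (i : Fin 4) : (bp i).1 = 0 := rfl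

lemma bp_mom (i : Fin 4) : (bp i).2.2 = Pi.single i 1 := rfl

section General

variable {F G H L : ℝ × ℝ → ℝ} {q : J1}

lemma hasLineDerivAt_delta (hF : ContDiffAt ℝ ∞ F (xy q)) (hG : ContDiffAt ℝ ∞ G (xy q)) (d : J1) :
    HasLineDerivAt ℝ (deltaIII F G) (dirDelta F G q d) q d :=
  (((hasLineDerivAt_xy hF d).mul (hasLineDerivAt_mom 2 q d)).add (hasLineDerivAt_xy hG d)).add
    (hasLineDerivAt_base 2 q d)

lemma contDiffAt_xy {f : ℝ × ℝ → ℝ} (hf : ContDiffAt ℝ ∞ f (xy q)) :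
    ContDiffAt ℝ ∞ (fun r => f (xy r)) q := contDiffAt_pair (i := 0) (k := 1) hf

lemma contDiffAt_delta (hF : ContDiffAt ℝ ∞ F (xy q)) (hG : ContDiffAt ℝ ∞ G (xy q)) :
    ContDiffAt ℝ ∞ (deltaIII F G) q :=
  (((contDiffAt_xy hF).mul (momL 2).contDiff.contDiffAt).add (contDiffAt_xy hG)).add
    (baseL 2).contDiff.contDiffAt

/-- The numerator of `Q` in the general branch. -/
def numIII (F G H L : ℝ × ℝ → ℝ) (q : J1) : ℝ :=
  F (xy q) * q.2.2 1 + q.2.2 0 - deltaIII F G q * deltaIII F G q * L (xy q) -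
    1 / 2 * ((pd1 F (xy q) - F (xy q) * pd2 F (xy q)) * (q.2.2 2 * q.2.2 2) +
      2 * ((pd1 G (xy q) - G (xy q) * pd2 F (xy q) - q.1 2 * pd2 F (xy q)) * q.2.2 2) -
      2 * (q.1 2 * pd2 G (xy q)) + H (xy q))

lemma generalIII_eq (hΔ : deltaIII F G q ≠ 0) :
    generalIII F G H L q = numIII F G H L q / deltaIII F G q := by
  rw [generalIII, numIII]
  field_simp

/-- The `z`-derivative of `Q Δ` in the general branch. -/
def slopeZ (F G L : ℝ × ℝ → ℝ) (q : J1) : ℝ :=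
  pd2 F (xy q) * q.2.2 2 + pd2 G (xy q) - 2 * (deltaIII F G q * L (xy q))

/-- The `u₃`-derivative of `Q Δ` in the general branch. -/
def slopeP (F G L : ℝ × ℝ → ℝ) (q : J1) : ℝ :=
  pd2 F (xy q) * deltaIII F G q - (pd1 F (xy q) * q.2.2 2 + pd1 G (xy q)) -
    2 * (deltaIII F G q * L (xy q) * F (xy q))

lemma hasLineDerivAt_slopeZ (hF : ContDiffAt ℝ ∞ F (xy q)) (hG : ContDiffAt ℝ ∞ G (xy q))
    (hL : ContDiffAt ℝ ∞ L (xy q)) (d : J1) :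
    HasLineDerivAt ℝ (slopeZ F G L) (dirXY (pd2 F) q d * q.2.2 2 + pd2 F (xy q) * d.2.2 2 +
      dirXY (pd2 G) q d -
      2 * (dirDelta F G q d * L (xy q) + deltaIII F G q * dirXY L q d)) q d :=
  (((hasLineDerivAt_xy hF.pd2 d).mul (hasLineDerivAt_mom 2 q d)).add
    (hasLineDerivAt_xy hG.pd2 d)).sub
    (((hasLineDerivAt_delta hF hG d).mul (hasLineDerivAt_xy hL d)).const_mul 2)

lemma hasLineDerivAt_slopeP (hF : ContDiffAt ℝ ∞ F (xy q)) (hG : ContDiffAt ℝ ∞ G (xy q))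
    (hL : ContDiffAt ℝ ∞ L (xy q)) (d : J1) :
    HasLineDerivAt ℝ (slopeP F G L) (dirXY (pd2 F) q d * deltaIII F G q +
      pd2 F (xy q) * dirDelta F G q d -
      (dirXY (pd1 F) q d * q.2.2 2 + pd1 F (xy q) * d.2.2 2 + dirXY (pd1 G) q d) -
      2 * ((dirDelta F G q d * L (xy q) + deltaIII F G q * dirXY L q d) * F (xy q) +
        deltaIII F G q * L (xy q) * dirXY F q d)) q d :=
  (((hasLineDerivAt_xy hF.pd2 d).mul (hasLineDerivAt_delta hF hG d)).sub
    (((hasLineDerivAt_xy hF.pd1 d).mul (hasLineDerivAt_mom 2 q d)).add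
    (hasLineDerivAt_xy hG.pd1 d))).sub
    ((((hasLineDerivAt_delta hF hG d).mul (hasLineDerivAt_xy hL d)).mul
      (hasLineDerivAt_xy hF d)).const_mul 2)

/-- The first derivatives of `Q` in the general branch. -/
lemma general_fderiv {Q : J1 → ℝ} (hQ : ContDiffAt ℝ ∞ Q q)
    (e : ∀ᶠ r in 𝓝 q, deltaIII F G r ≠ 0 ∧ Q r = generalIII F G H L r)
    (hF : ContDiffAt ℝ ∞ F (xy q)) (hG : ContDiffAt ℝ ∞ G (xy q))
    (hH : ContDiffAt ℝ ∞ H (xy q)) (hL : ContDiffAt ℝ ∞ L (xy q)) :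
    (fderiv ℝ Q q (bx 3) = 0 ∧ fderiv ℝ Q q bu = 0 ∧ fderiv ℝ Q q (bp 3) = 0) ∧
      fderiv ℝ Q q (bp 0) = 1 / deltaIII F G q ∧
      fderiv ℝ Q q (bp 1) = F (xy q) / deltaIII F G q ∧
      fderiv ℝ Q q (bx 2) = (slopeZ F G L q - Q q) / deltaIII F G q ∧
      fderiv ℝ Q q (bp 2) = (slopeP F G L q - F (xy q) * Q q) / deltaIII F G q := by
  have hΔ := e.self_of_nhds.1
  -- Differentiating the product `Q Δ` avoids quotients. Of the derivatives needed none is in the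
  -- directions `x, y`, so derivatives of `H` and `L` drop out.
  have e' : (fun r => Q r * deltaIII F G r) =ᶠ[𝓝 q] numIII F G H L := by
    filter_upwards [e] with r hr
    rw [hr.2, generalIII_eq hr.1, div_mul_cancel₀ _ hr.1]
  have f := fun d => hasLineDerivAt_xy hF d
  have fx := fun d => hasLineDerivAt_xy hF.pd1 d
  have fy := fun d => hasLineDerivAt_xy hF.pd2 d
  have p := fun i d => hasLineDerivAt_mom i q d
  have z := fun d => hasLineDerivAt_base 2 q d
  have Dd := fun d => hasLineDerivAt_delta hF hG d
  have key : ∀ d, _ := fun d =>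
    ((hQ.hasLineDerivAt d).mul (Dd d)).unique (hasLineDerivAt_congr
    (((((f d).mul (p 1 d)).add (p 0 d)).sub
    (((Dd d).mul (Dd d)).mul (hasLineDerivAt_xy hL d))).sub
    (((((((fx d).sub ((f d).mul (fy d))).mul ((p 2 d).mul (p 2 d))).add
      (((((hasLineDerivAt_xy hG.pd1 d).sub ((hasLineDerivAt_xy hG d).mul (fy d))).sub
        ((z d).mul (fy d))).mul (p 2 d)).const_mul 2)).sub
      (((z d).mul (hasLineDerivAt_xy hG.pd2 d)).const_mul 2)).add (hasLineDerivAt_xy hH d)).const_mul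
        (1 / 2))) e')
  have D : deltaIII F G q = F (xy q) * q.2.2 2 + G (xy q) + q.1 2 := rfl
  refine ⟨⟨?_, ?_, ?_⟩, ?_, ?_, ?_, ?_⟩
  · have := key (bx 3)
    simp [dirXY, dirDelta, bx_fst, bx_mom] at this
    exact this.resolve_right hΔ
  · have := key bu
    simp [dirXY, dirDelta, bu_fst, bu_mom] at this
    exact this.resolve_right hΔ
  · have := key (bp 3)
    simp [dirXY, dirDelta, bp_fst, bp_mom] at this
    exact this.resolve_right hΔ
  · have := key (bp 0)
    simp [dirXY, dirDelta, bp_fst, bp_mom] at this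
    rw [eq_div_iff hΔ]
    exact this
  · have := key (bp 1)
    simp [dirXY, dirDelta, bp_fst, bp_mom] at this
    rw [eq_div_iff hΔ]
    exact this
  · have := key (bx 2)
    simp [dirXY, dirDelta, bx_fst, bx_mom] at this
    rw [eq_div_iff hΔ, slopeZ]
    linear_combination this
  · have := key (bp 2)
    simp [dirXY, dirDelta, bp_fst, bp_mom] at this
    rw [eq_div_iff hΔ, slopeP]
    rw [D] at this ⊢
    linear_combination this

lemma IsGeneralNear.invariant {Q : J1 → ℝ} (hQ : ContDiffAt ℝ ∞ Q q) (h : IsGeneralNear Q q) :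
    fderiv ℝ Q q (bx 3) = 0 ∧ fderiv ℝ Q q bu = 0 ∧ fderiv ℝ Q q (bp 3) = 0 := by
  obtain ⟨O, F, G, H, L, N, hO, hN, hF, hG, hH, hL, -, h⟩ := h
  have hq := (h q (mem_of_mem_nhds hN)).1
  exact (general_fderiv hQ (Filter.eventually_of_mem hN fun r hr => (h r hr).2)
    (hF.contDiffAt (hO.mem_nhds hq)) (hG.contDiffAt (hO.mem_nhds hq))
    (hH.contDiffAt (hO.mem_nhds hq)) (hL.contDiffAt (hO.mem_nhds hq))).1

/-- Second derivatives come from differentiating the formulas for `Q_{u₁}, Q_{u₂}, Q_z, Q_{u₃}`, in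
which `H` no longer appears explicitly. The equation for `L` is needed only for the condition `e4`.
-/
lemma IsGeneralNear.condIII {Q : J1 → ℝ} (hQ : ∀ᶠ r in 𝓝 q, ContDiffAt ℝ ∞ Q r)
    (h : IsGeneralNear Q q) : CondIII Q q := by
  obtain ⟨O, F, G, H, L, N, hO, hN, hF, hG, hH, hL, hpde, h⟩ := h
  have hq := h q (mem_of_mem_nhds hN)
  have at' : ∀ {f : ℝ × ℝ → ℝ}, ContDiffOn ℝ ∞ f O → ∀ {a}, a ∈ O → ContDiffAt ℝ ∞ f a :=
    fun hf a ha => hf.contDiffAt (hO.mem_nhds ha)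
  have ev : ∀ᶠ r in 𝓝 q, fderiv ℝ Q r (bp 0) = 1 / deltaIII F G r ∧
      fderiv ℝ Q r (bp 1) = F (xy r) / deltaIII F G r ∧
      fderiv ℝ Q r (bx 2) = (slopeZ F G L r - Q r) / deltaIII F G r ∧
      fderiv ℝ Q r (bp 2) = (slopeP F G L r - F (xy r) * Q r) / deltaIII F G r := by
    filter_upwards [hQ, eventually_eventually_nhds.2 hN] with r hr hNr
    have hr' := (h r (mem_of_mem_nhds hNr)).1
    exact (general_fderiv hr (Filter.eventually_of_mem hNr fun s hs => (h s hs).2)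
      (at' hF hr') (at' hG hr') (at' hH hr') (at' hL hr')).2
  obtain ⟨f0, f1, fz, f2⟩ := ev.self_of_nhds
  have hQ := hQ.self_of_nhds
  have hΔ := hq.2.1
  have hF := at' hF hq.1
  have hG := at' hG hq.1
  have hL := at' hL hq.1
  have Dd := fun d => hasLineDerivAt_delta hF hG d
  have s0 : ∀ d, _ := fun d => hess_of_eventuallyEq (d := d) hQ (ev.mono fun r hr => hr.1)
    ((hasLineDerivAt_const 1 q d).div (Dd d) hΔ)
  have s1 : ∀ d, _ := fun d => hess_of_eventuallyEq (d := d) hQ (ev.mono fun r hr => hr.2.1)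
    ((hasLineDerivAt_xy hF d).div (Dd d) hΔ)
  have sz : ∀ d, _ := fun d => hess_of_eventuallyEq (d := d) hQ (ev.mono fun r hr => hr.2.2.1)
    (((hasLineDerivAt_slopeZ hF hG hL d).sub (hQ.hasLineDerivAt d)).div (Dd d) hΔ)
  have s2 : ∀ d, _ := fun d => hess_of_eventuallyEq (d := d) hQ (ev.mono fun r hr => hr.2.2.2)
    (((hasLineDerivAt_slopeP hF hG hL d).sub
      ((hasLineDerivAt_xy hF d).mul (hQ.hasLineDerivAt d))).div (Dd d) hΔ)
  have pde := hpde _ hq.1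
  have hsym : pd1 (pd2 F) (xy q) = pd2 (pd1 F) (xy q) := pd1_pd2 hF
  have hsymG : pd1 (pd2 G) (xy q) = pd2 (pd1 G) (xy q) := pd1_pd2 hG
  have e : pd2 (F * L) (xy q) = pd2 F (xy q) * L (xy q) + F (xy q) * pd2 L (xy q) :=
    ((hF.hasLineDerivAt _).mul (hL.hasLineDerivAt _)).pd2_eq (hF.mul hL)
  rw [e] at pde
  refine ⟨?_, ?_, ?_, ?_, ?_, ?_, ?_, ?_, ?_, ?_, ?_⟩
  all_goals
    simp only [s0, s1, sz, s2, f0, f1, fz, f2]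
    simp [dirXY, dirDelta, bx_fst, bx_mom, bp_fst, bp_mom, slopeZ, slopeP, hsym, hsymG]
  iterate 7
    · field_simp
      try ring
  linear_combination (norm := (field_simp; ring1)) 2 * pde

end General

/-! ### Integrability conditions of type III in a ball -/

/-- On the ball, `Q` is smooth, invariant and satisfies the integrability conditions. -/
structure LocalIII (Q : J1 → ℝ) (q : J1) (ε : ℝ) : Prop where
  smooth : ∀ r ∈ Metric.ball q ε, ContDiffAt ℝ ∞ Q r
  inv : IsInvariantIII (Metric.ball q ε) Q
  cond : ∀ r ∈ Metric.ball q ε, CondIII Q r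

namespace LocalIII

variable {Q : J1 → ℝ} {q : J1} {ε : ℝ}

lemma hess_zero (h : LocalIII Q q ε) {d : J1} (hd : d = bx 3 ∨ d = bu ∨ d = bp 3) {r : J1}
    (hr : r ∈ Metric.ball q ε) (d' : J1) : hess Q r d d' = 0 := by
  refine (hess_eq_zero Metric.isOpen_ball (fun r hr => (h.smooth r hr).contDiffWithinAt) (d := d)
    (fun s hs => ?_) hr d').2
  obtain ⟨h1, h2, h3⟩ := h.inv s hs
  rcases hd with rfl | rfl | rfl <;> assumption

lemma inv_eq (h : LocalIII Q q ε) {d : J1} (hd : d = bx 3 ∨ d = bu ∨ d = bp 3) {r : J1}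
    (hr : r ∈ Metric.ball q ε) : fderiv ℝ Q r d = 0 := by
  obtain ⟨h1, h2, h3⟩ := h.inv r hr
  rcases hd with rfl | rfl | rfl <;> assumption

lemma smooth_fderiv (h : LocalIII Q q ε) (d : J1) {r : J1} (hr : r ∈ Metric.ball q ε) :
    ContDiffAt ℝ ∞ (fun s => fderiv ℝ Q s d) r := (h.smooth r hr).fderiv_dir (by decide) d

/-- A function is a function of `x, y` if its derivatives in the other directions vanish. -/
lemma descend {g : J1 → ℝ} (hg : ∀ r ∈ Metric.ball q ε, ContDiffAt ℝ ∞ g r)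
    (h0 : ∀ r ∈ Metric.ball q ε, ∀ d, d = bx 2 ∨ d = bp 0 ∨ d = bp 1 ∨ d = bp 2 ∨
      d = bx 3 ∨ d = bu ∨ d = bp 3 → fderiv ℝ g r d = 0) :
    ∃ g' : ℝ × ℝ → ℝ, ContDiffOn ℝ ∞ g' (Metric.ball (xy q) ε) ∧
      ∀ r ∈ Metric.ball q ε, g r = g' (xy r) := by
  refine exists_descent_pair (i := 0) (k := 1) (by decide)
    (fun r hr => (hg r hr).contDiffWithinAt) (fun r hr m h1 h2 => ?_)
    (fun r hr => h0 r hr _ (by simp)) fun r hr m => ?_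
  · have : m = 2 ∨ m = 3 := by omega
    rcases this with rfl | rfl <;> exact h0 r hr _ (by simp)
  · fin_cases m <;> exact h0 r hr _ (by simp)

lemma xy_mem {r : J1} (hr : r ∈ Metric.ball q ε) : xy r ∈ Metric.ball (xy q) ε :=
  mem_ball_pairL (i := 0) (k := 1) hr

lemma contDiffAt_of_mem {f : ℝ × ℝ → ℝ} (hf : ContDiffOn ℝ ∞ f (Metric.ball (xy q) ε)) {r : J1}
    (hr : r ∈ Metric.ball q ε) : ContDiffAt ℝ ∞ f (xy r) :=
  hf.contDiffAt (Metric.isOpen_ball.mem_nhds (xy_mem hr))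

lemma eventually_of_ball {P : J1 → Prop} (hP : ∀ r ∈ Metric.ball q ε, P r) {r : J1}
    (hr : r ∈ Metric.ball q ε) : ∀ᶠ s in 𝓝 r, P s :=
  Filter.eventually_of_mem (Metric.isOpen_ball.mem_nhds hr) hP

/-- Existence of the coefficients `F`, `G` of the general branch. -/
lemma exists_delta (h : LocalIII Q q ε) (hne : ∀ r ∈ Metric.ball q ε, fderiv ℝ Q r (bp 0) ≠ 0) :
    ∃ F G : ℝ × ℝ → ℝ, ContDiffOn ℝ ∞ F (Metric.ball (xy q) ε) ∧
      ContDiffOn ℝ ∞ G (Metric.ball (xy q) ε) ∧ ∀ r ∈ Metric.ball q ε, deltaIII F G r ≠ 0 ∧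
        fderiv ℝ Q r (bp 0) = 1 / deltaIII F G r ∧
        fderiv ℝ Q r (bp 1) = F (xy r) / deltaIII F G r := by
  have d0 := fun r hr d => hasLineDerivAt_fderiv (h.smooth r hr) d (bp 0)
  have d1 := fun r hr d => hasLineDerivAt_fderiv (h.smooth r hr) d (bp 1)
  -- The conditions on second derivatives involving `u₁` or `u₂` say that the quotient `Q_{u₂} /
  -- Q_{u₁}` depends on `x, y` only.
  obtain ⟨F, hF, hFQ⟩ := descend
    (g := fun r => fderiv ℝ Q r (bp 1) / fderiv ℝ Q r (bp 0))
    (fun r hr => (h.smooth_fderiv _ hr).div (h.smooth_fderiv _ hr) (hne r hr))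
    (fun r hr d hd => by
      rw [HasLineDerivAt.fderiv_eq ((d1 r hr d).div (d0 r hr d) (hne r hr))
        (((h.smooth_fderiv _ hr).div (h.smooth_fderiv _ hr) (hne r hr)).differentiableAt (by simp))]
      have C := h.cond r hr
      have s := hess_symm (h.smooth r hr)
      rcases hd with rfl | rfl | rfl | rfl | hd
      · rw [C.hz0, C.hz1]; ring
      · rw [C.h00, C.h01]; ring
      · rw [s (bp 1) (bp 0), C.h01, C.h11]; ring
      · rw [s, C.h12, s _ (bp 0), C.h02]; ring
      · rw [h.hess_zero hd hr, h.hess_zero hd hr]; ring)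
  have hF' := fun r hr => hasLineDerivAt_xy (q := r) (contDiffAt_of_mem hF hr)
  -- By the same conditions `1 / Q_{u₁}` has `z`-derivative `1` and `u₃`-derivative `F`, and no
  -- derivative along `u₁`, `u₂`. What remains after subtracting `F u₃ + z` is `G`.
  have hGs : ∀ r ∈ Metric.ball q ε, ContDiffAt ℝ ∞
      (fun r => 1 / fderiv ℝ Q r (bp 0) - F (xy r) * r.2.2 2 - r.1 2) r := fun r hr =>
    ((contDiffAt_const.div (h.smooth_fderiv _ hr) (hne r hr)).sub
      ((contDiffAt_xy (contDiffAt_of_mem hF hr)).mul (momL 2).contDiff.contDiffAt)).sub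
      (baseL 2).contDiff.contDiffAt
  obtain ⟨G, hG, hGQ⟩ := descend hGs (fun r hr d hd => by
    rw [HasLineDerivAt.fderiv_eq ((((hasLineDerivAt_const 1 r d).div (d0 r hr d) (hne r hr)).sub
      ((hF' r hr d).mul (hasLineDerivAt_mom 2 r d))).sub (hasLineDerivAt_base 2 r d))
      ((hGs r hr).differentiableAt (by simp))]
    have C := h.cond r hr
    have s := hess_symm (h.smooth r hr)
    have hn := hne r hr
    have e := hFQ r hr
    rcases hd with rfl | rfl | rfl | rfl | hd
    · rw [C.hz0]; simp [dirXY, bx_fst, bx_mom]; field_simp; ring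
    · rw [C.h00]; simp [dirXY, bp_fst, bp_mom]
    · rw [s, C.h01]; simp [dirXY, bp_fst, bp_mom]
    · rw [s, C.h02, ← e]; simp [dirXY, bp_fst, bp_mom]; field_simp; ring
    · rw [h.hess_zero hd hr]
      rcases hd with rfl | rfl | rfl <;>
        simp [dirXY, bp_fst, bp_mom, bx_fst, bx_mom, bu_fst, bu_mom])
  refine ⟨F, G, hF, hG, fun r hr => ?_⟩
  have e : deltaIII F G r = 1 / fderiv ℝ Q r (bp 0) := by
    rw [deltaIII, ← hGQ r hr]; ring
  have hn := hne r hr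
  rw [e, ← hFQ r hr]
  refine ⟨by positivity, by field_simp, by field_simp⟩

end LocalIII

/-! ### The general branch of type III from the integrability conditions -/

/-- `Δ_y`. -/
def deltaY (F G : ℝ × ℝ → ℝ) (q : J1) : ℝ := pd2 F (xy q) * q.2.2 2 + pd2 G (xy q)

/-- `Δ_x`. -/
def deltaX (F G : ℝ × ℝ → ℝ) (q : J1) : ℝ := pd1 F (xy q) * q.2.2 2 + pd1 G (xy q)

section

variable {F G : ℝ × ℝ → ℝ} {q : J1}

lemma hasLineDerivAt_deltaY (hF : ContDiffAt ℝ ∞ F (xy q)) (hG : ContDiffAt ℝ ∞ G (xy q))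
    (d : J1) : HasLineDerivAt ℝ (deltaY F G)
      (dirXY (pd2 F) q d * q.2.2 2 + pd2 F (xy q) * d.2.2 2 + dirXY (pd2 G) q d) q d :=
  ((hasLineDerivAt_xy hF.pd2 d).mul (hasLineDerivAt_mom 2 q d)).add (hasLineDerivAt_xy hG.pd2 d)

lemma hasLineDerivAt_deltaX (hF : ContDiffAt ℝ ∞ F (xy q)) (hG : ContDiffAt ℝ ∞ G (xy q))
    (d : J1) : HasLineDerivAt ℝ (deltaX F G)
      (dirXY (pd1 F) q d * q.2.2 2 + pd1 F (xy q) * d.2.2 2 + dirXY (pd1 G) q d) q d :=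
  ((hasLineDerivAt_xy hF.pd1 d).mul (hasLineDerivAt_mom 2 q d)).add (hasLineDerivAt_xy hG.pd1 d)

lemma contDiffAt_deltaY (hF : ContDiffAt ℝ ∞ F (xy q)) (hG : ContDiffAt ℝ ∞ G (xy q)) :
    ContDiffAt ℝ ∞ (deltaY F G) q :=
  ((contDiffAt_xy hF.pd2).mul (momL 2).contDiff.contDiffAt).add (contDiffAt_xy hG.pd2)

end

/-! ### Reconstruction of the coefficients of the general branch -/

/-- The function which is `-2 L` in the general branch. -/
def rhoIII (F G : ℝ × ℝ → ℝ) (Q : J1 → ℝ) (q : J1) : ℝ :=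
  fderiv ℝ Q q (bx 2) + (Q q - deltaY F G q) / deltaIII F G q

namespace LocalIII

variable {Q : J1 → ℝ} {q : J1} {ε : ℝ} {F G : ℝ × ℝ → ℝ}

/-- The derivative of `rhoIII`. -/
def dirRho (F G : ℝ × ℝ → ℝ) (Q : J1 → ℝ) (r d : J1) : ℝ :=
  hess Q r d (bx 2) + ((fderiv ℝ Q r d -
    (dirXY (pd2 F) r d * r.2.2 2 + pd2 F (xy r) * d.2.2 2 + dirXY (pd2 G) r d)) * deltaIII F G r -
    (Q r - deltaY F G r) * dirDelta F G r d) / deltaIII F G r ^ 2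

lemma hasLineDerivAt_rho (h : LocalIII Q q ε) (hF : ContDiffOn ℝ ∞ F (Metric.ball (xy q) ε))
    (hG : ContDiffOn ℝ ∞ G (Metric.ball (xy q) ε)) {r : J1} (hr : r ∈ Metric.ball q ε)
    (hΔ : deltaIII F G r ≠ 0) (d : J1) :
    HasLineDerivAt ℝ (rhoIII F G Q) (dirRho F G Q r d) r d :=
  have hF' := contDiffAt_of_mem hF hr
  have hG' := contDiffAt_of_mem hG hr
  (hasLineDerivAt_fderiv (h.smooth r hr) d (bx 2)).add
    ((((h.smooth r hr).hasLineDerivAt d).sub (hasLineDerivAt_deltaY hF' hG' d)).div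
      (hasLineDerivAt_delta hF' hG' d) hΔ)

lemma contDiffAt_rho (h : LocalIII Q q ε) (hF : ContDiffOn ℝ ∞ F (Metric.ball (xy q) ε))
    (hG : ContDiffOn ℝ ∞ G (Metric.ball (xy q) ε)) {r : J1} (hr : r ∈ Metric.ball q ε)
    (hΔ : deltaIII F G r ≠ 0) : ContDiffAt ℝ ∞ (rhoIII F G Q) r :=
  have hF' := contDiffAt_of_mem hF hr
  have hG' := contDiffAt_of_mem hG hr
  (h.smooth_fderiv _ hr).add
    (((h.smooth r hr).sub (contDiffAt_deltaY hF' hG')).div (contDiffAt_delta hF' hG') hΔ)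

/-- With `Q_{u₁} = 1 / Δ`, this is the condition `e3`. -/
lemma dirRho_z (h : LocalIII Q q ε) (hF : ContDiffOn ℝ ∞ F (Metric.ball (xy q) ε))
    (hG : ContDiffOn ℝ ∞ G (Metric.ball (xy q) ε))
    (hΔ : ∀ r ∈ Metric.ball q ε, deltaIII F G r ≠ 0 ∧
      fderiv ℝ Q r (bp 0) = 1 / deltaIII F G r ∧ fderiv ℝ Q r (bp 1) = F (xy r) / deltaIII F G r)
    {r : J1} (hr : r ∈ Metric.ball q ε) : dirRho F G Q r (bx 2) = 0 := by
  obtain ⟨hn, f0, f1⟩ := hΔ r hr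
  have s0 := hess_of_eventuallyEq (d := bx 1) (h.smooth r hr)
    (eventually_of_ball (fun s hs => (hΔ s hs).2.1) hr)
    ((hasLineDerivAt_const 1 r _).div
      (hasLineDerivAt_delta (contDiffAt_of_mem hF hr) (contDiffAt_of_mem hG hr) _) hn)
  have e3 := (h.cond r hr).e3
  rw [s0, f0] at e3
  simp [dirXY, dirDelta, bx_fst, bx_mom] at e3
  simp [dirRho, dirXY, dirDelta, bx_fst, bx_mom, deltaY]
  linear_combination (norm := (field_simp; ring1)) e3

/-- The derivative of `rhoIII` by `u₃`, from the integrability conditions. -/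
lemma dirRho_p (h : LocalIII Q q ε) (hF : ContDiffOn ℝ ∞ F (Metric.ball (xy q) ε))
    (hG : ContDiffOn ℝ ∞ G (Metric.ball (xy q) ε))
    (hΔ : ∀ r ∈ Metric.ball q ε, deltaIII F G r ≠ 0 ∧
      fderiv ℝ Q r (bp 0) = 1 / deltaIII F G r ∧ fderiv ℝ Q r (bp 1) = F (xy r) / deltaIII F G r)
    {r : J1} (hr : r ∈ Metric.ball q ε) :
    fderiv ℝ Q r (bp 2) - F (xy r) * fderiv ℝ Q r (bx 2) +
      (deltaX F G r + F (xy r) * deltaY F G r) / deltaIII F G r - pd2 F (xy r) =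
        2 * (deltaIII F G r * dirRho F G Q r (bp 2)) := by
  obtain ⟨hn, f0, f1⟩ := hΔ r hr
  have hF' := contDiffAt_of_mem hF hr
  have hG' := contDiffAt_of_mem hG hr
  have s0 := hess_of_eventuallyEq (d := bx 0) (h.smooth r hr)
    (eventually_of_ball (fun s hs => (hΔ s hs).2.1) hr)
    ((hasLineDerivAt_const 1 r _).div (hasLineDerivAt_delta hF' hG' _) hn)
  have s1 := hess_of_eventuallyEq (d := bx 1) (h.smooth r hr)
    (eventually_of_ball (fun s hs => (hΔ s hs).2.2) hr)
    ((hasLineDerivAt_xy hF' _).div (hasLineDerivAt_delta hF' hG' _) hn)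
  have e2 := (h.cond r hr).e2
  rw [s0, s1, f0, f1] at e2
  rw [dirRho, hess_symm (h.smooth r hr) (bp 2) (bx 2)]
  simp [dirXY, dirDelta, bx_fst, bx_mom] at e2
  simp [dirXY, dirDelta, bp_fst, bp_mom, deltaY, deltaX]
  linear_combination (norm := (field_simp; ring1)) -deltaIII F G r * e2

/-- The delicate direction is `u₃`. Write `T` for the left hand side of `dirRho_p`, so `T = 2 Δ
ρ_{u₃}`. Since `ρ_z = 0` and `Δ_z = 1`, this gives `T_z = 2 ρ_{u₃}`. A direct computation gives `T_z
+ T / Δ = ρ_{u₃} - F ρ_z`. Hence `4 ρ_{u₃} = ρ_{u₃}`. -/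
lemma fderiv_rho_zero (h : LocalIII Q q ε) (hF : ContDiffOn ℝ ∞ F (Metric.ball (xy q) ε))
    (hG : ContDiffOn ℝ ∞ G (Metric.ball (xy q) ε))
    (hΔ : ∀ r ∈ Metric.ball q ε, deltaIII F G r ≠ 0 ∧
      fderiv ℝ Q r (bp 0) = 1 / deltaIII F G r ∧ fderiv ℝ Q r (bp 1) = F (xy r) / deltaIII F G r)
    {r : J1} (hr : r ∈ Metric.ball q ε) {d : J1} (hd : d = bx 2 ∨ d = bp 0 ∨ d = bp 1 ∨ d = bp 2 ∨
      d = bx 3 ∨ d = bu ∨ d = bp 3) : dirRho F G Q r d = 0 := by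
  obtain ⟨hn, f0, f1⟩ := hΔ r hr
  have C := h.cond r hr
  have hs := hess_symm (h.smooth r hr)
  rcases hd with rfl | rfl | rfl | rfl | hd
  · exact dirRho_z h hF hG hΔ hr
  · rw [dirRho, hs _ (bx 2), C.hz0, f0]
    simp [dirXY, dirDelta, bp_fst, bp_mom]
    field_simp
    ring
  · rw [dirRho, hs _ (bx 2), C.hz1, f0, f1]
    simp [dirXY, dirDelta, bp_fst, bp_mom]
    field_simp
    ring
  · have hρ : ContDiffOn ℝ ∞ (rhoIII F G Q) (Metric.ball q ε) := fun s hs =>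
      (contDiffAt_rho h hF hG hs (hΔ s hs).1).contDiffWithinAt
    have hf : ∀ s ∈ Metric.ball q ε, ∀ d, fderiv ℝ (rhoIII F G Q) s d = dirRho F G Q s d :=
      fun s hs d => HasLineDerivAt.fderiv_eq (hasLineDerivAt_rho h hF hG hs (hΔ s hs).1 d)
        ((contDiffAt_rho h hF hG hs (hΔ s hs).1).differentiableAt (by simp))
    have hz := (hess_eq_zero Metric.isOpen_ball hρ (d := bx 2)
      (fun s hs => (hf s hs _).trans (dirRho_z h hF hG hΔ hs)) hr (bp 2)).2
    have hF' := contDiffAt_of_mem hF hr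
    have hG' := contDiffAt_of_mem hG hr
    have l := hasLineDerivAt_fderiv (contDiffAt_rho h hF hG hr hn) (bx 2) (bp 2)
    rw [hz] at l
    have e := ((((hasLineDerivAt_fderiv (h.smooth r hr) (bx 2) (bp 2)).sub
      ((hasLineDerivAt_xy hF' (bx 2)).mul
        (hasLineDerivAt_fderiv (h.smooth r hr) (bx 2) (bx 2)))).add
      (((hasLineDerivAt_deltaX hF' hG' (bx 2)).add ((hasLineDerivAt_xy hF' (bx 2)).mul
        (hasLineDerivAt_deltaY hF' hG' (bx 2)))).div (hasLineDerivAt_delta hF' hG' (bx 2)) hn)).sub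
      (hasLineDerivAt_xy hF'.pd2 (bx 2))).unique (hasLineDerivAt_congr
        (((hasLineDerivAt_delta hF' hG' (bx 2)).mul l).const_mul 2)
        (eventually_of_ball (fun s hs => by beta_reduce; rw [hf s hs]; exact dirRho_p h hF hG hΔ hs) hr))
    have p := dirRho_p h hF hG hΔ hr
    have z := dirRho_z h hF hG hΔ hr
    rw [hf r hr] at e
    simp only [dirRho, hs (bp 2) (bx 2)] at e p z ⊢
    simp [dirXY, dirDelta, bx_fst, bx_mom, bp_fst, bp_mom, deltaY, deltaX] at e p z ⊢
    linear_combination (norm := (field_simp; ring1))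
      -(1 / 3) * (e + p / deltaIII F G r + F (xy r) * z)
  · rw [dirRho, h.hess_zero hd hr, h.inv_eq hd hr]
    rcases hd with rfl | rfl | rfl <;>
      simp [dirXY, dirDelta, bp_fst, bp_mom, bx_fst, bx_mom, bu_fst, bu_mom]

end LocalIII

/-- The numerator of `H` in the general branch. -/
def hIII (F G : ℝ × ℝ → ℝ) (Q : J1 → ℝ) (q : J1) : ℝ :=
  2 * (F (xy q) * q.2.2 1 + q.2.2 0) - 2 * (Q q * deltaIII F G q) +
    deltaIII F G q * deltaIII F G q * rhoIII F G Q q -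
    ((pd1 F (xy q) - F (xy q) * pd2 F (xy q)) * (q.2.2 2 * q.2.2 2) +
      2 * ((pd1 G (xy q) - G (xy q) * pd2 F (xy q) - q.1 2 * pd2 F (xy q)) * q.2.2 2) -
      2 * (q.1 2 * pd2 G (xy q)))

namespace LocalIII

variable {Q : J1 → ℝ} {q : J1} {ε : ℝ} {F G : ℝ × ℝ → ℝ}

lemma hasLineDerivAt_hIII (h : LocalIII Q q ε) (hF : ContDiffOn ℝ ∞ F (Metric.ball (xy q) ε))
    (hG : ContDiffOn ℝ ∞ G (Metric.ball (xy q) ε)) {r : J1} (hr : r ∈ Metric.ball q ε)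
    (hΔ : deltaIII F G r ≠ 0) (d : J1) :
    HasLineDerivAt ℝ (hIII F G Q)
      (2 * (dirXY F r d * r.2.2 1 + F (xy r) * d.2.2 1 + d.2.2 0) -
        2 * (fderiv ℝ Q r d * deltaIII F G r + Q r * dirDelta F G r d) +
        ((dirDelta F G r d * deltaIII F G r + deltaIII F G r * dirDelta F G r d) * rhoIII F G Q r +
          deltaIII F G r * deltaIII F G r * dirRho F G Q r d) -
        ((dirXY (pd1 F) r d - (dirXY F r d * pd2 F (xy r) + F (xy r) * dirXY (pd2 F) r d)) *
            (r.2.2 2 * r.2.2 2) +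
          (pd1 F (xy r) - F (xy r) * pd2 F (xy r)) * (d.2.2 2 * r.2.2 2 + r.2.2 2 * d.2.2 2) +
          2 * ((dirXY (pd1 G) r d - (dirXY G r d * pd2 F (xy r) + G (xy r) * dirXY (pd2 F) r d) -
            (d.1 2 * pd2 F (xy r) + r.1 2 * dirXY (pd2 F) r d)) * r.2.2 2 +
            (pd1 G (xy r) - G (xy r) * pd2 F (xy r) - r.1 2 * pd2 F (xy r)) * d.2.2 2) -
          2 * (d.1 2 * pd2 G (xy r) + r.1 2 * dirXY (pd2 G) r d))) r d := by
  have hF' := contDiffAt_of_mem hF hr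
  have hG' := contDiffAt_of_mem hG hr
  have f := hasLineDerivAt_xy hF' d
  have fx := hasLineDerivAt_xy hF'.pd1 d
  have fy := hasLineDerivAt_xy hF'.pd2 d
  have p := fun i => hasLineDerivAt_mom i r d
  have z := hasLineDerivAt_base 2 r d
  have Dd := hasLineDerivAt_delta hF' hG' d
  exact (((((f.mul (p 1)).add (p 0)).const_mul 2).sub
    ((((h.smooth r hr).hasLineDerivAt d).mul Dd).const_mul 2)).add
    ((Dd.mul Dd).mul (hasLineDerivAt_rho h hF hG hr hΔ d))).sub
    ((((fx.sub (f.mul fy)).mul ((p 2).mul (p 2))).add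
      (((((hasLineDerivAt_xy hG'.pd1 d).sub ((hasLineDerivAt_xy hG' d).mul fy)).sub
        (z.mul fy)).mul (p 2)).const_mul 2)).sub
      ((z.mul (hasLineDerivAt_xy hG'.pd2 d)).const_mul 2))

lemma contDiffAt_hIII (h : LocalIII Q q ε) (hF : ContDiffOn ℝ ∞ F (Metric.ball (xy q) ε))
    (hG : ContDiffOn ℝ ∞ G (Metric.ball (xy q) ε)) {r : J1} (hr : r ∈ Metric.ball q ε)
    (hΔ : deltaIII F G r ≠ 0) : ContDiffAt ℝ ∞ (hIII F G Q) r := by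
  have hF' := contDiffAt_of_mem hF hr
  have hG' := contDiffAt_of_mem hG hr
  have f := contDiffAt_xy hF'
  have fx := contDiffAt_xy hF'.pd1
  have fy := contDiffAt_xy hF'.pd2
  have p : ∀ i, ContDiffAt ℝ ∞ (fun r : J1 => r.2.2 i) r := fun i => (momL i).contDiff.contDiffAt
  have z : ContDiffAt ℝ ∞ (fun r : J1 => r.1 2) r := (baseL 2).contDiff.contDiffAt
  have Dd := contDiffAt_delta hF' hG'
  have c : ContDiffAt ℝ ∞ (fun _ : J1 => (2 : ℝ)) r := contDiffAt_const
  exact (((c.mul ((f.mul (p 1)).add (p 0))).sub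
    (c.mul ((h.smooth r hr).mul Dd))).add
    ((Dd.mul Dd).mul (contDiffAt_rho h hF hG hr hΔ))).sub
    ((((fx.sub (f.mul fy)).mul ((p 2).mul (p 2))).add
      (c.mul ((((contDiffAt_xy hG'.pd1).sub ((contDiffAt_xy hG').mul fy)).sub
        (z.mul fy)).mul (p 2)))).sub (c.mul (z.mul (contDiffAt_xy hG'.pd2))))

/-- The general branch. -/
lemma isGeneralNear (h : LocalIII Q q ε) (hε : 0 < ε)
    (hne : ∀ r ∈ Metric.ball q ε, fderiv ℝ Q r (bp 0) ≠ 0) : IsGeneralNear Q q := by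
  obtain ⟨F, G, hF, hG, hΔ⟩ := h.exists_delta hne
  have hf : ∀ s ∈ Metric.ball q ε, ∀ d, fderiv ℝ (rhoIII F G Q) s d = dirRho F G Q s d :=
    fun s hs d => HasLineDerivAt.fderiv_eq (hasLineDerivAt_rho h hF hG hs (hΔ s hs).1 d)
      ((contDiffAt_rho h hF hG hs (hΔ s hs).1).differentiableAt (by simp))
  -- Once `ρ_{u₃} = 0` is known, `dirRho_p` becomes an explicit formula for `Q_{u₃}`.
  have hT : ∀ s ∈ Metric.ball q ε, fderiv ℝ Q s (bp 2) = F (xy s) * fderiv ℝ Q s (bx 2) -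
      (deltaX F G s + F (xy s) * deltaY F G s) / deltaIII F G s + pd2 F (xy s) := fun s hs => by
    have := dirRho_p h hF hG hΔ hs
    rw [fderiv_rho_zero h hF hG hΔ hs (by simp)] at this
    linear_combination this
  obtain ⟨L, hL, hLρ⟩ := descend (g := fun r => -(1 / 2) * rhoIII F G Q r)
    (fun r hr => contDiffAt_const.mul (contDiffAt_rho h hF hG hr (hΔ r hr).1))
    (fun r hr d hd => by
      have l := (hasLineDerivAt_rho h hF hG hr (hΔ r hr).1 d).const_mul (-(1 / 2))
      rw [fderiv_rho_zero h hF hG hΔ hr hd] at l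
      rw [l.fderiv_eq ((contDiffAt_const.mul
        (contDiffAt_rho h hF hG hr (hΔ r hr).1)).differentiableAt (by simp)), mul_zero])
  have hρL : ∀ r ∈ Metric.ball q ε, rhoIII F G Q r = -2 * L (xy r) := fun r hr => by
    rw [← hLρ r hr]; ring
  -- Solving the general form for `H` gives `hIII`; the known first derivatives of `Q` make it a
  -- function of `x, y`.
  obtain ⟨H, hH, hHh⟩ := descend (g := hIII F G Q)
    (fun r hr => contDiffAt_hIII h hF hG hr (hΔ r hr).1) (fun r hr d hd => by
      obtain ⟨hn, f0, f1⟩ := hΔ r hr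
      rw [(hasLineDerivAt_hIII h hF hG hr hn d).fderiv_eq
        ((contDiffAt_hIII h hF hG hr hn).differentiableAt (by simp)),
        fderiv_rho_zero h hF hG hΔ hr hd, rhoIII]
      have D : deltaIII F G r = F (xy r) * r.2.2 2 + G (xy r) + r.1 2 := rfl
      rcases hd with rfl | rfl | rfl | rfl | hd
      · simp [dirXY, dirDelta, bx_fst, bx_mom, deltaY]
        field_simp
        ring
      · rw [f0]
        simp [dirXY, dirDelta, bp_fst, bp_mom]
        field_simp
        ring
      · rw [f1]
        simp [dirXY, dirDelta, bp_fst, bp_mom]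
        field_simp
        ring
      · rw [hT r hr]
        simp [dirXY, dirDelta, bp_fst, bp_mom, deltaX, deltaY]
        field_simp
        rw [D]
        ring
      · rw [h.inv_eq hd hr]
        rcases hd with rfl | rfl | rfl <;>
          simp [dirXY, dirDelta, bp_fst, bp_mom, bx_fst, bx_mom, bu_fst, bu_mom])
  refine ⟨_, F, G, H, L, _, Metric.isOpen_ball, Metric.ball_mem_nhds q hε, hF, hG, hH, hL,
    fun a ha => ?_, fun r hr => ⟨xy_mem hr, (hΔ r hr).1, ?_⟩⟩
  · obtain ⟨r, hr, rfl⟩ := exists_lift_pair (i := 0) (k := 1) (by decide) ha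
    change pd1 L (xy r) + pd2 (F * L) (xy r) = 1 / 2 * pd2 (pd2 F) (xy r)
    obtain ⟨hn, f0, f1⟩ := hΔ r hr
    have hF' := contDiffAt_of_mem hF hr
    have hG' := contDiffAt_of_mem hG hr
    have hL' := contDiffAt_of_mem hL hr
    have e : pd2 (F * L) (xy r) = pd2 F (xy r) * L (xy r) + F (xy r) * pd2 L (xy r) :=
      ((hF'.hasLineDerivAt _).mul (hL'.hasLineDerivAt _)).pd2_eq (hF'.mul hL')
    have lρ := fun d => (hasLineDerivAt_rho h hF hG hr hn d).unique
      (hasLineDerivAt_congr ((hasLineDerivAt_xy hL' d).const_mul (-2)) (eventually_of_ball hρL hr))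
    have lx := lρ (bx 0)
    have ly := lρ (bx 1)
    have l0 := fderiv_rho_zero h hF hG hΔ hr (d := bp 2) (by simp)
    have s2 := hess_of_eventuallyEq (d := bx 1) (h.smooth r hr) (eventually_of_ball hT hr)
      ((((hasLineDerivAt_xy hF' _).mul
        (hasLineDerivAt_fderiv (h.smooth r hr) (bx 1) (bx 2))).sub
        (((hasLineDerivAt_deltaX hF' hG' _).add ((hasLineDerivAt_xy hF' _).mul
          (hasLineDerivAt_deltaY hF' hG' _))).div (hasLineDerivAt_delta hF' hG' _) hn)).add
        (hasLineDerivAt_xy hF'.pd2 _))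
    have s1 := hess_of_eventuallyEq (d := bx 1) (h.smooth r hr)
      (eventually_of_ball (fun s hs => (hΔ s hs).2.2) hr)
      ((hasLineDerivAt_xy hF' _).div (hasLineDerivAt_delta hF' hG' _) hn)
    -- The equation for `L`: in `e4` the mixed derivatives `Q_{xz}` and `Q_{yz}` are replaced
    -- through `ρ_x = -2 L_x` and `ρ_y = -2 L_y`, and `Q_{z u₃}` through `ρ_{u₃} = 0`.
    have e4 := (h.cond r hr).e4
    have hρr := hρL r hr
    have hsym : pd1 (pd2 F) (xy r) = pd2 (pd1 F) (xy r) := pd1_pd2 hF'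
    have hsymG : pd1 (pd2 G) (xy r) = pd2 (pd1 G) (xy r) := pd1_pd2 hG'
    rw [s1, s2, f0, f1] at e4
    rw [dirRho, hess_symm (h.smooth r hr) (bp 2) (bx 2), hT r hr] at l0
    rw [dirRho] at lx ly
    rw [rhoIII] at hρr
    rw [e]
    have hz : fderiv ℝ Q r (bx 2) = -2 * L (xy r) - (Q r - deltaY F G r) / deltaIII F G r := by
      linear_combination hρr
    rw [hz] at e4 l0
    simp [dirXY, dirDelta, bx_fst, bx_mom, bp_fst, bp_mom, deltaY, deltaX, hsym, hsymG]
      at e4 l0 lx ly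
    linear_combination (norm := (field_simp; ring1)) 1 / 2 * e4 + 1 / 2 * lx +
      1 / 2 * F (xy r) * ly - 1 / 2 * Q r * l0
  · have e := hHh r hr
    rw [hIII, hρL r hr] at e
    rw [generalIII_eq (hΔ r hr).1, eq_div_iff (hΔ r hr).1, numIII, ← e]
    ring

end LocalIII

/-- A function of the base coordinate `x^i` only. -/
lemma exists_descent_base (i : Fin 4) {g : J1 → ℝ} {q : J1} {ε : ℝ}
    (hg : ContDiffOn ℝ ∞ g (Metric.ball q ε))
    (hx : ∀ r ∈ Metric.ball q ε, ∀ m, m ≠ i → fderiv ℝ g r (bx m) = 0)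
    (hu : ∀ r ∈ Metric.ball q ε, fderiv ℝ g r bu = 0)
    (hp : ∀ r ∈ Metric.ball q ε, ∀ m, fderiv ℝ g r (bp m) = 0) :
    ∃ g' : ℝ → ℝ, ContDiffOn ℝ ∞ g' (Metric.ball (q.1 i) ε) ∧
      ∀ r ∈ Metric.ball q ε, g r = g' (r.1 i) := by
  set ι : ℝ →L[ℝ] J1 := (ContinuousLinearMap.inl ℝ (Fin 4 → ℝ) (ℝ × (Fin 4 → ℝ))).comp
    (ContinuousLinearMap.single ℝ (fun _ => ℝ) i) with hι
  have hιe : ∀ e, ι e = (Pi.single i e, 0) := fun e => by simp [hι]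
  refine exists_descent (baseL i) ι (fun e => ?_) (fun e => ?_)
    (fun d => (norm_le_pi_norm d.1 i).trans (norm_fst_le d)) hg fun r hr d hd => ?_
  · rw [hιe]
    simp [baseL]
  · rw [hιe, Prod.norm_def, norm_zero, max_le_iff, Pi.norm_single]
    exact ⟨le_rfl, norm_nonneg e⟩
  · rw [J1_eq_sum d]
    have h1 : d.1 i = 0 := hd
    simp only [map_add, map_sum, map_smul, smul_eq_mul, hu r hr, hp r hr, mul_zero,
      Finset.sum_const_zero, add_zero]
    refine Finset.sum_eq_zero fun m _ => ?_
    by_cases hm : m = i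
    · rw [hm, h1, zero_mul]
    · rw [hx r hr m hm, mul_zero]

/-- Third derivatives from a local formula for a second derivative. -/
lemma hasLineDerivAt_hess {Q g : J1 → ℝ} {q d d' e : J1} {g' : ℝ} (hQ : ContDiffAt ℝ ∞ Q q)
    (hQ' : ∀ᶠ r in 𝓝 q, ContDiffAt ℝ ∞ Q r) (h : (fun r => hess Q r e d') =ᶠ[𝓝 q] g)
    (hg : HasLineDerivAt ℝ g g' q d) : HasLineDerivAt ℝ (fun r => hess Q r d d') g' q e := by
  have hP := hQ.fderiv_dir (n := ∞) (by decide) d'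
  have e1 : (fun r => fderiv ℝ (fun s => fderiv ℝ Q s d') r e) =ᶠ[𝓝 q] g := by
    filter_upwards [hQ', h] with r hr hr'
    rw [← hr', hess_eq_fderiv hr]
  have := hasLineDerivAt_fderiv hP e d
  rw [hess_symm hP, hess_of_eventuallyEq hP e1 hg] at this
  refine hasLineDerivAt_congr this ?_
  filter_upwards [hQ'] with r hr
  rw [hess_eq_fderiv hr]

/-! ### Point transformations -/

section Translation

variable {O : Set (ℝ × ℝ)} {f g : ℝ × ℝ → ℝ}

/-- The function `z f(x, y) + g(x, y)`. -/
def affineZ (f g : ℝ × ℝ → ℝ) (x : Fin 4 → ℝ) : ℝ := x 2 * f (x 0, x 1) + g (x 0, x 1)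

lemma hasFDerivAt_xy_base {f : ℝ × ℝ → ℝ} {x : Fin 4 → ℝ} (hf : ContDiffAt ℝ ∞ f (x 0, x 1)) :
    HasFDerivAt (fun y : Fin 4 → ℝ => f (y 0, y 1)) ((fderiv ℝ f (x 0, x 1)).comp
      ((ContinuousLinearMap.proj 0).prod (ContinuousLinearMap.proj 1))) x :=
  (hf.differentiableAt (by simp)).hasFDerivAt.comp (f := fun y : Fin 4 → ℝ => (y 0, y 1)) x
    ((ContinuousLinearMap.proj (R := ℝ) (φ := fun _ : Fin 4 => ℝ) 0).prod
      (ContinuousLinearMap.proj 1)).hasFDerivAt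

lemma contDiffAt_affineZ {x : Fin 4 → ℝ} (hf : ContDiffAt ℝ ∞ f (x 0, x 1))
    (hg : ContDiffAt ℝ ∞ g (x 0, x 1)) : ContDiffAt ℝ ∞ (affineZ f g) x := by
  have h : ContDiffAt ℝ ∞ (fun y : Fin 4 → ℝ => (y 0, y 1)) x := by fun_prop
  exact ((by fun_prop : ContDiffAt ℝ ∞ (fun y : Fin 4 → ℝ => y 2) x).mul (hf.comp x h)).add
    (hg.comp x h)

lemma fderiv_affineZ {x : Fin 4 → ℝ} (hf : ContDiffAt ℝ ∞ f (x 0, x 1))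
    (hg : ContDiffAt ℝ ∞ g (x 0, x 1)) (d : Fin 4 → ℝ) : fderiv ℝ (affineZ f g) x d =
      x 2 * (pd1 f (x 0, x 1) * d 0 + pd2 f (x 0, x 1) * d 1) + d 2 * f (x 0, x 1) +
        (pd1 g (x 0, x 1) * d 0 + pd2 g (x 0, x 1) * d 1) := by
  have h := ((hasFDerivAt_apply (𝕜 := ℝ) 2 x).mul (hasFDerivAt_xy_base hf)).add
    (hasFDerivAt_xy_base hg)
  rw [show fderiv ℝ (affineZ f g) x = _ from h.fderiv]
  simp [fderiv_eq_pd]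
  ring

lemma partialDerivs_pair {ψ : (Fin 4 → ℝ) → ℝ} {x : Fin 4 → ℝ} (hψ : ContDiffAt ℝ ∞ ψ x)
    (i k : Fin 4) : partialDerivs (({i, k} : Multiset (Fin 4)).toList) ψ x =
      fderiv ℝ (fun y => fderiv ℝ ψ y (Pi.single k 1)) x (Pi.single i 1) := by
  have hd := (hψ.fderiv_right (m := ∞) (by decide)).differentiableAt (by simp)
  have e : ∀ i k : Fin 4, fderiv ℝ (fun y => fderiv ℝ ψ y (Pi.single k 1)) x (Pi.single i 1) =
      fderiv ℝ (fderiv ℝ ψ) x (Pi.single i 1) (Pi.single k 1) := fun i k => by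
    rw [fderiv_clm_apply hd (differentiableAt_const _)]
    simp
  have hp : ({i, k} : Multiset (Fin 4)).toList.Perm [i, k] :=
    Multiset.coe_eq_coe.1 (Multiset.coe_toList _)
  rcases List.perm_pair.1 hp with h | h
  · rw [h]; rfl
  · rw [h, e]
    change fderiv ℝ (fun y => fderiv ℝ ψ y (Pi.single i 1)) x (Pi.single k 1) = _
    rw [e]
    exact (hψ.isSymmSndFDerivAt (by rw [minSmoothness_of_isRCLikeNormedField]; decide)) _ _

/-- Normalization of equations of type III by a point transformation. -/
lemma pointReducesIII {Q Q' : J1 → ℝ} {N : Set J1} (hO : IsOpen O) (hf : ContDiffOn ℝ ∞ f O)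
    (hg : ContDiffOn ℝ ∞ g O) (hN : ∀ r ∈ N, xy r ∈ O)
    (hQ : ∀ r ∈ N, ∀ r' : J1, r'.1 = r.1 →
      r'.2.2 1 = r.2.2 1 + r.1 2 * pd2 f (xy r) + pd2 g (xy r) →
      r'.2.2 2 = r.2.2 2 + f (xy r) → Q r = Q' r' - pd1 f (xy r)) : PointReducesIII Q Q' N := by
  -- The shift by `z f + g` adds `f_x` to `u₁₃` and leaves `u₂₄, u₁₄, u₃₄, u₃₃` unchanged, since it
  -- is affine in `z` and independent of `t`. Hence the term `-f_x` in the hypothesis.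
  refine ⟨affineZ f g, fun r hr => contDiffAt_affineZ (hf.contDiffAt (hO.mem_nhds (hN r hr)))
    (hg.contDiffAt (hO.mem_nhds (hN r hr))), fun j hj => ?_⟩
  have hx : ((j.1 0, j.1 1) : ℝ × ℝ) ∈ O := hN _ hj
  have at' : ∀ {f : ℝ × ℝ → ℝ}, ContDiffOn ℝ ∞ f O → ∀ {x : Fin 4 → ℝ}, (x 0, x 1) ∈ O →
      ContDiffAt ℝ ∞ f (x 0, x 1) := fun hf x ha => hf.contDiffAt (hO.mem_nhds ha)
  have d1 := fun d => fderiv_affineZ (at' hf hx) (at' hg hx) d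
  have ev : ∀ᶠ x in 𝓝 j.1, ((x 0, x 1) : ℝ × ℝ) ∈ O :=
    (by fun_prop : Continuous fun x : Fin 4 → ℝ => (x 0, x 1)).continuousAt.eventually
      (hO.mem_nhds hx)
  have v1 : ∀ i, (translateJet (affineZ f g) j).2 {i} =
      j.2 {i} + fderiv ℝ (affineZ f g) j.1 (Pi.single i 1) := fun i => by
    simp [translateJet, partialDerivs]
  have v2 : ∀ i k, (translateJet (affineZ f g) j).2 {i, k} = j.2 {i, k} +
      fderiv ℝ (fun y => fderiv ℝ (affineZ f g) y (Pi.single k 1)) j.1 (Pi.single i 1) :=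
    fun i k => congrArg (j.2 {i, k} + ·)
      (partialDerivs_pair (contDiffAt_affineZ (at' hf hx) (at' hg hx)) i k)
  have w3 : (fun y => fderiv ℝ (affineZ f g) y (Pi.single 3 1)) =ᶠ[𝓝 j.1] fun _ => 0 := by
    filter_upwards [ev] with x hx
    rw [fderiv_affineZ (at' hf hx) (at' hg hx)]
    simp
  have w2 : (fun y => fderiv ℝ (affineZ f g) y (Pi.single 2 1)) =ᶠ[𝓝 j.1]
      fun y => f (y 0, y 1) := by
    filter_upwards [ev] with x hx
    rw [fderiv_affineZ (at' hf hx) (at' hg hx)]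
    simp
  have e3 : ∀ i, (translateJet (affineZ f g) j).2 {i, 3} = j.2 {i, 3} := fun i => by
    rw [v2, w3.fderiv_eq]
    simp
  have e2 : ∀ i, (translateJet (affineZ f g) j).2 {i, 2} = j.2 {i, 2} +
      fderiv ℝ f (j.1 0, j.1 1) ((Pi.single i 1 : Fin 4 → ℝ) 0, (Pi.single i 1 : Fin 4 → ℝ) 1) :=
    fun i => by
      rw [v2, w2.fderiv_eq, (hasFDerivAt_xy_base (at' hf hx)).fderiv]
      rfl
  have hQ' := hQ _ hj (toJ1 (translateJet (affineZ f g) j)) rfl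
    (by
      change (translateJet (affineZ f g) j).2 {1} = _
      rw [v1, d1]
      simp [toJ1, xy]
      ring)
    (by
      change (translateJet (affineZ f g) j).2 {2} = _
      rw [v1, d1]
      simp [toJ1, xy])
  rw [eqIII, eqIII, e3, e3, e3, e2, e2, hQ']
  simp [fderiv_eq_pd, xy, toJ1]
  ring_nf

end Translation

/-! ### The singular branches of type III from the integrability conditions -/

namespace LocalIII

variable {Q : J1 → ℝ} {q : J1} {ε : ℝ}

lemma hasLineDerivAt_hess (h : LocalIII Q q ε) {r : J1} (hr : r ∈ Metric.ball q ε) {d d' e : J1}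
    {g : J1 → ℝ} {g' : ℝ} (hg : ∀ s ∈ Metric.ball q ε, hess Q s e d' = g s)
    (hg' : HasLineDerivAt ℝ g g' r d) : HasLineDerivAt ℝ (fun s => hess Q s d d') g' r e :=
  DispersionlessLax.hasLineDerivAt_hess (h.smooth r hr) (eventually_of_ball h.smooth hr)
    (eventually_of_ball hg hr) hg'

/-- Where `Q_{u₁} = 0` and `Q_{u₂} ≠ 0`, the mixed derivative of `Q` by `z` and `u₃`. -/
lemma hess_z_p (h : LocalIII Q q ε) (h0 : ∀ r ∈ Metric.ball q ε, fderiv ℝ Q r (bp 0) = 0)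
    (h1 : ∀ r ∈ Metric.ball q ε, fderiv ℝ Q r (bp 1) ≠ 0) {r : J1} (hr : r ∈ Metric.ball q ε) :
    hess Q r (bx 2) (bp 2) = -(fderiv ℝ Q r (bp 1) * fderiv ℝ Q r (bx 2)) := by
  have hs := fun s hs => hess_symm (h.smooth s hs)
  have dQ := fun d => (h.smooth r hr).hasLineDerivAt d
  have d1 := fun d d' => hasLineDerivAt_fderiv (h.smooth r hr) d d'
  -- The `u₂`-derivatives of the second derivatives in `e4`: the order of differentiation is changed
  -- so that conditions already expressing second derivatives can be differentiated.
  have txz := h.hasLineDerivAt_hess hr (d := bx 0) (d' := bx 2) (e := bp 1) (g := fun _ => 0)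
    (fun s hs' => by rw [hs s hs', (h.cond s hs').hz1, h0 s hs']; ring) (hasLineDerivAt_const _ _ _)
  have ty1 := h.hasLineDerivAt_hess hr (d := bx 1) (d' := bp 1) (e := bp 1) (g := fun _ => 0)
    (fun s hs' => (h.cond s hs').h11) (hasLineDerivAt_const _ _ _)
  have ty2 := h.hasLineDerivAt_hess hr (d := bx 1) (d' := bp 2) (e := bp 1)
    (g := fun s => -(fderiv ℝ Q s (bp 1) * fderiv ℝ Q s (bp 1)))
    (fun s hs' => by rw [(h.cond s hs').h12]; ring) ((d1 _ _).mul (d1 _ _)).neg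
  have tz2 := h.hasLineDerivAt_hess hr (d := bx 2) (d' := bp 2) (e := bp 1)
    (g := fun s => -(fderiv ℝ Q s (bp 1) * fderiv ℝ Q s (bp 1)))
    (fun s hs' => by rw [(h.cond s hs').h12]; ring) ((d1 _ _).mul (d1 _ _)).neg
  have e4 : ∀ s ∈ Metric.ball q ε, -(fderiv ℝ Q s (bp 1) * fderiv ℝ Q s (bx 1)) +
      Q s * fderiv ℝ Q s (bp 1) * fderiv ℝ Q s (bx 2) - hess Q s (bx 0) (bx 2) -
      Q s * hess Q s (bx 1) (bp 1) - hess Q s (bx 1) (bp 2) + Q s * hess Q s (bx 2) (bp 2) = 0 :=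
    fun s hs => by
      have := (h.cond s hs).e4
      rw [h0 s hs] at this
      linear_combination this
  -- The derivative of `e4` by `u₂`; it factors as `Q_{u₂} (Q_{z u₃} + Q_{u₂} Q_z) = 0`.
  have key := ((((((((d1 (bp 1) (bp 1)).mul (d1 (bp 1) (bx 1))).neg).add
    (((dQ (bp 1)).mul (d1 (bp 1) (bp 1))).mul (d1 (bp 1) (bx 2)))).sub txz).sub
    ((dQ (bp 1)).mul ty1)).sub ty2).add ((dQ (bp 1)).mul tz2)).unique
    (hasLineDerivAt_congr (hasLineDerivAt_const 0 r (bp 1)) (eventually_of_ball e4 hr))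
  have C := h.cond r hr
  have s := hs r hr
  rw [C.h11, s (bp 1) (bx 1), s (bp 1) (bx 2), C.hz1, h0 r hr] at key
  have : fderiv ℝ Q r (bp 1) *
      (hess Q r (bx 2) (bp 2) + fderiv ℝ Q r (bp 1) * fderiv ℝ Q r (bx 2)) = 0 := by
    linear_combination key
  linarith [(mul_eq_zero.1 this).resolve_left (h1 r hr)]

/-- The first singular branch. -/
lemma isSingular₁Near (h : LocalIII Q q ε) (hε : 0 < ε)
    (h0 : ∀ r ∈ Metric.ball q ε, fderiv ℝ Q r (bp 0) = 0)
    (h1 : ∀ r ∈ Metric.ball q ε, fderiv ℝ Q r (bp 1) ≠ 0) : IsSingular₁Near Q q := by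
  have hs := fun s hs => hess_symm (h.smooth s hs)
  have p2c : ∀ r, ContDiffAt ℝ ∞ (fun r : J1 => r.2.2 2) r := fun r =>
    (momL 2).contDiff.contDiffAt
  have hfs : ∀ r ∈ Metric.ball q ε, ContDiffAt ℝ ∞
      (fun r => 1 / fderiv ℝ Q r (bp 1) - r.2.2 2) r := fun r hr =>
    (contDiffAt_const.div (h.smooth_fderiv _ hr) (h1 r hr)).sub (p2c r)
  -- As `Q_{u₂ u₃} = -Q_{u₂}²`, the function `1 / Q_{u₂}` has `u₃`-derivative `1`; the rest is `f(x,
  -- y)`.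
  obtain ⟨f, hf, hfQ⟩ := descend hfs (fun r hr d hd => by
    rw [HasLineDerivAt.fderiv_eq (((hasLineDerivAt_const 1 r d).div
      (hasLineDerivAt_fderiv (h.smooth r hr) d (bp 1)) (h1 r hr)).sub (hasLineDerivAt_mom 2 r d))
      ((hfs r hr).differentiableAt (by simp))]
    have C := h.cond r hr
    have hn := h1 r hr
    rcases hd with rfl | rfl | rfl | rfl | hd
    · rw [C.hz1, h0 r hr]; simp [bx_mom]
    · rw [C.h01]; simp [bp_mom]
    · rw [C.h11]; simp [bp_mom]
    · rw [hs r hr, C.h12]; simp [bp_mom]; field_simp; ring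
    · rw [h.hess_zero hd hr]
      rcases hd with rfl | rfl | rfl <;> simp [bp_mom, bx_mom, bu_mom])
  have hD : ∀ r ∈ Metric.ball q ε, r.2.2 2 + f (xy r) ≠ 0 ∧
      fderiv ℝ Q r (bp 1) = 1 / (r.2.2 2 + f (xy r)) := fun r hr => by
    have e : r.2.2 2 + f (xy r) = 1 / fderiv ℝ Q r (bp 1) := by rw [← hfQ r hr]; ring
    have hn := h1 r hr
    rw [e]
    exact ⟨by positivity, by field_simp⟩
  have hf' := fun {r} hr => contDiffAt_of_mem (r := r) hf hr
  have Dd := fun r hr d => (hasLineDerivAt_mom 2 r d).add (hasLineDerivAt_xy (hf' hr) d)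
  have Dc : ∀ r ∈ Metric.ball q ε, ContDiffAt ℝ ∞ (fun r => r.2.2 2 + f (xy r)) r := fun r hr =>
    (p2c r).add (contDiffAt_xy (hf' hr))
  have hh1 := fun r hr d => hess_of_eventuallyEq (d := d) (h.smooth r hr)
    (eventually_of_ball (fun s hs => (hD s hs).2) hr)
    ((hasLineDerivAt_const 1 r d).div (Dd r hr d) (hD r hr).1)
  -- Together with `hess_z_p`, the condition `e2` reduces to `Q_{y u₂} = -Q_{u₂} Q_z`, and `Q_{u₂}`
  -- is already known.
  have hz : ∀ r ∈ Metric.ball q ε, fderiv ℝ Q r (bx 2) =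
      pd2 f (xy r) / (r.2.2 2 + f (xy r)) := fun r hr => by
    obtain ⟨hn, f1⟩ := hD r hr
    have e2 := (h.cond r hr).e2
    have e0 : hess Q r (bx 0) (bp 0) = 0 := (hess_of_eventuallyEq (h.smooth r hr)
      (eventually_of_ball h0 hr) (hasLineDerivAt_const 0 r _))
    rw [h.hess_z_p h0 h1 hr, hh1 r hr, h0 r hr, f1, e0] at e2
    simp [dirXY, bx_fst, bx_mom] at e2
    rw [eq_div_iff hn]
    field_simp at e2
    linear_combination -e2
  -- The expression for `k` obtained by solving the `u₃`-derivative of the expected form. It turns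
  -- out to depend on `x` only; the `y`-direction is `e4` and the `u₃`-direction is `e1`.
  have hkc : ∀ r ∈ Metric.ball q ε, ContDiffAt ℝ ∞
      (fun r => -(fderiv ℝ Q r (bp 2) * (r.2.2 2 + f (xy r)) + Q r + pd1 f (xy r)) /
        (2 * (r.2.2 2 + f (xy r)))) r := fun r hr =>
    ((((h.smooth_fderiv _ hr).mul (Dc r hr)).add (h.smooth r hr)).add
      (contDiffAt_xy (hf' hr).pd1)).neg.div (contDiffAt_const.mul (Dc r hr))
      (mul_ne_zero two_ne_zero (hD r hr).1)
  have hkd : ∀ r ∈ Metric.ball q ε, ∀ d, _ := fun r hr d =>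
    HasLineDerivAt.fderiv_eq (((((hasLineDerivAt_fderiv (h.smooth r hr) d (bp 2)).mul
      (Dd r hr d)).add ((h.smooth r hr).hasLineDerivAt d)).add
      (hasLineDerivAt_xy (hf' hr).pd1 d)).neg.div ((Dd r hr d).const_mul 2)
      (mul_ne_zero two_ne_zero (hD r hr).1)) ((hkc r hr).differentiableAt (by simp))
  have hpos : ∀ {r}, r ∈ Metric.ball q ε → ∀ {d}, d = bx 1 ∨ d = bx 2 ∨ d = bp 0 ∨ d = bp 1 ∨
      d = bp 2 ∨ d = bx 3 ∨ d = bu ∨ d = bp 3 → fderiv ℝ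
      (fun r => -(fderiv ℝ Q r (bp 2) * (r.2.2 2 + f (xy r)) + Q r + pd1 f (xy r)) /
        (2 * (r.2.2 2 + f (xy r)))) r d = 0 := fun {r} hr {d} hd => by
    rw [hkd r hr, div_eq_zero_iff]
    left
    have C := h.cond r hr
    obtain ⟨hn, f1⟩ := hD r hr
    rcases hd with rfl | rfl | rfl | rfl | rfl | hd
    · have l := hasLineDerivAt_fderiv (h.smooth r hr) (bx 0) (bx 2)
      have e := l.unique (hasLineDerivAt_congr ((hasLineDerivAt_xy (hf' hr).pd2 (bx 0)).div
        (Dd r hr (bx 0)) hn) (eventually_of_ball hz hr))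
      have hsym : pd1 (pd2 f) (xy r) = pd2 (pd1 f) (xy r) := pd1_pd2 (hf' hr)
      have e4 := C.e4
      rw [h.hess_z_p h0 h1 hr, e, hh1 r hr, h0 r hr, f1, hz r hr] at e4
      simp [dirXY, bx_fst, bx_mom] at e4 ⊢
      rw [hsym] at e4
      field_simp at e4
      linear_combination 2 * e4
    · rw [h.hess_z_p h0 h1 hr, f1, hz r hr]
      simp [dirXY, bx_fst, bx_mom]
      field_simp
      simp
    · rw [C.h02, h0 r hr]
      simp [dirXY, bp_fst, bp_mom]
    · rw [C.h12, f1]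
      simp [dirXY, bp_fst, bp_mom]
      field_simp
      simp
    · have e1 := C.e1
      rw [hh1 r hr, f1] at e1
      simp [dirXY, bp_fst, bp_mom, bx_fst, bx_mom] at e1 ⊢
      field_simp at e1
      linear_combination -2 * e1
    · rw [h.hess_zero hd hr, h.inv_eq hd hr]
      rcases hd with rfl | rfl | rfl <;> simp [dirXY, bp_fst, bp_mom, bx_fst, bx_mom, bu_fst, bu_mom]
  obtain ⟨k, hk, hkQ⟩ := exists_descent_base 0 (fun r hr => (hkc r hr).contDiffWithinAt)
    (fun r hr m hm => by
      fin_cases m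
      · exact absurd rfl hm
      all_goals exact hpos hr (by simp)) (fun r hr => hpos hr (by simp))
    (fun r hr m => by fin_cases m <;> exact hpos hr (by simp))
  have hKc : ContDiffOn ℝ ∞ (fun a : ℝ × ℝ => k a.1) (Metric.ball (xy q) ε) :=
    hk.comp contDiff_fst.contDiffOn fun a ha => by
      rw [mem_ball_iff_norm] at ha ⊢
      exact (norm_fst_le (a - xy q)).trans_lt ha
  have hK' := fun {r} hr => contDiffAt_of_mem (r := r) hKc hr
  have hKd := fun r hr d => hasLineDerivAt_xy (hK' (r := r) hr) d
  have hhc : ∀ r ∈ Metric.ball q ε, ContDiffAt ℝ ∞ (fun r => Q r * (r.2.2 2 + f (xy r)) -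
      r.2.2 1 - r.1 2 * pd2 f (xy r) + pd1 f (xy r) * (r.2.2 2 + f (xy r)) +
      k (r.1 0) * ((r.2.2 2 + f (xy r)) * (r.2.2 2 + f (xy r)))) r := fun r hr =>
    (((((h.smooth r hr).mul (Dc r hr)).sub (momL 1).contDiff.contDiffAt).sub
      ((baseL 2).contDiff.contDiffAt.mul (contDiffAt_xy (hf' hr).pd2))).add
      ((contDiffAt_xy (hf' hr).pd1).mul (Dc r hr))).add
      ((contDiffAt_xy (hK' hr)).mul ((Dc r hr).mul (Dc r hr)))
  have k1 : ∀ r ∈ Metric.ball q ε, fderiv ℝ Q r (bp 2) * (r.2.2 2 + f (xy r)) + Q r +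
      pd1 f (xy r) + 2 * k (r.1 0) * (r.2.2 2 + f (xy r)) = 0 := fun r hr => by
    have hn := (hD r hr).1
    rw [← hkQ r hr]
    field_simp
    ring
  obtain ⟨g, hg, hgQ⟩ := descend hhc (fun r hr d hd => by
    refine (HasLineDerivAt.fderiv_eq ((((((h.smooth r hr).hasLineDerivAt d).mul (Dd r hr d)).sub
      (hasLineDerivAt_mom 1 r d)).sub ((hasLineDerivAt_base 2 r d).mul
        (hasLineDerivAt_xy (hf' hr).pd2 d))).add
      ((hasLineDerivAt_xy (hf' hr).pd1 d).mul (Dd r hr d)) |>.add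
      ((hKd r hr d).mul ((Dd r hr d).mul (Dd r hr d))))
      ((hhc r hr).differentiableAt (by simp))).trans ?_
    obtain ⟨hn, f1⟩ := hD r hr
    rcases hd with rfl | rfl | rfl | rfl | hd
    · rw [hz r hr]
      simp [dirXY, bx_fst, bx_mom]
      field_simp
      simp
    · rw [h0 r hr]
      simp [dirXY, bp_fst, bp_mom]
    · rw [f1]
      simp [dirXY, bp_fst, bp_mom]
      field_simp
      simp
    · simp [dirXY, bp_fst, bp_mom]
      have e := k1 r hr
      change _ + 2 * k (xy r).1 * _ = 0 at e
      linear_combination e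
    · rw [h.inv_eq hd hr]
      rcases hd with rfl | rfl | rfl <;> simp [dirXY, bp_fst, bp_mom, bx_fst, bx_mom, bu_fst, bu_mom])
  have hQ : ∀ r ∈ Metric.ball q ε, Q r = (r.2.2 1 + r.1 2 * pd2 f (xy r) + g (xy r)) /
      (r.2.2 2 + f (xy r)) - pd1 f (xy r) - k (r.1 0) * (r.2.2 2 + f (xy r)) := fun r hr => by
    have hn := (hD r hr).1
    rw [← hgQ r hr]
    field_simp
    ring
  -- The shift `z f + g'` with `g'_y = h` turns the numerator into `u₂` and the denominator into
  -- `u₃`.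
  obtain ⟨g', hg', hgg'⟩ := exists_pd2_eq hg
  refine ⟨_, f, g, k, _, Metric.isOpen_ball, Metric.ball_mem_nhds q hε, hf, hg, fun a ha => ?_,
    fun r hr => ⟨xy_mem hr, (hD r hr).1, hQ r hr⟩,
    pointReducesIII Metric.isOpen_ball hf hg' (fun r hr => xy_mem hr) fun r hr r' e0 e1 e2 => ?_⟩
  · refine hk.contDiffAt (Metric.isOpen_ball.mem_nhds ?_)
    rw [mem_ball_iff_norm] at ha ⊢
    exact (norm_fst_le (a - xy q)).trans_lt ha
  · rw [hQ r hr, e0, e1, e2, hgg' _ (xy_mem hr)]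
    ring

/-- The second singular branch. -/
lemma isSingular₂Near (h : LocalIII Q q ε) (hε : 0 < ε)
    (h0 : ∀ r ∈ Metric.ball q ε, fderiv ℝ Q r (bp 0) = 0)
    (h1 : ∀ r ∈ Metric.ball q ε, fderiv ℝ Q r (bp 1) = 0) : IsSingular₂Near Q q := by
  have hs := fun {s} hs => hess_symm (h.smooth s hs)
  have z0 : ∀ r ∈ Metric.ball q ε, ∀ d, hess Q r d (bp 0) = 0 := fun r hr d =>
    hess_of_eventuallyEq (h.smooth r hr) (eventually_of_ball h0 hr) (hasLineDerivAt_const 0 r _)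
  have z1 : ∀ r ∈ Metric.ball q ε, ∀ d, hess Q r d (bp 1) = 0 := fun r hr d =>
    hess_of_eventuallyEq (h.smooth r hr) (eventually_of_ball h1 hr) (hasLineDerivAt_const 0 r _)
  have hz2 : ∀ r ∈ Metric.ball q ε, hess Q r (bx 2) (bp 2) = 0 := fun r hr => by
    have e := (h.cond r hr).e2
    rw [z0 r hr, z1 r hr, h0 r hr, h1 r hr] at e
    linear_combination 1 / 2 * e
  obtain ⟨A, hA, hAQ⟩ := descend (g := fun r => fderiv ℝ Q r (bx 2))
    (fun r hr => h.smooth_fderiv _ hr) (fun r hr d hd => by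
      rw [← hess_eq_fderiv (h.smooth r hr)]
      rcases hd with rfl | rfl | rfl | rfl | hd
      · have e := (h.cond r hr).e3
        rw [z0 r hr, h0 r hr] at e
        linear_combination e
      · rw [hs hr, z0 r hr]
      · rw [hs hr, z1 r hr]
      · rw [hs hr, hz2 r hr]
      · exact h.hess_zero hd hr _)
  obtain ⟨B, hB, hBQ⟩ := descend (g := fun r => fderiv ℝ Q r (bp 2))
    (fun r hr => h.smooth_fderiv _ hr) (fun r hr d hd => by
      rw [← hess_eq_fderiv (h.smooth r hr)]
      rcases hd with rfl | rfl | rfl | rfl | hd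
      · exact hz2 r hr
      · rw [hs hr, z0 r hr]
      · rw [hs hr, z1 r hr]
      · have e := (h.cond r hr).e1
        rw [z1 r hr, h1 r hr] at e
        linear_combination e
      · exact h.hess_zero hd hr _)
  have hA' := fun {r} hr => contDiffAt_of_mem (r := r) hA hr
  have hB' := fun {r} hr => contDiffAt_of_mem (r := r) hB hr
  have hCc : ∀ r ∈ Metric.ball q ε, ContDiffAt ℝ ∞
      (fun r => Q r - r.1 2 * A (xy r) - B (xy r) * r.2.2 2) r := fun r hr =>
    ((h.smooth r hr).sub ((baseL 2).contDiff.contDiffAt.mul (contDiffAt_xy (hA' hr)))).sub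
      ((contDiffAt_xy (hB' hr)).mul (momL 2).contDiff.contDiffAt)
  obtain ⟨C, hC, hCQ⟩ := descend hCc (fun r hr d hd => by
    rw [HasLineDerivAt.fderiv_eq ((((h.smooth r hr).hasLineDerivAt d).sub
      ((hasLineDerivAt_base 2 r d).mul (hasLineDerivAt_xy (hA' hr) d))).sub
      ((hasLineDerivAt_xy (hB' hr) d).mul (hasLineDerivAt_mom 2 r d)))
      ((hCc r hr).differentiableAt (by simp))]
    rcases hd with rfl | rfl | rfl | rfl | hd
    · rw [hAQ r hr]
      simp [dirXY, bx_fst, bx_mom]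
    · rw [h0 r hr]
      simp [dirXY, bp_fst, bp_mom]
    · rw [h1 r hr]
      simp [dirXY, bp_fst, bp_mom]
    · rw [hBQ r hr]
      simp [dirXY, bp_fst, bp_mom]
    · rw [h.inv_eq hd hr]
      rcases hd with rfl | rfl | rfl <;> simp [dirXY, bp_fst, bp_mom, bx_fst, bx_mom, bu_fst, bu_mom])
  -- With the derivatives by `u₁, u₂` absent, `e4` says `A_x + B_y = 0` for `A = Q_z` and `B =
  -- Q_{u₃}`, so `-B dx + A dy` is exact.
  obtain ⟨f, hf, hfd⟩ := exists_potential (convex_ball (xy q) ε) Metric.isOpen_ball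
    (A := fun a => -B a) hB.neg hA (fun a ha => by
      obtain ⟨r, hr, rfl⟩ := exists_lift_pair (i := 0) (k := 1) (by decide) ha
      have e := (h.cond r hr).e4
      rw [z1 r hr, hz2 r hr, h0 r hr, h1 r hr, hess_of_eventuallyEq (h.smooth r hr)
        (eventually_of_ball hAQ hr) (hasLineDerivAt_xy (hA' hr) _),
        hess_of_eventuallyEq (h.smooth r hr) (eventually_of_ball hBQ hr)
          (hasLineDerivAt_xy (hB' hr) _)] at e
      have e1 : pd2 (fun a => -B a) (xy r) = -pd2 B (xy r) := by
        simp only [pd2, fderiv_fun_neg]; rfl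
      change pd2 (fun a => -B a) (xy r) = pd1 A (xy r)
      rw [e1]
      simp [dirXY, bx_fst] at e
      linarith)
  -- A shift by `z a(x, y)` removes the free term `C` if `a_x + f_x a + C = 0`. The integrating
  -- factor `e^f` gives `a = -e^{-f} w` with `w_x = e^f C`.
  obtain ⟨w, hw, hwd⟩ := exists_pd1_eq (h := fun a => Real.exp (f a) * C a)
    ((Real.contDiff_exp.comp_contDiffOn hf).mul hC)
  have hac : ContDiffOn ℝ ∞ (fun a => -(Real.exp (-f a) * w a)) (Metric.ball (xy q) ε) :=
    ((Real.contDiff_exp.comp_contDiffOn hf.neg).mul hw).neg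
  have had : ∀ a ∈ Metric.ball (xy q) ε, pd1 (fun a => -(Real.exp (-f a) * w a)) a =
      pd1 f a * (Real.exp (-f a) * w a) - C a := fun a ha => by
    have hfa := hf.contDiffAt (Metric.isOpen_ball.mem_nhds ha)
    have hwa := hw.contDiffAt (Metric.isOpen_ball.mem_nhds ha)
    have hexp : HasLineDerivAt ℝ (fun a => Real.exp (-f a)) (Real.exp (-f a) * -pd1 f a) a (1, 0) := by
      have := HasDerivAt.exp (hfa.hasLineDerivAt (1, 0)).neg
      simpa [HasLineDerivAt, pd1] using this
    have := ((hexp.mul (hwa.hasLineDerivAt (1, 0))).neg).pd1_eq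
      (hac.contDiffAt (Metric.isOpen_ball.mem_nhds ha))
    rw [this]
    have e2 : fderiv ℝ w a (1, 0) = Real.exp (f a) * C a := hwd a ha
    have e3 : Real.exp (-f a) * Real.exp (f a) = 1 := by rw [← Real.exp_add]; simp
    rw [e2]
    linear_combination -C a * e3
  have hQ : ∀ r ∈ Metric.ball q ε, Q r =
      r.1 2 * pd2 f (xy r) - pd1 f (xy r) * r.2.2 2 + C (xy r) := fun r hr => by
    have e := hfd _ (xy_mem hr)
    rw [e.1, e.2, ← hCQ r hr]
    ring
  -- Here `k = 0`: an antiderivative of `k(x)` can always be absorbed into the potential `f`.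
  refine ⟨_, f, C, f, fun _ => 0, _, Metric.isOpen_ball, Metric.ball_mem_nhds q hε, hf, hC, hf,
    fun _ _ => contDiffAt_const, fun r hr => ⟨xy_mem hr, by rw [hQ r hr, singularIII₂]; ring⟩,
    pointReducesIII Metric.isOpen_ball hac (contDiffOn_const (c := (0 : ℝ)))
      (fun r hr => xy_mem hr) fun r hr r' e0 e1 e2 => ?_⟩
  have e3 : xy r' = xy r := by rw [xy, xy, e0]
  rw [hQ r hr, e0, e2, e3, had _ (xy_mem hr)]
  ring

/-- The third singular branch. -/
lemma isSingular₃Near (h : LocalIII Q q ε) (hε : 0 < ε)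
    (h0 : ∀ r ∈ Metric.ball q ε, fderiv ℝ Q r (bp 0) = 0)
    (h1 : ∀ r ∈ Metric.ball q ε, fderiv ℝ Q r (bp 1) = 0)
    (h2 : ∀ r ∈ Metric.ball q ε, fderiv ℝ Q r (bp 2) = 0) : IsSingular₃Near Q q := by
  have hs := fun {s} hs => hess_symm (h.smooth s hs)
  have z0 : ∀ i : Fin 4, i = 0 ∨ i = 1 ∨ i = 2 → ∀ r ∈ Metric.ball q ε,
      ∀ d, hess Q r d (bp i) = 0 := fun i hi r hr d =>
    hess_of_eventuallyEq (h.smooth r hr)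
      (eventually_of_ball (by rcases hi with rfl | rfl | rfl <;> assumption) hr)
      (hasLineDerivAt_const 0 r _)
  have hz : ∀ {r}, r ∈ Metric.ball q ε → ∀ {d}, d = bx 0 ∨ d = bx 2 ∨ d = bp 0 ∨ d = bp 1 ∨
      d = bp 2 ∨ d = bx 3 ∨ d = bu ∨ d = bp 3 →
      fderiv ℝ (fun r => fderiv ℝ Q r (bx 2)) r d = 0 := fun {r} hr {d} hd => by
    rw [← hess_eq_fderiv (h.smooth r hr)]
    rcases hd with rfl | rfl | rfl | rfl | rfl | hd
    -- Without dependence on `u₁, u₂, u₃`, the condition `e4` says `Q_{xz} = 0`.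
    · have e := (h.cond r hr).e4
      rw [z0 1 (by simp) r hr, z0 2 (by simp) r hr, z0 2 (by simp) r hr, h0 r hr, h1 r hr] at e
      linear_combination -e
    · have e := (h.cond r hr).e3
      rw [z0 0 (by simp) r hr, h0 r hr] at e
      linear_combination e
    · rw [hs hr, z0 0 (by simp) r hr]
    · rw [hs hr, z0 1 (by simp) r hr]
    · rw [hs hr, z0 2 (by simp) r hr]
    · exact h.hess_zero hd hr _
  obtain ⟨f, hf, hfQ⟩ := exists_descent_base 1
    (fun r hr => (h.smooth_fderiv (bx 2) hr).contDiffWithinAt)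
    (fun r hr m hm => by
      fin_cases m
      · exact hz hr (by simp)
      · exact absurd rfl hm
      all_goals exact hz hr (by simp)) (fun r hr => hz hr (by simp))
    (fun r hr m => by fin_cases m <;> exact hz hr (by simp))
  have hmem : ∀ a ∈ Metric.ball (xy q) ε, a.2 ∈ Metric.ball (q.1 1) ε := fun a ha => by
    rw [mem_ball_iff_norm] at ha ⊢
    exact (norm_snd_le (a - xy q)).trans_lt ha
  have hFc : ContDiffOn ℝ ∞ (fun a : ℝ × ℝ => f a.2) (Metric.ball (xy q) ε) :=
    hf.comp contDiff_snd.contDiffOn hmem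
  have hF' := fun {r} hr => contDiffAt_of_mem (r := r) hFc hr
  have hCc : ∀ r ∈ Metric.ball q ε, ContDiffAt ℝ ∞ (fun r => Q r - r.1 2 * f (r.1 1)) r :=
    fun r hr => (h.smooth r hr).sub ((baseL 2).contDiff.contDiffAt.mul (contDiffAt_xy (hF' hr)))
  obtain ⟨C, hC, hCQ⟩ := descend hCc (fun r hr d hd => by
    refine (HasLineDerivAt.fderiv_eq (((h.smooth r hr).hasLineDerivAt d).sub
      ((hasLineDerivAt_base 2 r d).mul (hasLineDerivAt_xy (hF' hr) d)))
      ((hCc r hr).differentiableAt (by simp))).trans ?_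
    rcases hd with rfl | rfl | rfl | rfl | hd
    · rw [hfQ r hr]
      simp [dirXY, bx_fst, xy]
    · rw [h0 r hr]
      simp [dirXY, bp_fst]
    · rw [h1 r hr]
      simp [dirXY, bp_fst]
    · rw [h2 r hr]
      simp [dirXY, bp_fst]
    · rw [h.inv_eq hd hr]
      rcases hd with rfl | rfl | rfl <;> simp [dirXY, bp_fst, bx_fst, bu_fst])
  have hQ : ∀ r ∈ Metric.ball q ε, Q r = r.1 2 * f (r.1 1) + C (xy r) := fun r hr => by
    rw [← hCQ r hr]
    ring
  -- A shift by `z a` with `a_x = -C` absorbs `C` through `u₁₃`.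
  obtain ⟨a, ha, had⟩ := exists_pd1_eq hC.neg
  refine ⟨_, f, C, _, Metric.isOpen_ball, Metric.ball_mem_nhds q hε,
    fun a ha => hf.contDiffAt (Metric.isOpen_ball.mem_nhds (hmem a ha)), hC,
    fun r hr => ⟨xy_mem hr, hQ r hr⟩,
    pointReducesIII Metric.isOpen_ball ha (contDiffOn_const (c := (0 : ℝ)))
      (fun r hr => xy_mem hr) fun r hr r' e0 e1 e2 => ?_⟩
  rw [hQ r hr, e0, had _ (xy_mem hr)]
  simp

end LocalIII

/-! ### The singular branches of type III satisfy the integrability conditions -/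

section Singular

variable {f h K : ℝ × ℝ → ℝ} {Q : J1 → ℝ} {q : J1}

/-- The first derivatives of `Q` in the first singular branch. -/
lemma singular₁_fderiv (hQ : ContDiffAt ℝ ∞ Q q)
    (e : ∀ᶠ r in 𝓝 q, r.2.2 2 + f (xy r) ≠ 0 ∧
      Q r = (r.2.2 1 + r.1 2 * pd2 f (xy r) + h (xy r)) / (r.2.2 2 + f (xy r)) - pd1 f (xy r) -
        K (xy r) * (r.2.2 2 + f (xy r)))
    (hf : ContDiffAt ℝ ∞ f (xy q)) (hh : ContDiffAt ℝ ∞ h (xy q)) (hK : ContDiffAt ℝ ∞ K (xy q)) :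
    (fderiv ℝ Q q (bx 3) = 0 ∧ fderiv ℝ Q q bu = 0 ∧ fderiv ℝ Q q (bp 3) = 0) ∧
      fderiv ℝ Q q (bp 0) = 0 ∧
      fderiv ℝ Q q (bp 1) = 1 / (q.2.2 2 + f (xy q)) ∧
      fderiv ℝ Q q (bx 2) = pd2 f (xy q) / (q.2.2 2 + f (xy q)) ∧
      fderiv ℝ Q q (bp 2) = -(Q q + pd1 f (xy q)) / (q.2.2 2 + f (xy q)) - 2 * K (xy q) := by
  have hn := e.self_of_nhds.1
  have e' : (fun r => Q r * (r.2.2 2 + f (xy r))) =ᶠ[𝓝 q] fun r =>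
      r.2.2 1 + r.1 2 * pd2 f (xy r) + h (xy r) - pd1 f (xy r) * (r.2.2 2 + f (xy r)) -
        K (xy r) * ((r.2.2 2 + f (xy r)) * (r.2.2 2 + f (xy r))) := by
    filter_upwards [e] with r hr
    have := hr.1
    rw [hr.2]
    field_simp
  have Dd := fun d => (hasLineDerivAt_mom 2 q d).add (hasLineDerivAt_xy hf d)
  have key : ∀ d, _ := fun d =>
    ((hQ.hasLineDerivAt d).mul (Dd d)).unique (hasLineDerivAt_congr
      (((((hasLineDerivAt_mom 1 q d).add ((hasLineDerivAt_base 2 q d).mul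
        (hasLineDerivAt_xy hf.pd2 d))).add (hasLineDerivAt_xy hh d)).sub
        ((hasLineDerivAt_xy hf.pd1 d).mul (Dd d))).sub
        ((hasLineDerivAt_xy hK d).mul ((Dd d).mul (Dd d)))) e')
  refine ⟨⟨?_, ?_, ?_⟩, ?_, ?_, ?_, ?_⟩
  · have := key (bx 3)
    simp [dirXY, bx_fst, bx_mom] at this
    exact this.resolve_right hn
  · have := key bu
    simp [dirXY, bu_fst, bu_mom] at this
    exact this.resolve_right hn
  · have := key (bp 3)
    simp [dirXY, bp_fst, bp_mom] at this
    exact this.resolve_right hn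
  · have := key (bp 0)
    simp [dirXY, bp_fst, bp_mom] at this
    exact this.resolve_right hn
  · have := key (bp 1)
    simp [dirXY, bp_fst, bp_mom] at this
    rw [eq_div_iff hn]
    exact this
  · have := key (bx 2)
    simp [dirXY, bx_fst, bx_mom] at this
    rw [eq_div_iff hn]
    exact this
  · have := key (bp 2)
    simp [dirXY, bp_fst, bp_mom] at this
    field_simp
    linear_combination this

/-- The function `K` stands for `k(x)` regarded as a function of `(x, y)`; `K_y = 0` is needed for
the derivative `Q_{y u₃}` in `e4`. -/
lemma singular₁_condIII (hQ : ContDiffAt ℝ ∞ Q q)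
    (ev : ∀ᶠ r in 𝓝 q, fderiv ℝ Q r (bp 0) = 0 ∧
      fderiv ℝ Q r (bp 1) = 1 / (r.2.2 2 + f (xy r)) ∧
      fderiv ℝ Q r (bx 2) = pd2 f (xy r) / (r.2.2 2 + f (xy r)) ∧
      fderiv ℝ Q r (bp 2) = -(Q r + pd1 f (xy r)) / (r.2.2 2 + f (xy r)) - 2 * K (xy r))
    (hn : q.2.2 2 + f (xy q) ≠ 0)
    (hf : ContDiffAt ℝ ∞ f (xy q)) (hK : ContDiffAt ℝ ∞ K (xy q)) (hK2 : pd2 K (xy q) = 0) :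
    CondIII Q q := by
  obtain ⟨f0, f1, fz, f2⟩ := ev.self_of_nhds
  have Dd := fun d => (hasLineDerivAt_mom 2 q d).add (hasLineDerivAt_xy hf d)
  have s0 : ∀ d, _ := fun d => hess_of_eventuallyEq (d := d) hQ (ev.mono fun r hr => hr.1)
    (hasLineDerivAt_const 0 q d)
  have s1 : ∀ d, _ := fun d => hess_of_eventuallyEq (d := d) hQ (ev.mono fun r hr => hr.2.1)
    ((hasLineDerivAt_const 1 q d).div (Dd d) hn)
  have sz : ∀ d, _ := fun d => hess_of_eventuallyEq (d := d) hQ (ev.mono fun r hr => hr.2.2.1)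
    ((hasLineDerivAt_xy hf.pd2 d).div (Dd d) hn)
  have s2 : ∀ d, _ := fun d => hess_of_eventuallyEq (d := d) hQ (ev.mono fun r hr => hr.2.2.2)
    ((((hQ.hasLineDerivAt d).add (hasLineDerivAt_xy hf.pd1 d)).neg.div (Dd d) hn).sub
      ((hasLineDerivAt_xy hK d).const_mul 2))
  have hsym : pd1 (pd2 f) (xy q) = pd2 (pd1 f) (xy q) := pd1_pd2 hf
  refine ⟨?_, ?_, ?_, ?_, ?_, ?_, ?_, ?_, ?_, ?_, ?_⟩
  all_goals
    simp [s0, s1, sz, s2, f0, f1, fz, f2, dirXY, bx_fst, bx_mom, bp_fst, bp_mom, hsym, hK2]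
  all_goals field_simp <;> ring

/-- The first derivatives of `Q` in the second singular branch. -/
lemma singular₂_fderiv (hQ : ContDiffAt ℝ ∞ Q q)
    (e : ∀ᶠ r in 𝓝 q, Q r =
      r.1 2 * pd2 f (xy r) - (pd1 f (xy r) + K (xy r)) * r.2.2 2 + h (xy r))
    (hf : ContDiffAt ℝ ∞ f (xy q)) (hh : ContDiffAt ℝ ∞ h (xy q)) (hK : ContDiffAt ℝ ∞ K (xy q)) :
    (fderiv ℝ Q q (bx 3) = 0 ∧ fderiv ℝ Q q bu = 0 ∧ fderiv ℝ Q q (bp 3) = 0) ∧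
      fderiv ℝ Q q (bp 0) = 0 ∧ fderiv ℝ Q q (bp 1) = 0 ∧
      fderiv ℝ Q q (bx 2) = pd2 f (xy q) ∧
      fderiv ℝ Q q (bp 2) = -(pd1 f (xy q) + K (xy q)) := by
  have key : ∀ d, _ := fun d => (hQ.hasLineDerivAt d).unique (hasLineDerivAt_congr
    ((((hasLineDerivAt_base 2 q d).mul (hasLineDerivAt_xy hf.pd2 d)).sub
      (((hasLineDerivAt_xy hf.pd1 d).add (hasLineDerivAt_xy hK d)).mul
        (hasLineDerivAt_mom 2 q d))).add (hasLineDerivAt_xy hh d)) e)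
  simp only [key]
  simp [dirXY, bx_fst, bx_mom, bu_fst, bu_mom, bp_fst, bp_mom]
  try ring

lemma singular₂_condIII (hQ : ContDiffAt ℝ ∞ Q q)
    (ev : ∀ᶠ r in 𝓝 q, fderiv ℝ Q r (bp 0) = 0 ∧ fderiv ℝ Q r (bp 1) = 0 ∧
      fderiv ℝ Q r (bx 2) = pd2 f (xy r) ∧ fderiv ℝ Q r (bp 2) = -(pd1 f (xy r) + K (xy r)))
    (hf : ContDiffAt ℝ ∞ f (xy q)) (hK : ContDiffAt ℝ ∞ K (xy q)) (hK2 : pd2 K (xy q) = 0) :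
    CondIII Q q := by
  obtain ⟨f0, f1, fz, f2⟩ := ev.self_of_nhds
  have s0 : ∀ d, _ := fun d => hess_of_eventuallyEq (d := d) hQ (ev.mono fun r hr => hr.1)
    (hasLineDerivAt_const 0 q d)
  have s1 : ∀ d, _ := fun d => hess_of_eventuallyEq (d := d) hQ (ev.mono fun r hr => hr.2.1)
    (hasLineDerivAt_const 0 q d)
  have sz : ∀ d, _ := fun d => hess_of_eventuallyEq (d := d) hQ (ev.mono fun r hr => hr.2.2.1)
    (hasLineDerivAt_xy hf.pd2 d)
  have s2 : ∀ d, _ := fun d => hess_of_eventuallyEq (d := d) hQ (ev.mono fun r hr => hr.2.2.2)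
    ((hasLineDerivAt_xy hf.pd1 d).add (hasLineDerivAt_xy hK d)).neg
  have hsym : pd1 (pd2 f) (xy q) = pd2 (pd1 f) (xy q) := pd1_pd2 hf
  refine ⟨?_, ?_, ?_, ?_, ?_, ?_, ?_, ?_, ?_, ?_, ?_⟩
  all_goals
    simp [s0, s1, sz, s2, f0, f1, dirXY, bx_fst, bp_fst, hsym, hK2]

end Singular

section

variable {Q : J1 → ℝ} {q : J1}

lemma pd2_comp_fst {k : ℝ → ℝ} {a : ℝ × ℝ} (hk : ContDiffAt ℝ ∞ k a.1) :
    ContDiffAt ℝ ∞ (fun b : ℝ × ℝ => k b.1) a ∧ pd2 (fun b : ℝ × ℝ => k b.1) a = 0 := by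
  have hc : ContDiffAt ℝ ∞ (fun b : ℝ × ℝ => k b.1) a := hk.comp a contDiffAt_fst
  refine ⟨hc, HasLineDerivAt.pd2_eq ?_ hc⟩
  have e : (fun t : ℝ => k (a + t • ((0, 1) : ℝ × ℝ)).1) = fun _ => k a.1 := by
    funext t
    simp
  rw [HasLineDerivAt, e]
  exact hasDerivAt_const _ _

lemma IsSingular₁Near.cond (hQ : ∀ᶠ r in 𝓝 q, ContDiffAt ℝ ∞ Q r) (h : IsSingular₁Near Q q) :
    (fderiv ℝ Q q (bx 3) = 0 ∧ fderiv ℝ Q q bu = 0 ∧ fderiv ℝ Q q (bp 3) = 0) ∧ CondIII Q q := by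
  obtain ⟨O, f, g, k, N, hO, hN, hf, hg, hk, h, -⟩ := h
  have hq := h q (mem_of_mem_nhds hN)
  have hf' := fun {a} ha => hf.contDiffAt (x := a) (hO.mem_nhds ha)
  have hg' := fun {a} ha => hg.contDiffAt (x := a) (hO.mem_nhds ha)
  have key : ∀ᶠ r in 𝓝 q, (fderiv ℝ Q r (bx 3) = 0 ∧ fderiv ℝ Q r bu = 0 ∧
      fderiv ℝ Q r (bp 3) = 0) ∧ fderiv ℝ Q r (bp 0) = 0 ∧
      fderiv ℝ Q r (bp 1) = 1 / (r.2.2 2 + f (xy r)) ∧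
      fderiv ℝ Q r (bx 2) = pd2 f (xy r) / (r.2.2 2 + f (xy r)) ∧
      fderiv ℝ Q r (bp 2) = -(Q r + pd1 f (xy r)) / (r.2.2 2 + f (xy r)) - 2 * k (xy r).1 := by
    filter_upwards [hQ, eventually_eventually_nhds.2 hN] with r hr hNr
    have hr' := (h r (mem_of_mem_nhds hNr)).1
    exact singular₁_fderiv (K := fun a => k a.1) hr
      (Filter.eventually_of_mem hNr fun s hs => (h s hs).2) (hf' hr') (hg' hr')
      (pd2_comp_fst (hk _ hr')).1
  have hK := pd2_comp_fst (hk _ hq.1)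
  exact ⟨key.self_of_nhds.1, singular₁_condIII (K := fun a => k a.1) hQ.self_of_nhds
    (key.mono fun r hr => hr.2) hq.2.1 (hf' hq.1) hK.1 hK.2⟩

lemma IsSingular₂Near.cond (hQ : ∀ᶠ r in 𝓝 q, ContDiffAt ℝ ∞ Q r) (h : IsSingular₂Near Q q) :
    (fderiv ℝ Q q (bx 3) = 0 ∧ fderiv ℝ Q q bu = 0 ∧ fderiv ℝ Q q (bp 3) = 0) ∧ CondIII Q q := by
  obtain ⟨O, f, g, -, k, N, hO, hN, hf, hg, -, hk, h, -⟩ := h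
  have hq := h q (mem_of_mem_nhds hN)
  have hf' := fun {a} ha => hf.contDiffAt (x := a) (hO.mem_nhds ha)
  have hg' := fun {a} ha => hg.contDiffAt (x := a) (hO.mem_nhds ha)
  have key : ∀ᶠ r in 𝓝 q, (fderiv ℝ Q r (bx 3) = 0 ∧ fderiv ℝ Q r bu = 0 ∧
      fderiv ℝ Q r (bp 3) = 0) ∧ fderiv ℝ Q r (bp 0) = 0 ∧ fderiv ℝ Q r (bp 1) = 0 ∧
      fderiv ℝ Q r (bx 2) = pd2 f (xy r) ∧
      fderiv ℝ Q r (bp 2) = -(pd1 f (xy r) + k (xy r).1) := by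
    filter_upwards [hQ, eventually_eventually_nhds.2 hN] with r hr hNr
    have hr' := (h r (mem_of_mem_nhds hNr)).1
    exact singular₂_fderiv (K := fun a => k a.1) hr
      (Filter.eventually_of_mem hNr fun s hs => (h s hs).2) (hf' hr') (hg' hr')
      (pd2_comp_fst (hk _ hr')).1
  have hK := pd2_comp_fst (hk _ hq.1)
  exact ⟨key.self_of_nhds.1, singular₂_condIII (K := fun a => k a.1) hQ.self_of_nhds
    (key.mono fun r hr => hr.2) (hf' hq.1) hK.1 hK.2⟩

end

/-! ### Type III: local forms and integrability conditions -/

section TypeIII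

variable {Ω : Set J1} {Q : J1 → ℝ}

/-- The local forms of `Q` of type III at a 1-jet. -/
def LocalFormsIII (Q : J1 → ℝ) (q : J1) : Prop :=
  (dp 0 Q q ≠ 0 → IsGeneralNear Q q) ∧
    ((∀ᶠ r in 𝓝 q, dp 0 Q r = 0) → dp 1 Q q ≠ 0 → IsSingular₁Near Q q) ∧
    ((∀ᶠ r in 𝓝 q, dp 0 Q r = 0 ∧ dp 1 Q r = 0) → IsSingular₂Near Q q) ∧
    ((∀ᶠ r in 𝓝 q, dp 0 Q r = 0 ∧ dp 1 Q r = 0 ∧ dp 2 Q r = 0) → IsSingular₃Near Q q)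

lemma exists_localIII (hΩ : IsOpen Ω) (hQ : ContDiffOn ℝ ∞ Q Ω) (hi : IsInvariantIII Ω Q)
    (hC : ∀ q ∈ Ω, CondIII Q q) {q : J1} (hq : q ∈ Ω) {P : J1 → Prop} (hP : ∀ᶠ r in 𝓝 q, P r) :
    ∃ ε > 0, LocalIII Q q ε ∧ ∀ r ∈ Metric.ball q ε, P r := by
  obtain ⟨ε, hε, hεΩ⟩ := Metric.eventually_nhds_iff_ball.1 (hP.and (hΩ.mem_nhds hq))
  exact ⟨ε, hε, ⟨fun r hr => hQ.contDiffAt (hΩ.mem_nhds (hεΩ r hr).2),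
    fun r hr => hi r (hεΩ r hr).2, fun r hr => hC r (hεΩ r hr).2⟩, fun r hr => (hεΩ r hr).1⟩

lemma continuousAt_fderiv (hΩ : IsOpen Ω) (hQ : ContDiffOn ℝ ∞ Q Ω) {q : J1} (hq : q ∈ Ω)
    (d : J1) : ContinuousAt (fun r => fderiv ℝ Q r d) q :=
  ((hQ.contDiffAt (hΩ.mem_nhds hq)).fderiv_dir (n := ∞) (by decide) d).continuousAt

lemma continuousAt_hess (hΩ : IsOpen Ω) (hQ : ContDiffOn ℝ ∞ Q Ω) {q : J1} (hq : q ∈ Ω)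
    (d d' : J1) : ContinuousAt (fun r => hess Q r d d') q :=
  (((((hQ.contDiffAt (hΩ.mem_nhds hq)).fderiv_right (m := ∞) (by decide)).fderiv_right
    (m := ∞) (by decide)).clm_apply contDiffAt_const).clm_apply contDiffAt_const).continuousAt

lemma localFormsIII (hΩ : IsOpen Ω) (hQ : ContDiffOn ℝ ∞ Q Ω) (hi : IsInvariantIII Ω Q)
    (hC : ∀ q ∈ Ω, CondIII Q q) {q : J1} (hq : q ∈ Ω) : LocalFormsIII Q q := by
  have hc := fun i => continuousAt_fderiv hΩ hQ hq (bp i)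
  refine ⟨fun h0 => ?_, fun h0 h1 => ?_, fun h => ?_, fun h => ?_⟩
  · obtain ⟨ε, hε, L, hne⟩ := exists_localIII hΩ hQ hi hC hq ((hc 0).eventually_ne h0)
    exact L.isGeneralNear hε hne
  · obtain ⟨ε, hε, L, hne⟩ := exists_localIII hΩ hQ hi hC hq (h0.and ((hc 1).eventually_ne h1))
    exact L.isSingular₁Near hε (fun r hr => (hne r hr).1) fun r hr => (hne r hr).2
  · obtain ⟨ε, hε, L, hz⟩ := exists_localIII hΩ hQ hi hC hq h
    exact L.isSingular₂Near hε (fun r hr => (hz r hr).1) fun r hr => (hz r hr).2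
  · obtain ⟨ε, hε, L, hz⟩ := exists_localIII hΩ hQ hi hC hq h
    exact L.isSingular₃Near hε (fun r hr => (hz r hr).1) (fun r hr => (hz r hr).2.1)
      fun r hr => (hz r hr).2.2

lemma eventually_contDiffAt (hΩ : IsOpen Ω) (hQ : ContDiffOn ℝ ∞ Q Ω) {q : J1} (hq : q ∈ Ω) :
    ∀ᶠ r in 𝓝 q, ContDiffAt ℝ ∞ Q r :=
  Filter.eventually_of_mem (hΩ.mem_nhds hq) fun _ hr => hQ.contDiffAt (hΩ.mem_nhds hr)

/-- The 1-jets at which one of the first three local forms applies are dense. -/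
lemma exists_near_of_localFormsIII (hΩ : IsOpen Ω) (hQ : ContDiffOn ℝ ∞ Q Ω)
    (hL : ∀ q ∈ Ω, LocalFormsIII Q q) {q : J1} (hq : q ∈ Ω) {U : Set J1} (hU : U ∈ 𝓝 q) :
    ∃ r ∈ U ∩ Ω, (fderiv ℝ Q r (bx 3) = 0 ∧ fderiv ℝ Q r bu = 0 ∧ fderiv ℝ Q r (bp 3) = 0) ∧
      CondIII Q r := by
  -- Either `Q_{u₁}` is nonzero somewhere near `q`, or it vanishes throughout a neighbourhood; in
  -- the second case the same alternative is applied to `Q_{u₂}`. One of the first three forms thus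
  -- applies at a point of every neighbourhood.
  by_cases h0 : ∃ r ∈ interior U ∩ Ω, dp 0 Q r ≠ 0
  · obtain ⟨r, hr, h0⟩ := h0
    have hG := (hL r hr.2).1 h0
    have hQr := eventually_contDiffAt hΩ hQ hr.2
    exact ⟨r, ⟨interior_subset hr.1, hr.2⟩, hG.invariant hQr.self_of_nhds, hG.condIII hQr⟩
  push Not at h0
  have hV : IsOpen (interior U ∩ Ω) := isOpen_interior.inter hΩ
  have h0' : ∀ r ∈ interior U ∩ Ω, ∀ᶠ s in 𝓝 r, dp 0 Q s = 0 := fun r hr =>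
    Filter.eventually_of_mem (hV.mem_nhds hr) h0
  by_cases h1 : ∃ r ∈ interior U ∩ Ω, dp 1 Q r ≠ 0
  · obtain ⟨r, hr, h1⟩ := h1
    exact ⟨r, ⟨interior_subset hr.1, hr.2⟩,
      ((hL r hr.2).2.1 (h0' r hr) h1).cond (eventually_contDiffAt hΩ hQ hr.2)⟩
  push Not at h1
  have hqV : q ∈ interior U ∩ Ω := ⟨mem_interior_iff_mem_nhds.2 hU, hq⟩
  exact ⟨q, ⟨mem_of_mem_nhds hU, hq⟩, ((hL q hq).2.2.1 (Filter.eventually_of_mem (hV.mem_nhds hqV)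
    fun r hr => ⟨h0 r hr, h1 r hr⟩)).cond (eventually_contDiffAt hΩ hQ hq)⟩

/-- All the conditions are equalities between continuous functions, so it suffices that they hold at
a dense set of 1-jets. -/
lemma cond_of_localFormsIII (hΩ : IsOpen Ω) (hQ : ContDiffOn ℝ ∞ Q Ω)
    (hL : ∀ q ∈ Ω, LocalFormsIII Q q) : IsInvariantIII Ω Q ∧ ∀ q ∈ Ω, CondIII Q q := by
  have key : ∀ {q}, q ∈ Ω → ∀ {g : J1 → ℝ}, ContinuousAt g q →
      (∀ r, (fderiv ℝ Q r (bx 3) = 0 ∧ fderiv ℝ Q r bu = 0 ∧ fderiv ℝ Q r (bp 3) = 0) ∧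
        CondIII Q r → g r = 0) → g q = 0 := fun {q} hq {g} hg h => by
    by_contra hne
    obtain ⟨r, hr, hr'⟩ := exists_near_of_localFormsIII hΩ hQ hL hq (hg.eventually_ne hne)
    exact hr.1 (h r hr')
  refine ⟨fun q hq => ?_, fun q hq => ?_⟩
  · have c := continuousAt_fderiv hΩ hQ hq
    exact ⟨key hq (c _) fun r h => h.1.1, key hq (c _) fun r h => h.1.2.1,
      key hq (c _) fun r h => h.1.2.2⟩
  · have c := continuousAt_fderiv hΩ hQ hq
    have H := continuousAt_hess hΩ hQ hq
    have c0 := (hQ.contDiffAt (hΩ.mem_nhds hq)).continuousAt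
    refine ⟨key hq (H _ _) fun r h => h.2.h00, key hq (H _ _) fun r h => h.2.h01,
      key hq (H _ _) fun r h => h.2.h11, ?_, ?_, ?_, ?_, ?_, ?_, ?_, ?_⟩
    · exact sub_eq_zero.1 (key hq ((H _ _).sub ((c (bp 0)).pow 2).neg)
        fun r h => sub_eq_zero.2 h.2.hz0)
    · exact sub_eq_zero.1 (key hq ((H _ _).sub ((c _).mul (c _)).neg)
        fun r h => sub_eq_zero.2 h.2.hz1)
    · exact sub_eq_zero.1 (key hq ((H _ _).sub ((c _).mul (c _)).neg)
        fun r h => sub_eq_zero.2 h.2.h02)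
    · exact sub_eq_zero.1 (key hq ((H _ _).sub ((c (bp 1)).pow 2).neg)
        fun r h => sub_eq_zero.2 h.2.h12)
    · refine key hq ?_ fun r h => h.2.e1
      fun_prop
    · refine key hq ?_ fun r h => h.2.e2
      fun_prop
    · refine key hq ?_ fun r h => h.2.e3
      fun_prop
    · refine key hq ?_ fun r h => h.2.e4
      fun_prop

end TypeIII

end

end DispersionlessLax

theorem mainTheorem4 :
    -- Type III with the ideal of generating functions `A(t, u₄)`
    (∀ (Ω : Set J1) (Q : J1 → ℝ), IsOpen Ω → ContDiffOn ℝ ∞ Q Ω →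
      ((IsSymmetric (poissonIdeal 3) (eqIII Q) (toJ1 ⁻¹' Ω) ∧
          LaxIntegrable (eqIII Q) (toJ1 ⁻¹' Ω)) ↔
        ∀ q ∈ Ω,
          (dp 0 Q q ≠ 0 → IsGeneralNear Q q) ∧
          ((∀ᶠ r in 𝓝 q, dp 0 Q r = 0) → dp 1 Q q ≠ 0 → IsSingular₁Near Q q) ∧
          ((∀ᶠ r in 𝓝 q, dp 0 Q r = 0 ∧ dp 1 Q r = 0) → IsSingular₂Near Q q) ∧
          ((∀ᶠ r in 𝓝 q, dp 0 Q r = 0 ∧ dp 1 Q r = 0 ∧ dp 2 Q r = 0) → IsSingular₃Near Q q)) ∧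
      (IsSymmetric (poissonIdeal 3) (eqIII Q) (toJ1 ⁻¹' Ω) →
        LaxIntegrable (eqIII Q) (toJ1 ⁻¹' Ω) →
          IsLaxPair (eqIII Q) (toJ1 ⁻¹' Ω) Set.univ (laxVIII Q) (laxWIII Q))) ∧
    -- Type II with the ideal of generating functions `A(x, u₁) + B(t, u₄)`
    (∀ (Ω : Set J1) (Q : J1 → ℝ), IsOpen Ω → ContDiffOn ℝ ∞ Q Ω →
      ((IsSymmetric (poissonIdeal 0 + poissonIdeal 3) (eqII Q) (toJ1 ⁻¹' Ω) ∧
          LaxIntegrable (eqII Q) (toJ1 ⁻¹' Ω)) ↔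
        ∀ q ∈ Ω, IsBranchIINear Q q) ∧
      ∀ (O : Set (ℝ × ℝ)) (f h : ℝ × ℝ → ℝ), IsOpen O → ContDiffOn ℝ ∞ f O → ContDiffOn ℝ ∞ h O →
        (∀ q ∈ Ω, yz q ∈ O ∧ Q q = branchII f h q) →
          IsLaxPair (eqII Q) (toJ1 ⁻¹' Ω) {1}ᶜ (laxVII f) (laxWII f)) := by
  refine ⟨fun Ω Q hΩ hQ => ⟨⟨?_, fun hL => ?_⟩, ?_⟩, fun Ω Q hΩ hQ => ⟨⟨?_, fun hb => ?_⟩, ?_⟩⟩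
  · rintro ⟨hS, h⟩ q hq
    have hi := (isSymmetric_eqIII_iff hΩ hQ).1 hS
    exact localFormsIII hΩ hQ hi (fun r hr => h.condIII hΩ hQ hi hr) hq
  · obtain ⟨hi, hC⟩ := cond_of_localFormsIII hΩ hQ hL
    -- Integrability follows from one Lax pair over the whole of `Ω`, valid in all branches at once.
    exact ⟨(isSymmetric_eqIII_iff hΩ hQ).2 hi, (isLaxPair_eqIII hΩ hQ hi hC).laxIntegrable⟩
  · intro hS h
    have hi := (isSymmetric_eqIII_iff hΩ hQ).1 hS
    exact isLaxPair_eqIII hΩ hQ hi fun r hr => h.condIII hΩ hQ hi hr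
  · rintro ⟨hS, h⟩ q hq
    have hi := (isSymmetric_eqII_iff hΩ hQ).1 hS
    exact isBranchIINear hΩ hQ hi (fun r hr => h.condII hΩ hQ hi hr) hq
  · exact ⟨(isSymmetric_eqII_iff hΩ hQ).2 fun q hq => (hb q hq).cond, laxIntegrable_eqII hb⟩
  · intro O f h hO hf hh hQO
    exact isLaxPair_eqII hΩ hO hf hh hQO
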